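/- **Setting.** Let $D_2=\{\zeta=(\zeta_1,\zeta_2)\in\mathbb C^2:\ \operatorname{Im}\zeta_2-|\zeta_1|^2>0\}$ be the Siegel domain, $\mathbb R_+=(0,\infty)$, and let all $L^2$ spaces be taken with respect to Lebesgue measure. For integers $j,k\ge 0$ let $\mathcal A^2_{j,k}$ be the closed subspace of all $f\in L^2(D_2)$ with $$\Big(\frac{\partial}{\partial\bar\zeta_1}-2i\zeta_1\frac{\partial}{\partial\bar\zeta_2}\Big)^{j}f=0,\qquad \Big(\frac{\partial}{\partial\bar\zeta_2}\Big)^{k}f=0$$ on $D_2$ in the sense of distributions (such $f$ are then smooth, and the equations hold pointwise). For $L=(j,k)$ with $j,k\ge1$ the true-poly-Bergman type space is $$\mathcal A^2_{(L)}(D_2)=\mathcal A^2_{j,k}\ominus\big(\mathcal A^2_{j-1,k}+\mathcal A^2_{j,k-1}\big),$$ and $B_{(L)}$ is the orthogonal projection of $L^2(D_2)$ onto it. Let $h_m(y)=\frac{(-1)^m}{(2^m\sqrt\pi\,m!)^{1/2}}H_m(y)e^{-y^2/2}$ with $H_m(y)=(-1)^me^{y^2}\frac{d^m}{dy^m}e^{-y^2}$,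 and $\ell_m(y)=(-1)^mL_m(y)e^{-y/2}$ with $L_m(y)=\frac{e^y}{m!}\frac{d^m}{dy^m}(e^{-y}y^m)$. Let $\mathcal D=\mathbb R\times\mathbb R\times\mathbb R\times\mathbb R_+$, identified with $\mathbb C\times(\mathbb R+i\mathbb R_+)$ by $(u_1,v_1,u_2,v_2)\mapsto(u_1+iv_1,u_2+iv_2)$, and let $U=V_2V_1U_1U_0:L^2(D_2)\to L^2(\mathcal D)$, where * $(U_0f)(w_1,w_2)=f(w_1,w_2+i|w_1|^2)$; * $U_1=F\otimes I\otimes F\otimes I$, with $(Fg)(t)=\frac1{\sqrt{2\pi}}\int_{\mathbb R}g(x)e^{-itx}\,dx$ the unitary Fourier transform on $L^2(\mathbb R)$; * $(V_1f)(t_1,s_1,t_2,s_2)=(2|t_2|)^{-1/2}f\big(t_1,s_1,t_2,\tfrac{s_2}{2|t_2|}\big)$; * $(V_2g)(x_1,y_1,x_2,y_2)=g\big(\sqrt{|x_2|}(x_1+y_1),\tfrac{-x_1+y_1}{2\sqrt{|x_2|}},x_2,y_2\big)$. Let $R_{0(L)}:L^2(\mathbb R\times\mathbb R_+)\to L^2(\mathcal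 D)$, $(R_{0(L)}g)(x_1,y_1,x_2,y_2)=\chi_{\mathbb R_+}(x_2)\,g(x_1,x_2)\,h_{j-1}(y_1)\,\ell_{k-1}(y_2)$, and let $R_{(L)}=R_{0(L)}^*U:L^2(D_2)\to L^2(\mathbb R\times\mathbb R_+)$. **Theorem.** Let $L=(j,k)$ with $j,k\ge1$, and let $c:\mathbb R\times\mathbb R_+\to\mathbb C$ be such that the nilpotent symbol $\zeta\mapsto c(\operatorname{Im}\zeta_1,\operatorname{Im}\zeta_2-|\zeta_1|^2)$ belongs to $L^\infty(D_2)$. Let $T_c$ be the Toeplitz operator on $\mathcal A^2_{(L)}(D_2)$, $T_cf=B_{(L)}(cf)$. Then, for all $x_1\in\mathbb R$ and $x_2>0$, the integral $$\gamma^c(x_1,x_2)=\int_{\mathbb R}\int_{\mathbb R_+}c\Big(\frac{-x_1+y_1}{2\sqrt{x_2}},\frac{y_2}{2x_2}\Big)\,h_{j-1}(y_1)^2\,\ell_{k-1}(y_2)^2\,dy_2\,dy_1$$ converges absolutely, and $\gamma^c\in L^\infty(\mathbb R\times\mathbb R_+)$. The restriction of $R_{(L)}$ to $\mathcal A^2_{(L)}(D_2)$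 is a unitary operator onto $L^2(\mathbb R\times\mathbb R_+)$ whose inverse is $R_{(L)}^*$, and it carries $T_c$ to multiplication by $\gamma^c$: $$R_{(L)}T_cR_{(L)}^*\,g=\gamma^c\,g\qquad\text{for all } g\in L^2(\mathbb R\times\mathbb R_+).$$ -/

import Mathlib

open MeasureTheory Set
open scoped ENNReal TensorProduct

noncomputable section

namespace SiegelToeplitz

/-- `L²(X, μ)`, complex valued. -/
abbrev L2 {α : Type*} [MeasurableSpace α] (μ : Measure α) := Lp ℂ 2 μ

/-! ### Domains and measures -/

/-- The Siegel domain `D₂ = {ζ : Im ζ₂ - |ζ₁|² > 0}`. -/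
def siegel : Set (ℂ × ℂ) := {ζ | 0 < ζ.2.im - ‖ζ.1‖ ^ 2}

/-- Lebesgue measure on `D₂`. -/
abbrev siegelMeasure : Measure (ℂ × ℂ) := volume.restrict siegel

/-- Lebesgue measure on `ℝ₊ = (0, ∞)`. -/
abbrev posMeasure : Measure ℝ := volume.restrict (Ioi 0)

/-- Lebesgue measure on `ℝ × ℝ₊`. -/
abbrev halfMeasure : Measure (ℝ × ℝ) := (volume : Measure ℝ).prod posMeasure

/-- Lebesgue measure on the flat domain `𝒟 = ℂ × Π`, in the real coordinates
`(u₁, v₁, u₂, v₂) ∈ ℝ × ℝ × ℝ × ℝ₊`. -/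
abbrev flatMeasure : Measure (ℝ × ℝ × ℝ × ℝ) :=
  (volume : Measure ℝ).prod ((volume : Measure ℝ).prod ((volume : Measure ℝ).prod posMeasure))

/-! ### Weighted composition operators on `L²` -/

section WeightedComp

variable {α β : Type*} [MeasurableSpace α] [MeasurableSpace β]

/-- Conditions under which `f ↦ w · (f ∘ φ)` is an isometry `L²(ν) → L²(μ)`:
the image of `|w|² μ` under `φ` is `ν`. -/
structure IsWeightedPullback (μ : Measure α) (ν : Measure β) (w : α → ℂ) (φ : α → β) :
    Prop where
  measurable_weight : Measurable w
  measurable_map : Measurable φ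
  weight_ne_zero : ∀ᵐ x ∂μ, w x ≠ 0
  map_eq : (μ.withDensity fun x => ‖w x‖ₑ ^ 2).map φ = ν

variable {μ : Measure α} {ν : Measure β} {w : α → ℂ} {φ : α → β}

theorem IsWeightedPullback.quasi (h : IsWeightedPullback μ ν w φ) :
    Measure.QuasiMeasurePreserving φ μ ν := by
  refine ⟨h.measurable_map, ?_⟩
  rw [← h.map_eq]
  refine Measure.AbsolutelyContinuous.map ?_ h.measurable_map
  refine withDensity_absolutelyContinuous' ?_ ?_
  · exact (h.measurable_weight.enorm.pow_const 2).aemeasurable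
  · filter_upwards [h.weight_ne_zero] with x hx
    simpa using hx

theorem IsWeightedPullback.eLpNorm_eq (h : IsWeightedPullback μ ν w φ) {f : β → ℂ}
    (hf : AEStronglyMeasurable f ν) :
    eLpNorm (fun x => w x * f (φ x)) 2 μ = eLpNorm f 2 ν := by
  have hw : Measurable fun x => ‖w x‖ₑ ^ 2 := h.measurable_weight.enorm.pow_const 2
  have hf' : AEStronglyMeasurable f ((μ.withDensity fun x => ‖w x‖ₑ ^ 2).map φ) := by
    rwa [h.map_eq]
  rw [eLpNorm_eq_lintegral_rpow_enorm_toReal (by norm_num) (by norm_num),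
    eLpNorm_eq_lintegral_rpow_enorm_toReal (by norm_num) (by norm_num)]
  congr 1
  rw [← h.map_eq, lintegral_map' (by fun_prop) h.measurable_map.aemeasurable,
    lintegral_withDensity_eq_lintegral_mul₀' hw.aemeasurable]
  · refine lintegral_congr fun x => ?_
    simp [enorm_mul, mul_pow]
  · have := hf'.comp_measurable h.measurable_map
    exact (this.enorm.pow_const _)

theorem IsWeightedPullback.memLp (h : IsWeightedPullback μ ν w φ) {f : β → ℂ}
    (hf : MemLp f 2 ν) : MemLp (fun x => w x * f (φ x)) 2 μ :=
  ⟨h.measurable_weight.aestronglyMeasurable.mul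
      (hf.1.comp_quasiMeasurePreserving h.quasi),
    by rw [h.eLpNorm_eq hf.1]; exact hf.2⟩

/-- The isometry `f ↦ w · (f ∘ φ)` from `L²(ν)` to `L²(μ)`. -/
def weightedComp (h : IsWeightedPullback μ ν w φ) : L2 ν →ₗᵢ[ℂ] L2 μ where
  toFun f := (h.memLp (Lp.memLp f)).toLp fun x => w x * f (φ x)
  map_add' f g := by
    rw [← MemLp.toLp_add]
    refine MemLp.toLp_congr _ _ ?_
    filter_upwards [h.quasi.ae (Lp.coeFn_add f g)] with x hx
    rw [Pi.add_apply, hx, Pi.add_apply, mul_add]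
  map_smul' a f := by
    rw [RingHom.id_apply, ← MemLp.toLp_const_smul]
    refine MemLp.toLp_congr _ _ ?_
    filter_upwards [h.quasi.ae (Lp.coeFn_smul a f)] with x hx
    simp [hx, mul_left_comm]
  norm_map' f := by
    change ‖(h.memLp (Lp.memLp f)).toLp _‖ = ‖f‖
    rw [Lp.norm_toLp, h.eLpNorm_eq (Lp.memLp f).1, Lp.norm_def]

theorem weightedComp_coeFn (h : IsWeightedPullback μ ν w φ) (f : L2 ν) :
    weightedComp h f =ᵐ[μ] fun x => w x * f (φ x) :=
  MemLp.coeFn_toLp (h.memLp (Lp.memLp f))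

theorem IsWeightedPullback.of_measurePreserving (h : MeasurePreserving φ μ ν) :
    IsWeightedPullback μ ν (fun _ => 1) φ where
  measurable_weight := measurable_const
  measurable_map := h.1
  weight_ne_zero := by simp
  map_eq := by simpa using h.map_eq

end WeightedComp

/-! ### Tensor products of isometries between `L²` spaces -/

section Tensor

variable {α β : Type*} [MeasurableSpace α] [MeasurableSpace β]
  {μ : Measure α} {ν : Measure β}

theorem memLp_tensor {f : α → ℂ} {g : β → ℂ} (hf : MemLp f 2 μ) (hg : MemLp g 2 ν) :
    MemLp (fun p : α × β => f p.1 * g p.2) 2 (μ.prod ν) := by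
  have hm : AEStronglyMeasurable (fun p : α × β => f p.1 * g p.2) (μ.prod ν) :=
    hf.1.comp_fst.mul hg.1.comp_snd
  rw [memLp_two_iff_integrable_sq_norm hm]
  have h := ((memLp_two_iff_integrable_sq_norm hf.1).1 hf).mul_prod
    ((memLp_two_iff_integrable_sq_norm hg.1).1 hg)
  refine h.congr (Filter.Eventually.of_forall fun p => ?_)
  simp [mul_pow]

/-- The function `f ⊗ g : (x, y) ↦ f x * g y`, as an element of `L²(μ × ν)`. -/
def tensor (f : L2 μ) (g : L2 ν) : L2 (μ.prod ν) :=
  (memLp_tensor (Lp.memLp f) (Lp.memLp g)).toLp fun p : α × β => f p.1 * g p.2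

theorem tensor_coeFn (f : L2 μ) (g : L2 ν) :
    tensor f g =ᵐ[μ.prod ν] fun p : α × β => f p.1 * g p.2 :=
  MemLp.coeFn_toLp (memLp_tensor (Lp.memLp f) (Lp.memLp g))

variable [SFinite μ] [SFinite ν]

/-- `(f, g) ↦ f ⊗ g` as a bilinear map. -/
def tensorBilin : L2 μ →ₗ[ℂ] L2 ν →ₗ[ℂ] L2 (μ.prod ν) :=
  LinearMap.mk₂ ℂ tensor
    (fun f f' g => by
      rw [tensor, tensor, tensor, ← MemLp.toLp_add]
      refine MemLp.toLp_congr _ _ ?_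
      filter_upwards [Measure.quasiMeasurePreserving_fst.ae (Lp.coeFn_add f f')] with p hp
      rw [Pi.add_apply, hp, Pi.add_apply, add_mul])
    (fun a f g => by
      rw [tensor, tensor, ← MemLp.toLp_const_smul]
      refine MemLp.toLp_congr _ _ ?_
      filter_upwards [Measure.quasiMeasurePreserving_fst.ae (Lp.coeFn_smul a f)] with p hp
      simp [hp, mul_assoc])
    (fun f g g' => by
      rw [tensor, tensor, tensor, ← MemLp.toLp_add]
      refine MemLp.toLp_congr _ _ ?_
      filter_upwards [Measure.quasiMeasurePreserving_snd.ae (Lp.coeFn_add g g')] with p hp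
      rw [Pi.add_apply, hp, Pi.add_apply, mul_add])
    (fun a f g => by
      rw [tensor, tensor, ← MemLp.toLp_const_smul]
      refine MemLp.toLp_congr _ _ ?_
      filter_upwards [Measure.quasiMeasurePreserving_snd.ae (Lp.coeFn_smul a g)] with p hp
      simp [hp, mul_left_comm])

theorem inner_tensor (f f' : L2 μ) (g g' : L2 ν) :
    inner ℂ (tensor f g) (tensor f' g') = inner ℂ f f' * inner ℂ g g' := by
  rw [L2.inner_def, L2.inner_def, L2.inner_def, ← integral_prod_mul]
  refine integral_congr_ae ?_
  filter_upwards [tensor_coeFn f g, tensor_coeFn f' g'] with p h h'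
  rw [h, h']
  simp [RCLike.inner_apply]
  ring

/-- The canonical isometric embedding of the algebraic tensor product `L²(μ) ⊗ L²(ν)` into
`L²(μ × ν)`. -/
def tensorEmb : (L2 μ ⊗[ℂ] L2 ν) →ₗᵢ[ℂ] L2 (μ.prod ν) :=
  (TensorProduct.lift (tensorBilin (μ := μ) (ν := ν))).isometryOfInner fun x y => by
    induction x using TensorProduct.induction_on with
    | zero => simp
    | add x x' hx hx' => simp only [map_add, inner_add_left, hx, hx']
    | tmul f g =>
      induction y using TensorProduct.induction_on with
      | zero => simp
      | add y y' hy hy' => simp only [map_add, inner_add_right, hy, hy']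
      | tmul f' g' =>
        simpa [tensorBilin] using inner_tensor f f' g g'

theorem tensorEmb_tmul (f : L2 μ) (g : L2 ν) : tensorEmb (f ⊗ₜ[ℂ] g) = tensor f g := by
  rfl

theorem denseRange_tensorEmb [SigmaFinite μ] [SigmaFinite ν] :
    DenseRange (tensorEmb (μ := μ) (ν := ν)) := by
  have key : (LinearMap.range (tensorEmb (μ := μ) (ν := ν)).toLinearMap)ᗮ = ⊥ := by
    rw [Submodule.eq_bot_iff]
    intro F hF
    have hF0 : ∀ f g, inner ℂ (tensor f g) F = 0 := fun f g =>
      (Submodule.mem_orthogonal _ _).1 hF _ ⟨f ⊗ₜ g, tensorEmb_tmul f g⟩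
    have rect : ∀ s t, MeasurableSet s → MeasurableSet t → μ s ≠ ∞ → ν t ≠ ∞ →
        ∫ p in s ×ˢ t, F p ∂(μ.prod ν) = 0 := by
      intro s t hs ht hμ hν
      rw [← hF0 (indicatorConstLp 2 hs hμ 1) (indicatorConstLp 2 ht hν 1), L2.inner_def,
        ← integral_indicator (hs.prod ht)]
      refine integral_congr_ae ?_
      filter_upwards [tensor_coeFn (indicatorConstLp 2 hs hμ (1 : ℂ))
          (indicatorConstLp 2 ht hν (1 : ℂ)),
        Measure.quasiMeasurePreserving_fst.ae
          (indicatorConstLp_coeFn (p := 2) (hs := hs) (hμs := hμ) (c := (1 : ℂ))),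
        Measure.quasiMeasurePreserving_snd.ae
          (indicatorConstLp_coeFn (p := 2) (hs := ht) (hμs := hν) (c := (1 : ℂ)))]
        with p h1 h2 h3
      rw [h1, h2, h3]
      by_cases hp1 : p.1 ∈ s <;> by_cases hp2 : p.2 ∈ t <;> simp [hp1, hp2, indicator]
    have hint : ∀ n : ℕ, IntegrableOn F (spanningSets μ n ×ˢ spanningSets ν n) (μ.prod ν) := by
      intro n
      have hfin : IsFiniteMeasure
          ((μ.prod ν).restrict (spanningSets μ n ×ˢ spanningSets ν n)) := by
        refine ⟨?_⟩
        rw [Measure.restrict_apply_univ, Measure.prod_prod]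
        exact ENNReal.mul_lt_top (measure_spanningSets_lt_top μ n)
          (measure_spanningSets_lt_top ν n)
      exact ((Lp.memLp F).restrict _).integrable (by norm_num)
    have hn : ∀ n : ℕ, ∀ᵐ p ∂(μ.prod ν),
        p ∈ spanningSets μ n ×ˢ spanningSets ν n → F p = 0 := by
      intro n
      have hS := (measurableSet_spanningSets μ n).prod (measurableSet_spanningSets ν n)
      rw [← ae_restrict_iff' hS]
      refine Integrable.ae_eq_zero_of_forall_setIntegral_eq_zero (hint n) ?_
      intro E hE _
      induction E, hE using MeasurableSpace.induction_on_inter generateFrom_prod.symm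
        isPiSystem_prod with
      | empty => simp
      | basic E hE =>
        obtain ⟨s, hs, t, ht, rfl⟩ := hE
        rw [Measure.restrict_restrict (MeasurableSet.prod hs ht), prod_inter_prod]
        refine rect _ _ (MeasurableSet.inter hs (measurableSet_spanningSets μ n))
          (MeasurableSet.inter ht (measurableSet_spanningSets ν n)) ?_ ?_
        · exact (measure_mono inter_subset_right |>.trans_lt
            (measure_spanningSets_lt_top μ n)).ne
        · exact (measure_mono inter_subset_right |>.trans_lt
            (measure_spanningSets_lt_top ν n)).ne
      | compl E hE ih =>
        have h := setIntegral_compl hE (hint n)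
        rw [h, ih (by
          refine (measure_mono (subset_univ E)).trans_lt ?_
          rw [Measure.restrict_apply_univ, Measure.prod_prod]
          exact ENNReal.mul_lt_top (measure_spanningSets_lt_top μ n)
            (measure_spanningSets_lt_top ν n)), sub_zero]
        exact rect _ _ (measurableSet_spanningSets μ n) (measurableSet_spanningSets ν n)
          (measure_spanningSets_lt_top μ n).ne (measure_spanningSets_lt_top ν n).ne
      | iUnion E hd hm ih =>
        rw [integral_iUnion hm hd (hint n).integrableOn]
        have hfin : (μ.prod ν).restrict (spanningSets μ n ×ˢ spanningSets ν n) univ < ∞ := by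
          rw [Measure.restrict_apply_univ, Measure.prod_prod]
          exact ENNReal.mul_lt_top (measure_spanningSets_lt_top μ n)
            (measure_spanningSets_lt_top ν n)
        simp [fun i => ih i ((measure_mono (subset_univ _)).trans_lt hfin)]
    refine Lp.ext ?_
    filter_upwards [ae_all_iff.2 hn, Lp.coeFn_zero ℂ 2 (μ.prod ν)] with p hp h0
    rw [h0]
    obtain ⟨n, hpn⟩ := mem_iUnion.1 ((iUnion_spanningSets μ).symm ▸ mem_univ p.1)
    obtain ⟨m, hpm⟩ := mem_iUnion.1 ((iUnion_spanningSets ν).symm ▸ mem_univ p.2)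
    exact hp (max n m) ⟨monotone_spanningSets μ (le_max_left n m) hpn,
      monotone_spanningSets ν (le_max_right n m) hpm⟩
  have h2 := (Submodule.topologicalClosure_eq_top_iff).2 key
  rw [denseRange_iff_closure_range]
  have h3 := congrArg (fun S : Submodule ℂ (L2 (μ.prod ν)) => (S : Set (L2 (μ.prod ν)))) h2
  rw [Submodule.topologicalClosure_coe] at h3
  exact h3

variable {α' β' : Type*} [MeasurableSpace α'] [MeasurableSpace β']
  {μ' : Measure α'} {ν' : Measure β'} [SFinite μ'] [SFinite ν']

/-- The tensor product `A ⊗ B : L²(μ × ν) → L²(μ' × ν')` of two isometries: the continuous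
extension of `f ⊗ g ↦ A f ⊗ B g` from the algebraic tensor product. -/
def tensorMap (A : L2 μ →ₗᵢ[ℂ] L2 μ') (B : L2 ν →ₗᵢ[ℂ] L2 ν') :
    L2 (μ.prod ν) →L[ℂ] L2 (μ'.prod ν') :=
  (tensorEmb.toContinuousLinearMap ∘L
    (TensorProduct.mapIsometry A B).toContinuousLinearMap).extend
      tensorEmb.toContinuousLinearMap

theorem tensorMap_tensorEmb [SigmaFinite μ] [SigmaFinite ν]
    (A : L2 μ →ₗᵢ[ℂ] L2 μ') (B : L2 ν →ₗᵢ[ℂ] L2 ν') (x : L2 μ ⊗[ℂ] L2 ν) :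
    tensorMap A B (tensorEmb x) = tensorEmb (TensorProduct.mapIsometry A B x) :=
  ContinuousLinearMap.extend_eq
    (tensorEmb.toContinuousLinearMap ∘L
      (TensorProduct.mapIsometry A B).toContinuousLinearMap)
    (e := tensorEmb.toContinuousLinearMap)
    denseRange_tensorEmb tensorEmb.isometry.isUniformInducing x

/-- `(A ⊗ B) (f ⊗ g) = A f ⊗ B g`. -/
theorem tensorMap_tensor [SigmaFinite μ] [SigmaFinite ν]
    (A : L2 μ →ₗᵢ[ℂ] L2 μ') (B : L2 ν →ₗᵢ[ℂ] L2 ν') (f : L2 μ) (g : L2 ν) :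
    tensorMap A B (tensor f g) = tensor (A f) (B g) :=
  tensorMap_tensorEmb A B (f ⊗ₜ g)

theorem norm_tensorMap [SigmaFinite μ] [SigmaFinite ν]
    (A : L2 μ →ₗᵢ[ℂ] L2 μ') (B : L2 ν →ₗᵢ[ℂ] L2 ν') (F : L2 (μ.prod ν)) :
    ‖tensorMap A B F‖ = ‖F‖ := by
  refine denseRange_tensorEmb.induction_on (p := fun F => ‖tensorMap A B F‖ = ‖F‖) F
    (isClosed_eq (by fun_prop) (by fun_prop)) fun x => ?_
  rw [tensorMap_tensorEmb]
  simp

/-- `A ⊗ B` as an isometry. -/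
def tensorIsometry [SigmaFinite μ] [SigmaFinite ν]
    (A : L2 μ →ₗᵢ[ℂ] L2 μ') (B : L2 ν →ₗᵢ[ℂ] L2 ν') :
    L2 (μ.prod ν) →ₗᵢ[ℂ] L2 (μ'.prod ν') where
  toLinearMap := (tensorMap A B).toLinearMap
  norm_map' := norm_tensorMap A B

end Tensor

/-! ### The Fourier transform on `L²(ℝ)` -/

theorem isWeightedPullback_dilation :
    IsWeightedPullback (volume : Measure ℝ) volume
      (fun _ => ((2 * Real.pi) ^ (-(1 / 2) : ℝ) : ℝ)) (fun t => t / (2 * Real.pi)) where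
  measurable_weight := measurable_const
  measurable_map := by fun_prop
  weight_ne_zero := by
    refine Filter.Eventually.of_forall fun _ => ?_
    have : (0 : ℝ) < (2 * Real.pi) ^ (-(1 / 2) : ℝ) := by positivity
    exact_mod_cast this.ne'
  map_eq := by
    have h2 : (0 : ℝ) < 2 * Real.pi := by positivity
    rw [withDensity_const, Measure.map_smul]
    simp only [div_eq_mul_inv]
    rw [Real.map_volume_mul_right (inv_ne_zero h2.ne'), smul_smul, inv_inv]
    have : ‖(((2 * Real.pi) ^ (-(1 * 2⁻¹) : ℝ) : ℝ) : ℂ)‖ₑ ^ 2 * ENNReal.ofReal |2 * Real.pi|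
        = 1 := by
      rw [← ofReal_norm, Complex.norm_real, Real.norm_of_nonneg (by positivity),
        ← ENNReal.ofReal_pow (by positivity), abs_of_pos h2,
        ← ENNReal.ofReal_mul (by positivity), ← Real.rpow_natCast, ← Real.rpow_mul h2.le]
      norm_num
      rw [Real.rpow_neg_one]
      field_simp
    rw [this, one_smul]

/-- The unitary Fourier transform `(F g)(t) = (2π)^{-1/2} ∫ g(x) e^{-itx} dx` on `L²(ℝ)`.
Mathlib's transform has kernel `e^{-2πitx}`, so `(F g)(t) = (2π)^{-1/2} (𝓕 g)(t / 2π)`. -/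
def fourierL2 : L2 (volume : Measure ℝ) →ₗᵢ[ℂ] L2 (volume : Measure ℝ) :=
  (weightedComp isWeightedPullback_dilation).comp
    (Lp.fourierTransformₗᵢ ℝ ℂ).toLinearIsometry

/-! ### The unitary operators `U₀`, `U₁`, `V₁`, `V₂` -/

theorem flatMeasure_eq :
    flatMeasure = volume.restrict {p : ℝ × ℝ × ℝ × ℝ | 0 < p.2.2.2} := by
  have h : {p : ℝ × ℝ × ℝ × ℝ | 0 < p.2.2.2} = univ ×ˢ (univ ×ˢ (univ ×ˢ Ioi 0)) := by
    ext p; simp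
  have h1 : ∀ {γ : Type} [MeasureSpace γ] [SFinite (volume : Measure γ)] (s : Set γ),
      (volume : Measure ℝ).prod ((volume : Measure γ).restrict s) =
        (volume : Measure (ℝ × γ)).restrict (univ ×ˢ s) := by
    intro γ _ _ s
    rw [Measure.volume_eq_prod, ← Measure.prod_restrict, Measure.restrict_univ]
  rw [h, flatMeasure, posMeasure, h1, h1, h1]

/-- `(u₁, v₁, u₂, v₂) ↦ (u₁ + i v₁, u₂ + i v₂)`. -/
def toComplex (p : ℝ × ℝ × ℝ × ℝ) : ℂ × ℂ := (⟨p.1, p.2.1⟩, ⟨p.2.2.1, p.2.2.2⟩)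

/-- `κ(w₁, w₂) = (w₁, w₂ + i |w₁|²)`. -/
def kappa (p : ℝ × ℝ × ℝ × ℝ) : ℂ × ℂ :=
  ((toComplex p).1, (toComplex p).2 + Complex.I * (‖(toComplex p).1‖ : ℂ) ^ 2)

theorem measurePreserving_toComplex : MeasurePreserving toComplex volume volume := by
  have h := (Complex.volume_preserving_equiv_real_prod.symm.prod
    Complex.volume_preserving_equiv_real_prod.symm).comp
      (volume_preserving_prodAssoc (α₁ := ℝ) (β₁ := ℝ) (γ₁ := ℝ × ℝ)).symm
  exact h

theorem measurePreserving_kappa : MeasurePreserving kappa flatMeasure siegelMeasure := by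
  have hsh : MeasurePreserving
      (fun w : ℂ × ℂ => (w.1, w.2 + Complex.I * (‖w.1‖ : ℂ) ^ 2)) volume volume := by
    refine (MeasurePreserving.id (volume : Measure ℂ)).skew_product
      (g := fun a b => b + Complex.I * (‖a‖ : ℂ) ^ 2) (by fun_prop) ?_
    exact Filter.Eventually.of_forall fun a => map_add_right_eq_self _ _
  have h : MeasurePreserving kappa volume volume := hsh.comp measurePreserving_toComplex
  have hs : MeasurableSet siegel := by
    apply measurableSet_lt <;> fun_prop
  have hpre : kappa ⁻¹' siegel = {p : ℝ × ℝ × ℝ × ℝ | 0 < p.2.2.2} := by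
    ext p
    have h : (Complex.I * (‖(toComplex p).1‖ : ℂ) ^ 2).im = ‖(toComplex p).1‖ ^ 2 := by
      rw [← Complex.ofReal_pow, Complex.I_mul_im, Complex.ofReal_re]
    simp only [mem_preimage, siegel, kappa, mem_ofPred_eq, Complex.add_im, h]
    simp [toComplex]
  have h' := h.restrict_preimage hs
  rwa [hpre, ← flatMeasure_eq] at h'

/-- `(U₀ f)(w) = f(κ(w))`. -/
def opU0 : L2 siegelMeasure →ₗᵢ[ℂ] L2 flatMeasure :=
  weightedComp (.of_measurePreserving measurePreserving_kappa)

/-- `U₁ = F ⊗ I ⊗ F ⊗ I`. -/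
def opU1 : L2 flatMeasure →ₗᵢ[ℂ] L2 flatMeasure :=
  tensorIsometry fourierL2
    (tensorIsometry LinearIsometry.id (tensorIsometry fourierL2 LinearIsometry.id))

/-- `ψ₁(ξ₁, t₂ + i s₂) = (ξ₁, t₂ + i s₂ / (2|t₂|))`. -/
def psi1 (p : ℝ × ℝ × ℝ × ℝ) : ℝ × ℝ × ℝ × ℝ :=
  (p.1, p.2.1, p.2.2.1, p.2.2.2 / (2 * |p.2.2.1|))

/-- The weight `(2|t₂|)^{-1/2}`. -/
def weight1 (p : ℝ × ℝ × ℝ × ℝ) : ℂ := (1 / (2 * |p.2.2.1|) ^ (1 / 2 : ℝ) : ℝ)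

theorem IsWeightedPullback.prod_left {α β γ : Type*} [MeasurableSpace α] [MeasurableSpace β]
    [MeasurableSpace γ] {μ : Measure α} {ν : Measure β} (τ : Measure γ) [SigmaFinite τ]
    [SigmaFinite μ] [SigmaFinite ν] {w : α → ℂ} {φ : α → β}
    (h : IsWeightedPullback μ ν w φ) :
    IsWeightedPullback (τ.prod μ) (τ.prod ν) (fun p => w p.2) (Prod.map id φ) where
  measurable_weight := h.measurable_weight.comp measurable_snd
  measurable_map := measurable_id.prodMap h.measurable_map
  weight_ne_zero := Measure.quasiMeasurePreserving_snd.ae h.weight_ne_zero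
  map_eq := by
    have hw : Measurable fun x => ‖w x‖ₑ ^ 2 := h.measurable_weight.enorm.pow_const 2
    have hφ := h.measurable_map
    have hwm := h.measurable_weight
    refine Measure.ext_of_lintegral _ fun f hf => ?_
    rw [lintegral_map hf (measurable_id.prodMap hφ),
      lintegral_withDensity_eq_lintegral_mul _ (f := fun x : γ × α => ‖w x.2‖ₑ ^ 2)
        (hw.comp measurable_snd) (by fun_prop),
      lintegral_prod _ (by fun_prop), lintegral_prod _ (by fun_prop)]
    refine lintegral_congr fun x => ?_
    rw [← h.map_eq, lintegral_map (by fun_prop) hφ,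
      lintegral_withDensity_eq_lintegral_mul _ hw (by fun_prop)]
    rfl

theorem isWeightedPullback_psi1_aux :
    IsWeightedPullback halfMeasure halfMeasure
      (fun p : ℝ × ℝ => (1 / (2 * |p.1|) ^ (1 / 2 : ℝ) : ℝ))
      (fun p : ℝ × ℝ => (p.1, p.2 / (2 * |p.1|))) where
  measurable_weight := by fun_prop
  measurable_map := by fun_prop
  weight_ne_zero := by
    have h : ∀ᵐ t : ℝ, t ≠ 0 := by simp [ae_iff]
    filter_upwards [Measure.quasiMeasurePreserving_fst.ae h] with p hp
    have : (0 : ℝ) < 2 * |p.1| := by positivity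
    have : (0 : ℝ) < 1 / (2 * |p.1|) ^ (1 / 2 : ℝ) := by positivity
    exact_mod_cast this.ne'
  map_eq := by
    have hw : Measurable fun p : ℝ × ℝ =>
        ‖((1 / (2 * |p.1|) ^ (1 / 2 : ℝ) : ℝ) : ℂ)‖ₑ ^ 2 := by fun_prop
    refine Measure.ext_of_lintegral _ fun f hf => ?_
    rw [lintegral_map hf (by fun_prop),
      lintegral_withDensity_eq_lintegral_mul _ hw (by fun_prop),
      lintegral_prod _ (by fun_prop), lintegral_prod _ (by fun_prop)]
    refine lintegral_congr_ae ?_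
    have h : ∀ᵐ t : ℝ, t ≠ 0 := by simp [ae_iff]
    filter_upwards [h] with t ht
    set a : ℝ := 2 * |t| with ha_def
    have ha : 0 < a := by positivity
    have hwt : ‖((1 / a ^ (1 / 2 : ℝ) : ℝ) : ℂ)‖ₑ ^ 2 = ENNReal.ofReal a⁻¹ := by
      rw [← ofReal_norm, Complex.norm_real, Real.norm_of_nonneg (by positivity),
        ← ENNReal.ofReal_pow (by positivity), div_pow, ← Real.rpow_natCast (a ^ _),
        ← Real.rpow_mul ha.le]
      norm_num
    simp only [Pi.mul_apply, ← ha_def]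
    rw [hwt, lintegral_const_mul _ (by fun_prop)]
    have hmp : Measure.map (fun s : ℝ => s / a) posMeasure = ENNReal.ofReal a • posMeasure := by
      have hpre : (fun s : ℝ => s / a) ⁻¹' Ioi 0 = Ioi 0 := by
        ext s; simp [div_pos_iff_of_pos_right ha]
      have hr := Measure.restrict_map (μ := (volume : Measure ℝ)) (f := fun s : ℝ => s / a)
        (by fun_prop) (measurableSet_Ioi (a := (0 : ℝ)))
      rw [hpre] at hr
      rw [posMeasure, ← hr]
      simp only [div_eq_mul_inv]
      rw [Real.map_volume_mul_right (inv_ne_zero ha.ne'), Measure.restrict_smul, inv_inv,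
        abs_of_pos ha]
    have h3 : ∫⁻ s, f (t, s / a) ∂posMeasure = ENNReal.ofReal a * ∫⁻ s, f (t, s) ∂posMeasure := by
      rw [← lintegral_map (f := fun s => f (t, s)) (g := fun s => s / a) (by fun_prop)
        (by fun_prop), hmp, lintegral_smul_measure, smul_eq_mul]
    rw [h3, ← mul_assoc, ← ENNReal.ofReal_mul (by positivity), inv_mul_cancel₀ ha.ne',
      ENNReal.ofReal_one, one_mul]

theorem isWeightedPullback_psi1 : IsWeightedPullback flatMeasure flatMeasure weight1 psi1 :=
  (isWeightedPullback_psi1_aux.prod_left volume).prod_left volume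

/-- `(V₁ f)(ξ) = (2|t₂|)^{-1/2} f(ψ₁(ξ))`. -/
def opV1 : L2 flatMeasure →ₗᵢ[ℂ] L2 flatMeasure := weightedComp isWeightedPullback_psi1

/-- `ψ₂(x₁ + i y₁, z₂) = (√|x₂| (x₁ + y₁) + i (-x₁ + y₁) / (2 √|x₂|), z₂)`. -/
def psi2 (p : ℝ × ℝ × ℝ × ℝ) : ℝ × ℝ × ℝ × ℝ :=
  (√|p.2.2.1| * (p.1 + p.2.1), 1 / (2 * √|p.2.2.1|) * (-p.1 + p.2.1), p.2.2.1, p.2.2.2)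

theorem map_volume_shear (a : ℝ) (ha : a ≠ 0) :
    Measure.map (fun q : ℝ × ℝ => (a * (q.1 + q.2), 1 / (2 * a) * (-q.1 + q.2))) volume =
      volume := by
  let M : Matrix (Fin 2) (Fin 2) ℝ := !![a, a; -(1 / (2 * a)), 1 / (2 * a)]
  let B := Module.Basis.finTwoProd ℝ
  have hdet : LinearMap.det (Matrix.toLin B B M) = 1 := by
    rw [LinearMap.det_toLin, Matrix.det_fin_two_of]
    field_simp
    norm_num
  have h := Measure.map_linearMap_addHaar_eq_smul_addHaar (volume : Measure (ℝ × ℝ))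
    (f := Matrix.toLin B B M) (by rw [hdet]; exact one_ne_zero)
  rw [hdet] at h
  have hfun : (fun q : ℝ × ℝ => (a * (q.1 + q.2), 1 / (2 * a) * (-q.1 + q.2))) =
      Matrix.toLin B B M := by
    funext q
    rw [Matrix.toLin_finTwoProd_apply]
    ext <;> simp <;> ring
  rw [hfun, h]
  simp

theorem measurePreserving_psi2 : MeasurePreserving psi2 flatMeasure flatMeasure := by
  have hsk : MeasurePreserving (fun r : (ℝ × ℝ) × (ℝ × ℝ) =>
      (r.1, (√|r.1.1| * (r.2.1 + r.2.2), 1 / (2 * √|r.1.1|) * (-r.2.1 + r.2.2))))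
      (halfMeasure.prod volume) (halfMeasure.prod volume) := by
    refine (MeasurePreserving.id halfMeasure).skew_product
      (g := fun (z q : ℝ × ℝ) => (√|z.1| * (q.1 + q.2), 1 / (2 * √|z.1|) * (-q.1 + q.2)))
      (by fun_prop) ?_
    have h : ∀ᵐ t : ℝ, t ≠ 0 := by simp [ae_iff]
    filter_upwards [Measure.quasiMeasurePreserving_fst.ae h] with z hz
    exact map_volume_shear _ (by positivity)
  have he : MeasurePreserving (fun p : ℝ × ℝ × ℝ × ℝ => (p.2.2, (p.1, p.2.1)))
      flatMeasure (halfMeasure.prod volume) :=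
    (Measure.measurePreserving_swap (μ := (volume : Measure (ℝ × ℝ))) (ν := halfMeasure)).comp
      (measurePreserving_prodAssoc (volume : Measure ℝ) (volume : Measure ℝ) halfMeasure).symm
  have he' : MeasurePreserving
      (fun r : (ℝ × ℝ) × (ℝ × ℝ) => (r.2.1, (r.2.2, r.1)))
      (halfMeasure.prod volume) flatMeasure :=
    (measurePreserving_prodAssoc (volume : Measure ℝ) (volume : Measure ℝ) halfMeasure).comp
      (Measure.measurePreserving_swap (μ := halfMeasure) (ν := (volume : Measure (ℝ × ℝ))))
  exact he'.comp (hsk.comp he)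

/-- `(V₂ g)(z) = g(ψ₂(z))`. -/
def opV2 : L2 flatMeasure →ₗᵢ[ℂ] L2 flatMeasure :=
  weightedComp (.of_measurePreserving measurePreserving_psi2)

/-- `U = V₂ V₁ U₁ U₀`. -/
def opU : L2 siegelMeasure →ₗᵢ[ℂ] L2 flatMeasure :=
  opV2.comp (opV1.comp (opU1.comp opU0))

/-! ### Hermite and Laguerre functions -/

/-- The Hermite polynomial `H_m(y) = (-1)^m e^{y²} (d/dy)^m e^{-y²}`. -/
def hermiteH (m : ℕ) (y : ℝ) : ℝ :=
  (-1) ^ m * Real.exp (y ^ 2) * iteratedDeriv m (fun t : ℝ => Real.exp (-t ^ 2)) y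

/-- The Hermite function `h_m(y) = (-1)^m (2^m √π m!)^{-1/2} H_m(y) e^{-y²/2}`. -/
def hermiteFun (m : ℕ) (y : ℝ) : ℝ :=
  (-1) ^ m / √(2 ^ m * √Real.pi * m.factorial) * hermiteH m y * Real.exp (-y ^ 2 / 2)

/-- The Laguerre polynomial `L_m(y) = (e^y / m!) (d/dy)^m (e^{-y} y^m)`. -/
def laguerreL (m : ℕ) (y : ℝ) : ℝ :=
  Real.exp y / m.factorial * iteratedDeriv m (fun t : ℝ => Real.exp (-t) * t ^ m) y

/-- The Laguerre function `ℓ_m(y) = (-1)^m c_m L_m(y) e^{-y/2}`, with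
`c_m = (m! / Γ(m + 1))^{1/2} = 1`. -/
def laguerreFun (m : ℕ) (y : ℝ) : ℝ :=
  (-1) ^ m * laguerreL m y * Real.exp (-y / 2)

theorem exists_poly_hermite (m : ℕ) : ∃ P : Polynomial ℝ,
    iteratedDeriv m (fun t : ℝ => Real.exp (-t ^ 2)) =
      fun y => P.eval y * Real.exp (-y ^ 2) := by
  induction m with
  | zero => exact ⟨1, by simp⟩
  | succ m ih =>
    obtain ⟨P, hP⟩ := ih
    refine ⟨P.derivative - 2 * Polynomial.X * P, ?_⟩
    rw [iteratedDeriv_succ, hP]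
    funext y
    have h1 : HasDerivAt (fun y : ℝ => Real.exp (-y ^ 2)) (Real.exp (-y ^ 2) * (-(2 * y))) y := by
      simpa using ((hasDerivAt_id y).pow 2).neg.exp
    refine ((P.hasDerivAt y).mul h1).deriv.trans ?_
    simp
    ring

theorem exists_poly_laguerre (Q : Polynomial ℝ) (m : ℕ) : ∃ P : Polynomial ℝ,
    iteratedDeriv m (fun t : ℝ => Real.exp (-t) * Q.eval t) =
      fun y => Real.exp (-y) * P.eval y := by
  induction m with
  | zero => exact ⟨Q, by simp⟩
  | succ m ih =>
    obtain ⟨P, hP⟩ := ih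
    refine ⟨P.derivative - P, ?_⟩
    rw [iteratedDeriv_succ, hP]
    funext y
    have h1 : HasDerivAt (fun y : ℝ => Real.exp (-y)) (-Real.exp (-y)) y := by
      simpa using (hasDerivAt_id y).neg.exp
    have h2 := (h1.mul (P.hasDerivAt y)).deriv
    refine h2.trans ?_
    simp
    ring

theorem memLp_hermiteFun (m : ℕ) : MemLp (fun y => (hermiteFun m y : ℂ)) 2 volume := by
  obtain ⟨P, hP⟩ := exists_poly_hermite m
  have hform : ∀ y, hermiteFun m y =
      1 / √(2 ^ m * √Real.pi * m.factorial) * (P.eval y * Real.exp (-y ^ 2 / 2)) := by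
    intro y
    rw [hermiteFun, hermiteH, hP]
    have h1 : ((-1 : ℝ) ^ m) * (-1) ^ m = 1 := by rw [← mul_pow]; simp
    have h2 : Real.exp (y ^ 2) * Real.exp (-y ^ 2) = 1 := by rw [← Real.exp_add]; simp
    linear_combination
      (1 / √(2 ^ m * √Real.pi * m.factorial) * (P.eval y * Real.exp (-y ^ 2 / 2))) *
        (Real.exp (y ^ 2) * Real.exp (-y ^ 2) * h1 + h2)
  have hc : Continuous fun y : ℝ => P.eval y * Real.exp (-y ^ 2 / 2) :=
    P.continuous.mul (by fun_prop)
  have hpoly : ∀ Q : Polynomial ℝ, Integrable fun y : ℝ => Q.eval y * Real.exp (-y ^ 2) := by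
    intro Q
    induction Q using Polynomial.induction_on' with
    | add p q hp hq =>
      refine (hp.add hq).congr (Filter.Eventually.of_forall fun y => ?_)
      simp [add_mul]
    | monomial n a =>
      have h := (integrable_rpow_mul_exp_neg_mul_sq (b := 1) one_pos (s := (n : ℝ))
        (by linarith [n.cast_nonneg (α := ℝ)])).const_mul a
      simpa [mul_assoc] using h
  have h2 : MemLp (fun y : ℝ => P.eval y * Real.exp (-y ^ 2 / 2)) 2 volume := by
    rw [memLp_two_iff_integrable_sq hc.aestronglyMeasurable]
    refine (hpoly (P ^ 2)).congr (Filter.Eventually.of_forall fun y => ?_)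
    simp only [Polynomial.eval_pow, mul_pow]
    rw [← Real.exp_nat_mul]
    congr 2
    push_cast
    ring
  simp_rw [hform]
  exact (h2.const_mul _).ofReal

theorem memLp_laguerreFun (m : ℕ) : MemLp (fun y => (laguerreFun m y : ℂ)) 2 posMeasure := by
  obtain ⟨P, hP⟩ := exists_poly_laguerre (Polynomial.X ^ m) m
  simp only [Polynomial.eval_pow, Polynomial.eval_X] at hP
  have hform : ∀ y, laguerreFun m y =
      (-1) ^ m / m.factorial * (P.eval y * Real.exp (-y / 2)) := by
    intro y
    rw [laguerreFun, laguerreL, hP]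
    have h2 : Real.exp y * Real.exp (-y) = 1 := by rw [← Real.exp_add]; simp
    linear_combination
      ((-1) ^ m / m.factorial * (P.eval y * Real.exp (-y / 2))) * h2
  have hc : Continuous fun y : ℝ => P.eval y * Real.exp (-y / 2) :=
    P.continuous.mul (by fun_prop)
  have hpoly : ∀ Q : Polynomial ℝ,
      Integrable (fun y : ℝ => Q.eval y * Real.exp (-y)) posMeasure := by
    intro Q
    induction Q using Polynomial.induction_on' with
    | add p q hp hq =>
      refine (hp.add hq).congr (Filter.Eventually.of_forall fun y => ?_)
      simp [add_mul]
    | monomial n a =>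
      have h := (Real.GammaIntegral_convergent (s := (n : ℝ) + 1) (by positivity)).const_mul a
      refine h.congr (Filter.Eventually.of_forall fun y => ?_)
      simp
      ring
  have h2 : MemLp (fun y : ℝ => P.eval y * Real.exp (-y / 2)) 2 posMeasure := by
    rw [memLp_two_iff_integrable_sq hc.aestronglyMeasurable]
    refine (hpoly (P ^ 2)).congr (Filter.Eventually.of_forall fun y => ?_)
    simp only [Polynomial.eval_pow, mul_pow]
    rw [← Real.exp_nat_mul]
    congr 2
    push_cast
    ring
  simp_rw [hform]
  exact (h2.const_mul _).ofReal

/-! ### The operators `R₀` and `R` -/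

/-- The function `χ_{ℝ₊}(x₂) g(x₁, x₂) h_{j-1}(y₁) ℓ_{k-1}(y₂)` of `(x₁, y₁, x₂, y₂)`. -/
def embedFun (j k : ℕ) (g : ℝ × ℝ → ℂ) (p : ℝ × ℝ × ℝ × ℝ) : ℂ :=
  (Ioi (0 : ℝ)).indicator 1 p.2.2.1 * g (p.1, p.2.2.1) *
    hermiteFun (j - 1) p.2.1 * laguerreFun (k - 1) p.2.2.2

theorem measurePreserving_shuffle :
    MeasurePreserving (fun p : ℝ × ℝ × ℝ × ℝ => ((p.1, p.2.2.1), (p.2.1, p.2.2.2)))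
      flatMeasure ((volume : Measure (ℝ × ℝ)).prod halfMeasure) := by
  have h1 : MeasurePreserving (fun q : ℝ × ℝ × ℝ => (q.2.1, (q.1, q.2.2)))
      ((volume : Measure ℝ).prod halfMeasure) ((volume : Measure ℝ).prod halfMeasure) :=
    (measurePreserving_prodAssoc (volume : Measure ℝ) volume posMeasure).comp
      (((Measure.measurePreserving_swap (μ := (volume : Measure ℝ))
        (ν := (volume : Measure ℝ))).prod (MeasurePreserving.id posMeasure)).comp
          (measurePreserving_prodAssoc (volume : Measure ℝ) volume posMeasure).symm)
  exact (measurePreserving_prodAssoc (volume : Measure ℝ) volume halfMeasure).symm.comp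
    ((MeasurePreserving.id (volume : Measure ℝ)).prod h1)

theorem halfMeasure_eq : halfMeasure = volume.restrict (univ ×ˢ Ioi (0 : ℝ)) := by
  rw [Measure.volume_eq_prod, ← Measure.prod_restrict, Measure.restrict_univ]

theorem embedFun_eq_tensor (j k : ℕ) (g : ℝ × ℝ → ℂ) :
    embedFun j k g = fun p => (univ ×ˢ Ioi (0 : ℝ)).indicator g (p.1, p.2.2.1) *
      (hermiteFun (j - 1) p.2.1 * laguerreFun (k - 1) p.2.2.2) := by
  funext p
  by_cases h : 0 < p.2.2.1 <;> simp [embedFun, indicator, h, mul_assoc]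

theorem memLp_indicator {g : ℝ × ℝ → ℂ} (hg : MemLp g 2 halfMeasure) :
    MemLp ((univ ×ˢ Ioi (0 : ℝ)).indicator g) 2 volume := by
  rw [memLp_indicator_iff_restrict (MeasurableSet.univ.prod measurableSet_Ioi),
    ← halfMeasure_eq]
  exact hg

theorem memLp_embedFun (j k : ℕ) {g : ℝ × ℝ → ℂ} (hg : MemLp g 2 halfMeasure) :
    MemLp (embedFun j k g) 2 flatMeasure := by
  rw [embedFun_eq_tensor]
  have h1 : MemLp (fun q : ℝ × ℝ => (hermiteFun (j - 1) q.1 : ℂ) * laguerreFun (k - 1) q.2) 2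
      halfMeasure := memLp_tensor (memLp_hermiteFun (j - 1)) (memLp_laguerreFun (k - 1))
  have h2 := memLp_tensor (memLp_indicator hg) h1
  have h3 := h2.comp_measurePreserving measurePreserving_shuffle
  exact h3

theorem quasi_embed {P : ℝ × ℝ → Prop} (h : ∀ᵐ x ∂halfMeasure, P x) :
    ∀ᵐ p ∂flatMeasure, 0 < p.2.2.1 → P (p.1, p.2.2.1) := by
  rw [halfMeasure_eq, ae_restrict_iff' (MeasurableSet.univ.prod measurableSet_Ioi)] at h
  have h1 := (Measure.quasiMeasurePreserving_fst.comp
    measurePreserving_shuffle.quasiMeasurePreserving).ae h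
  filter_upwards [h1] with p hp hpos
  exact hp ⟨mem_univ _, hpos⟩

/-- The linear map underlying `R₀`. -/
def linR0 (j k : ℕ) : L2 halfMeasure →ₗ[ℂ] L2 flatMeasure where
  toFun g := (memLp_embedFun j k (Lp.memLp g)).toLp
  map_add' f g := by
    rw [← MemLp.toLp_add]
    refine MemLp.toLp_congr _ _ ?_
    filter_upwards [quasi_embed (Lp.coeFn_add f g)] with p hp
    by_cases h : 0 < p.2.2.1
    · rw [Pi.add_apply, embedFun, embedFun, embedFun, hp h, Pi.add_apply]
      ring
    · simp [embedFun, h]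
  map_smul' a g := by
    rw [RingHom.id_apply, ← MemLp.toLp_const_smul]
    refine MemLp.toLp_congr _ _ ?_
    filter_upwards [quasi_embed (Lp.coeFn_smul a g)] with p hp
    by_cases h : 0 < p.2.2.1
    · rw [Pi.smul_apply, embedFun, embedFun, hp h, Pi.smul_apply, smul_eq_mul, smul_eq_mul]
      ring
    · simp [embedFun, h]

theorem linR0_bound (j k : ℕ) : ∃ C, ∀ g : L2 halfMeasure, ‖linR0 j k g‖ ≤ C * ‖g‖ := by
  set H : L2 halfMeasure :=
    tensor (memLp_hermiteFun (j - 1)).toLp (memLp_laguerreFun (k - 1)).toLp with hH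
  refine ⟨‖H‖, fun g => ?_⟩
  set G : L2 (volume : Measure (ℝ × ℝ)) := (memLp_indicator (Lp.memLp g)).toLp with hG
  have hGn : ‖G‖ = ‖g‖ := by
    rw [hG, Lp.norm_toLp, eLpNorm_indicator_eq_eLpNorm_restrict
      (MeasurableSet.univ.prod measurableSet_Ioi), ← halfMeasure_eq, Lp.norm_def]
  have hT : ‖tensor G H‖ = ‖G‖ * ‖H‖ := by
    rw [← tensorEmb_tmul, LinearIsometry.norm_map, TensorProduct.norm_tmul]
  have heq : linR0 j k g =
      weightedComp (.of_measurePreserving measurePreserving_shuffle) (tensor G H) := by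
    refine Lp.ext ?_
    have hq := measurePreserving_shuffle.quasiMeasurePreserving
    have hH' : H =ᵐ[halfMeasure] fun q =>
        (hermiteFun (j - 1) q.1 : ℂ) * laguerreFun (k - 1) q.2 := by
      filter_upwards [tensor_coeFn (memLp_hermiteFun (j - 1)).toLp
          (memLp_laguerreFun (k - 1)).toLp,
        Measure.quasiMeasurePreserving_fst.ae (memLp_hermiteFun (j - 1)).coeFn_toLp,
        Measure.quasiMeasurePreserving_snd.ae (memLp_laguerreFun (k - 1)).coeFn_toLp]
        with q h1 h2 h3
      rw [hH, h1, h2, h3]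
    have h0 : linR0 j k g =ᵐ[flatMeasure] embedFun j k g :=
      (memLp_embedFun j k (Lp.memLp g)).coeFn_toLp
    filter_upwards [h0,
      weightedComp_coeFn (.of_measurePreserving measurePreserving_shuffle) (tensor G H),
      hq.ae (tensor_coeFn G H),
      hq.ae (Measure.quasiMeasurePreserving_fst.ae (memLp_indicator (Lp.memLp g)).coeFn_toLp),
      hq.ae (Measure.quasiMeasurePreserving_snd.ae hH')] with p h1 h2 h3 h4 h5
    rw [h1, h2, h3, h4, h5, embedFun_eq_tensor, one_mul]
  rw [heq, LinearIsometry.norm_map, hT, hGn, mul_comm]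

/-- The embedding `R₀ : L²(ℝ × ℝ₊) → L²(𝒟)`,
`(R₀ g)(x₁, y₁, x₂, y₂) = χ_{ℝ₊}(x₂) g(x₁, x₂) h_{j-1}(y₁) ℓ_{k-1}(y₂)`. -/
def opR0 (j k : ℕ) : L2 halfMeasure →L[ℂ] L2 flatMeasure :=
  (linR0 j k).mkContinuousOfExistsBound (linR0_bound j k)

theorem opR0_coeFn (j k : ℕ) (g : L2 halfMeasure) :
    opR0 j k g =ᵐ[flatMeasure] embedFun j k g :=
  MemLp.coeFn_toLp (memLp_embedFun j k (Lp.memLp g))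

/-- The Bargmann-type transform `R_{(L)} = R₀* U : L²(D₂) → L²(ℝ × ℝ₊)`, `L = (j, k)`. -/
def opR (j k : ℕ) : L2 siegelMeasure →L[ℂ] L2 halfMeasure :=
  (ContinuousLinearMap.adjoint (opR0 j k)).comp opU.toContinuousLinearMap

/-! ### True-poly-Bergman type spaces -/

/-- `∂f/∂ζ̄₁ = (∂f/∂u₁ + i ∂f/∂v₁) / 2`. -/
def dbar1 (f : ℂ × ℂ → ℂ) (ζ : ℂ × ℂ) : ℂ :=
  (1 / 2) * (fderiv ℝ f ζ (1, 0) + Complex.I * fderiv ℝ f ζ (Complex.I, 0))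

/-- `∂f/∂ζ̄₂ = (∂f/∂u₂ + i ∂f/∂v₂) / 2`. -/
def dbar2 (f : ℂ × ℂ → ℂ) (ζ : ℂ × ℂ) : ℂ :=
  (1 / 2) * (fderiv ℝ f ζ (0, 1) + Complex.I * fderiv ℝ f ζ (0, Complex.I))

/-- The operator `∂/∂ζ̄₁ - 2i ζ₁ ∂/∂ζ̄₂`. -/
def tangCR (f : ℂ × ℂ → ℂ) (ζ : ℂ × ℂ) : ℂ :=
  dbar1 f ζ - 2 * Complex.I * ζ.1 * dbar2 f ζ

/-- Smooth test functions on `D₂`. -/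
structure IsTest (φ : ℂ × ℂ → ℂ) : Prop where
  smooth : ContDiff ℝ (⊤ : ℕ∞) φ
  compact : HasCompactSupport φ
  support : tsupport φ ⊆ siegel

theorem IsTest.fderiv_apply {φ : ℂ × ℂ → ℂ} (h : IsTest φ) (v : ℂ × ℂ) :
    IsTest fun ζ => fderiv ℝ φ ζ v := by
  have hs : (Function.support fun ζ => fderiv ℝ φ ζ v) ⊆ tsupport φ := by
    intro ζ hζ
    refine support_fderiv_subset ℝ (f := φ) ?_
    intro h0
    exact hζ (by simp [h0])
  exact ⟨(h.smooth.fderiv_right (m := (⊤ : ℕ∞)) (by norm_cast)).clm_apply contDiff_const,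
    h.compact.mono' hs,
    (closure_minimal hs (isClosed_tsupport φ)).trans h.support⟩

theorem IsTest.mul_left {φ a : ℂ × ℂ → ℂ} (h : IsTest φ) (ha : ContDiff ℝ (⊤ : ℕ∞) a) :
    IsTest fun ζ => a ζ * φ ζ :=
  ⟨ha.mul h.smooth, h.compact.mul_left,
    (closure_mono (Function.support_mul_subset_right a φ)).trans h.support⟩

theorem IsTest.add {φ ψ : ℂ × ℂ → ℂ} (h : IsTest φ) (h' : IsTest ψ) :
    IsTest fun ζ => φ ζ + ψ ζ :=
  ⟨h.smooth.add h'.smooth, h.compact.add h'.compact,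
    (tsupport_add φ ψ).trans (union_subset h.support h'.support)⟩

theorem IsTest.dbar1 {φ : ℂ × ℂ → ℂ} (h : IsTest φ) : IsTest (dbar1 φ) :=
  ((h.fderiv_apply _).add ((h.fderiv_apply _).mul_left contDiff_const)).mul_left contDiff_const

theorem IsTest.dbar2 {φ : ℂ × ℂ → ℂ} (h : IsTest φ) : IsTest (dbar2 φ) :=
  ((h.fderiv_apply _).add ((h.fderiv_apply _).mul_left contDiff_const)).mul_left contDiff_const

theorem IsTest.tangCR {φ : ℂ × ℂ → ℂ} (h : IsTest φ) : IsTest (tangCR φ) := by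
  have h2 := h.dbar1.add (h.dbar2.mul_left (a := fun ζ => -(2 * Complex.I * ζ.1))
    (by fun_prop))
  have h3 : SiegelToeplitz.tangCR φ = fun ζ => SiegelToeplitz.dbar1 φ ζ +
      -(2 * Complex.I * ζ.1) * SiegelToeplitz.dbar2 φ ζ := by
    funext ζ
    rw [SiegelToeplitz.tangCR]
    ring
  rw [h3]
  exact h2

theorem IsTest.iterate {D : (ℂ × ℂ → ℂ) → (ℂ × ℂ → ℂ)} (hD : ∀ φ, IsTest φ → IsTest (D φ))
    {φ : ℂ × ℂ → ℂ} (h : IsTest φ) (n : ℕ) : IsTest (D^[n] φ) := by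
  induction n with
  | zero => exact h
  | succ n ih => rw [Function.iterate_succ_apply']; exact hD _ ih

theorem IsTest.memLp {φ : ℂ × ℂ → ℂ} (h : IsTest φ) : MemLp φ 2 siegelMeasure :=
  (h.smooth.continuous.memLp_of_hasCompactSupport (μ := volume) h.compact).restrict _

/-- `f ∈ L²(D₂)` is a weak (distributional) solution of `D^n f = 0` on `D₂`, where `D` is
`∂/∂ζ̄₂` or `∂/∂ζ̄₁ - 2i ζ₁ ∂/∂ζ̄₂`. The formal transpose of either operator is `-D`
(as `∂ζ₁/∂ζ̄₂ = 0`), and the sign `(-1)^n` plays no role. -/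
def IsWeakSol (D : (ℂ × ℂ → ℂ) → (ℂ × ℂ → ℂ)) (n : ℕ) (f : L2 siegelMeasure) : Prop :=
  ∀ φ, IsTest φ → ∫ ζ in siegel, f ζ * (D^[n] φ) ζ = 0

/-- The solutions of `D^n f = 0` in `L²(D₂)`. -/
def weakKer (D : (ℂ × ℂ → ℂ) → (ℂ × ℂ → ℂ)) (hD : ∀ φ, IsTest φ → IsTest (D φ)) (n : ℕ) :
    Submodule ℂ (L2 siegelMeasure) where
  carrier := {f | IsWeakSol D n f}
  zero_mem' φ _ := by
    refine integral_eq_zero_of_ae ?_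
    filter_upwards [Lp.coeFn_zero ℂ 2 siegelMeasure] with ζ hζ
    rw [hζ, Pi.zero_apply, zero_mul]
  add_mem' {f g} hf hg φ hφ := by
    have hm := (hφ.iterate hD n).memLp
    have hfi := (Lp.memLp f).integrable_mul hm
    have hgi := (Lp.memLp g).integrable_mul hm
    have h := integral_add hfi hgi
    simp only [Pi.mul_apply] at h
    rw [hf φ hφ, hg φ hφ, add_zero] at h
    rw [← h]
    refine integral_congr_ae ?_
    filter_upwards [Lp.coeFn_add f g] with ζ hζ
    rw [hζ, Pi.add_apply, add_mul]
  smul_mem' a f hf φ hφ := by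
    have h := integral_const_mul (μ := siegelMeasure) a fun ζ => f ζ * (D^[n] φ) ζ
    rw [hf φ hφ, mul_zero] at h
    rw [← h]
    refine integral_congr_ae ?_
    filter_upwards [Lp.coeFn_smul a f] with ζ hζ
    rw [hζ, Pi.smul_apply, smul_eq_mul, mul_assoc]

theorem isClosed_weakKer (D : (ℂ × ℂ → ℂ) → (ℂ × ℂ → ℂ))
    (hD : ∀ φ, IsTest φ → IsTest (D φ)) (n : ℕ) :
    IsClosed (weakKer D hD n : Set (L2 siegelMeasure)) := by
  have hset : (weakKer D hD n : Set (L2 siegelMeasure)) =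
      ⋂ (φ) (hφ : IsTest φ), {f | inner ℂ ((hφ.iterate hD n).memLp.star.toLp) f = (0 : ℂ)} := by
    ext f
    simp only [mem_iInter, mem_ofPred_eq]
    refine forall_congr' fun φ => forall_congr' fun hφ => ?_
    rw [L2.inner_def]
    refine Eq.congr (integral_congr_ae ?_) rfl
    filter_upwards [(hφ.iterate hD n).memLp.star.coeFn_toLp] with ζ hζ
    rw [hζ]
    simp [RCLike.inner_apply]
  rw [hset]
  exact isClosed_iInter fun φ => isClosed_iInter fun hφ =>
    isClosed_eq (by fun_prop) continuous_const

/-- The poly-Bergman type space `A²_L(D₂)`, `L = (j, k)`: all `f ∈ L²(D₂)` with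
`(∂/∂ζ̄₁ - 2i ζ₁ ∂/∂ζ̄₂)^j f = 0` and `(∂/∂ζ̄₂)^k f = 0`. The elements of `L²(D₂)` are classes
of functions, and the equations are read in the sense of distributions. The two operators commute,
so the system gives `(∂/∂ζ̄₁)^(j+k-1) f = 0` and `(∂/∂ζ̄₂)^k f = 0`, hence the classes that solve
it are exactly those of smooth functions that solve it pointwise. -/
def polyBergman (j k : ℕ) : Submodule ℂ (L2 siegelMeasure) :=
  weakKer tangCR (fun _ h => h.tangCR) j ⊓ weakKer dbar2 (fun _ h => h.dbar2) k

/-- The true-poly-Bergman type space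
`A²_{(L)}(D₂) = A²_{(j, k)} ⊖ (A²_{(j-1, k)} + A²_{(j, k-1)})`, for `j, k ≥ 1`
(the spaces with a zero index are `{0}`). -/
def truePolyBergman (j k : ℕ) : Submodule ℂ (L2 siegelMeasure) :=
  polyBergman j k ⊓ (polyBergman (j - 1) k ⊔ polyBergman j (k - 1))ᗮ

theorem isClosed_truePolyBergman (j k : ℕ) :
    IsClosed (truePolyBergman j k : Set (L2 siegelMeasure)) :=
  ((isClosed_weakKer _ _ _).inter (isClosed_weakKer _ _ _)).inter
    (Submodule.isClosed_orthogonal _)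

instance (j k : ℕ) : CompleteSpace (truePolyBergman j k) :=
  (isClosed_truePolyBergman j k).completeSpace_coe

/-! ### Toeplitz operators with nilpotent symbols -/

/-- The function `ζ ↦ c(Im ζ₁, Im ζ₂ - |ζ₁|²)`. -/
def nilpotentSymbol (c : ℝ → ℝ → ℂ) (ζ : ℂ × ℂ) : ℂ := c ζ.1.im (ζ.2.im - ‖ζ.1‖ ^ 2)

/-- Multiplication by `a ∈ L^∞(D₂)` on `L²(D₂)`. -/
def mulOp {a : ℂ × ℂ → ℂ} (ha : MemLp a ∞ siegelMeasure) :
    L2 siegelMeasure →L[ℂ] L2 siegelMeasure :=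
  (ContinuousLinearMap.mul ℂ ℂ).holderL siegelMeasure ∞ 2 2 ha.toLp

theorem mulOp_coeFn {a : ℂ × ℂ → ℂ} (ha : MemLp a ∞ siegelMeasure) (f : L2 siegelMeasure) :
    mulOp ha f =ᵐ[siegelMeasure] fun ζ => a ζ * f ζ := by
  filter_upwards [(ContinuousLinearMap.mul ℂ ℂ).coeFn_holder (r := 2) ha.toLp f,
    ha.coeFn_toLp] with ζ h1 h2
  rw [← h2]
  exact h1

/-- The Toeplitz operator `T_a f = B_{(L)}(a f)` on `A²_{(L)}(D₂)`, where `B_{(L)}` is the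
orthogonal projection of `L²(D₂)` onto `A²_{(L)}(D₂)`. -/
def toeplitz (j k : ℕ) {a : ℂ × ℂ → ℂ} (ha : MemLp a ∞ siegelMeasure) :
    truePolyBergman j k →L[ℂ] truePolyBergman j k :=
  (truePolyBergman j k).orthogonalProjectionOnto ∘L mulOp ha ∘L (truePolyBergman j k).subtypeL

/-- The integrand in the definition of `γ^c(x₁, x₂)`, as a function of `(y₁, y₂)`. -/
def gammaIntegrand (j k : ℕ) (c : ℝ → ℝ → ℂ) (x y : ℝ × ℝ) : ℂ :=
  c ((-x.1 + y.1) / (2 * √x.2)) (y.2 / (2 * x.2)) *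
    (hermiteFun (j - 1) y.1 : ℂ) ^ 2 * (laguerreFun (k - 1) y.2 : ℂ) ^ 2

/-- The spectral function
`γ^c(x₁, x₂) = ∫_ℝ ∫_{ℝ₊} c((-x₁+y₁)/(2√x₂), y₂/(2x₂)) h_{j-1}(y₁)² ℓ_{k-1}(y₂)² dy₂ dy₁`. -/
def gammaFun (j k : ℕ) (c : ℝ → ℝ → ℂ) (x : ℝ × ℝ) : ℂ :=
  ∫ y₁ : ℝ, ∫ y₂ in Ioi (0 : ℝ), gammaIntegrand j k c x (y₁, y₂)

end SiegelToeplitz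

end

/-!
The unitary operator `U` diagonalises the two Cauchy-Riemann equations. After `U₀` their
coefficients do not depend on `(u₁, u₂)` except for one linear factor `u₁`, so that the Fourier
transform `U₁` turns them into first-order operators in which `t₂` is a parameter (`hatCR`,
`hatBar`). In the coordinates `(x₁, y₁, x₂, y₂)` of `V₂ V₁`, these are, up to factors that depend on
`x₂` only, the operator `∂/∂y₁ + y₁` (for `x₂ > 0`) and the operators `∂/∂y₂ ± 1/2` with the sign
of `x₂` (`IsChartData.hatCR_eq`, `IsChartData.hatBar_eq`). Hence the solutions of the equations of
orders `j` and `k` should be spanned by `g(x₁, x₂) h_m(y₁) ℓ_n(y₂)` with `m < j`, `n < k` and `g`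
supported in `x₂ > 0`, and `U` should map the true-poly-Bergman type space onto the range of
`R_{0(L)}`, which is the component `m = j - 1`, `n = k - 1`.

This is proved for the distributional equations themselves, without regularity theory.

* A weak solution `f` may be tested against functions whose Fourier transform in `(u₁, u₂)` has
  compact support, although these do not have compact support themselves: the cutoffs
  `θ(r u₁) θ(r² u₂)` with `r → 0` have `D`-derivatives that tend to zero, since the unbounded
  coefficient `u₁ + i v₁` only ever meets a derivative in `u₂` (`isCutoff_cutTerm`,
  `integral_hatCR_eq_zero`, `integral_hatBar_eq_zero`). With Parseval's identity
  (`integral_mul_partFour`), and with products of test functions in the coordinates of `U` on the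
  Fourier side, one obtains the two ordinary differential equations for `U f` in the weak sense
  (`integral_opU_gaugeDeriv_fst`, `integral_opU_gaugeDeriv_snd`).
* The lemma of du Bois-Reymond for `(d/dy + μ)ⁿ` (`exists_poly_mul_exp`) shows that the solutions
  are polynomials of degree less than `n` times `e^{-y₁²/2}`, or times `e^{∓y₂/2}`. They are
  orthogonal to `h_m` and to `ℓ_m` for `m ≥ n` (`inner_opR0_opU_eq_zero_of_tangCR`,
  `inner_opR0_opU_eq_zero_of_dbar2`), and for `x₂ < 0`, where the exponential grows, square
  integrability leaves only zero (`opU_eq_zero_of_neg`).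
* Conversely, every `f` with `U f` in the range of `R_{0(L)}` is a weak solution
  (`isWeakSol_tangCR_of_opU_eq`, `isWeakSol_dbar2_of_opU_eq`): after integration by parts, the
  equation holds for truncations of `h_{j-1}` and `ℓ_{k-1}` against any fixed test function, and
  the truncations can be removed by dominated convergence.
* The Hermite and Laguerre functions are complete (`hermiteFun_complete`, `laguerreFun_complete`),
  so an element of `L²(𝒟)` that vanishes for `x₂ < 0` is determined by its components in the ranges
  of all the embeddings. Therefore `U` maps the true-poly-Bergman type space onto the range of
  `R_{0(L)}` (`opU_eq_opR0_of_mem_truePolyBergman`, `mem_truePolyBergman_of_opU_eq`), which makes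
  `R_{(L)}` unitary on it (`bargmannEquiv`).

As for the Toeplitz operator, a nilpotent symbol depends on `(v₁, v₂)` only, and `U₁` does not act on
these variables; so `U` carries multiplication by the symbol to multiplication by
`c((-x₁ + y₁) / (2 √|x₂|), y₂ / (2 |x₂|))` (`opU_mulOp`). Compressing this to the range of `R_{0(L)}`
integrates it against `h_{j-1}² ℓ_{k-1}²` in `(y₁, y₂)`, and the result is the spectral function
(`adjoint_opR0_mul`).
-/

noncomputable section

namespace SiegelToeplitz

/-! ### Hermite functions -/

/-- The polynomial `P_m` with `(d/dy)^m e^{-y²} = P_m(y) e^{-y²}`. -/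
def hermPoly : ℕ → Polynomial ℝ
  | 0 => 1
  | m + 1 => (hermPoly m).derivative - 2 * Polynomial.X * hermPoly m

theorem iteratedDeriv_gaussian (m : ℕ) :
    iteratedDeriv m (fun t : ℝ => Real.exp (-t ^ 2)) =
      fun y => (hermPoly m).eval y * Real.exp (-y ^ 2) := by
  induction m with
  | zero => simp [hermPoly]
  | succ m ih =>
    rw [iteratedDeriv_succ, ih]
    funext y
    have h1 : HasDerivAt (fun y : ℝ => Real.exp (-y ^ 2)) (Real.exp (-y ^ 2) * (-(2 * y))) y := by
      simpa using ((hasDerivAt_id y).pow 2).neg.exp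
    refine (((hermPoly m).hasDerivAt y).mul h1).deriv.trans ?_
    simp [hermPoly]
    ring

/-- The normalising constant of the Hermite function `h_m`. -/
def hermConst (m : ℕ) : ℝ := 1 / √(2 ^ m * √Real.pi * m.factorial)

theorem hermiteFun_eq (m : ℕ) (y : ℝ) :
    hermiteFun m y = hermConst m * ((hermPoly m).eval y * Real.exp (-y ^ 2 / 2)) := by
  rw [hermiteFun, hermiteH, iteratedDeriv_gaussian, hermConst]
  have h1 : ((-1 : ℝ) ^ m) * (-1) ^ m = 1 := by rw [← mul_pow]; simp
  have h2 : Real.exp (y ^ 2) * Real.exp (-y ^ 2) = 1 := by rw [← Real.exp_add]; simp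
  linear_combination
    (1 / √(2 ^ m * √Real.pi * m.factorial) *
      ((hermPoly m).eval y * Real.exp (-y ^ 2 / 2))) *
        (Real.exp (y ^ 2) * Real.exp (-y ^ 2) * h1 + h2)

theorem hermConst_pos (m : ℕ) : 0 < hermConst m := by
  unfold hermConst; positivity

theorem hermPoly_degree (m : ℕ) :
    (hermPoly m).natDegree ≤ m ∧ (hermPoly m).coeff m = (-2) ^ m := by
  induction m with
  | zero => simp [hermPoly]
  | succ m ih =>
    have hd : (hermPoly m).derivative.natDegree ≤ m - 1 :=
      (Polynomial.natDegree_derivative_le _).trans (Nat.sub_le_sub_right ih.1 1)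
    have h2 : (2 * Polynomial.X * hermPoly m : Polynomial ℝ) =
        Polynomial.C 2 * (hermPoly m * Polynomial.X) := by
      rw [show (2 : Polynomial ℝ) = Polynomial.C 2 from rfl]; ring
    have h3 : (Polynomial.C 2 * (hermPoly m * Polynomial.X) : Polynomial ℝ).natDegree ≤ m + 1 := by
      refine (Polynomial.natDegree_C_mul_le _ _).trans ?_
      refine Polynomial.natDegree_mul_le.trans ?_
      have := Polynomial.natDegree_X_le (R := ℝ)
      omega
    constructor
    · rw [hermPoly, h2]
      refine (Polynomial.natDegree_sub_le _ _).trans (max_le (by omega) h3)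
    · rw [hermPoly, h2, Polynomial.coeff_sub, Polynomial.coeff_C_mul, Polynomial.coeff_mul_X,
        ih.2, Polynomial.coeff_eq_zero_of_natDegree_lt (by omega)]
      ring

/-- A polynomial times a Gaussian is bounded. -/
theorem bounded_poly_mul_gaussian (P : Polynomial ℝ) :
    ∃ C, ∀ y : ℝ, |P.eval y * Real.exp (-y ^ 2 / 2)| ≤ C := by
  induction P using Polynomial.induction_on' with
  | add p q hp hq =>
    obtain ⟨C, hC⟩ := hp
    obtain ⟨D, hD⟩ := hq
    refine ⟨C + D, fun y => ?_⟩
    rw [Polynomial.eval_add, add_mul]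
    exact (abs_add_le _ _).trans (add_le_add (hC y) (hD y))
  | monomial n a =>
    refine ⟨|a| * (n.factorial * Real.exp (1 / 2)), fun y => ?_⟩
    rw [Polynomial.eval_monomial, abs_mul, abs_mul, abs_pow, Real.abs_exp, mul_assoc]
    refine mul_le_mul_of_nonneg_left ?_ (abs_nonneg a)
    have h1 : |y| ^ n ≤ n.factorial * Real.exp |y| := by
      have := Real.pow_div_factorial_le_exp |y| (abs_nonneg y) n
      rwa [div_le_iff₀' (by positivity)] at this
    calc |y| ^ n * Real.exp (-y ^ 2 / 2)
        ≤ n.factorial * Real.exp |y| * Real.exp (-y ^ 2 / 2) := by gcongr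
      _ = n.factorial * Real.exp (|y| + -y ^ 2 / 2) := by rw [mul_assoc, Real.exp_add]
      _ ≤ n.factorial * Real.exp (1 / 2) := by
          gcongr
          nlinarith [sq_nonneg (|y| - 1), sq_abs y]

theorem integrable_poly_mul_gaussian {b : ℝ} (hb : 0 < b) (P : Polynomial ℝ) :
    Integrable fun y : ℝ => P.eval y * Real.exp (-b * y ^ 2) := by
  induction P using Polynomial.induction_on' with
  | add p q hp hq =>
    refine (hp.add hq).congr (Filter.Eventually.of_forall fun y => ?_)
    simp [add_mul]
  | monomial n a =>
    have h := (integrable_rpow_mul_exp_neg_mul_sq hb (s := (n : ℝ))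
      (by linarith [n.cast_nonneg (α := ℝ)])).const_mul a
    simpa [mul_assoc] using h

theorem integrable_poly_mul_gaussian_half (P : Polynomial ℝ) :
    Integrable fun y : ℝ => ((P.eval y * Real.exp (-y ^ 2 / 2) : ℝ) : ℂ) := by
  refine Integrable.ofReal ?_
  refine (integrable_poly_mul_gaussian (b := 1 / 2) (by norm_num) P).congr
    (Filter.Eventually.of_forall fun y => ?_)
  simp only
  congr 2
  ring

theorem hasDerivAt_poly_mul_gaussian (P : Polynomial ℝ) (y : ℝ) :
    HasDerivAt (fun y : ℝ => P.eval y * Real.exp (-y ^ 2 / 2))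
      ((P.derivative.eval y - y * P.eval y) * Real.exp (-y ^ 2 / 2)) y := by
  have h1 : HasDerivAt (fun y : ℝ => Real.exp (-y ^ 2 / 2)) (Real.exp (-y ^ 2 / 2) * (-y)) y := by
    have h0 : HasDerivAt (fun y : ℝ => -y ^ 2 / 2) (-y) y := by
      refine (((hasDerivAt_id y).pow 2).neg.div_const 2).congr_deriv ?_
      simp
      ring
    exact h0.exp
  refine ((P.hasDerivAt y).mul h1).congr_deriv ?_
  ring

/-- Integration by parts against a Gaussian: `∂ - y` is the negative transpose of `∂ + y`, and
`∂ + y` acts on `P(y) e^{-y²/2}` by differentiating `P`. -/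
theorem integral_hermite_by_parts (P : Polynomial ℝ) {G G' : ℝ → ℂ} {C : ℝ}
    (hG : ∀ y, HasDerivAt G (G' y + y * G y) y) (hC : ∀ y, ‖G y‖ ≤ C)
    (hG' : Continuous G') {C' : ℝ} (hC' : ∀ y, ‖G' y‖ ≤ C') :
    ∫ y : ℝ, ((P.eval y * Real.exp (-y ^ 2 / 2) : ℝ) : ℂ) * G' y =
      -∫ y : ℝ, ((P.derivative.eval y * Real.exp (-y ^ 2 / 2) : ℝ) : ℂ) * G y := by
  have hGc : Continuous G := continuous_iff_continuousAt.2 fun y => (hG y).continuousAt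
  have hi1 : Integrable fun y : ℝ => ((P.eval y * Real.exp (-y ^ 2 / 2) : ℝ) : ℂ) * G' y :=
    (integrable_poly_mul_gaussian_half P).mul_bdd hG'.aestronglyMeasurable
      (Filter.Eventually.of_forall hC')
  have hi2 : Integrable fun y : ℝ =>
      ((P.derivative.eval y * Real.exp (-y ^ 2 / 2) : ℝ) : ℂ) * G y :=
    (integrable_poly_mul_gaussian_half _).mul_bdd hGc.aestronglyMeasurable
      (Filter.Eventually.of_forall hC)
  have hi3 : Integrable fun y : ℝ => ((P.eval y * Real.exp (-y ^ 2 / 2) : ℝ) : ℂ) * G y :=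
    (integrable_poly_mul_gaussian_half _).mul_bdd hGc.aestronglyMeasurable
      (Filter.Eventually.of_forall hC)
  have hd : ∀ y : ℝ, HasDerivAt
      (fun y : ℝ => ((P.eval y * Real.exp (-y ^ 2 / 2) : ℝ) : ℂ) * G y)
      (((P.derivative.eval y * Real.exp (-y ^ 2 / 2) : ℝ) : ℂ) * G y +
        ((P.eval y * Real.exp (-y ^ 2 / 2) : ℝ) : ℂ) * G' y) y := by
    intro y
    refine ((hasDerivAt_poly_mul_gaussian P y).ofReal_comp.mul (hG y)).congr_deriv ?_
    push_cast
    ring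
  have h := integral_eq_zero_of_hasDerivAt_of_integrable hd (hi2.add hi1) hi3
  rw [integral_add hi2 hi1] at h
  linear_combination h

theorem integral_hermite_by_parts_iterate (n : ℕ) (P : Polynomial ℝ) {G : ℕ → ℝ → ℂ}
    (hG : ∀ i y, HasDerivAt (G i) (G (i + 1) y + y * G i y) y)
    (hC : ∀ i, ∃ C, ∀ y, ‖G i y‖ ≤ C) :
    ∫ y : ℝ, ((P.eval y * Real.exp (-y ^ 2 / 2) : ℝ) : ℂ) * G n y =
      (-1) ^ n * ∫ y : ℝ,
        (((Polynomial.derivative^[n] P).eval y * Real.exp (-y ^ 2 / 2) : ℝ) : ℂ) * G 0 y := by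
  induction n generalizing P with
  | zero => simp
  | succ n ih =>
    obtain ⟨C, hC0⟩ := hC n
    obtain ⟨C', hC1⟩ := hC (n + 1)
    have hc : Continuous (G (n + 1)) :=
      continuous_iff_continuousAt.2 fun y => (hG (n + 1) y).continuousAt
    rw [integral_hermite_by_parts P (hG n) hC0 hc hC1, ih, Function.iterate_succ_apply]
    ring

theorem iterate_derivative_of_degree_le {P : Polynomial ℝ} {n : ℕ} (h : P.natDegree ≤ n) :
    Polynomial.derivative^[n] P = Polynomial.C (n.factorial * P.coeff n) := by
  refine Polynomial.ext fun i => ?_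
  rw [Polynomial.coeff_iterate_derivative, Polynomial.coeff_C]
  by_cases hi : i = 0
  · subst hi
    simp [Nat.descFactorial_self]
  · rw [Polynomial.coeff_eq_zero_of_natDegree_lt (by omega)]
    simp [hi]

/-- Moving the `m` derivatives of Rodrigues' formula to `P`. -/
theorem integral_poly_hermPoly (P : Polynomial ℝ) (m : ℕ) :
    ∫ y : ℝ, ((P.eval y * Real.exp (-y ^ 2 / 2) : ℝ) : ℂ) *
        (((hermPoly m).eval y * Real.exp (-y ^ 2 / 2) : ℝ) : ℂ) =
      (-1) ^ m * ∫ y : ℝ,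
        (((Polynomial.derivative^[m] P).eval y * Real.exp (-y ^ 2 / 2) : ℝ) : ℂ) *
          ((Real.exp (-y ^ 2 / 2) : ℝ) : ℂ) := by
  have h := integral_hermite_by_parts_iterate m P
    (G := fun i y => (((hermPoly i).eval y * Real.exp (-y ^ 2 / 2) : ℝ) : ℂ)) ?_ ?_
  · simpa [hermPoly] using h
  · intro i y
    refine (hasDerivAt_poly_mul_gaussian (hermPoly i) y).ofReal_comp.congr_deriv ?_
    simp [hermPoly]
    ring
  · intro i
    obtain ⟨C, hC⟩ := bounded_poly_mul_gaussian (hermPoly i)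
    refine ⟨C, fun y => ?_⟩
    rw [Complex.norm_real]
    exact hC y

theorem integral_poly_hermPoly_eq_zero {P : Polynomial ℝ} {m : ℕ} (h : P.natDegree < m) :
    ∫ y : ℝ, ((P.eval y * Real.exp (-y ^ 2 / 2) : ℝ) : ℂ) *
        (((hermPoly m).eval y * Real.exp (-y ^ 2 / 2) : ℝ) : ℂ) = 0 := by
  rw [integral_poly_hermPoly, Polynomial.iterate_derivative_eq_zero h]
  simp

theorem integral_hermiteFun_mul (m n : ℕ) :
    ∫ y : ℝ, (hermiteFun m y : ℂ) * hermiteFun n y = if m = n then 1 else 0 := by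
  have key : ∀ m n : ℕ, ∫ y : ℝ, (hermiteFun m y : ℂ) * hermiteFun n y =
      hermConst m * hermConst n * ∫ y : ℝ,
        (((hermPoly m).eval y * Real.exp (-y ^ 2 / 2) : ℝ) : ℂ) *
        (((hermPoly n).eval y * Real.exp (-y ^ 2 / 2) : ℝ) : ℂ) := by
    intro m n
    rw [← integral_const_mul]
    congr 1
    funext y
    rw [hermiteFun_eq, hermiteFun_eq]
    push_cast
    ring
  have hlt : ∀ m n : ℕ, m < n → ∫ y : ℝ, (hermiteFun m y : ℂ) * hermiteFun n y = 0 := by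
    intro m n hmn
    rw [key, integral_poly_hermPoly_eq_zero ((hermPoly_degree m).1.trans_lt hmn), mul_zero]
  rcases lt_trichotomy m n with h | h | h
  · rw [hlt m n h, if_neg h.ne]
  · subst h
    rw [if_pos rfl, key, integral_poly_hermPoly,
      iterate_derivative_of_degree_le (hermPoly_degree m).1, (hermPoly_degree m).2]
    have h1 : ∀ y : ℝ,
        (((Polynomial.C ((m.factorial : ℝ) * (-2) ^ m)).eval y * Real.exp (-y ^ 2 / 2) : ℝ) : ℂ) *
          ((Real.exp (-y ^ 2 / 2) : ℝ) : ℂ) =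
        (((m.factorial : ℝ) * (-2) ^ m : ℝ) : ℂ) * ((Real.exp (-1 * y ^ 2) : ℝ) : ℂ) := by
      intro y
      rw [Polynomial.eval_C, ← Complex.ofReal_mul, ← Complex.ofReal_mul, mul_assoc, ← Real.exp_add]
      congr 4
      ring
    simp_rw [h1]
    rw [integral_const_mul, integral_complex_ofReal, integral_gaussian, div_one]
    norm_cast
    have h2 : hermConst m * hermConst m = 1 / (2 ^ m * √Real.pi * m.factorial) := by
      rw [hermConst, div_mul_div_comm, Real.mul_self_sqrt (by positivity), one_mul]
    rw [h2]
    have h3 : ((-1 : ℝ)) ^ m * (-2) ^ m = 2 ^ m := by rw [← mul_pow]; norm_num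
    have h4 : √Real.pi ≠ 0 := by positivity
    have h5 : (m.factorial : ℝ) ≠ 0 := by positivity
    push_cast
    field_simp
    linear_combination h3
  · rw [if_neg h.ne', ← hlt n m h]
    congr 1
    funext y
    ring

/-! ### Laguerre functions -/

/-- The polynomial `Q_{m,i}` with `(d/dy)^i (e^{-y} y^m) = e^{-y} Q_{m,i}(y)`. -/
def lagPoly (m : ℕ) : ℕ → Polynomial ℝ
  | 0 => Polynomial.X ^ m
  | i + 1 => (lagPoly m i).derivative - lagPoly m i

theorem iteratedDeriv_exp_mul_pow (m i : ℕ) :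
    iteratedDeriv i (fun t : ℝ => Real.exp (-t) * t ^ m) =
      fun y => Real.exp (-y) * (lagPoly m i).eval y := by
  induction i with
  | zero => simp [lagPoly]
  | succ i ih =>
    rw [iteratedDeriv_succ, ih]
    funext y
    have h1 : HasDerivAt (fun y : ℝ => Real.exp (-y)) (-Real.exp (-y)) y := by
      simpa using (hasDerivAt_id y).neg.exp
    refine (h1.mul ((lagPoly m i).hasDerivAt y)).deriv.trans ?_
    simp [lagPoly]
    ring

theorem laguerreFun_eq (m : ℕ) (y : ℝ) :
    laguerreFun m y =
      (-1) ^ m / m.factorial * ((lagPoly m m).eval y * Real.exp (-y / 2)) := by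
  rw [laguerreFun, laguerreL, iteratedDeriv_exp_mul_pow]
  have h2 : Real.exp y * Real.exp (-y) = 1 := by rw [← Real.exp_add]; simp
  linear_combination
    ((-1) ^ m / m.factorial * ((lagPoly m m).eval y * Real.exp (-y / 2))) * h2

theorem lagPoly_degree (m i : ℕ) :
    (lagPoly m i).natDegree ≤ m ∧ (lagPoly m i).coeff m = (-1) ^ i := by
  induction i with
  | zero => simp [lagPoly]
  | succ i ih =>
    have hd : (lagPoly m i).derivative.natDegree ≤ m - 1 :=
      (Polynomial.natDegree_derivative_le _).trans (Nat.sub_le_sub_right ih.1 1)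
    constructor
    · rw [lagPoly]
      exact (Polynomial.natDegree_sub_le _ _).trans (max_le (by omega) ih.1)
    · have h0 : (lagPoly m i).derivative.coeff m = 0 := by
        rw [Polynomial.coeff_derivative, Polynomial.coeff_eq_zero_of_natDegree_lt (by omega)]
        simp
      rw [lagPoly, Polynomial.coeff_sub, ih.2, h0]
      ring

/-- The derivatives `(d/dy)^i (e^{-y} y^m)` still carry the factor `y^{m-i}`, so that the boundary
terms at `0` vanish in the integrations by parts. -/
theorem lagPoly_dvd (m i : ℕ) : (Polynomial.X ^ (m - i) : Polynomial ℝ) ∣ lagPoly m i := by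
  induction i with
  | zero => simp [lagPoly]
  | succ i ih =>
    rw [lagPoly]
    refine dvd_sub ?_ ((pow_dvd_pow _ (by omega)).trans ih)
    obtain ⟨R, hR⟩ := ih
    rw [hR, Polynomial.derivative_mul, Polynomial.derivative_X_pow]
    refine dvd_add (dvd_mul_of_dvd_left (dvd_mul_of_dvd_right ?_ _) _)
      (dvd_mul_of_dvd_left (pow_dvd_pow _ (by omega)) _)
    exact pow_dvd_pow _ (by omega)

theorem lagPoly_eval_zero {m i : ℕ} (h : i < m) : (lagPoly m i).eval 0 = 0 := by
  obtain ⟨R, hR⟩ := lagPoly_dvd m i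
  rw [hR, Polynomial.eval_mul, Polynomial.eval_pow, Polynomial.eval_X,
    zero_pow (by omega), zero_mul]

theorem integrable_poly_mul_exp_neg (P : Polynomial ℝ) :
    Integrable (fun y : ℝ => P.eval y * Real.exp (-y)) posMeasure := by
  induction P using Polynomial.induction_on' with
  | add p q hp hq =>
    refine (hp.add hq).congr (Filter.Eventually.of_forall fun y => ?_)
    simp [add_mul]
  | monomial n a =>
    have h := (Real.GammaIntegral_convergent (s := (n : ℝ) + 1) (by positivity)).const_mul a
    refine h.congr (Filter.Eventually.of_forall fun y => ?_)
    simp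
    ring

theorem tendsto_poly_mul_exp (P : Polynomial ℝ) :
    Filter.Tendsto (fun y : ℝ => P.eval y * Real.exp (-y / 2)) Filter.atTop (nhds 0) := by
  induction P using Polynomial.induction_on' with
  | add p q hp hq =>
    have := hp.add hq
    rw [add_zero] at this
    refine this.congr fun y => ?_
    simp [add_mul]
  | monomial n a =>
    have h := (Real.tendsto_pow_mul_exp_neg_atTop_nhds_zero n).comp
      (Filter.tendsto_id.atTop_div_const (two_pos (α := ℝ)))
    have h2 := h.const_mul (a * 2 ^ n)
    rw [mul_zero] at h2
    refine h2.congr fun y => ?_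
    simp [div_pow, neg_div]
    field_simp

theorem integrable_poly_mul_exp_half (P : Polynomial ℝ) :
    Integrable (fun y : ℝ => ((P.eval y * Real.exp (-y / 2) : ℝ) : ℂ)) posMeasure := by
  have h := integrable_poly_mul_exp_neg (P.comp (Polynomial.C 2 * Polynomial.X))
  have h2 := (integrableOn_Ioi_comp_mul_left_iff
    (fun y => (P.eval y * Real.exp (-y / 2))) 0 (two_pos (α := ℝ))).1 (by
      refine Integrable.congr h (Filter.Eventually.of_forall fun y => ?_)
      simp
      left; ring_nf)
  rw [mul_zero] at h2
  exact h2.ofReal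

theorem hasDerivAt_poly_mul_exp (P : Polynomial ℝ) (y : ℝ) :
    HasDerivAt (fun y : ℝ => P.eval y * Real.exp (-y / 2))
      ((P.derivative.eval y - 1 / 2 * P.eval y) * Real.exp (-y / 2)) y := by
  have h1 : HasDerivAt (fun y : ℝ => Real.exp (-y / 2)) (Real.exp (-y / 2) * (-1 / 2)) y :=
    ((hasDerivAt_id y).neg.div_const 2).exp
  refine ((P.hasDerivAt y).mul h1).congr_deriv ?_
  ring

theorem bounded_poly_mul_exp (P : Polynomial ℝ) :
    ∃ C, ∀ y : ℝ, 0 < y → ‖((P.eval y * Real.exp (-y / 2) : ℝ) : ℂ)‖ ≤ C := by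
  have h := (tendsto_poly_mul_exp P).norm.isBoundedUnder_le
  obtain ⟨C, hC⟩ := h
  rw [Filter.eventually_map, Filter.eventually_atTop] at hC
  obtain ⟨a, ha⟩ := hC
  obtain ⟨D, hD⟩ := (isCompact_Icc (a := (0 : ℝ)) (b := a)).exists_bound_of_continuousOn
    (f := fun y : ℝ => P.eval y * Real.exp (-y / 2))
    (P.continuous.mul (by fun_prop)).continuousOn
  refine ⟨max C D, fun y hy => ?_⟩
  rw [Complex.norm_real]
  rcases le_total a y with h | h
  · exact (ha y h).trans (le_max_left _ _)
  · exact (hD y ⟨hy.le, h⟩).trans (le_max_right _ _)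

/-- Integration by parts on the half-line: `∂ - 1/2` is the negative transpose of `∂ + 1/2`,
and `∂ + 1/2` acts on `P(y) e^{-y/2}` by differentiating `P`. -/
theorem integral_laguerre_by_parts (P : Polynomial ℝ) {G G' : ℝ → ℂ} {C : ℝ}
    (hG : ∀ y, HasDerivAt G (G' y + 1 / 2 * G y) y) (h0 : G 0 = 0)
    (hC : ∀ y, 0 < y → ‖G y‖ ≤ C)
    (hG' : Continuous G') {C' : ℝ} (hC' : ∀ y, 0 < y → ‖G' y‖ ≤ C') :
    ∫ y, ((P.eval y * Real.exp (-y / 2) : ℝ) : ℂ) * G' y ∂posMeasure =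
      -∫ y, ((P.derivative.eval y * Real.exp (-y / 2) : ℝ) : ℂ) * G y ∂posMeasure := by
  have hGc : Continuous G := continuous_iff_continuousAt.2 fun y => (hG y).continuousAt
  have hpos : ∀ᵐ y ∂posMeasure, 0 < y := ae_restrict_mem measurableSet_Ioi
  have hi1 : Integrable (fun y : ℝ => ((P.eval y * Real.exp (-y / 2) : ℝ) : ℂ) * G' y)
      posMeasure :=
    (integrable_poly_mul_exp_half P).mul_bdd (c := C') hG'.aestronglyMeasurable
      (hpos.mono hC')
  have hi2 : Integrable (fun y : ℝ =>
      ((P.derivative.eval y * Real.exp (-y / 2) : ℝ) : ℂ) * G y) posMeasure :=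
    (integrable_poly_mul_exp_half _).mul_bdd (c := C) hGc.aestronglyMeasurable (hpos.mono hC)
  have hd : ∀ y : ℝ, HasDerivAt
      (fun y : ℝ => ((P.eval y * Real.exp (-y / 2) : ℝ) : ℂ) * G y)
      (((P.derivative.eval y * Real.exp (-y / 2) : ℝ) : ℂ) * G y +
        ((P.eval y * Real.exp (-y / 2) : ℝ) : ℂ) * G' y) y := by
    intro y
    refine ((hasDerivAt_poly_mul_exp P y).ofReal_comp.mul (hG y)).congr_deriv ?_
    push_cast
    ring
  have ht : Filter.Tendsto (fun y : ℝ => ((P.eval y * Real.exp (-y / 2) : ℝ) : ℂ) * G y)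
      Filter.atTop (nhds 0) := by
    have h1 : Filter.Tendsto (fun y : ℝ => ((P.eval y * Real.exp (-y / 2) : ℝ) : ℂ))
        Filter.atTop (nhds 0) := by
      have := (Complex.continuous_ofReal.tendsto 0).comp (tendsto_poly_mul_exp P)
      rwa [Complex.ofReal_zero] at this
    refine h1.zero_mul_isBoundedUnder_le ⟨C, ?_⟩
    rw [Filter.eventually_map]
    filter_upwards [Filter.eventually_gt_atTop 0] with y hy using hC y hy
  have h := integral_Ioi_of_hasDerivAt_of_tendsto (a := 0) (hd 0).continuousAt.continuousWithinAt
    (fun y _ => hd y) (hi2.add hi1) ht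
  rw [h0, mul_zero, sub_zero] at h
  have h' := integral_add hi2 hi1
  rw [h] at h'
  linear_combination -h'

theorem integral_laguerre_by_parts_iterate (n : ℕ) (P : Polynomial ℝ) {G : ℕ → ℝ → ℂ}
    (hG : ∀ i y, HasDerivAt (G i) (G (i + 1) y + 1 / 2 * G i y) y)
    (h0 : ∀ i < n, G i 0 = 0) (hC : ∀ i, ∃ C, ∀ y, 0 < y → ‖G i y‖ ≤ C) :
    ∫ y, ((P.eval y * Real.exp (-y / 2) : ℝ) : ℂ) * G n y ∂posMeasure =
      (-1) ^ n * ∫ y,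
        (((Polynomial.derivative^[n] P).eval y * Real.exp (-y / 2) : ℝ) : ℂ) * G 0 y
          ∂posMeasure := by
  induction n generalizing P with
  | zero => simp
  | succ n ih =>
    obtain ⟨C, hC0⟩ := hC n
    obtain ⟨C', hC1⟩ := hC (n + 1)
    have hc : Continuous (G (n + 1)) :=
      continuous_iff_continuousAt.2 fun y => (hG (n + 1) y).continuousAt
    rw [integral_laguerre_by_parts P (hG n) (h0 n (by omega)) hC0 hc hC1,
      ih _ fun i hi => h0 i (by omega), Function.iterate_succ_apply]
    ring

/-- Moving the `m` derivatives of Rodrigues' formula to `P`. -/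
theorem integral_poly_lagPoly (P : Polynomial ℝ) (m : ℕ) :
    ∫ y, ((P.eval y * Real.exp (-y / 2) : ℝ) : ℂ) *
        (((lagPoly m m).eval y * Real.exp (-y / 2) : ℝ) : ℂ) ∂posMeasure =
      (-1) ^ m * ∫ y,
        (((Polynomial.derivative^[m] P).eval y * Real.exp (-y / 2) : ℝ) : ℂ) *
          ((y ^ m * Real.exp (-y / 2) : ℝ) : ℂ) ∂posMeasure := by
  have h := integral_laguerre_by_parts_iterate m P
    (G := fun i y => (((lagPoly m i).eval y * Real.exp (-y / 2) : ℝ) : ℂ)) ?_ ?_ ?_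
  · simpa [lagPoly] using h
  · intro i y
    refine (hasDerivAt_poly_mul_exp (lagPoly m i) y).ofReal_comp.congr_deriv ?_
    simp [lagPoly]
    ring
  · intro i hi
    simp [lagPoly_eval_zero hi]
  · exact fun i => bounded_poly_mul_exp (lagPoly m i)

theorem integral_poly_lagPoly_eq_zero {P : Polynomial ℝ} {m : ℕ} (h : P.natDegree < m) :
    ∫ y, ((P.eval y * Real.exp (-y / 2) : ℝ) : ℂ) *
        (((lagPoly m m).eval y * Real.exp (-y / 2) : ℝ) : ℂ) ∂posMeasure = 0 := by
  rw [integral_poly_lagPoly, Polynomial.iterate_derivative_eq_zero h]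
  simp

theorem integral_laguerreFun_mul (m n : ℕ) :
    ∫ y, (laguerreFun m y : ℂ) * laguerreFun n y ∂posMeasure = if m = n then 1 else 0 := by
  have key : ∀ m n : ℕ, ∫ y, (laguerreFun m y : ℂ) * laguerreFun n y ∂posMeasure =
      ((-1) ^ m / m.factorial) * ((-1) ^ n / n.factorial) * ∫ y,
        (((lagPoly m m).eval y * Real.exp (-y / 2) : ℝ) : ℂ) *
        (((lagPoly n n).eval y * Real.exp (-y / 2) : ℝ) : ℂ) ∂posMeasure := by
    intro m n
    rw [← integral_const_mul]
    congr 1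
    funext y
    rw [laguerreFun_eq, laguerreFun_eq]
    push_cast
    ring
  have hlt : ∀ m n : ℕ, m < n →
      ∫ y, (laguerreFun m y : ℂ) * laguerreFun n y ∂posMeasure = 0 := by
    intro m n hmn
    rw [key, integral_poly_lagPoly_eq_zero ((lagPoly_degree m m).1.trans_lt hmn), mul_zero]
  rcases lt_trichotomy m n with h | h | h
  · rw [hlt m n h, if_neg h.ne]
  · subst h
    rw [if_pos rfl, key, integral_poly_lagPoly,
      iterate_derivative_of_degree_le (lagPoly_degree m m).1, (lagPoly_degree m m).2]
    have h1 : ∀ y : ℝ,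
        (((Polynomial.C ((m.factorial : ℝ) * (-1) ^ m)).eval y * Real.exp (-y / 2) : ℝ) : ℂ) *
          ((y ^ m * Real.exp (-y / 2) : ℝ) : ℂ) =
        (((m.factorial : ℝ) * (-1) ^ m : ℝ) : ℂ) *
          ((Real.exp (-y) * y ^ ((m : ℝ) + 1 - 1) : ℝ) : ℂ) := by
      intro y
      have h2 : Real.exp (-y) = Real.exp (-y / 2) * Real.exp (-y / 2) := by
        rw [← Real.exp_add]; congr 1; ring
      rw [Polynomial.eval_C, ← Complex.ofReal_mul, ← Complex.ofReal_mul, h2, add_sub_cancel_right,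
        Real.rpow_natCast]
      congr 1
      ring
    simp_rw [h1]
    rw [integral_const_mul, integral_complex_ofReal, ← Real.Gamma_eq_integral (by positivity),
      Real.Gamma_nat_eq_factorial]
    have h5 : (m.factorial : ℂ) ≠ 0 := by exact_mod_cast m.factorial_ne_zero
    have h3 : ((-1 : ℂ)) ^ m * (-1) ^ m = 1 := by rw [← mul_pow]; norm_num
    push_cast
    field_simp
    linear_combination ((-1) ^ m * (-1) ^ m + 1) * h3
  · rw [if_neg h.ne', ← hlt n m h]
    congr 1
    funext y
    ring

/-! ### Completeness of the Hermite and Laguerre functions -/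

theorem memLp_poly_mul_gaussian (P : Polynomial ℝ) :
    MemLp (fun y : ℝ => ((P.eval y * Real.exp (-y ^ 2 / 2) : ℝ) : ℂ)) 2 volume := by
  have hc : Continuous fun y : ℝ => P.eval y * Real.exp (-y ^ 2 / 2) :=
    P.continuous.mul (by fun_prop)
  suffices h : MemLp (fun y : ℝ => P.eval y * Real.exp (-y ^ 2 / 2)) 2 volume from h.ofReal
  rw [memLp_two_iff_integrable_sq hc.aestronglyMeasurable]
  refine (integrable_poly_mul_gaussian one_pos (P ^ 2)).congr
    (Filter.Eventually.of_forall fun y => ?_)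
  simp only [Polynomial.eval_pow, mul_pow]
  rw [← Real.exp_nat_mul]
  congr 2
  push_cast
  ring

theorem memLp_poly_mul_exp (P : Polynomial ℝ) :
    MemLp (fun y : ℝ => ((P.eval y * Real.exp (-y / 2) : ℝ) : ℂ)) 2 posMeasure := by
  have hc : Continuous fun y : ℝ => P.eval y * Real.exp (-y / 2) :=
    P.continuous.mul (by fun_prop)
  suffices h : MemLp (fun y : ℝ => P.eval y * Real.exp (-y / 2)) 2 posMeasure from h.ofReal
  rw [memLp_two_iff_integrable_sq hc.aestronglyMeasurable]
  refine (integrable_poly_mul_exp_neg (P ^ 2)).congr (Filter.Eventually.of_forall fun y => ?_)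
  simp only [Polynomial.eval_pow, mul_pow]
  rw [← Real.exp_nat_mul]
  congr 2
  push_cast
  ring

/-- A linear functional on polynomials that vanishes on a sequence of polynomials of degrees
`0, 1, 2, …` vanishes. -/
theorem linear_eq_zero_of_triangular (Λ : Polynomial ℝ →ₗ[ℝ] ℂ) (p : ℕ → Polynomial ℝ)
    (hd : ∀ m, (p m).natDegree ≤ m) (hc : ∀ m, (p m).coeff m ≠ 0) (h : ∀ m, Λ (p m) = 0)
    (P : Polynomial ℝ) : Λ P = 0 := by
  have key : ∀ n (P : Polynomial ℝ), P.natDegree < n → Λ P = 0 := by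
    intro n
    induction n with
    | zero => intro P hP; omega
    | succ n ih =>
      intro P hP
      set Q := P - Polynomial.C (P.coeff n / (p n).coeff n) * p n with hQ
      have h1 : Λ P = Λ Q := by
        rw [hQ, map_sub, ← Polynomial.smul_eq_C_mul, map_smul, h n, smul_zero, sub_zero]
      have h2 : Q.natDegree ≤ n := by
        refine (Polynomial.natDegree_sub_le _ _).trans (max_le (by omega) ?_)
        exact (Polynomial.natDegree_C_mul_le _ _).trans (hd n)
      have h3 : Q.coeff n = 0 := by
        rw [hQ, Polynomial.coeff_sub, Polynomial.coeff_C_mul, div_mul_cancel₀ _ (hc n), sub_self]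
      rw [h1]
      rcases Nat.eq_zero_or_pos n with h0 | h0
      · subst h0
        rw [Polynomial.eq_C_of_natDegree_eq_zero (Nat.le_zero.1 h2), h3]
        simp
      · refine ih Q (lt_of_le_of_ne h2 fun he => ?_)
        have : Q = 0 := by
          rw [← Polynomial.leadingCoeff_eq_zero, Polynomial.leadingCoeff, he, h3]
        rw [this, Polynomial.natDegree_zero] at he
        omega
  exact key _ P (Nat.lt_succ_self _)

/-- If `ν` integrates to zero against all kernels `k ξ`, then it integrates to zero against every
superposition of them. -/
theorem integral_mul_superposition_eq_zero {X : Type*} [MeasurableSpace X] {μ : Measure X}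
    [SFinite μ] {ν : X → ℂ} (hν : Integrable ν μ) {k : ℝ → X → ℂ}
    (hk : Measurable (Function.uncurry k)) (hk1 : ∀ ξ x, ‖k ξ x‖ ≤ 1)
    (h : ∀ ξ, ∫ x, ν x * k ξ x ∂μ = 0) {a : ℝ → ℂ} (ha : Integrable a) :
    ∫ x, ν x * (∫ ξ, a ξ * k ξ x) ∂μ = 0 := by
  have hint : Integrable (Function.uncurry fun (x : X) (ξ : ℝ) => ν x * (a ξ * k ξ x))
      (μ.prod volume) := by
    have h1 := (hν.mul_prod ha).mul_bdd (c := 1)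
      ((hk.comp measurable_swap).aestronglyMeasurable)
      (Filter.Eventually.of_forall fun p => hk1 p.2 p.1)
    refine h1.congr (Filter.Eventually.of_forall fun p => ?_)
    simp [Function.uncurry, mul_assoc]
  calc ∫ x, ν x * (∫ ξ, a ξ * k ξ x) ∂μ = ∫ x, (∫ ξ, ν x * (a ξ * k ξ x)) ∂μ := by
        simp_rw [integral_const_mul]
    _ = ∫ ξ, ∫ x, ν x * (a ξ * k ξ x) ∂μ := integral_integral_swap hint
    _ = ∫ ξ, a ξ * ∫ x, ν x * k ξ x ∂μ := by
        congr 1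
        funext ξ
        rw [← integral_const_mul]
        congr 1
        funext x
        ring
    _ = 0 := by simp [h]

/-- Fourier inversion, in the form that `integral_mul_superposition_eq_zero` takes: a Schwartz
function is a superposition of the exponentials `e^{iξx}`. -/
theorem schwartz_eq_integral_exp (ψ : SchwartzMap ℝ ℂ) :
    ∃ a : ℝ → ℂ, Integrable a ∧
      ∀ x : ℝ, ψ x = ∫ ξ : ℝ, a ξ * Complex.exp ((ξ * x : ℝ) * Complex.I) := by
  set a0 : SchwartzMap ℝ ℂ := FourierTransform.fourier ψ
  have h1 : ∀ x : ℝ, ψ x = ∫ ξ : ℝ, a0 ξ * Complex.exp ((2 * Real.pi * ξ * x : ℝ) * Complex.I) := by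
    intro x
    have h0 : FourierTransformInv.fourierInv a0 = ψ := FourierTransform.fourierInv_fourier_eq ψ
    rw [← h0, SchwartzMap.fourierInv_coe, Real.fourierInv_eq']
    congr 1
    funext ξ
    rw [smul_eq_mul, mul_comm]
    congr 4
    simp
    ring
  refine ⟨fun ξ => ((2 * Real.pi)⁻¹ : ℝ) * a0 (ξ / (2 * Real.pi)), ?_, fun x => ?_⟩
  · exact (a0.integrable.comp_div (by positivity)).const_mul _
  · have h2 : ∀ ξ : ℝ, (((2 * Real.pi)⁻¹ : ℝ) : ℂ) * a0 (ξ / (2 * Real.pi)) *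
        Complex.exp ((ξ * x : ℝ) * Complex.I) =
        (((2 * Real.pi)⁻¹ : ℝ) : ℂ) * (fun ξ : ℝ => a0 ξ *
          Complex.exp ((2 * Real.pi * ξ * x : ℝ) * Complex.I)) (ξ / (2 * Real.pi)) := by
      intro ξ
      simp only
      rw [mul_assoc]
      congr 5
      field_simp
    simp_rw [h2]
    rw [integral_const_mul, Measure.integral_comp_div (fun ξ : ℝ => a0 ξ *
      Complex.exp ((2 * Real.pi * ξ * x : ℝ) * Complex.I)), h1, abs_of_pos (by positivity),
      Complex.real_smul, ← mul_assoc, ← Complex.ofReal_mul, inv_mul_cancel₀ (by positivity)]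
    simp

/-- If all moments of `ν = e^{-y²/2} g` vanish, then so does `∫ ν(y) e^{iξy} dy`, by expanding the
exponential; superposing these gives `∫ ν ψ = 0` for every test function `ψ`. -/
theorem hermite_complete {g : ℝ → ℂ} (hg : MemLp g 2 volume)
    (h : ∀ m : ℕ, ∫ y : ℝ, ((y ^ m * Real.exp (-y ^ 2 / 2) : ℝ) : ℂ) * g y = 0) :
    g =ᵐ[volume] 0 := by
  set ν : ℝ → ℂ := fun y => ((Real.exp (-y ^ 2 / 2) : ℝ) : ℂ) * g y with hνdef
  have hexp : ∀ ξ : ℝ, Integrable fun y => (Real.exp |ξ * y| : ℝ) * ‖ν y‖ := by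
    intro ξ
    have hm : MemLp (fun y : ℝ => Real.exp |ξ * y| * Real.exp (-y ^ 2 / 2)) 2 volume := by
      have hc : Continuous fun y : ℝ => Real.exp |ξ * y| * Real.exp (-y ^ 2 / 2) := by fun_prop
      rw [memLp_two_iff_integrable_sq hc.aestronglyMeasurable]
      refine Integrable.mono' ((integrable_exp_neg_mul_sq (b := 1 / 2) (by norm_num)).const_mul
        (Real.exp (2 * ξ ^ 2))) (hc.pow 2).aestronglyMeasurable
        (Filter.Eventually.of_forall fun y => ?_)
      rw [Real.norm_of_nonneg (by positivity), ← Real.exp_add, ← Real.exp_nat_mul, ← Real.exp_add]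
      refine Real.exp_le_exp.2 ?_
      push_cast
      nlinarith [sq_nonneg (2 * |ξ| - |y|), abs_mul ξ y, sq_abs ξ, sq_abs y]
    have h2 := hm.integrable_mul hg.norm
    refine h2.congr (Filter.Eventually.of_forall fun y => ?_)
    simp only [hνdef, Pi.mul_apply, norm_mul, Complex.norm_real]
    rw [Real.norm_of_nonneg (Real.exp_pos _).le]
    ring
  have hν : Integrable ν := by
    have h0 := hexp 0
    simp only [zero_mul, abs_zero, Real.exp_zero, one_mul] at h0
    refine (integrable_norm_iff ?_).1 h0
    exact (Continuous.aestronglyMeasurable (by fun_prop)).mul hg.1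
  have hF : ∀ ξ : ℝ, ∫ y, ν y * Complex.exp ((ξ * y : ℝ) * Complex.I) = 0 := by
    intro ξ
    have hs : ∀ y : ℝ, HasSum (fun n : ℕ => |ξ * y| ^ n / n.factorial * ‖ν y‖)
        (Real.exp |ξ * y| * ‖ν y‖) := by
      intro y
      have := NormedSpace.expSeries_div_hasSum_exp |ξ * y|
      rw [← Real.exp_eq_exp_ℝ] at this
      exact this.mul_right _
    have hsum := hasSum_integral_of_dominated_convergence (μ := (volume : Measure ℝ))
      (F := fun (n : ℕ) (y : ℝ) => ν y * (((ξ * y : ℝ) * Complex.I) ^ n / n.factorial))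
      (f := fun y => ν y * Complex.exp ((ξ * y : ℝ) * Complex.I))
      (fun n y => |ξ * y| ^ n / n.factorial * ‖ν y‖)
      (fun n => hν.1.mul (Continuous.aestronglyMeasurable (by fun_prop)))
      (fun n => Filter.Eventually.of_forall fun y => by
        rw [norm_mul (ν y), mul_comm]
        refine le_of_eq (congrArg (· * ‖ν y‖) ?_)
        rw [norm_div, norm_pow, norm_mul, Complex.norm_I, mul_one, Complex.norm_real,
          Real.norm_eq_abs, Complex.norm_natCast])
      (Filter.Eventually.of_forall fun y => (hs y).summable)
      (by simp_rw [fun y => (hs y).tsum_eq]; exact hexp ξ)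
      (Filter.Eventually.of_forall fun y => by
        have := NormedSpace.expSeries_div_hasSum_exp (((ξ * y : ℝ) : ℂ) * Complex.I)
        rw [← Complex.exp_eq_exp_ℂ] at this
        exact this.mul_left _)
    refine hsum.unique ?_
    convert hasSum_zero using 2 with n
    have : ∀ y : ℝ, ν y * (((ξ * y : ℝ) * Complex.I) ^ n / n.factorial) =
        ((ξ * Complex.I) ^ n / n.factorial) *
          (((y ^ n * Real.exp (-y ^ 2 / 2) : ℝ) : ℂ) * g y) := by
      intro y
      simp only [hνdef]
      push_cast
      ring
    simp_rw [this]
    rw [integral_const_mul, h, mul_zero]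
  have hzero : ∀ᵐ y, ν y = 0 := by
    refine ae_eq_zero_of_integral_contDiff_smul_eq_zero hν.locallyIntegrable fun φ hφ hφc => ?_
    have hφ' : ContDiff ℝ (⊤ : ℕ∞) fun y => ((φ y : ℝ) : ℂ) := Complex.ofRealCLM.contDiff.comp hφ
    have hφc' : HasCompactSupport fun y => ((φ y : ℝ) : ℂ) :=
      hφc.comp_left (g := fun x : ℝ => (x : ℂ)) Complex.ofReal_zero
    obtain ⟨a, ha, hψ⟩ := schwartz_eq_integral_exp (hφc'.toSchwartzMap hφ')
    have h0 := integral_mul_superposition_eq_zero hν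
      (k := fun ξ y => Complex.exp ((ξ * y : ℝ) * Complex.I))
      (by simp only [Function.uncurry_def]; fun_prop)
      (fun ξ x => by rw [Complex.norm_exp_ofReal_mul_I]) hF ha
    rw [← h0]
    congr 1
    funext y
    rw [← hψ, Complex.real_smul, mul_comm]
    rfl
  filter_upwards [hzero] with y hy
  simp only [hνdef, mul_eq_zero, Complex.ofReal_eq_zero] at hy
  exact hy.resolve_left (Real.exp_pos _).ne'

/-- On the half-line, `ν = e^{-y/2} g` decays too slowly for the exponential series of `e^{iξy}` to
be integrated termwise for all `ξ`. The series of `cos (ξ √y)` is a power series in `y` as well, and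
`ν(y) cosh (ξ √y)` is integrable for every `ξ`; so cosines in `√y` replace the exponentials. -/
theorem laguerre_complete {g : ℝ → ℂ} (hg : MemLp g 2 posMeasure)
    (h : ∀ m : ℕ, ∫ y : ℝ, ((y ^ m * Real.exp (-y / 2) : ℝ) : ℂ) * g y ∂posMeasure = 0) :
    g =ᵐ[posMeasure] 0 := by
  set ν : ℝ → ℂ := fun y => ((Real.exp (-y / 2) : ℝ) : ℂ) * g y with hνdef
  have hpos : ∀ᵐ y ∂posMeasure, 0 < y := ae_restrict_mem measurableSet_Ioi
  have hexp : ∀ ξ : ℝ, Integrable (fun y => (Real.cosh (ξ * √y) : ℝ) * ‖ν y‖) posMeasure := by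
    intro ξ
    have hm : MemLp (fun y : ℝ => Real.cosh (ξ * √y) * Real.exp (-y / 2)) 2 posMeasure := by
      have hc : Continuous fun y : ℝ => Real.cosh (ξ * √y) * Real.exp (-y / 2) := by fun_prop
      rw [memLp_two_iff_integrable_sq hc.aestronglyMeasurable]
      have hi : Integrable (fun y : ℝ => Real.exp (2 * ξ ^ 2) * Real.exp (-y / 2)) posMeasure := by
        have := (integrable_poly_mul_exp_half 1).re
        simp only [Polynomial.eval_one, one_mul] at this
        exact this.const_mul _
      refine hi.mono' (hc.pow 2).aestronglyMeasurable ?_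
      filter_upwards [hpos] with y hy
      have hs : √y ^ 2 = y := Real.sq_sqrt hy.le
      have h1 : Real.cosh (ξ * √y) ≤ Real.exp |ξ * √y| := by
        rw [← Real.cosh_abs, Real.cosh_eq]
        have : Real.exp (-|ξ * √y|) ≤ Real.exp |ξ * √y| :=
          Real.exp_le_exp.2 (by linarith [abs_nonneg (ξ * √y)])
        linarith
      have h2 : Real.cosh (ξ * √y) * Real.exp (-y / 2) ≤ Real.exp |ξ * √y| * Real.exp (-y / 2) := by
        gcongr
      have h3 : 0 ≤ Real.cosh (ξ * √y) * Real.exp (-y / 2) := by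
        have := Real.cosh_pos (ξ * √y)
        positivity
      rw [Real.norm_of_nonneg (by positivity)]
      refine (pow_le_pow_left₀ h3 h2 2).trans ?_
      rw [← Real.exp_add, ← Real.exp_nat_mul, ← Real.exp_add]
      refine Real.exp_le_exp.2 ?_
      have he : |ξ * √y| = |ξ| * √y := by rw [abs_mul, abs_of_nonneg (Real.sqrt_nonneg y)]
      rw [he]
      push_cast
      nlinarith [sq_nonneg (2 * |ξ| - √y), sq_abs ξ]
    have h2 := hm.integrable_mul hg.norm
    refine h2.congr (Filter.Eventually.of_forall fun y => ?_)
    simp only [hνdef, Pi.mul_apply, norm_mul, Complex.norm_real]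
    rw [Real.norm_of_nonneg (Real.exp_pos _).le]
    ring
  have hν : Integrable ν posMeasure := by
    have h0 := hexp 0
    simp only [zero_mul, Real.cosh_zero, one_mul] at h0
    refine (integrable_norm_iff ?_).1 h0
    exact (Continuous.aestronglyMeasurable (by fun_prop)).mul hg.1
  have hF : ∀ ξ : ℝ, ∫ y, ν y * Complex.cos ((ξ * √y : ℝ)) ∂posMeasure = 0 := by
    intro ξ
    have hs : ∀ y : ℝ, HasSum (fun n : ℕ => (ξ * √y) ^ (2 * n) / (2 * n).factorial * ‖ν y‖)
        (Real.cosh (ξ * √y) * ‖ν y‖) := fun y => (Real.hasSum_cosh _).mul_right _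
    have hsum := hasSum_integral_of_dominated_convergence (μ := posMeasure)
      (F := fun (n : ℕ) (y : ℝ) =>
        ν y * ((-1) ^ n * ((ξ * √y : ℝ) : ℂ) ^ (2 * n) / (2 * n).factorial))
      (f := fun y => ν y * Complex.cos ((ξ * √y : ℝ)))
      (fun n y => (ξ * √y) ^ (2 * n) / (2 * n).factorial * ‖ν y‖)
      (fun n => hν.1.mul (Continuous.aestronglyMeasurable (by fun_prop)))
      (fun n => Filter.Eventually.of_forall fun y => by
        rw [norm_mul (ν y), mul_comm]
        refine le_of_eq (congrArg (· * ‖ν y‖) ?_)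
        rw [norm_div, norm_mul, norm_pow, norm_neg, norm_one, one_pow, one_mul, norm_pow,
          Complex.norm_real, Real.norm_eq_abs, pow_mul |_|, sq_abs, ← pow_mul,
          Complex.norm_natCast])
      (Filter.Eventually.of_forall fun y => (hs y).summable)
      (by simp_rw [fun y => (hs y).tsum_eq]; exact hexp ξ)
      (Filter.Eventually.of_forall fun y => (Complex.hasSum_cos _).mul_left _)
    refine hsum.unique ?_
    convert hasSum_zero using 2 with n
    have : ∫ y, ν y * ((-1) ^ n * ((ξ * √y : ℝ) : ℂ) ^ (2 * n) / (2 * n).factorial) ∂posMeasure =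
        ∫ y, ((-1) ^ n * (ξ : ℂ) ^ (2 * n) / (2 * n).factorial) *
          (((y ^ n * Real.exp (-y / 2) : ℝ) : ℂ) * g y) ∂posMeasure := by
      refine integral_congr_ae ?_
      filter_upwards [hpos] with y hy
      have h1 : ((ξ * √y : ℝ) : ℂ) ^ (2 * n) = (ξ : ℂ) ^ (2 * n) * ((y ^ n : ℝ) : ℂ) := by
        have : (ξ * √y) ^ (2 * n) = ξ ^ (2 * n) * y ^ n := by
          rw [mul_pow, pow_mul √y, Real.sq_sqrt hy.le]
        exact_mod_cast this
      simp only [hνdef]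
      rw [h1]
      push_cast
      ring
    rw [this, integral_const_mul, h, mul_zero]
  have hνI : IntegrableOn ν (Ioi 0) volume := hν
  have hzero : ∀ᵐ y : ℝ, y ∈ Ioi (0 : ℝ) → ν y = 0 := by
    refine isOpen_Ioi.ae_eq_zero_of_integral_contDiff_smul_eq_zero hνI.locallyIntegrableOn
      fun φ hφ hφc hφs => ?_
    -- the even test function `x ↦ φ(x²)` is a superposition of cosines
    have hφ' : ContDiff ℝ (⊤ : ℕ∞) fun x : ℝ => ((φ (x ^ 2) : ℝ) : ℂ) :=
      Complex.ofRealCLM.contDiff.comp (hφ.comp (by fun_prop))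
    have hφc' : HasCompactSupport fun x : ℝ => ((φ (x ^ 2) : ℝ) : ℂ) := by
      obtain ⟨R, hR⟩ := hφc.isCompact.isBounded.subset_closedBall 0
      refine HasCompactSupport.intro (isCompact_closedBall (0 : ℝ) (|R| + 1)) fun x hx => ?_
      have : φ (x ^ 2) = 0 := by
        by_contra hne
        have h1 := hR (subset_tsupport _ (Function.mem_support.2 hne))
        rw [Metric.mem_closedBall, dist_zero_right, Real.norm_of_nonneg (sq_nonneg x)] at h1
        refine hx ?_
        rw [Metric.mem_closedBall, dist_zero_right, Real.norm_eq_abs]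
        nlinarith [abs_nonneg R, le_abs_self R, sq_abs x, abs_nonneg x]
      rw [this, Complex.ofReal_zero]
    obtain ⟨a, ha, hψ⟩ := schwartz_eq_integral_exp (hφc'.toSchwartzMap hφ')
    have hcos : ∀ x : ℝ, ((φ (x ^ 2) : ℝ) : ℂ) = ∫ ξ : ℝ, a ξ * Complex.cos ((ξ * x : ℝ)) := by
      intro x
      have e1 := hψ x
      have e2 := hψ (-x)
      change ((φ (x ^ 2) : ℝ) : ℂ) = _ at e1
      change ((φ ((-x) ^ 2) : ℝ) : ℂ) = _ at e2
      rw [neg_sq] at e2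
      have hb : ∀ x : ℝ, Integrable fun ξ : ℝ => a ξ * Complex.exp ((ξ * x : ℝ) * Complex.I) :=
        fun x => ha.mul_bdd (c := 1) (Continuous.aestronglyMeasurable (by fun_prop))
          (Filter.Eventually.of_forall fun ξ => by rw [Complex.norm_exp_ofReal_mul_I])
      have e3 := integral_add (hb x) (hb (-x))
      rw [← e1, ← e2] at e3
      have e4 : ∀ ξ : ℝ, a ξ * Complex.exp ((ξ * x : ℝ) * Complex.I) +
          a ξ * Complex.exp ((ξ * (-x) : ℝ) * Complex.I) =
          2 * (a ξ * Complex.cos ((ξ * x : ℝ))) := by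
        intro ξ
        rw [Complex.cos]
        push_cast
        ring_nf
      simp_rw [e4] at e3
      rw [integral_const_mul] at e3
      linear_combination -(1 / 2 : ℂ) * e3
    have h0 := integral_mul_superposition_eq_zero hν
      (k := fun ξ y => Complex.cos ((ξ * √y : ℝ)))
      (by simp only [Function.uncurry_def]; fun_prop)
      (fun ξ x => by
        rw [← Complex.ofReal_cos, Complex.norm_real]
        exact Real.abs_cos_le_one _) hF ha
    have h1 : ∫ y in Ioi (0 : ℝ), φ y • ν y = 0 := by
      rw [← h0]
      refine integral_congr_ae ?_
      filter_upwards [hpos] with y hy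
      rw [← hcos, Real.sq_sqrt hy.le, Complex.real_smul, mul_comm]
    rw [← h1, setIntegral_eq_integral_of_forall_compl_eq_zero]
    intro y hy
    have : φ y = 0 := by
      by_contra hne
      exact hy (hφs (subset_tsupport _ (Function.mem_support.2 hne)))
    rw [this, zero_smul]
  refine (ae_restrict_iff' measurableSet_Ioi).2 ?_
  filter_upwards [hzero] with y hy hy0
  have := hy hy0
  simp only [hνdef, mul_eq_zero, Complex.ofReal_eq_zero] at this
  exact this.resolve_left (Real.exp_pos _).ne'

/-- The Hermite functions are complete in `L²(ℝ)`. -/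
theorem hermiteFun_complete {g : ℝ → ℂ} (hg : MemLp g 2 volume)
    (h : ∀ m : ℕ, ∫ y : ℝ, (hermiteFun m y : ℂ) * g y = 0) : g =ᵐ[volume] 0 := by
  have hint : ∀ P : Polynomial ℝ,
      Integrable fun y : ℝ => ((P.eval y * Real.exp (-y ^ 2 / 2) : ℝ) : ℂ) * g y :=
    fun P => (memLp_poly_mul_gaussian P).integrable_mul hg
  let Λ : Polynomial ℝ →ₗ[ℝ] ℂ :=
    { toFun P := ∫ y : ℝ, ((P.eval y * Real.exp (-y ^ 2 / 2) : ℝ) : ℂ) * g y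
      map_add' P Q := by
        rw [← integral_add (hint P) (hint Q)]
        congr 1; funext y; rw [Polynomial.eval_add]; push_cast; ring
      map_smul' a P := by
        rw [RingHom.id_apply, Complex.real_smul, ← integral_const_mul]
        congr 1; funext y; rw [Polynomial.eval_smul, smul_eq_mul]; push_cast; ring }
  refine hermite_complete hg fun m => ?_
  have := linear_eq_zero_of_triangular Λ hermPoly (fun m => (hermPoly_degree m).1)
    (fun m => by rw [(hermPoly_degree m).2]; positivity) (fun m => ?_) (Polynomial.X ^ m)
  · simpa [Λ] using this
  · have h1 := h m
    simp_rw [hermiteFun_eq] at h1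
    have h2 : ∀ y : ℝ, ((hermConst m * ((hermPoly m).eval y * Real.exp (-y ^ 2 / 2)) : ℝ) : ℂ) * g y
        = hermConst m * (((((hermPoly m).eval y * Real.exp (-y ^ 2 / 2)) : ℝ) : ℂ) * g y) := by
      intro y; push_cast; ring
    simp_rw [h2] at h1
    rw [integral_const_mul] at h1
    exact (mul_eq_zero.1 h1).resolve_left (by exact_mod_cast (hermConst_pos m).ne')

/-- The Laguerre functions are complete in `L²(ℝ₊)`. -/
theorem laguerreFun_complete {g : ℝ → ℂ} (hg : MemLp g 2 posMeasure)
    (h : ∀ m : ℕ, ∫ y : ℝ, (laguerreFun m y : ℂ) * g y ∂posMeasure = 0) :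
    g =ᵐ[posMeasure] 0 := by
  have hint : ∀ P : Polynomial ℝ,
      Integrable (fun y : ℝ => ((P.eval y * Real.exp (-y / 2) : ℝ) : ℂ) * g y) posMeasure :=
    fun P => (memLp_poly_mul_exp P).integrable_mul hg
  let Λ : Polynomial ℝ →ₗ[ℝ] ℂ :=
    { toFun P := ∫ y : ℝ, ((P.eval y * Real.exp (-y / 2) : ℝ) : ℂ) * g y ∂posMeasure
      map_add' P Q := by
        rw [← integral_add (hint P) (hint Q)]
        congr 1; funext y; rw [Polynomial.eval_add]; push_cast; ring
      map_smul' a P := by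
        rw [RingHom.id_apply, Complex.real_smul, ← integral_const_mul]
        congr 1; funext y; rw [Polynomial.eval_smul, smul_eq_mul]; push_cast; ring }
  refine laguerre_complete hg fun m => ?_
  have := linear_eq_zero_of_triangular Λ (fun m => lagPoly m m) (fun m => (lagPoly_degree m m).1)
    (fun m => by rw [(lagPoly_degree m m).2]; positivity) (fun m => ?_) (Polynomial.X ^ m)
  · simpa [Λ] using this
  · have h1 := h m
    simp_rw [laguerreFun_eq] at h1
    have h2 : ∀ y : ℝ,
        (((-1) ^ m / m.factorial * ((lagPoly m m).eval y * Real.exp (-y / 2)) : ℝ) : ℂ) * g y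
        = ((-1) ^ m / m.factorial : ℝ) *
          (((((lagPoly m m).eval y * Real.exp (-y / 2)) : ℝ) : ℂ) * g y) := by
      intro y; push_cast; ring
    simp_rw [h2] at h1
    rw [integral_const_mul] at h1
    refine (mul_eq_zero.1 h1).resolve_left ?_
    have : ((-1 : ℝ) ^ m / m.factorial) ≠ 0 := by positivity
    exact_mod_cast this

/-! ### Total sets and surjectivity -/

/-- A set of vectors whose orthogonal complement is zero. -/
def IsTotal {H : Type*} [NormedAddCommGroup H] [InnerProductSpace ℂ H] (S : Set H) : Prop :=
  ∀ v : H, (∀ s ∈ S, inner ℂ s v = 0) → v = 0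

theorem isTotal_univ {H : Type*} [NormedAddCommGroup H] [InnerProductSpace ℂ H] :
    IsTotal (univ : Set H) := fun v h => inner_self_eq_zero.1 (h v (mem_univ v))

theorem isTotal_of_dense {H : Type*} [NormedAddCommGroup H] [InnerProductSpace ℂ H] {S : Set H}
    (hS : Dense S) : IsTotal S := by
  intro v h
  have hc : IsClosed {w : H | inner ℂ w v = 0} := isClosed_eq (by fun_prop) continuous_const
  have : v ∈ {w : H | inner ℂ w v = 0} := by
    have h1 := hc.closure_subset_iff.2 (show S ⊆ {w : H | inner ℂ w v = 0} from h)
    exact h1 (hS v)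
  exact inner_self_eq_zero.1 this

/-- The range of an isometry is closed, so it is everything once it contains a total set. -/
theorem LinearIsometry.surjective_of_isTotal {H K : Type*} [NormedAddCommGroup H]
    [InnerProductSpace ℂ H] [CompleteSpace H] [NormedAddCommGroup K] [InnerProductSpace ℂ K]
    (A : H →ₗᵢ[ℂ] K) {S : Set K} (hS : IsTotal S) (h : ∀ s ∈ S, ∃ x, A x = s) :
    Function.Surjective A := by
  have hc : IsComplete (A.toLinearMap.range : Set K) := by
    have h1 : (A.toLinearMap.range : Set K) = range A := by ext; simp
    rw [h1]
    exact A.isometry.isUniformInducing.isComplete_range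
  have : CompleteSpace A.toLinearMap.range := hc.completeSpace_coe
  have htop : A.toLinearMap.range = ⊤ := by
    rw [← Submodule.orthogonal_eq_bot_iff, Submodule.eq_bot_iff]
    intro v hv
    refine hS v fun s hs => ?_
    obtain ⟨x, rfl⟩ := h s hs
    exact (Submodule.mem_orthogonal _ _).1 hv _ ⟨x, rfl⟩
  intro y
  have : y ∈ A.toLinearMap.range := htop ▸ Submodule.mem_top
  exact this

section Tensor

variable {α β : Type*} [MeasurableSpace α] [MeasurableSpace β]
  {μ : Measure α} {ν : Measure β} [SigmaFinite μ] [SigmaFinite ν]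

theorem norm_tensor (f : L2 μ) (g : L2 ν) : ‖tensor f g‖ = ‖f‖ * ‖g‖ := by
  rw [← tensorEmb_tmul, LinearIsometry.norm_map, TensorProduct.norm_tmul]

/-- `(f, g) ↦ f ⊗ g` as a continuous bilinear map. -/
def tensorCLM : L2 μ →L[ℂ] L2 ν →L[ℂ] L2 (μ.prod ν) :=
  (tensorBilin (μ := μ) (ν := ν)).mkContinuous₂ 1 fun f g => by
    rw [one_mul]
    exact (norm_tensor f g).le

/-- Elementary tensors of total sets form a total set. -/
theorem IsTotal.tensor {S : Set (L2 μ)} {T : Set (L2 ν)} (hS : IsTotal S) (hT : IsTotal T) :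
    IsTotal (image2 tensor S T) := by
  intro F hF
  have h1 : ∀ t ∈ T, ∀ f : L2 μ, inner ℂ (SiegelToeplitz.tensor f t) F = 0 := by
    intro t ht f
    have h0 : (ContinuousLinearMap.adjoint (tensorCLM.flip t : L2 μ →L[ℂ] L2 (μ.prod ν))) F = 0 :=
      hS _ fun s hs => by
        rw [ContinuousLinearMap.adjoint_inner_right]
        exact hF _ (mem_image2_of_mem hs ht)
    have h2 := ContinuousLinearMap.adjoint_inner_right
      (tensorCLM.flip t : L2 μ →L[ℂ] L2 (μ.prod ν)) f F
    rw [h0, inner_zero_right] at h2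
    exact h2.symm
  have h3 : ∀ (f : L2 μ) (g : L2 ν), inner ℂ (SiegelToeplitz.tensor f g) F = 0 := by
    intro f g
    have h0 : (ContinuousLinearMap.adjoint (tensorCLM f : L2 ν →L[ℂ] L2 (μ.prod ν))) F = 0 :=
      hT _ fun t ht => by
        rw [ContinuousLinearMap.adjoint_inner_right]
        exact h1 t ht f
    have h2 := ContinuousLinearMap.adjoint_inner_right
      (tensorCLM f : L2 ν →L[ℂ] L2 (μ.prod ν)) g F
    rw [h0, inner_zero_right] at h2
    exact h2.symm
  refine isTotal_of_dense (denseRange_tensorEmb (μ := μ) (ν := ν)) F ?_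
  rintro _ ⟨x, rfl⟩
  induction x using TensorProduct.induction_on with
  | zero => simp
  | add x y hx hy => rw [map_add, inner_add_left, hx, hy, add_zero]
  | tmul f g => rw [tensorEmb_tmul]; exact h3 f g

variable {α' β' : Type*} [MeasurableSpace α'] [MeasurableSpace β']
  {μ' : Measure α'} {ν' : Measure β'} [SigmaFinite μ'] [SigmaFinite ν']

theorem tensorIsometry_tensor (A : L2 μ →ₗᵢ[ℂ] L2 μ') (B : L2 ν →ₗᵢ[ℂ] L2 ν')
    (f : L2 μ) (g : L2 ν) : tensorIsometry A B (tensor f g) = tensor (A f) (B g) :=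
  tensorMap_tensor A B f g

theorem tensorIsometry_surjective {A : L2 μ →ₗᵢ[ℂ] L2 μ'} {B : L2 ν →ₗᵢ[ℂ] L2 ν'}
    (hA : Function.Surjective A) (hB : Function.Surjective B) :
    Function.Surjective (tensorIsometry A B) := by
  refine LinearIsometry.surjective_of_isTotal _
    ((isTotal_univ (H := L2 μ')).tensor (isTotal_univ (H := L2 ν'))) ?_
  rintro _ ⟨f, -, g, -, rfl⟩
  obtain ⟨f, rfl⟩ := hA f
  obtain ⟨g, rfl⟩ := hB g
  exact ⟨tensor f g, tensorIsometry_tensor A B f g⟩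

end Tensor

/-- An almost everywhere left inverse `ψ` of `φ` gives the preimage `(w⁻¹ g) ∘ ψ` of `g`. -/
theorem weightedComp_surjective {α β : Type*} [MeasurableSpace α] [MeasurableSpace β]
    {μ : Measure α} {ν : Measure β} {w : α → ℂ} {φ : α → β} (h : IsWeightedPullback μ ν w φ)
    (ψ : β → α) (hψ : Measurable ψ) (hψφ : ∀ᵐ x ∂μ, ψ (φ x) = x) :
    Function.Surjective (weightedComp h) := by
  intro g
  obtain ⟨g', hg', hgg'⟩ := (Lp.memLp g).1
  set f : β → ℂ := fun y => (w (ψ y))⁻¹ * g' (ψ y) with hf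
  have hfm : AEStronglyMeasurable f ν :=
    (((h.measurable_weight.comp hψ).inv).mul (hg'.measurable.comp hψ)).aestronglyMeasurable
  have hwf : (fun x => w x * f (φ x)) =ᵐ[μ] g := by
    filter_upwards [hψφ, h.weight_ne_zero, hgg'] with x h1 h2 h3
    rw [hf]
    simp only [h1]
    rw [mul_inv_cancel_left₀ h2, h3]
  have hfL : MemLp f 2 ν := by
    refine ⟨hfm, ?_⟩
    rw [← h.eLpNorm_eq hfm, eLpNorm_congr_ae hwf]
    exact (Lp.memLp g).2
  refine ⟨hfL.toLp, Lp.ext ?_⟩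
  filter_upwards [weightedComp_coeFn h hfL.toLp, h.quasi.ae hfL.coeFn_toLp, hwf] with x h1 h2 h3
  rw [h1, h2, h3]

theorem fourierL2_surjective : Function.Surjective fourierL2 := by
  have h1 : Function.Surjective (weightedComp isWeightedPullback_dilation) :=
    weightedComp_surjective _ (fun t => t * (2 * Real.pi)) (by fun_prop)
      (Filter.Eventually.of_forall fun x => by field_simp)
  exact h1.comp (Lp.fourierTransformₗᵢ ℝ ℂ).surjective

/-- The inverse of `κ`. -/
def kappaInv (ζ : ℂ × ℂ) : ℝ × ℝ × ℝ × ℝ := (ζ.1.re, ζ.1.im, ζ.2.re, ζ.2.im - ‖ζ.1‖ ^ 2)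

theorem kappaInv_kappa (p : ℝ × ℝ × ℝ × ℝ) : kappaInv (kappa p) = p := by
  obtain ⟨a, b, c, d⟩ := p
  simp [kappa, kappaInv, toComplex, ← Complex.ofReal_pow]

theorem kappa_kappaInv (ζ : ℂ × ℂ) : kappa (kappaInv ζ) = ζ := by
  obtain ⟨a, b⟩ := ζ
  refine Prod.ext ?_ ?_
  · exact Complex.ext rfl rfl
  · have : (toComplex (kappaInv (a, b))).1 = a := Complex.ext rfl rfl
    rw [kappa]
    simp only
    rw [this]
    refine Complex.ext ?_ ?_ <;> simp [toComplex, kappaInv, ← Complex.ofReal_pow]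

theorem measurable_kappaInv : Measurable kappaInv := by
  unfold kappaInv; fun_prop

theorem opU0_surjective : Function.Surjective opU0 :=
  weightedComp_surjective _ kappaInv measurable_kappaInv
    (Filter.Eventually.of_forall kappaInv_kappa)

theorem opU1_surjective : Function.Surjective opU1 :=
  tensorIsometry_surjective fourierL2_surjective
    (tensorIsometry_surjective (fun x => ⟨x, rfl⟩)
      (tensorIsometry_surjective fourierL2_surjective fun x => ⟨x, rfl⟩))

theorem ae_flat_x2_ne_zero : ∀ᵐ p ∂flatMeasure, p.2.2.1 ≠ 0 := by
  have h : ∀ᵐ t : ℝ, t ≠ 0 := by simp [ae_iff]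
  exact (Measure.quasiMeasurePreserving_fst.comp
    (Measure.quasiMeasurePreserving_snd.comp Measure.quasiMeasurePreserving_snd)).ae h

theorem opV1_surjective : Function.Surjective opV1 := by
  refine weightedComp_surjective _
    (fun p => (p.1, p.2.1, p.2.2.1, p.2.2.2 * (2 * |p.2.2.1|))) (by fun_prop) ?_
  filter_upwards [ae_flat_x2_ne_zero] with p hp
  obtain ⟨a, b, c, d⟩ := p
  have : |c| ≠ 0 := abs_ne_zero.2 hp
  simp only [psi1]
  congr 3
  field_simp

theorem opV2_surjective : Function.Surjective opV2 := by
  refine weightedComp_surjective _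
    (fun p => (p.1 / (2 * √|p.2.2.1|) - √|p.2.2.1| * p.2.1,
      p.1 / (2 * √|p.2.2.1|) + √|p.2.2.1| * p.2.1, p.2.2.1, p.2.2.2)) (by fun_prop) ?_
  filter_upwards [ae_flat_x2_ne_zero] with p hp
  obtain ⟨a, b, c, d⟩ := p
  have : √|c| ≠ 0 := (Real.sqrt_pos.2 (abs_pos.2 hp)).ne'
  simp only [psi2]
  refine Prod.ext ?_ (Prod.ext ?_ rfl) <;> simp only <;> field_simp <;> ring

theorem opU_surjective : Function.Surjective opU :=
  opV2_surjective.comp (opV1_surjective.comp (opU1_surjective.comp opU0_surjective))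

/-! ### The embeddings `R₀` -/

theorem ae_halfMeasure_iff {P : ℝ × ℝ → Prop} :
    (∀ᵐ x ∂halfMeasure, P x) ↔ ∀ᵐ x ∂volume, x ∈ univ ×ˢ Ioi (0 : ℝ) → P x := by
  rw [halfMeasure_eq, ae_restrict_iff' (MeasurableSet.univ.prod measurableSet_Ioi)]

theorem integral_halfMeasure_eq (f : ℝ × ℝ → ℂ) :
    ∫ x, f x ∂halfMeasure = ∫ x, (univ ×ˢ Ioi (0 : ℝ)).indicator f x := by
  rw [halfMeasure_eq, integral_indicator (MeasurableSet.univ.prod measurableSet_Ioi)]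

/-- Extension by zero from `ℝ × ℝ₊` to `ℝ × ℝ`. -/
def zeroExt (g : L2 halfMeasure) : L2 (volume : Measure (ℝ × ℝ)) :=
  (memLp_indicator (Lp.memLp g)).toLp

theorem zeroExt_coeFn (g : L2 halfMeasure) :
    zeroExt g =ᵐ[volume] (univ ×ˢ Ioi (0 : ℝ)).indicator g :=
  (memLp_indicator (Lp.memLp g)).coeFn_toLp

theorem inner_zeroExt (f : L2 halfMeasure) (v : L2 (volume : Measure (ℝ × ℝ))) :
    inner ℂ (zeroExt f) v = ∫ x, inner ℂ (f x) (v x) ∂halfMeasure := by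
  rw [L2.inner_def, integral_halfMeasure_eq]
  refine integral_congr_ae ?_
  filter_upwards [zeroExt_coeFn f] with x hx
  rw [hx]
  by_cases h : x ∈ (univ ×ˢ Ioi (0 : ℝ) : Set (ℝ × ℝ)) <;> simp [h]

theorem inner_zeroExt_zeroExt (f g : L2 halfMeasure) :
    inner ℂ (zeroExt f) (zeroExt g) = inner ℂ f g := by
  rw [inner_zeroExt, L2.inner_def]
  have h := zeroExt_coeFn g
  refine integral_congr_ae ?_
  have h2 : ∀ᵐ x ∂halfMeasure, zeroExt g x = g x := by
    rw [ae_halfMeasure_iff]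
    filter_upwards [h] with x hx hm
    rw [hx, indicator_of_mem hm]
  filter_upwards [h2] with x hx
  rw [hx]

/-- The Hermite function `h_m` as an element of `L²(ℝ)`. -/
def hermiteL2 (m : ℕ) : L2 (volume : Measure ℝ) := (memLp_hermiteFun m).toLp

/-- The Laguerre function `ℓ_m` as an element of `L²(ℝ₊)`. -/
def laguerreL2 (m : ℕ) : L2 posMeasure := (memLp_laguerreFun m).toLp

theorem inner_hermiteL2 (m : ℕ) (g : L2 (volume : Measure ℝ)) :
    inner ℂ (hermiteL2 m) g = ∫ y : ℝ, (hermiteFun m y : ℂ) * g y := by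
  rw [L2.inner_def]
  refine integral_congr_ae ?_
  filter_upwards [(memLp_hermiteFun m).coeFn_toLp] with y hy
  rw [hermiteL2, hy, RCLike.inner_apply, Complex.conj_ofReal, mul_comm]

theorem inner_laguerreL2 (m : ℕ) (g : L2 posMeasure) :
    inner ℂ (laguerreL2 m) g = ∫ y : ℝ, (laguerreFun m y : ℂ) * g y ∂posMeasure := by
  rw [L2.inner_def]
  refine integral_congr_ae ?_
  filter_upwards [(memLp_laguerreFun m).coeFn_toLp] with y hy
  rw [laguerreL2, hy, RCLike.inner_apply, Complex.conj_ofReal, mul_comm]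

theorem inner_hermiteL2_hermiteL2 (m n : ℕ) :
    inner ℂ (hermiteL2 m) (hermiteL2 n) = if m = n then 1 else 0 := by
  rw [inner_hermiteL2, ← integral_hermiteFun_mul]
  refine integral_congr_ae ?_
  filter_upwards [(memLp_hermiteFun n).coeFn_toLp] with y hy
  rw [hermiteL2, hy]

theorem inner_laguerreL2_laguerreL2 (m n : ℕ) :
    inner ℂ (laguerreL2 m) (laguerreL2 n) = if m = n then 1 else 0 := by
  rw [inner_laguerreL2, ← integral_laguerreFun_mul]
  refine integral_congr_ae ?_
  filter_upwards [(memLp_laguerreFun n).coeFn_toLp] with y hy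
  rw [laguerreL2, hy]

theorem isTotal_hermiteL2 : IsTotal (range hermiteL2) := by
  intro v hv
  refine Lp.ext ?_
  have := hermiteFun_complete (Lp.memLp v) fun m => by
    rw [← inner_hermiteL2]; exact hv _ ⟨m, rfl⟩
  exact this.trans (Lp.coeFn_zero _ _ _).symm

theorem isTotal_laguerreL2 : IsTotal (range laguerreL2) := by
  intro v hv
  refine Lp.ext ?_
  have := laguerreFun_complete (Lp.memLp v) fun m => by
    rw [← inner_laguerreL2]; exact hv _ ⟨m, rfl⟩
  exact this.trans (Lp.coeFn_zero _ _ _).symm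

theorem measurePreserving_unshuffle :
    MeasurePreserving (fun q : (ℝ × ℝ) × (ℝ × ℝ) => (q.1.1, q.2.1, q.1.2, q.2.2))
      ((volume : Measure (ℝ × ℝ)).prod halfMeasure) flatMeasure := by
  refine ⟨by fun_prop, ?_⟩
  rw [← measurePreserving_shuffle.map_eq, Measure.map_map (by fun_prop) (by fun_prop)]
  exact Measure.map_id

/-- The rearrangement of coordinates `(x₁, y₁, x₂, y₂) ↦ ((x₁, x₂), (y₁, y₂))` on `L²`. -/
def shuffleL2 : L2 ((volume : Measure (ℝ × ℝ)).prod halfMeasure) →ₗᵢ[ℂ] L2 flatMeasure :=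
  weightedComp (.of_measurePreserving measurePreserving_shuffle)

theorem shuffleL2_coeFn (F : L2 ((volume : Measure (ℝ × ℝ)).prod halfMeasure)) :
    shuffleL2 F =ᵐ[flatMeasure] fun p => F ((p.1, p.2.2.1), (p.2.1, p.2.2.2)) := by
  filter_upwards [weightedComp_coeFn (.of_measurePreserving measurePreserving_shuffle) F] with p hp
  rw [shuffleL2, hp, one_mul]

theorem shuffleL2_surjective : Function.Surjective shuffleL2 :=
  weightedComp_surjective _ (fun q => (q.1.1, q.2.1, q.1.2, q.2.2)) (by fun_prop)
    (Filter.Eventually.of_forall fun _ => rfl)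

/-- `R₀ g` is, after rearranging the coordinates, the tensor product of `g` (extended by zero)
with `h_{j-1} ⊗ ℓ_{k-1}`. -/
theorem opR0_eq (j k : ℕ) (g : L2 halfMeasure) :
    opR0 j k g =
      shuffleL2 (tensor (zeroExt g) (tensor (hermiteL2 (j - 1)) (laguerreL2 (k - 1)))) := by
  refine Lp.ext ?_
  have hq := measurePreserving_shuffle.quasiMeasurePreserving
  filter_upwards [opR0_coeFn j k g, shuffleL2_coeFn (tensor (zeroExt g)
      (tensor (hermiteL2 (j - 1)) (laguerreL2 (k - 1)))),
    hq.ae (tensor_coeFn (zeroExt g) (tensor (hermiteL2 (j - 1)) (laguerreL2 (k - 1)))),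
    hq.ae (Measure.quasiMeasurePreserving_fst.ae (zeroExt_coeFn g)),
    hq.ae (Measure.quasiMeasurePreserving_snd.ae
      (tensor_coeFn (hermiteL2 (j - 1)) (laguerreL2 (k - 1)))),
    hq.ae (Measure.quasiMeasurePreserving_snd.ae
      (Measure.quasiMeasurePreserving_fst.ae (memLp_hermiteFun (j - 1)).coeFn_toLp)),
    hq.ae (Measure.quasiMeasurePreserving_snd.ae
      (Measure.quasiMeasurePreserving_snd.ae (memLp_laguerreFun (k - 1)).coeFn_toLp))]
    with p h1 h2 h3 h4 h5 h6 h7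
  rw [h1, h2, h3, h4, h5, hermiteL2, laguerreL2, h6, h7, embedFun_eq_tensor]

theorem inner_opR0 (j k j' k' : ℕ) (g g' : L2 halfMeasure) :
    inner ℂ (opR0 j k g) (opR0 j' k' g') =
      inner ℂ g g' * ((if j - 1 = j' - 1 then 1 else 0) * (if k - 1 = k' - 1 then 1 else 0)) := by
  rw [opR0_eq, opR0_eq, LinearIsometry.inner_map_map, inner_tensor, inner_tensor,
    inner_zeroExt_zeroExt, inner_hermiteL2_hermiteL2, inner_laguerreL2_laguerreL2]

theorem adjoint_opR0_opR0 (j k : ℕ) (g : L2 halfMeasure) :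
    ContinuousLinearMap.adjoint (opR0 j k) (opR0 j k g) = g := by
  refine ext_inner_left ℂ fun f => ?_
  rw [ContinuousLinearMap.adjoint_inner_right, inner_opR0]
  simp

/-- A function in `L²(𝒟)` that vanishes for `x₂ < 0` and is orthogonal to the ranges of all
the embeddings `R₀` is zero. -/
theorem eq_zero_of_adjoint_opR0_eq_zero {F : L2 flatMeasure}
    (hneg : ∀ᵐ p ∂flatMeasure, p.2.2.1 < 0 → F p = 0)
    (h : ∀ j k : ℕ, 1 ≤ j → 1 ≤ k → ∀ g, inner ℂ (opR0 j k g) F = 0) : F = 0 := by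
  obtain ⟨F', rfl⟩ := shuffleL2_surjective F
  have hF' : F' = 0 := by
    have htot := (isTotal_univ (H := L2 (volume : Measure (ℝ × ℝ)))).tensor
      (isTotal_hermiteL2.tensor isTotal_laguerreL2)
    refine htot F' ?_
    rintro _ ⟨G, -, _, ⟨_, ⟨a, rfl⟩, _, ⟨b, rfl⟩, rfl⟩, rfl⟩
    -- only the part of `G` on `ℝ × ℝ₊` contributes
    have hG : MemLp G 2 halfMeasure := by
      rw [halfMeasure_eq]; exact (Lp.memLp G).restrict _
    have h1 := h (a + 1) (b + 1) (by omega) (by omega) hG.toLp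
    rw [opR0_eq, LinearIsometry.inner_map_map] at h1
    rw [← h1, L2.inner_def, L2.inner_def]
    simp only [Nat.add_sub_cancel]
    have hneg' : ∀ᵐ q ∂((volume : Measure (ℝ × ℝ)).prod halfMeasure), q.1.2 < 0 → F' q = 0 := by
      filter_upwards [measurePreserving_unshuffle.quasiMeasurePreserving.ae hneg,
        measurePreserving_unshuffle.quasiMeasurePreserving.ae (shuffleL2_coeFn F')] with q h1 h2 hq
      rw [← h1 hq, h2]
    have hne : ∀ᵐ q ∂((volume : Measure (ℝ × ℝ)).prod halfMeasure), q.1.2 ≠ 0 := by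
      have h : ∀ᵐ t : ℝ, t ≠ 0 := by simp [ae_iff]
      exact (Measure.quasiMeasurePreserving_snd (μ := (volume : Measure ℝ))
        (ν := (volume : Measure ℝ)) |>.comp Measure.quasiMeasurePreserving_fst).ae h
    have hGe : ∀ᵐ x ∂(volume : Measure (ℝ × ℝ)), 0 < x.2 → zeroExt hG.toLp x = G x := by
      have h2 := hG.coeFn_toLp
      rw [Filter.EventuallyEq, ae_halfMeasure_iff] at h2
      filter_upwards [h2, zeroExt_coeFn hG.toLp] with x h3 h4 hx
      rw [h4, indicator_of_mem (show x ∈ univ ×ˢ Ioi (0 : ℝ) from ⟨mem_univ _, hx⟩),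
        h3 ⟨mem_univ _, hx⟩]
    refine integral_congr_ae ?_
    filter_upwards [tensor_coeFn G (tensor (hermiteL2 a) (laguerreL2 b)),
      tensor_coeFn (zeroExt hG.toLp) (tensor (hermiteL2 a) (laguerreL2 b)), hneg', hne,
      Measure.quasiMeasurePreserving_fst.ae hGe] with q h1 h2 h3 h4 h5
    rcases lt_or_gt_of_ne h4 with hq | hq
    · rw [h3 hq, inner_zero_right, inner_zero_right]
    · rw [h1, h2, h5 hq]
  rw [hF', map_zero]

/-! ### Multiplication by functions of `(v₁, v₂)` -/

theorem ContinuousLinearMap.eq_of_isTotal {H K : Type*} [NormedAddCommGroup H]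
    [InnerProductSpace ℂ H] [CompleteSpace H] [NormedAddCommGroup K] [InnerProductSpace ℂ K]
    [CompleteSpace K] {S : Set H} (hS : IsTotal S) {A B : H →L[ℂ] K}
    (h : ∀ s ∈ S, A s = B s) : A = B := by
  have h1 : ContinuousLinearMap.adjoint (A - B) = 0 := by
    ext1 v
    refine hS _ fun s hs => ?_
    rw [ContinuousLinearMap.adjoint_inner_right, sub_apply, h s hs, sub_self,
      inner_zero_left]
  rw [← sub_eq_zero, ← ContinuousLinearMap.adjoint_adjoint (A - B), h1, map_zero]

theorem IsTotal.image {H K : Type*} [NormedAddCommGroup H] [InnerProductSpace ℂ H]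
    [NormedAddCommGroup K] [InnerProductSpace ℂ K] {S : Set H} (hS : IsTotal S)
    (A : H →ₗᵢ[ℂ] K) (hA : Function.Surjective A) : IsTotal (A '' S) := by
  intro v hv
  obtain ⟨w, rfl⟩ := hA v
  rw [hS w fun s hs => by rw [← A.inner_map_map]; exact hv _ (mem_image_of_mem _ hs), map_zero]

/-- Multiplication by a bounded function on `L²(μ)`. -/
def mulL2 {α : Type*} [MeasurableSpace α] {μ : Measure α} {a : α → ℂ} (ha : MemLp a ∞ μ) :
    L2 μ →L[ℂ] L2 μ :=
  (ContinuousLinearMap.mul ℂ ℂ).holderL μ ∞ 2 2 ha.toLp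

theorem mulL2_coeFn {α : Type*} [MeasurableSpace α] {μ : Measure α} {a : α → ℂ}
    (ha : MemLp a ∞ μ) (f : L2 μ) : mulL2 ha f =ᵐ[μ] fun x => a x * f x := by
  filter_upwards [(ContinuousLinearMap.mul ℂ ℂ).coeFn_holder (r := 2) ha.toLp f,
    ha.coeFn_toLp] with ζ h1 h2
  rw [← h2]
  exact h1

theorem shuffleL2_tensor (α γ β : L2 (volume : Measure ℝ)) (δ : L2 posMeasure) :
    shuffleL2 (tensor (μ := volume) (tensor (μ := (volume : Measure ℝ)) α γ) (tensor β δ)) =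
      tensor α (tensor β (tensor γ δ)) := by
  refine Lp.ext ?_
  have hq := measurePreserving_shuffle.quasiMeasurePreserving
  filter_upwards [shuffleL2_coeFn (tensor (tensor α γ) (tensor β δ)),
    hq.ae (tensor_coeFn (tensor (μ := (volume : Measure ℝ)) α γ) (tensor β δ)),
    hq.ae (Measure.quasiMeasurePreserving_fst.ae (tensor_coeFn α γ)),
    hq.ae (Measure.quasiMeasurePreserving_snd.ae (tensor_coeFn β δ)),
    tensor_coeFn α (tensor β (tensor γ δ)),
    Measure.quasiMeasurePreserving_snd.ae (tensor_coeFn β (tensor γ δ)),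
    Measure.quasiMeasurePreserving_snd.ae
      (Measure.quasiMeasurePreserving_snd.ae (tensor_coeFn γ δ))] with p h1 h2 h3 h4 h5 h6 h7
  rw [h1, h2, h3, h4, h5, h6, h7]
  ring

theorem opU1_tensor (α γ β : L2 (volume : Measure ℝ)) (δ : L2 posMeasure) :
    opU1 (tensor α (tensor β (tensor γ δ))) =
      tensor (fourierL2 α) (tensor β (tensor (fourierL2 γ) δ)) := by
  rw [opU1, tensorIsometry_tensor, tensorIsometry_tensor, tensorIsometry_tensor]
  rfl

/-- `U₁` acts in the variables `(u₁, u₂)` only. -/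
theorem opU1_shuffleL2 (α γ : L2 (volume : Measure ℝ)) (ω : L2 halfMeasure) :
    opU1 (shuffleL2 (tensor (μ := volume) (tensor (μ := (volume : Measure ℝ)) α γ) ω)) =
      shuffleL2 (tensor (μ := volume)
        (tensor (μ := (volume : Measure ℝ)) (fourierL2 α) (fourierL2 γ)) ω) := by
  have h := ContinuousLinearMap.eq_of_isTotal
    ((isTotal_univ (H := L2 (volume : Measure ℝ))).tensor (isTotal_univ (H := L2 posMeasure)))
    (A := (opU1.comp shuffleL2).toContinuousLinearMap ∘L
      tensorCLM (μ := volume) (tensor (μ := (volume : Measure ℝ)) α γ))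
    (B := shuffleL2.toContinuousLinearMap ∘L tensorCLM (μ := volume)
      (tensor (μ := (volume : Measure ℝ)) (fourierL2 α) (fourierL2 γ))) ?_
  · exact congrArg (fun A => A ω) h
  · rintro _ ⟨β, -, δ, -, rfl⟩
    change opU1 (shuffleL2 (tensor (tensor α γ) (tensor β δ))) =
      shuffleL2 (tensor (tensor (fourierL2 α) (fourierL2 γ)) (tensor β δ))
    rw [shuffleL2_tensor, shuffleL2_tensor, opU1_tensor]

theorem isTotal_shuffleL2_tensor :
    IsTotal (shuffleL2 '' (image2 tensor
      (image2 tensor (univ : Set (L2 (volume : Measure ℝ))) (univ : Set (L2 (volume : Measure ℝ))))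
      (univ : Set (L2 halfMeasure)))) :=
  ((((isTotal_univ (H := L2 (volume : Measure ℝ))).tensor
    (isTotal_univ (H := L2 (volume : Measure ℝ)))).tensor
      (isTotal_univ (H := L2 halfMeasure))).image _ shuffleL2_surjective)

theorem exists_ae_bound_of_memLp_top {α : Type*} [MeasurableSpace α] {μ : Measure α} {a : α → ℂ}
    (ha : MemLp a ∞ μ) : ∃ C, 0 ≤ C ∧ ∀ᵐ x ∂μ, ‖a x‖ ≤ C := by
  have hfin : eLpNormEssSup a μ ≠ ∞ := by
    have := ha.2.ne
    rwa [eLpNorm_exponent_top] at this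
  refine ⟨(eLpNormEssSup a μ).toReal, ENNReal.toReal_nonneg, ?_⟩
  filter_upwards [ae_le_eLpNormEssSup (f := a) (μ := μ)] with x hx
  rw [← toReal_enorm]
  exact (ENNReal.toReal_le_toReal (by simp) hfin).2 hx

theorem memLp_top_comp {α β : Type*} [MeasurableSpace α] [MeasurableSpace β] {μ : Measure α}
    {ν : Measure β} {φ : α → β} (h : Measure.QuasiMeasurePreserving φ μ ν) {a : β → ℂ}
    (ha : MemLp a ∞ ν) : MemLp (a ∘ φ) ∞ μ := by
  obtain ⟨C, -, hC⟩ := exists_ae_bound_of_memLp_top ha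
  exact memLp_top_of_bound (ha.1.comp_quasiMeasurePreserving h) C (h.ae hC)

/-- `U₁` commutes with multiplication by bounded functions of `(v₁, v₂)`. -/
theorem opU1_mul {m : ℝ × ℝ → ℂ} (hm : MemLp m ∞ halfMeasure) {F F' : L2 flatMeasure}
    (h : F' =ᵐ[flatMeasure] fun p => m (p.2.1, p.2.2.2) * F p) :
    opU1 F' =ᵐ[flatMeasure] fun p => m (p.2.1, p.2.2.2) * opU1 F p := by
  have hq : Measure.QuasiMeasurePreserving (fun p : ℝ × ℝ × ℝ × ℝ => (p.2.1, p.2.2.2))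
      flatMeasure halfMeasure :=
    Measure.quasiMeasurePreserving_snd.comp measurePreserving_shuffle.quasiMeasurePreserving
  have ha := memLp_top_comp hq hm
  have hF' : F' = mulL2 ha F := Lp.ext (h.trans (mulL2_coeFn ha F).symm)
  have hmul : ∀ (τ : L2 (volume : Measure (ℝ × ℝ))) (ω : L2 halfMeasure),
      mulL2 ha (shuffleL2 (tensor τ ω)) = shuffleL2 (tensor τ (mulL2 hm ω)) := by
    intro τ ω
    refine Lp.ext ?_
    have hs := measurePreserving_shuffle.quasiMeasurePreserving
    filter_upwards [mulL2_coeFn ha (shuffleL2 (tensor τ ω)), shuffleL2_coeFn (tensor τ ω),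
      shuffleL2_coeFn (tensor τ (mulL2 hm ω)), hs.ae (tensor_coeFn τ ω),
      hs.ae (tensor_coeFn τ (mulL2 hm ω)), hq.ae (mulL2_coeFn hm ω)] with p h1 h2 h3 h4 h5 h6
    rw [h1, h2, h3, h4, h5, h6, Function.comp_apply]
    ring
  have key := ContinuousLinearMap.eq_of_isTotal isTotal_shuffleL2_tensor
    (A := opU1.toContinuousLinearMap ∘L mulL2 ha) (B := mulL2 ha ∘L opU1.toContinuousLinearMap) ?_
  · have h1 : opU1 (mulL2 ha F) = mulL2 ha (opU1 F) := congrArg (fun A => A F) key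
    rw [hF', h1]
    exact mulL2_coeFn ha _
  · rintro _ ⟨_, ⟨_, ⟨α, -, γ, -, rfl⟩, ω, -, rfl⟩, rfl⟩
    change opU1 (mulL2 ha (shuffleL2 (tensor (tensor α γ) ω))) =
      mulL2 ha (opU1 (shuffleL2 (tensor (tensor α γ) ω)))
    rw [hmul, opU1_shuffleL2, opU1_shuffleL2, hmul]

theorem weightedComp_mul {α β : Type*} [MeasurableSpace α] [MeasurableSpace β]
    {μ : Measure α} {ν : Measure β} {w : α → ℂ} {φ : α → β} (h : IsWeightedPullback μ ν w φ)
    {a : β → ℂ} {F F' : L2 ν} (hF : F' =ᵐ[ν] fun y => a y * F y) :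
    weightedComp h F' =ᵐ[μ] fun x => a (φ x) * weightedComp h F x := by
  filter_upwards [weightedComp_coeFn h F', weightedComp_coeFn h F, h.quasi.ae hF] with x h1 h2 h3
  rw [h1, h2, h3]
  ring

theorem nilpotentSymbol_kappa (c : ℝ → ℝ → ℂ) (p : ℝ × ℝ × ℝ × ℝ) :
    nilpotentSymbol c (kappa p) = c p.2.1 p.2.2.2 := by
  have h := kappaInv_kappa p
  have h1 : (kappa p).1.im = p.2.1 := congrArg (fun q => q.2.1) h
  have h2 : (kappa p).2.im - ‖(kappa p).1‖ ^ 2 = p.2.2.2 := congrArg (fun q => q.2.2.2) h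
  rw [nilpotentSymbol, h1, h2]

/-- Measurability of `c` itself is recovered from that of the symbol, as `κ` carries the latter to
`c (v₁, v₂)`, a function that does not depend on `(u₁, u₂)`. -/
theorem memLp_top_of_nilpotentSymbol {c : ℝ → ℝ → ℂ}
    (hc : MemLp (nilpotentSymbol c) ∞ siegelMeasure) :
    MemLp (fun v : ℝ × ℝ => c v.1 v.2) ∞ halfMeasure := by
  have h1 := memLp_top_comp
    (measurePreserving_kappa.comp measurePreserving_unshuffle).quasiMeasurePreserving hc
  have h2 : (nilpotentSymbol c ∘ (kappa ∘
      fun q : (ℝ × ℝ) × (ℝ × ℝ) => (q.1.1, q.2.1, q.1.2, q.2.2))) = fun q => c q.2.1 q.2.2 := by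
    funext q
    simp [nilpotentSymbol_kappa]
  rw [h2] at h1
  have hne : (volume : Measure (ℝ × ℝ)) ≠ 0 := NeZero.ne _
  have hm : AEStronglyMeasurable (fun v : ℝ × ℝ => c v.1 v.2) halfMeasure :=
    AEStronglyMeasurable.of_comp_snd (μ := (volume : Measure (ℝ × ℝ))) h1.1 hne
  obtain ⟨C, -, hC⟩ := exists_ae_bound_of_memLp_top h1
  have := Measure.ae_ae_of_ae_prod hC
  obtain ⟨x, hx⟩ := this.exists
  exact memLp_top_of_bound hm C hx

/-- `U` carries multiplication by a nilpotent symbol to a multiplication operator, as `U₁` acts in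
the variables on which the symbol does not depend, and the other factors are weighted compositions.
-/
theorem opU_mulOp {c : ℝ → ℝ → ℂ} (hc : MemLp (nilpotentSymbol c) ∞ siegelMeasure)
    (f : L2 siegelMeasure) :
    opU (mulOp hc f) =ᵐ[flatMeasure] fun p =>
      c (1 / (2 * √|p.2.2.1|) * (-p.1 + p.2.1)) (p.2.2.2 / (2 * |p.2.2.1|)) * opU f p := by
  have h0 : opU0 (mulOp hc f) =ᵐ[flatMeasure] fun p => c p.2.1 p.2.2.2 * opU0 f p := by
    have := weightedComp_mul (.of_measurePreserving measurePreserving_kappa) (mulOp_coeFn hc f)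
    simp only [nilpotentSymbol_kappa] at this
    exact this
  have h1 := opU1_mul (memLp_top_of_nilpotentSymbol hc) h0
  have h2 := weightedComp_mul isWeightedPullback_psi1
    (a := fun p : ℝ × ℝ × ℝ × ℝ => c p.2.1 p.2.2.2) h1
  exact weightedComp_mul (.of_measurePreserving measurePreserving_psi2) h2

/-! ### The spectral function -/

theorem quasiMeasurePreserving_affine {a : ℝ} (ha : 0 < a) (b : ℝ) :
    Measure.QuasiMeasurePreserving (fun y : ℝ => (b + y) / a) volume volume := by
  refine ⟨by fun_prop, ?_⟩
  have h : (fun y : ℝ => (b + y) / a) = (fun y => y * a⁻¹) ∘ fun y => b + y := by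
    funext y; simp [div_eq_mul_inv]
  rw [h, ← Measure.map_map (by fun_prop) (by fun_prop), map_add_left_eq_self,
    Real.map_volume_mul_right (inv_ne_zero ha.ne')]
  exact Measure.smul_absolutelyContinuous

theorem quasiMeasurePreserving_div_pos {a : ℝ} (ha : 0 < a) :
    Measure.QuasiMeasurePreserving (fun y : ℝ => y / a) posMeasure posMeasure := by
  have h := (quasiMeasurePreserving_affine ha 0).restrict (s := Ioi 0) (t := Ioi 0)
    (fun y hy => by simp only [zero_add]; exact div_pos hy ha)
  simpa using h

/-- For each fixed `x`, the argument of `c` in the spectral function lies in a given null set only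
for a null set of `(y₁, y₂)`, so the essential bound of `c` applies for every `x`, not only for
almost every `x`. -/
theorem quasiMeasurePreserving_gamma {x : ℝ × ℝ} (hx : 0 < x.2) :
    Measure.QuasiMeasurePreserving
      (fun y : ℝ × ℝ => ((-x.1 + y.1) / (2 * √x.2), y.2 / (2 * x.2))) halfMeasure halfMeasure := by
  have hs : 0 < 2 * √x.2 := by positivity
  have h1 := quasiMeasurePreserving_affine hs (-x.1)
  have h2 := quasiMeasurePreserving_div_pos (show 0 < 2 * x.2 by positivity)
  refine ⟨by fun_prop, ?_⟩
  have := Measure.map_prod_map (volume : Measure ℝ) posMeasure h1.measurable h2.measurable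
  rw [show (fun y : ℝ × ℝ => ((-x.1 + y.1) / (2 * √x.2), y.2 / (2 * x.2))) =
    Prod.map (fun y => (-x.1 + y) / (2 * √x.2)) (fun y => y / (2 * x.2)) from rfl, ← this]
  exact h1.absolutelyContinuous.prod h2.absolutelyContinuous

theorem integrable_sq_hermite_laguerre (a b : ℕ) :
    Integrable (fun y : ℝ × ℝ => (hermiteFun a y.1 : ℂ) ^ 2 * (laguerreFun b y.2 : ℂ) ^ 2)
      halfMeasure := by
  have h1 : Integrable fun y : ℝ => (hermiteFun a y : ℂ) ^ 2 := by
    have := (memLp_hermiteFun a).integrable_mul (memLp_hermiteFun a)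
    refine this.congr (Filter.Eventually.of_forall fun y => ?_)
    simp [sq]
  have h2 : Integrable (fun y : ℝ => (laguerreFun b y : ℂ) ^ 2) posMeasure := by
    have := (memLp_laguerreFun b).integrable_mul (memLp_laguerreFun b)
    refine this.congr (Filter.Eventually.of_forall fun y => ?_)
    simp [sq]
  exact h1.mul_prod h2

theorem integrable_gammaIntegrand (j k : ℕ) {c : ℝ → ℝ → ℂ}
    (hm : MemLp (fun v : ℝ × ℝ => c v.1 v.2) ∞ halfMeasure) {x : ℝ × ℝ} (hx : 0 < x.2) :
    Integrable (gammaIntegrand j k c x) halfMeasure := by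
  have h := memLp_top_comp (quasiMeasurePreserving_gamma hx) hm
  obtain ⟨C, -, hC⟩ := exists_ae_bound_of_memLp_top h
  have := (integrable_sq_hermite_laguerre (j - 1) (k - 1)).bdd_mul (c := C) h.1 hC
  refine this.congr (Filter.Eventually.of_forall fun y => ?_)
  simp [gammaIntegrand, mul_assoc]

theorem gammaFun_eq (j k : ℕ) {c : ℝ → ℝ → ℂ}
    (hm : MemLp (fun v : ℝ × ℝ => c v.1 v.2) ∞ halfMeasure) {x : ℝ × ℝ} (hx : 0 < x.2) :
    gammaFun j k c x = ∫ y, gammaIntegrand j k c x y ∂halfMeasure :=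
  (integral_prod _ (integrable_gammaIntegrand j k hm hx)).symm

theorem ae_half_pos : ∀ᵐ x ∂halfMeasure, 0 < x.2 := by
  rw [ae_halfMeasure_iff]
  exact Filter.Eventually.of_forall fun x hx => hx.2

theorem aestronglyMeasurable_gammaIntegrand (j k : ℕ) {c : ℝ → ℝ → ℂ}
    (hm : MemLp (fun v : ℝ × ℝ => c v.1 v.2) ∞ halfMeasure) :
    AEStronglyMeasurable (fun q : (ℝ × ℝ) × (ℝ × ℝ) => gammaIntegrand j k c q.1 q.2)
      (halfMeasure.prod halfMeasure) := by
  have hq : Measure.QuasiMeasurePreserving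
      (fun q : (ℝ × ℝ) × (ℝ × ℝ) => ((-q.1.1 + q.2.1) / (2 * √q.1.2), q.2.2 / (2 * q.1.2)))
      (halfMeasure.prod halfMeasure) halfMeasure := by
    have hmeas : Measurable
        (fun q : (ℝ × ℝ) × (ℝ × ℝ) => ((-q.1.1 + q.2.1) / (2 * √q.1.2), q.2.2 / (2 * q.1.2))) := by
      fun_prop
    refine ⟨hmeas, Measure.AbsolutelyContinuous.mk fun s hs h0 => ?_⟩
    rw [Measure.map_apply hmeas hs, Measure.measure_prod_null (hmeas hs)]
    filter_upwards [ae_half_pos] with x hx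
    exact (quasiMeasurePreserving_gamma hx).preimage_null h0
  have h1 := hm.1.comp_quasiMeasurePreserving hq
  have h2 : AEStronglyMeasurable (fun y : ℝ × ℝ =>
      (hermiteFun (j - 1) y.1 : ℂ) ^ 2 * (laguerreFun (k - 1) y.2 : ℂ) ^ 2) halfMeasure :=
    (integrable_sq_hermite_laguerre (j - 1) (k - 1)).1
  refine (h1.mul (h2.comp_snd (μ := halfMeasure))).congr (Filter.Eventually.of_forall fun q => ?_)
  simp [gammaIntegrand, mul_assoc]

theorem memLp_gammaFun (j k : ℕ) {c : ℝ → ℝ → ℂ}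
    (hm : MemLp (fun v : ℝ × ℝ => c v.1 v.2) ∞ halfMeasure) :
    MemLp (gammaFun j k c) ∞ halfMeasure := by
  obtain ⟨C, hC0, hC⟩ := exists_ae_bound_of_memLp_top hm
  have hsm : AEStronglyMeasurable (gammaFun j k c) halfMeasure := by
    refine ((aestronglyMeasurable_gammaIntegrand j k hm).integral_prod_right').congr ?_
    filter_upwards [ae_half_pos] with x hx
    rw [gammaFun_eq j k hm hx]
  refine memLp_top_of_bound hsm (C * ∫ y : ℝ × ℝ,
    ‖(hermiteFun (j - 1) y.1 : ℂ) ^ 2 * (laguerreFun (k - 1) y.2 : ℂ) ^ 2‖ ∂halfMeasure) ?_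
  filter_upwards [ae_half_pos] with x hx
  rw [gammaFun_eq j k hm hx, ← integral_const_mul]
  refine norm_integral_le_of_norm_le
    ((integrable_sq_hermite_laguerre (j - 1) (k - 1)).norm.const_mul C) ?_
  filter_upwards [(quasiMeasurePreserving_gamma hx).ae hC] with y hy
  rw [gammaIntegrand, mul_assoc, norm_mul]
  exact mul_le_mul_of_nonneg_right hy (norm_nonneg _)

/-- Compressing multiplication by the transported symbol to the range of `R₀` gives
multiplication by the spectral function. -/
theorem adjoint_opR0_mul (j k : ℕ) {c : ℝ → ℝ → ℂ}
    (hm : MemLp (fun v : ℝ × ℝ => c v.1 v.2) ∞ halfMeasure) (g : L2 halfMeasure)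
    {F : L2 flatMeasure}
    (hF : F =ᵐ[flatMeasure] fun p =>
      c (1 / (2 * √|p.2.2.1|) * (-p.1 + p.2.1)) (p.2.2.2 / (2 * |p.2.2.1|)) * opR0 j k g p) :
    ContinuousLinearMap.adjoint (opR0 j k) F =ᵐ[halfMeasure] fun x => gammaFun j k c x * g x := by
  have hγ := memLp_gammaFun j k hm
  suffices h : ContinuousLinearMap.adjoint (opR0 j k) F = mulL2 hγ g by
    rw [h]; exact mulL2_coeFn hγ g
  refine ext_inner_left ℂ fun f => ?_
  rw [ContinuousLinearMap.adjoint_inner_right, L2.inner_def, L2.inner_def]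
  set Φ : (ℝ × ℝ) × (ℝ × ℝ) → ℂ := fun q =>
    (univ ×ˢ Ioi (0 : ℝ)).indicator (fun x => g x * (starRingEnd ℂ) (f x)) q.1 *
      gammaIntegrand j k c q.1 q.2 with hΦ
  have e1 : (fun p => inner ℂ (opR0 j k f p) (F p)) =ᵐ[flatMeasure]
      fun p => Φ ((p.1, p.2.2.1), (p.2.1, p.2.2.2)) := by
    filter_upwards [opR0_coeFn j k f, opR0_coeFn j k g, hF] with p h1 h2 h3
    rw [h1, h3, h2, embedFun_eq_tensor, embedFun_eq_tensor, RCLike.inner_apply, hΦ]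
    simp only [gammaIntegrand]
    by_cases hp : (p.1, p.2.2.1) ∈ (univ ×ˢ Ioi (0 : ℝ) : Set (ℝ × ℝ))
    · have hpos : 0 < p.2.2.1 := hp.2
      simp only [indicator_of_mem hp, map_mul, Complex.conj_ofReal, abs_of_pos hpos]
      rw [one_div_mul_eq_div]
      ring
    · simp only [indicator_of_notMem hp, map_zero, zero_mul, mul_zero]
  have hint : Integrable (fun p => Φ ((p.1, p.2.2.1), (p.2.1, p.2.2.2))) flatMeasure :=
    (L2.integrable_inner (opR0 j k f) F).congr e1
  have hint' : Integrable Φ ((volume : Measure (ℝ × ℝ)).prod halfMeasure) := by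
    have := measurePreserving_unshuffle.integrable_comp_of_integrable hint
    exact this
  have e2 : ∫ p, Φ ((p.1, p.2.2.1), (p.2.1, p.2.2.2)) ∂flatMeasure =
      ∫ q, Φ q ∂((volume : Measure (ℝ × ℝ)).prod halfMeasure) := by
    rw [← measurePreserving_shuffle.map_eq]
    refine (integral_map measurePreserving_shuffle.measurable.aemeasurable ?_).symm
    rw [measurePreserving_shuffle.map_eq]
    exact hint'.1
  rw [integral_congr_ae e1, e2, integral_prod _ hint']
  have hpt : ∀ x : ℝ × ℝ, ∫ y, Φ (x, y) ∂halfMeasure = (univ ×ˢ Ioi (0 : ℝ)).indicator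
      (fun x => gammaFun j k c x * g x * (starRingEnd ℂ) (f x)) x := by
    intro x
    simp only [hΦ]
    rw [integral_const_mul]
    by_cases hx : x ∈ (univ ×ˢ Ioi (0 : ℝ) : Set (ℝ × ℝ))
    · rw [indicator_of_mem hx, indicator_of_mem hx, gammaFun_eq j k hm hx.2]
      ring
    · rw [indicator_of_notMem hx, indicator_of_notMem hx, zero_mul]
  simp_rw [hpt]
  rw [← integral_halfMeasure_eq]
  refine integral_congr_ae ?_
  filter_upwards [mulL2_coeFn hγ g] with x hx
  rw [hx, RCLike.inner_apply]

/-! ### Parameter integrals of smooth kernels -/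

/-- A parameter integral as the value at `0` of a convolution with the constant `1`; this gives
access to the smoothness results for convolutions with parameters. -/
theorem integral_eq_convolution {E : Type*} (K : E → ℝ × ℝ → ℂ) (p : E) :
    ∫ t, K p t = convolution (fun _ : ℝ × ℝ => (1 : ℝ)) (K p) (ContinuousLinearMap.lsmul ℝ ℝ) volume 0 := by
  rw [convolution, ← integral_neg_eq_self]
  simp

section ParamIntegral

variable {E : Type*} [NormedAddCommGroup E] [NormedSpace ℝ E] {K : E → ℝ × ℝ → ℂ} {k : Set (ℝ × ℝ)}

theorem contDiff_integral_of_compact (hK : ContDiff ℝ (⊤ : ℕ∞) (fun q : E × (ℝ × ℝ) => K q.1 q.2))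
    (hk : IsCompact k) (h0 : ∀ p, ∀ t ∉ k, K p t = 0) :
    ContDiff ℝ (⊤ : ℕ∞) fun p => ∫ t, K p t := by
  have h := contDiffOn_convolution_right_with_param (μ := (volume : Measure (ℝ × ℝ)))
    (f := fun _ : ℝ × ℝ => (1 : ℝ)) (n := ⊤) (ContinuousLinearMap.lsmul ℝ ℝ : ℝ →L[ℝ] ℂ →L[ℝ] ℂ)
    (g := K) isOpen_univ hk (fun p t _ ht => h0 p t ht) (locallyIntegrable_const _) hK.contDiffOn
  rw [univ_prod_univ, contDiffOn_univ] at h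
  have h2 := h.comp (contDiff_id.prodMk contDiff_const : ContDiff ℝ _ fun p : E => (p, (0 : ℝ × ℝ)))
  rwa [show (fun p => ∫ t, K p t) = _ from funext fun p => integral_eq_convolution K p]

theorem fderiv_integral_of_compact (hK : ContDiff ℝ (⊤ : ℕ∞) (fun q : E × (ℝ × ℝ) => K q.1 q.2))
    (hk : IsCompact k) (h0 : ∀ p, ∀ t ∉ k, K p t = 0) (p v : E) :
    fderiv ℝ (fun p => ∫ t, K p t) p v = ∫ t, fderiv ℝ (fun p => K p t) p v := by
  have hK1 : ContDiff ℝ 1 (fun q : E × (ℝ × ℝ) => K q.1 q.2) := hK.of_le (by norm_cast)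
  have h := hasFDerivAt_convolution_right_with_param (μ := (volume : Measure (ℝ × ℝ)))
    (f := fun _ : ℝ × ℝ => (1 : ℝ)) (ContinuousLinearMap.lsmul ℝ ℝ : ℝ →L[ℝ] ℂ →L[ℝ] ℂ)
    (g := K) isOpen_univ hk (fun p t _ ht => h0 p t ht) (locallyIntegrable_const _)
    hK1.contDiffOn (p, 0) (mem_univ _)
  have hl : HasFDerivAt (fun p : E => (p, (0 : ℝ × ℝ)))
      ((ContinuousLinearMap.id ℝ E).prod 0) p := (hasFDerivAt_id p).prodMk (hasFDerivAt_const _ _)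
  have h2 := h.comp p hl
  have h3 : (fun p => ∫ t, K p t) = (fun q : E × (ℝ × ℝ) =>
      convolution (fun _ : ℝ × ℝ => (1 : ℝ)) (K q.1) (ContinuousLinearMap.lsmul ℝ ℝ) volume q.2) ∘
        fun p => (p, 0) := funext fun p => integral_eq_convolution K p
  have hpart : ∀ t, fderiv ℝ (fun p => K p t) p v =
      fderiv ℝ (fun q : E × (ℝ × ℝ) => K q.1 q.2) (p, t) (v, 0) := by
    intro t
    have hl' : HasFDerivAt (fun p : E => (p, t))
      ((ContinuousLinearMap.id ℝ E).prod 0) p := (hasFDerivAt_id p).prodMk (hasFDerivAt_const _ _)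
    have := ((hK1.differentiable one_ne_zero (p, t)).hasFDerivAt.comp p hl').fderiv
    rw [Function.comp_def] at this
    simp only at this
    rw [this]
    simp
  have hcont : Continuous (fderiv ℝ (fun q : E × (ℝ × ℝ) => K q.1 q.2)) :=
    hK1.continuous_fderiv one_ne_zero
  have hsupp : ∀ t ∉ k, fderiv ℝ (fun q : E × (ℝ × ℝ) => K q.1 q.2) (p, t) = 0 := by
    intro t ht
    have : (fun q : E × (ℝ × ℝ) => K q.1 q.2) =ᶠ[nhds (p, t)] fun _ => 0 := by
      have : ∀ᶠ q : E × (ℝ × ℝ) in nhds (p, t), q.2 ∈ kᶜ :=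
        continuous_snd.continuousAt.eventually (hk.isClosed.isOpen_compl.mem_nhds ht)
      filter_upwards [this] with q hq
      exact h0 _ _ hq
    rw [this.fderiv_eq]
    simp
  have hint : Integrable fun t : ℝ × ℝ =>
      fderiv ℝ (fun q : E × (ℝ × ℝ) => K q.1 q.2) (p, t) :=
    (hcont.comp (by fun_prop : Continuous fun t : ℝ × ℝ => (p, t))).integrable_of_hasCompactSupport
      (HasCompactSupport.intro hk hsupp)
  rw [h3, h2.fderiv]
  simp only [hpart]
  rw [convolution]
  have e' : ∀ t : ℝ × ℝ, ((ContinuousLinearMap.lsmul ℝ ℝ : ℝ →L[ℝ] ℂ →L[ℝ] ℂ).precompR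
      (E × (ℝ × ℝ)) (1 : ℝ)) (fderiv ℝ (↿K) ((p, (0 : ℝ × ℝ)).1, (p, (0 : ℝ × ℝ)).2 - t)) =
      fderiv ℝ (fun q : E × (ℝ × ℝ) => K q.1 q.2) (p, -t) := by
    intro t
    refine ContinuousLinearMap.ext fun w => ?_
    simp only [ContinuousLinearMap.precompR_apply, zero_sub]
    exact one_smul ℝ _
  simp_rw [e']
  rw [integral_neg_eq_self (fun t => fderiv ℝ (fun q : E × (ℝ × ℝ) => K q.1 q.2) (p, t)) volume,
    ContinuousLinearMap.comp_apply, ContinuousLinearMap.integral_apply hint]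
  simp

end ParamIntegral

/-! ### Partial Fourier transform of smooth functions with compact support -/

/-- Smooth functions with compact support on `ℝ⁴`. -/
structure IsCc (η : ℝ × ℝ × ℝ × ℝ → ℂ) : Prop where
  smooth : ContDiff ℝ (⊤ : ℕ∞) η
  compact : HasCompactSupport η

theorem IsCc.fderiv_apply {η : ℝ × ℝ × ℝ × ℝ → ℂ} (h : IsCc η) (v : ℝ × ℝ × ℝ × ℝ) :
    IsCc fun p => fderiv ℝ η p v := by
  refine ⟨(h.smooth.fderiv_right (m := (⊤ : ℕ∞)) (by norm_cast)).clm_apply contDiff_const,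
    h.compact.mono' fun p hp => support_fderiv_subset ℝ (f := η) ?_⟩
  intro h0
  exact hp (by simp [h0])

theorem IsCc.mul_left {η a : ℝ × ℝ × ℝ × ℝ → ℂ} (h : IsCc η) (ha : ContDiff ℝ (⊤ : ℕ∞) a) :
    IsCc fun p => a p * η p :=
  ⟨ha.mul h.smooth, h.compact.mul_left⟩

theorem IsCc.add {η ξ : ℝ × ℝ × ℝ × ℝ → ℂ} (h : IsCc η) (h' : IsCc ξ) :
    IsCc fun p => η p + ξ p :=
  ⟨h.smooth.add h'.smooth, h.compact.add h'.compact⟩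

theorem IsCc.continuous {η : ℝ × ℝ × ℝ × ℝ → ℂ} (h : IsCc η) : Continuous η := h.smooth.continuous

/-- The kernel `Ξ(t₁, s₁, t₂, s₂) e^{iε(t₁u₁ + t₂u₂)}`, at `p = (u₁, s₁, u₂, s₂)`. -/
def fourKernel (ε : ℝ) (Ξ : ℝ × ℝ × ℝ × ℝ → ℂ) (p : ℝ × ℝ × ℝ × ℝ) (t : ℝ × ℝ) : ℂ :=
  Ξ (t.1, p.2.1, t.2, p.2.2.2) *
    Complex.exp (Complex.I * (ε * (t.1 * p.1 + t.2 * p.2.2.1)))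

/-- The partial Fourier transform
`(J Ξ)(u₁, s₁, u₂, s₂) = (2π)⁻¹ ∫ Ξ(t₁, s₁, t₂, s₂) e^{iε(t₁u₁ + t₂u₂)} dt₁ dt₂`;
the sign `ε = ±1` selects the transform or its inverse. -/
def partFour (ε : ℝ) (Ξ : ℝ × ℝ × ℝ × ℝ → ℂ) (p : ℝ × ℝ × ℝ × ℝ) : ℂ :=
  ((2 * Real.pi)⁻¹ : ℝ) * ∫ t : ℝ × ℝ, fourKernel ε Ξ p t

theorem contDiff_fourKernel (ε : ℝ) {Ξ : ℝ × ℝ × ℝ × ℝ → ℂ} (h : IsCc Ξ) :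
    ContDiff ℝ (⊤ : ℕ∞) (fun q : (ℝ × ℝ × ℝ × ℝ) × (ℝ × ℝ) => fourKernel ε Ξ q.1 q.2) := by
  unfold fourKernel
  refine ContDiff.mul (h.smooth.comp (by fun_prop)) (ContDiff.cexp ?_)
  have : ContDiff ℝ (⊤ : ℕ∞) fun x : ℝ => (x : ℂ) := Complex.ofRealCLM.contDiff
  fun_prop

/-- A compact set of `(t₁, t₂)` outside which `Ξ(t₁, ·, t₂, ·)` vanishes. -/
def timeSupport (Ξ : ℝ × ℝ × ℝ × ℝ → ℂ) : Set (ℝ × ℝ) := (fun q => (q.1, q.2.2.1)) '' tsupport Ξ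

theorem IsCc.isCompact_timeSupport {Ξ : ℝ × ℝ × ℝ × ℝ → ℂ} (h : IsCc Ξ) :
    IsCompact (timeSupport Ξ) := h.compact.isCompact.image (by fun_prop)

theorem eq_zero_of_notMem_timeSupport {Ξ : ℝ × ℝ × ℝ × ℝ → ℂ} {t : ℝ × ℝ} (ht : t ∉ timeSupport Ξ)
    (a b : ℝ) : Ξ (t.1, a, t.2, b) = 0 := by
  by_contra hne
  exact ht ⟨_, subset_tsupport _ hne, rfl⟩

theorem fourKernel_eq_zero (ε : ℝ) {Ξ : ℝ × ℝ × ℝ × ℝ → ℂ} (p : ℝ × ℝ × ℝ × ℝ) {t : ℝ × ℝ}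
    (ht : t ∉ timeSupport Ξ) : fourKernel ε Ξ p t = 0 := by
  rw [fourKernel, eq_zero_of_notMem_timeSupport ht, zero_mul]

theorem integrable_fourKernel (ε : ℝ) {Ξ : ℝ × ℝ × ℝ × ℝ → ℂ} (h : IsCc Ξ)
    (p : ℝ × ℝ × ℝ × ℝ) : Integrable (fourKernel ε Ξ p) :=
  ((contDiff_fourKernel ε h).continuous.comp
    (by fun_prop : Continuous fun t : ℝ × ℝ => (p, t))).integrable_of_hasCompactSupport
      (HasCompactSupport.intro h.isCompact_timeSupport fun _ ht => fourKernel_eq_zero ε p ht)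

theorem contDiff_partFour (ε : ℝ) {Ξ : ℝ × ℝ × ℝ × ℝ → ℂ} (h : IsCc Ξ) :
    ContDiff ℝ (⊤ : ℕ∞) (partFour ε Ξ) :=
  contDiff_const.mul (contDiff_integral_of_compact (contDiff_fourKernel ε h)
    h.isCompact_timeSupport fun p _ ht => fourKernel_eq_zero ε p ht)

theorem partFour_add (ε : ℝ) {Ξ Ξ' : ℝ × ℝ × ℝ × ℝ → ℂ} (h : IsCc Ξ) (h' : IsCc Ξ')
    (p : ℝ × ℝ × ℝ × ℝ) : partFour ε (fun q => Ξ q + Ξ' q) p = partFour ε Ξ p + partFour ε Ξ' p := by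
  rw [partFour, partFour, partFour, ← mul_add,
    ← integral_add (integrable_fourKernel ε h p) (integrable_fourKernel ε h' p)]
  simp only [fourKernel, add_mul]

theorem partFour_const_mul (ε : ℝ) (Ξ : ℝ × ℝ × ℝ × ℝ → ℂ) (c : ℂ) (p : ℝ × ℝ × ℝ × ℝ) :
    partFour ε (fun q => c * Ξ q) p = c * partFour ε Ξ p := by
  simp only [partFour, fourKernel, mul_assoc]
  rw [integral_const_mul]
  ring

theorem partFour_mul_side (ε : ℝ) (Ξ : ℝ × ℝ × ℝ × ℝ → ℂ) (m : ℝ → ℝ → ℂ)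
    (p : ℝ × ℝ × ℝ × ℝ) :
    partFour ε (fun q => m q.2.1 q.2.2.2 * Ξ q) p = m p.2.1 p.2.2.2 * partFour ε Ξ p := by
  simp only [partFour, fourKernel, mul_assoc]
  rw [integral_const_mul]
  ring

/-- Differentiating the transform: derivatives in `s₁, s₂` pass to `Ξ`, derivatives in `u₁, u₂`
become multiplications by `iεt₁, iεt₂`. -/
theorem fderiv_partFour (ε : ℝ) {Ξ : ℝ × ℝ × ℝ × ℝ → ℂ} (h : IsCc Ξ) (p v : ℝ × ℝ × ℝ × ℝ) :
    fderiv ℝ (partFour ε Ξ) p v = partFour ε (fun q => fderiv ℝ Ξ q (0, v.2.1, 0, v.2.2.2) +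
      Complex.I * (ε * (q.1 * v.1 + q.2.2.1 * v.2.2.1)) * Ξ q) p := by
  have hd : DifferentiableAt ℝ (fun p => ∫ t : ℝ × ℝ, fourKernel ε Ξ p t) p :=
    (contDiff_integral_of_compact (contDiff_fourKernel ε h) h.isCompact_timeSupport
      fun p _ ht => fourKernel_eq_zero ε p ht).differentiable (by simp) p
  have h1 : partFour ε Ξ = fun p => (((2 * Real.pi)⁻¹ : ℝ) : ℂ) * ∫ t : ℝ × ℝ, fourKernel ε Ξ p t := rfl
  rw [h1, fderiv_const_mul hd, smul_apply,
    fderiv_integral_of_compact (contDiff_fourKernel ε h) h.isCompact_timeSupport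
      fun p _ ht => fourKernel_eq_zero ε p ht]
  rw [smul_eq_mul, partFour]
  congr 2
  funext t
  have hι : HasFDerivAt (fun p : ℝ × ℝ × ℝ × ℝ => (t.1, p.2.1, t.2, p.2.2.2))
      (((0 : (ℝ × ℝ × ℝ × ℝ) →L[ℝ] ℝ)).prod
        ((ContinuousLinearMap.fst ℝ ℝ (ℝ × ℝ) ∘L ContinuousLinearMap.snd ℝ ℝ (ℝ × ℝ × ℝ)).prod
          ((0 : (ℝ × ℝ × ℝ × ℝ) →L[ℝ] ℝ).prod
            (ContinuousLinearMap.snd ℝ ℝ ℝ ∘L ContinuousLinearMap.snd ℝ ℝ (ℝ × ℝ) ∘L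
              ContinuousLinearMap.snd ℝ ℝ (ℝ × ℝ × ℝ))))) p :=
    (hasFDerivAt_const _ _).prodMk (HasFDerivAt.prodMk (ContinuousLinearMap.hasFDerivAt
      (ContinuousLinearMap.fst ℝ ℝ (ℝ × ℝ) ∘L ContinuousLinearMap.snd ℝ ℝ (ℝ × ℝ × ℝ)))
      ((hasFDerivAt_const _ _).prodMk (ContinuousLinearMap.hasFDerivAt
        (ContinuousLinearMap.snd ℝ ℝ ℝ ∘L ContinuousLinearMap.snd ℝ ℝ (ℝ × ℝ) ∘L
          ContinuousLinearMap.snd ℝ ℝ (ℝ × ℝ × ℝ)))))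
  have hΞ := ((h.smooth.differentiable (by simp) (t.1, p.2.1, t.2, p.2.2.2)).hasFDerivAt).comp p hι
  have hph : HasFDerivAt (fun p : ℝ × ℝ × ℝ × ℝ =>
      Complex.I * (ε * (t.1 * p.1 + t.2 * p.2.2.1) : ℂ))
      ((Complex.I * ε * t.1) • (Complex.ofRealCLM ∘L ContinuousLinearMap.fst ℝ ℝ (ℝ × ℝ × ℝ)) +
        (Complex.I * ε * t.2) • (Complex.ofRealCLM ∘L ContinuousLinearMap.fst ℝ ℝ ℝ ∘L
          ContinuousLinearMap.snd ℝ ℝ (ℝ × ℝ) ∘L ContinuousLinearMap.snd ℝ ℝ (ℝ × ℝ × ℝ))) p := by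
    refine (ContinuousLinearMap.hasFDerivAt _).congr_of_eventuallyEq
      (Filter.Eventually.of_forall fun q => ?_)
    simp
    ring
  have := (hΞ.mul hph.cexp).fderiv
  simp only [Function.comp_def] at this
  rw [show (fun p => fourKernel ε Ξ p t) = _ from rfl]
  unfold fourKernel
  erw [this]
  simp
  ring

/-- Integration by parts in `(t₁, t₂)`: derivatives of `Ξ` in these variables become
multiplications of the transform. -/
theorem partFour_fderiv (ε : ℝ) {Ξ : ℝ × ℝ × ℝ × ℝ → ℂ} (h : IsCc Ξ) (p : ℝ × ℝ × ℝ × ℝ)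
    (w : ℝ × ℝ) : partFour ε (fun q => fderiv ℝ Ξ q (w.1, 0, w.2, 0)) p =
      -(Complex.I * (ε * (w.1 * p.1 + w.2 * p.2.2.1))) * partFour ε Ξ p := by
  set e : ℝ × ℝ → ℂ := fun t => Complex.exp (Complex.I * (ε * (t.1 * p.1 + t.2 * p.2.2.1))) with he
  set X : ℝ × ℝ → ℂ := fun t => Ξ (t.1, p.2.1, t.2, p.2.2.2) with hX
  have hXs : ContDiff ℝ (⊤ : ℕ∞) X := h.smooth.comp (by fun_prop)
  have hes : ContDiff ℝ (⊤ : ℕ∞) e := by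
    have : ContDiff ℝ (⊤ : ℕ∞) fun x : ℝ => (x : ℂ) := Complex.ofRealCLM.contDiff
    exact ContDiff.cexp (by fun_prop)
  have hX0 : HasCompactSupport X := HasCompactSupport.intro h.isCompact_timeSupport
    fun t ht => eq_zero_of_notMem_timeSupport ht _ _
  have hXw : ∀ t, fderiv ℝ X t w = fderiv ℝ Ξ (t.1, p.2.1, t.2, p.2.2.2) (w.1, 0, w.2, 0) := by
    intro t
    have hι : HasFDerivAt (fun t : ℝ × ℝ => (t.1, p.2.1, t.2, p.2.2.2))
        ((ContinuousLinearMap.fst ℝ ℝ ℝ).prod ((0 : (ℝ × ℝ) →L[ℝ] ℝ).prod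
          ((ContinuousLinearMap.snd ℝ ℝ ℝ).prod (0 : (ℝ × ℝ) →L[ℝ] ℝ)))) t :=
      (ContinuousLinearMap.hasFDerivAt (ContinuousLinearMap.fst ℝ ℝ ℝ)).prodMk
        ((hasFDerivAt_const _ _).prodMk
          ((ContinuousLinearMap.hasFDerivAt (ContinuousLinearMap.snd ℝ ℝ ℝ)).prodMk
            (hasFDerivAt_const _ _)))
    have := (((h.smooth.differentiable (by simp) (t.1, p.2.1, t.2, p.2.2.2)).hasFDerivAt).comp t
      hι).fderiv
    simp only [Function.comp_def] at this
    rw [hX, this]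
    simp
  have hew : ∀ t, fderiv ℝ e t w =
      (Complex.I * (ε * (w.1 * p.1 + w.2 * p.2.2.1))) * e t := by
    intro t
    have hph : HasFDerivAt (fun t : ℝ × ℝ => Complex.I * (ε * (t.1 * p.1 + t.2 * p.2.2.1) : ℂ))
        ((Complex.I * ε * p.1) • (Complex.ofRealCLM ∘L ContinuousLinearMap.fst ℝ ℝ ℝ) +
          (Complex.I * ε * p.2.2.1) • (Complex.ofRealCLM ∘L ContinuousLinearMap.snd ℝ ℝ ℝ)) t := by
      refine (ContinuousLinearMap.hasFDerivAt _).congr_of_eventuallyEq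
        (Filter.Eventually.of_forall fun q => ?_)
      simp
      ring
    rw [he, hph.cexp.fderiv]
    simp
    ring
  have hXc : Continuous X := hXs.continuous
  have hec : Continuous e := hes.continuous
  have hXdc : Continuous fun t => fderiv ℝ X t w :=
    (hXs.continuous_fderiv (by simp)).clm_apply continuous_const
  have hedc : Continuous fun t => fderiv ℝ e t w :=
    (hes.continuous_fderiv (by simp)).clm_apply continuous_const
  have ibp := integral_mul_fderiv_eq_neg_fderiv_mul_of_integrable (μ := (volume : Measure (ℝ × ℝ)))
    (f := X) (g := e) (v := w)
    ((hXdc.mul hec).integrable_of_hasCompactSupport (hX0.fderiv_apply ℝ w).mul_right)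
    ((hXc.mul hedc).integrable_of_hasCompactSupport hX0.mul_right)
    ((hXc.mul hec).integrable_of_hasCompactSupport hX0.mul_right)
    (fun t _ => hXs.differentiable (by simp) t) (fun t _ => hes.differentiable (by simp) t)
  simp only [partFour, fourKernel]
  have e1 : ∫ t : ℝ × ℝ, fderiv ℝ Ξ (t.1, p.2.1, t.2, p.2.2.2) (w.1, 0, w.2, 0) *
      Complex.exp (Complex.I * (ε * (t.1 * p.1 + t.2 * p.2.2.1))) =
      ∫ t, fderiv ℝ X t w * e t := by
    simp only [hXw, he]
  rw [e1, ← neg_eq_iff_eq_neg.2 ibp]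
  simp only [hew]
  have e2 : ∀ t, X t * (Complex.I * (ε * (w.1 * p.1 + w.2 * p.2.2.1)) * e t) =
      (Complex.I * (ε * (w.1 * p.1 + w.2 * p.2.2.1))) * (X t * e t) := fun t => by ring
  simp only [e2]
  rw [integral_const_mul]
  ring

/-! ### The Cauchy-Riemann operators in flat coordinates -/

/-- The operator `∂/∂ζ̄₁ - 2i ζ₁ ∂/∂ζ̄₂` in the coordinates `(u₁, v₁, u₂, v₂) = κ⁻¹(ζ)`. -/
def flatCR (η : ℝ × ℝ × ℝ × ℝ → ℂ) (p : ℝ × ℝ × ℝ × ℝ) : ℂ :=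
  (1 / 2) * (fderiv ℝ η p (1, 0, 0, 0) + Complex.I * fderiv ℝ η p (0, 1, 0, 0)) -
    Complex.I * (p.1 + p.2.1 * Complex.I) * fderiv ℝ η p (0, 0, 1, 0)

/-- The operator `∂/∂ζ̄₂` in the coordinates `(u₁, v₁, u₂, v₂) = κ⁻¹(ζ)`. -/
def flatBar (η : ℝ × ℝ × ℝ × ℝ → ℂ) (p : ℝ × ℝ × ℝ × ℝ) : ℂ :=
  (1 / 2) * (fderiv ℝ η p (0, 0, 1, 0) + Complex.I * fderiv ℝ η p (0, 0, 0, 1))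

/-- The operator on the Fourier side that corresponds to `flatCR`. -/
def hatCR (ε : ℝ) (Ξ : ℝ × ℝ × ℝ × ℝ → ℂ) (q : ℝ × ℝ × ℝ × ℝ) : ℂ :=
  (Complex.I / 2) * (fderiv ℝ Ξ q (0, 1, 0, 0) + 2 * q.2.2.1 * fderiv ℝ Ξ q (1, 0, 0, 0) +
    ε * (q.1 + 2 * q.2.2.1 * q.2.1) * Ξ q)

/-- The operator on the Fourier side that corresponds to `flatBar`. -/
def hatBar (ε : ℝ) (Ξ : ℝ × ℝ × ℝ × ℝ → ℂ) (q : ℝ × ℝ × ℝ × ℝ) : ℂ :=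
  (Complex.I / 2) * (fderiv ℝ Ξ q (0, 0, 0, 1) + ε * q.2.2.1 * Ξ q)

theorem contDiff_ofReal : ContDiff ℝ (⊤ : ℕ∞) fun x : ℝ => (x : ℂ) := Complex.ofRealCLM.contDiff

theorem IsCc.hatCR {Ξ : ℝ × ℝ × ℝ × ℝ → ℂ} (h : IsCc Ξ) (ε : ℝ) : IsCc (hatCR ε Ξ) := by
  have := contDiff_ofReal
  exact ((((h.fderiv_apply _).add ((h.fderiv_apply _).mul_left (by fun_prop))).add
    (h.mul_left (by fun_prop))).mul_left contDiff_const)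

theorem IsCc.hatBar {Ξ : ℝ × ℝ × ℝ × ℝ → ℂ} (h : IsCc Ξ) (ε : ℝ) : IsCc (hatBar ε Ξ) := by
  have := contDiff_ofReal
  exact (((h.fderiv_apply _).add (h.mul_left (by fun_prop))).mul_left contDiff_const)

theorem flatBar_partFour {ε : ℝ} {Ξ : ℝ × ℝ × ℝ × ℝ → ℂ} (h : IsCc Ξ) :
    flatBar (partFour ε Ξ) = partFour ε (hatBar ε Ξ) := by
  funext p
  have hr := contDiff_ofReal
  have h3 : IsCc fun q : ℝ × ℝ × ℝ × ℝ => Complex.I * (ε * (q.2.2.1 : ℂ)) * Ξ q :=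
    h.mul_left (by fun_prop)
  rw [flatBar, fderiv_partFour ε h, fderiv_partFour ε h]
  have e1 : partFour ε (SiegelToeplitz.hatBar ε Ξ) p = (1 / 2) *
      (partFour ε (fun q => Complex.I * (ε * (q.2.2.1 : ℂ)) * Ξ q) p +
        Complex.I * partFour ε (fun q => fderiv ℝ Ξ q (0, 0, 0, 1)) p) := by
    rw [← partFour_const_mul, ← partFour_add ε h3 ((h.fderiv_apply _).mul_left contDiff_const),
      ← partFour_const_mul]
    congr 1
    funext q
    rw [SiegelToeplitz.hatBar]
    ring
  rw [e1]
  simp only [mul_one, mul_zero, add_zero, zero_add, Complex.ofReal_one, Complex.ofReal_zero,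
    zero_mul, Prod.mk_zero_zero, map_zero]

theorem flatCR_partFour {ε : ℝ} (hε : ε * ε = 1) {Ξ : ℝ × ℝ × ℝ × ℝ → ℂ} (h : IsCc Ξ) :
    flatCR (partFour ε Ξ) = partFour ε (hatCR ε Ξ) := by
  funext p
  have hr := contDiff_ofReal
  have hε' : (ε : ℂ) * ε = 1 := by exact_mod_cast hε
  have h1 : IsCc fun q : ℝ × ℝ × ℝ × ℝ => Complex.I * (ε * (q.1 : ℂ)) * Ξ q :=
    h.mul_left (by fun_prop)
  have h3 : IsCc fun q : ℝ × ℝ × ℝ × ℝ => Complex.I * (ε * (q.2.2.1 : ℂ)) * Ξ q :=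
    h.mul_left (by fun_prop)
  rw [flatCR, fderiv_partFour ε h, fderiv_partFour ε h, fderiv_partFour ε h]
  -- multiplication by `u₁` is `iε ∂/∂t₁` on the Fourier side
  have h4 := partFour_fderiv ε h3 p (1, 0)
  have e1 : ∀ q : ℝ × ℝ × ℝ × ℝ, fderiv ℝ (fun q : ℝ × ℝ × ℝ × ℝ =>
      Complex.I * (ε * (q.2.2.1 : ℂ)) * Ξ q) q (1, 0, 0, 0) =
      Complex.I * (ε * (q.2.2.1 : ℂ)) * fderiv ℝ Ξ q (1, 0, 0, 0) := by
    intro q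
    have hm : HasFDerivAt (fun q : ℝ × ℝ × ℝ × ℝ => Complex.I * (ε * (q.2.2.1 : ℂ)))
        ((Complex.I * ε) • (Complex.ofRealCLM ∘L ContinuousLinearMap.fst ℝ ℝ ℝ ∘L
          ContinuousLinearMap.snd ℝ ℝ (ℝ × ℝ) ∘L ContinuousLinearMap.snd ℝ ℝ (ℝ × ℝ × ℝ))) q := by
      refine (ContinuousLinearMap.hasFDerivAt _).congr_of_eventuallyEq
        (Filter.Eventually.of_forall fun q => ?_)
      simp
      ring
    have := (hm.mul (h.smooth.differentiable (by simp) q).hasFDerivAt).fderiv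
    erw [this]
    simp
  simp only [e1] at h4
  have hd1 : IsCc fun q : ℝ × ℝ × ℝ × ℝ => Complex.I * (ε * (q.2.2.1 : ℂ)) *
      fderiv ℝ Ξ q (1, 0, 0, 0) := (h.fderiv_apply _).mul_left (by fun_prop)
  have e2 : partFour ε (SiegelToeplitz.hatCR ε Ξ) p = (1 / 2) *
      (partFour ε (fun q => Complex.I * (ε * (q.1 : ℂ)) * Ξ q) p +
        Complex.I * partFour ε (fun q => fderiv ℝ Ξ q (0, 1, 0, 0)) p) +
      (ε * partFour ε (fun q => Complex.I * (ε * (q.2.2.1 : ℂ)) * fderiv ℝ Ξ q (1, 0, 0, 0)) p +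
        p.2.1 * partFour ε (fun q => Complex.I * (ε * (q.2.2.1 : ℂ)) * Ξ q) p) := by
    have hs := partFour_mul_side ε (fun q => Complex.I * (ε * (q.2.2.1 : ℂ)) * Ξ q)
      (fun a _ => (a : ℂ)) p
    rw [← hs, ← partFour_const_mul ε _ Complex.I, ← partFour_const_mul ε _ (ε : ℂ),
      ← partFour_add ε h1 ((h.fderiv_apply _).mul_left contDiff_const), ← partFour_const_mul,
      ← partFour_add ε (hd1.mul_left contDiff_const) (h3.mul_left (by fun_prop)),
      ← partFour_add ε ((h1.add ((h.fderiv_apply _).mul_left contDiff_const)).mul_left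
        contDiff_const) ((hd1.mul_left contDiff_const).add (h3.mul_left (by fun_prop)))]
    congr 1
    funext q
    rw [SiegelToeplitz.hatCR]
    linear_combination (-Complex.I * (q.2.2.1 : ℂ) * fderiv ℝ Ξ q (1, 0, 0, 0)) * hε'
  rw [e2, h4]
  simp only [mul_one, mul_zero, add_zero, zero_add, Complex.ofReal_one, Complex.ofReal_zero,
    zero_mul, Prod.mk_zero_zero, map_zero, one_mul]
  linear_combination (Complex.I * (p.1 : ℂ) *
    partFour ε (fun q => Complex.I * (ε * (q.2.2.1 : ℂ)) * Ξ q) p) * hε' -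
    (p.2.1 : ℂ) * partFour ε (fun q => Complex.I * (ε * (q.2.2.1 : ℂ)) * Ξ q) p * Complex.I_sq

/-! ### Test functions of one variable -/

/-- Smooth functions on `ℝ` with compact support in `I`. -/
structure IsTest1 (I : Set ℝ) (b : ℝ → ℂ) : Prop where
  smooth : ContDiff ℝ (⊤ : ℕ∞) b
  compact : HasCompactSupport b
  support : tsupport b ⊆ I

theorem IsTest1.memLp {I : Set ℝ} {b : ℝ → ℂ} (h : IsTest1 I b) (J : Set ℝ) :
    MemLp b 2 (volume.restrict J) :=
  (h.smooth.continuous.memLp_of_hasCompactSupport (μ := volume) h.compact).restrict _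

theorem IsTest1.memLp_volume {I : Set ℝ} {b : ℝ → ℂ} (h : IsTest1 I b) : MemLp b 2 volume :=
  h.smooth.continuous.memLp_of_hasCompactSupport (μ := volume) h.compact

theorem IsTest1.ofReal {I : Set ℝ} {g : ℝ → ℝ} (h1 : ContDiff ℝ (⊤ : ℕ∞) g)
    (h2 : HasCompactSupport g) (h3 : tsupport g ⊆ I) : IsTest1 I fun y => (g y : ℂ) := by
  refine ⟨contDiff_ofReal.comp h1, h2.comp_left (g := fun x : ℝ => (x : ℂ)) Complex.ofReal_zero,
    (closure_mono fun y hy => ?_).trans h3⟩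
  intro h0
  exact hy (by simp [h0])

theorem IsTest1.mono {I J : Set ℝ} {b : ℝ → ℂ} (h : IsTest1 I b) (hIJ : I ⊆ J) : IsTest1 J b :=
  ⟨h.smooth, h.compact, h.support.trans hIJ⟩

theorem IsTest1.conj {I : Set ℝ} {b : ℝ → ℂ} (h : IsTest1 I b) :
    IsTest1 I fun y => (starRingEnd ℂ) (b y) :=
  ⟨Complex.conjCLE.contDiff.comp h.smooth,
    h.compact.comp_left (g := starRingEnd ℂ) (map_zero _),
    (closure_mono fun y (hy : _ ≠ _) (h0 : b y = 0) => hy (by simp [h0])).trans h.support⟩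

/-- The elements of `L²(I)` that are classes of test functions. -/
def testClasses (μ : Measure ℝ) (I : Set ℝ) : Set (L2 μ) := {f | ∃ b, IsTest1 I b ∧ f =ᵐ[μ] b}

theorem locallyIntegrableOn_of_memLp {I : Set ℝ} (hI : IsOpen I) {v : ℝ → ℂ}
    (hv : MemLp v 2 (volume.restrict I)) : LocallyIntegrableOn v I := by
  intro x hx
  obtain ⟨ε, hε, hball⟩ := Metric.isOpen_iff.1 hI x hx
  refine ⟨Metric.ball x ε, nhdsWithin_le_nhds (Metric.ball_mem_nhds x hε), ?_⟩
  have h1 : MemLp v 2 (volume.restrict (Metric.ball x ε)) := hv.mono_measure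
    (Measure.restrict_mono hball le_rfl)
  have : IsFiniteMeasure ((volume : Measure ℝ).restrict (Metric.ball x ε)) :=
    ⟨by rw [Measure.restrict_apply_univ]; exact measure_ball_lt_top⟩
  exact h1.integrable (by norm_num)

theorem ae_eq_zero_of_integral_test {I : Set ℝ} (hI : IsOpen I) {v : ℝ → ℂ}
    (hv : MemLp v 2 (volume.restrict I)) (h : ∀ b, IsTest1 I b → ∫ y in I, b y * v y = 0) :
    v =ᵐ[volume.restrict I] 0 := by
  have := hI.ae_eq_zero_of_integral_contDiff_smul_eq_zero
    (locallyIntegrableOn_of_memLp hI hv) fun g hg hgc hgs => by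
    rw [← h _ (IsTest1.ofReal hg hgc hgs), setIntegral_eq_integral_of_forall_compl_eq_zero]
    · simp
    · intro y hy
      have : g y = 0 := by
        by_contra hne
        exact hy (hgs (subset_tsupport _ hne))
      simp [this]
  exact (ae_restrict_iff' hI.measurableSet).2 this

theorem isTotal_testClasses_restrict {I : Set ℝ} (hI : IsOpen I) :
    IsTotal (testClasses (volume.restrict I) I) := by
  intro v hv
  refine Lp.ext ((ae_eq_zero_of_integral_test hI (Lp.memLp v) fun b hb => ?_).trans
    (Lp.coeFn_zero _ _ _).symm)
  have hb' := hb.conj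
  rw [← hv ((hb'.memLp I).toLp) ⟨_, hb', (hb'.memLp I).coeFn_toLp⟩, L2.inner_def]
  refine integral_congr_ae ?_
  filter_upwards [(hb'.memLp I).coeFn_toLp] with y hy
  rw [hy, RCLike.inner_apply, Complex.conj_conj, mul_comm]

theorem isTotal_testClasses_half : IsTotal (testClasses posMeasure (Ioi 0)) :=
  isTotal_testClasses_restrict isOpen_Ioi

theorem isTotal_testClasses : IsTotal (testClasses (volume : Measure ℝ) univ) := by
  have := isTotal_testClasses_restrict isOpen_univ
  rwa [Measure.restrict_univ] at this

/-- The Fourier integral `(2π)^{-1/2} ∫ b(x) e^{-itx} dx`. -/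
def fourInt (b : ℝ → ℂ) (t : ℝ) : ℂ :=
  ((2 * Real.pi) ^ (-(1 / 2) : ℝ) : ℝ) * ∫ x : ℝ, b x * Complex.exp (-(Complex.I * (t * x)))

theorem fourInt_eq (b : ℝ → ℂ) (t : ℝ) : fourInt b t =
    ((2 * Real.pi) ^ (-(1 / 2) : ℝ) : ℝ) * FourierTransform.fourier b (t / (2 * Real.pi)) := by
  rw [Real.fourier_real_eq_integral_exp_smul, fourInt]
  congr 2
  funext x
  rw [smul_eq_mul, mul_comm]
  congr 2
  have : (Real.pi : ℂ) ≠ 0 := by exact_mod_cast Real.pi_ne_zero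
  push_cast
  field_simp

theorem IsTest1.continuous_fourInt {I : Set ℝ} {b : ℝ → ℂ} (h : IsTest1 I b) :
    Continuous (fourInt b) := by
  have h1 : fourInt b = fun t => (((2 * Real.pi) ^ (-(1 / 2) : ℝ) : ℝ) : ℂ) *
      (FourierTransform.fourier (h.compact.toSchwartzMap h.smooth)) (t / (2 * Real.pi)) := by
    funext t
    rw [fourInt_eq, SchwartzMap.fourier_coe]
    rfl
  rw [h1]
  exact continuous_const.mul ((SchwartzMap.continuous _).comp (by fun_prop))

theorem IsTest1.fourierL2_eq {I : Set ℝ} {b : ℝ → ℂ} (h : IsTest1 I b)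
    {f : L2 (volume : Measure ℝ)} (hf : f =ᵐ[volume] b) : fourierL2 f =ᵐ[volume] fourInt b := by
  set ψ := h.compact.toSchwartzMap h.smooth
  have hfψ : f = ψ.toLp 2 := Lp.ext (hf.trans (ψ.coeFn_toLp 2 volume).symm)
  have h1 : fourierL2 f = weightedComp isWeightedPullback_dilation
      (FourierTransform.fourier (ψ.toLp 2 : L2 (volume : Measure ℝ))) := by rw [hfψ]; rfl
  rw [h1, SchwartzMap.toLp_fourier_eq]
  filter_upwards [weightedComp_coeFn isWeightedPullback_dilation
      ((FourierTransform.fourier ψ).toLp 2 : L2 (volume : Measure ℝ)),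
    isWeightedPullback_dilation.quasi.ae ((FourierTransform.fourier ψ).coeFn_toLp 2 volume)]
    with t h2 h3
  rw [h2, h3, fourInt_eq, SchwartzMap.fourier_coe]
  rfl

/-! ### Decay of the partial Fourier transform -/

theorem norm_fourKernel (ε : ℝ) (Ξ : ℝ × ℝ × ℝ × ℝ → ℂ) (p : ℝ × ℝ × ℝ × ℝ) (t : ℝ × ℝ) :
    ‖fourKernel ε Ξ p t‖ = ‖Ξ (t.1, p.2.1, t.2, p.2.2.2)‖ := by
  rw [fourKernel, norm_mul]
  have : Complex.I * (ε * (t.1 * p.1 + t.2 * p.2.2.1) : ℂ) =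
      ((ε * (t.1 * p.1 + t.2 * p.2.2.1) : ℝ) : ℂ) * Complex.I := by push_cast; ring
  rw [this, Complex.norm_exp_ofReal_mul_I, mul_one]

theorem exists_bound_partFour (ε : ℝ) {Ξ : ℝ × ℝ × ℝ × ℝ → ℂ} (h : IsCc Ξ) :
    ∃ C, ∀ p, ‖partFour ε Ξ p‖ ≤ C := by
  obtain ⟨C, hC⟩ := h.compact.exists_bound_of_continuous h.continuous
  refine ⟨‖(((2 * Real.pi)⁻¹ : ℝ) : ℂ)‖ * (C * volume.real (timeSupport Ξ)), fun p => ?_⟩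
  rw [partFour, norm_mul]
  refine mul_le_mul_of_nonneg_left ?_ (norm_nonneg _)
  rw [← setIntegral_eq_integral_of_forall_compl_eq_zero (s := timeSupport Ξ)
    fun t ht => fourKernel_eq_zero ε p ht]
  refine norm_setIntegral_le_of_norm_le_const h.isCompact_timeSupport.measure_lt_top fun t _ => ?_
  rw [norm_fourKernel]
  exact hC _

theorem partFour_eq_zero (ε : ℝ) {Ξ : ℝ × ℝ × ℝ × ℝ → ℂ} {p : ℝ × ℝ × ℝ × ℝ}
    (hp : ∀ t : ℝ × ℝ, Ξ (t.1, p.2.1, t.2, p.2.2.2) = 0) : partFour ε Ξ p = 0 := by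
  simp [partFour, fourKernel, hp]

/-- With `D = w₁ ∂/∂t₁ + w₂ ∂/∂t₂`, the operator `1 - D²` becomes multiplication by `1 + (w · u)²`.
-/
theorem partFour_second_order {ε : ℝ} (hε : ε * ε = 1) {Ξ : ℝ × ℝ × ℝ × ℝ → ℂ} (h : IsCc Ξ)
    (w : ℝ × ℝ) (p : ℝ × ℝ × ℝ × ℝ) :
    partFour ε (fun q => Ξ q + (-1) * fderiv ℝ (fun q => fderiv ℝ Ξ q (w.1, 0, w.2, 0)) q
      (w.1, 0, w.2, 0)) p = (1 + (w.1 * p.1 + w.2 * p.2.2.1 : ℝ) ^ 2 : ℝ) * partFour ε Ξ p := by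
  have h1 := h.fderiv_apply (w.1, 0, w.2, 0)
  rw [partFour_add ε h ((h1.fderiv_apply _).mul_left contDiff_const), partFour_const_mul,
    partFour_fderiv ε h1, partFour_fderiv ε h]
  have hε' : (ε : ℂ) * ε = 1 := by exact_mod_cast hε
  push_cast
  linear_combination (-(ε : ℂ) * ε * (w.1 * p.1 + w.2 * p.2.2.1) ^ 2 * partFour ε Ξ p) *
    Complex.I_sq + ((w.1 * p.1 + w.2 * p.2.2.1) ^ 2 * partFour ε Ξ p) * hε'

theorem memLp_inv_one_add_sq : MemLp (fun u : ℝ => (((1 + u ^ 2)⁻¹ : ℝ) : ℂ)) 2 volume := by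
  suffices h : MemLp (fun u : ℝ => (1 + u ^ 2)⁻¹) 2 volume from h.ofReal
  have hc : Continuous fun u : ℝ => (1 + u ^ 2)⁻¹ :=
    Continuous.inv₀ (by fun_prop) fun u => by positivity
  rw [memLp_two_iff_integrable_sq hc.aestronglyMeasurable]
  refine integrable_inv_one_add_sq.mono' (hc.pow 2).aestronglyMeasurable
    (Filter.Eventually.of_forall fun u => ?_)
  rw [Real.norm_of_nonneg (by positivity), sq]
  refine mul_le_of_le_one_left (by positivity) (inv_le_one_of_one_le₀ ?_)
  nlinarith [sq_nonneg u]

theorem memLp_indicator_Icc (R : ℝ) (J : Set ℝ) :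
    MemLp ((Icc (-R) R).indicator fun _ : ℝ => (1 : ℂ)) 2 (volume.restrict J) :=
  (memLp_indicator_const 2 measurableSet_Icc 1 (Or.inr measure_Icc_lt_top.ne)).restrict _

/-- `partFour ε Ξ` has compact support in `(s₁, s₂)`, and two derivatives of `Ξ` in each of `t₁, t₂`
give the decay `(1 + u₁²)⁻¹ (1 + u₂²)⁻¹`. -/
theorem memLp_partFour {ε : ℝ} (hε : ε * ε = 1) {Ξ : ℝ × ℝ × ℝ × ℝ → ℂ} (h : IsCc Ξ) :
    MemLp (partFour ε Ξ) 2 flatMeasure := by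
  obtain ⟨R, hR⟩ := h.compact.isCompact.isBounded.subset_closedBall 0
  have h1 := h.add (((h.fderiv_apply (1, 0, 0, 0)).fderiv_apply (1, 0, 0, 0)).mul_left
    (contDiff_const (c := (-1 : ℂ))))
  have h2 := h1.add (((h1.fderiv_apply (0, 0, 1, 0)).fderiv_apply (0, 0, 1, 0)).mul_left
    (contDiff_const (c := (-1 : ℂ))))
  obtain ⟨C, hC⟩ := exists_bound_partFour ε h2
  have hkey : ∀ p : ℝ × ℝ × ℝ × ℝ,
      (1 + p.2.2.1 ^ 2) * ((1 + p.1 ^ 2) * ‖partFour ε Ξ p‖) ≤ C := by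
    intro p
    have e1 := partFour_second_order hε h1 (0, 1) p
    have e2 := partFour_second_order hε h (1, 0) p
    have := hC p
    rw [e1, e2, norm_mul, norm_mul, Complex.norm_real, Complex.norm_real,
      Real.norm_of_nonneg (by positivity), Real.norm_of_nonneg (by positivity)] at this
    simpa using this
  have hb := (memLp_inv_one_add_sq.const_mul (C : ℂ))
  have hI := memLp_indicator_Icc R univ
  rw [Measure.restrict_univ] at hI
  have hD := memLp_tensor hb (memLp_tensor hI
    (memLp_tensor memLp_inv_one_add_sq (memLp_indicator_Icc R (Ioi 0))))
  refine hD.mono (contDiff_partFour ε h).continuous.aestronglyMeasurable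
    (Filter.Eventually.of_forall fun p => ?_)
  have hC0 : 0 ≤ C := (norm_nonneg _).trans (hC p)
  by_cases hp : p.2.1 ∈ Icc (-R) R ∧ p.2.2.2 ∈ Icc (-R) R
  · rw [indicator_of_mem hp.1, indicator_of_mem hp.2]
    simp only [one_mul, mul_one, norm_mul, Complex.norm_real]
    rw [Real.norm_of_nonneg hC0, Real.norm_of_nonneg (by positivity),
      Real.norm_of_nonneg (by positivity), ← div_eq_mul_inv, ← div_eq_mul_inv,
      le_div_iff₀ (by positivity), le_div_iff₀ (by positivity)]
    linarith [hkey p]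
  · rw [partFour_eq_zero, norm_zero]
    · exact norm_nonneg _
    · intro t
      by_contra hne
      have := hR (subset_tsupport _ hne)
      rw [mem_closedBall_zero_iff, Prod.norm_def, Prod.norm_def, Prod.norm_def] at this
      simp only [sup_le_iff, Real.norm_eq_abs, abs_le] at this
      exact hp ⟨this.2.1, this.2.2.2⟩

theorem IsCc.memLp {Ξ : ℝ × ℝ × ℝ × ℝ → ℂ} (h : IsCc Ξ) : MemLp Ξ 2 flatMeasure := by
  rw [flatMeasure_eq]
  exact (h.continuous.memLp_of_hasCompactSupport h.compact).restrict _

/-! ### Parseval's identity for the partial Fourier transform -/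

theorem integral_shuffle {Φ : (ℝ × ℝ) × (ℝ × ℝ) → ℂ} (hΦ : Continuous Φ) :
    ∫ p, Φ ((p.1, p.2.2.1), (p.2.1, p.2.2.2)) ∂flatMeasure =
      ∫ q, Φ q ∂((volume : Measure (ℝ × ℝ)).prod halfMeasure) := by
  rw [← measurePreserving_shuffle.map_eq]
  exact (integral_map measurePreserving_shuffle.measurable.aemeasurable
    hΦ.aestronglyMeasurable).symm

theorem integrable_shuffle {Φ : (ℝ × ℝ) × (ℝ × ℝ) → ℂ} (hΦ : Continuous Φ)
    (hΦc : HasCompactSupport Φ) : Integrable Φ ((volume : Measure (ℝ × ℝ)).prod halfMeasure) := by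
  have h1 := hΦ.integrable_of_hasCompactSupport (μ := volume) hΦc
  have h2 : (volume : Measure (ℝ × ℝ)).prod halfMeasure =
      (volume : Measure ((ℝ × ℝ) × (ℝ × ℝ))).restrict (univ ×ˢ (univ ×ˢ Ioi (0 : ℝ))) := by
    rw [halfMeasure_eq, Measure.volume_eq_prod (ℝ × ℝ), ← Measure.prod_restrict,
      Measure.restrict_univ]
  rw [h2]
  exact h1.integrableOn

/-- The constant `(2π)⁻¹` of `partFour` is the product of the two constants `(2π)^{-1/2}` of
`fourInt`. -/
theorem integral_test_exp (α γ : ℝ → ℂ) (t : ℝ × ℝ) :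
    (((2 * Real.pi)⁻¹ : ℝ) : ℂ) * ∫ u : ℝ × ℝ, α u.1 * γ u.2 *
      Complex.exp (Complex.I * (((-1 : ℝ) : ℂ) * (t.1 * u.1 + t.2 * u.2))) =
      fourInt α t.1 * fourInt γ t.2 := by
  have h : ∀ u : ℝ × ℝ, α u.1 * γ u.2 *
      Complex.exp (Complex.I * (((-1 : ℝ) : ℂ) * (t.1 * u.1 + t.2 * u.2))) =
      (α u.1 * Complex.exp (-(Complex.I * (t.1 * u.1)))) *
        (γ u.2 * Complex.exp (-(Complex.I * (t.2 * u.2)))) := by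
    intro u
    rw [show Complex.I * (((-1 : ℝ) : ℂ) * (t.1 * u.1 + t.2 * u.2)) =
      -(Complex.I * (t.1 * u.1)) + -(Complex.I * (t.2 * u.2)) by push_cast; ring, Complex.exp_add]
    ring
  simp_rw [h]
  rw [Measure.volume_eq_prod, integral_prod_mul (fun x => α x * Complex.exp (-(Complex.I * (t.1 * x))))
    (fun x => γ x * Complex.exp (-(Complex.I * (t.2 * x)))), fourInt, fourInt]
  have h2 : (((2 * Real.pi)⁻¹ : ℝ) : ℂ) = (((2 * Real.pi) ^ (-(1 / 2) : ℝ) : ℝ) : ℂ) *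
      (((2 * Real.pi) ^ (-(1 / 2) : ℝ) : ℝ) : ℂ) := by
    rw [← Complex.ofReal_mul, ← Real.rpow_add (by positivity)]
    norm_num
    rw [Real.rpow_neg_one]
    push_cast
    rw [mul_inv]
    ring
  rw [h2]
  ring

/-- Fubini's theorem for the transform of `Ξ` against a product of test functions. -/
theorem integral_tests_mul_partFour {α β γ δ : ℝ → ℂ} {I₁ I₂ I₃ I₄ : Set ℝ} (hα : IsTest1 I₁ α)
    (hβ : IsTest1 I₂ β) (hγ : IsTest1 I₃ γ) (hδ : IsTest1 I₄ δ) {Ξ : ℝ × ℝ × ℝ × ℝ → ℂ}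
    (h : IsCc Ξ) :
    ∫ p : ℝ × ℝ × ℝ × ℝ, (α p.1 * (β p.2.1 * (γ p.2.2.1 * δ p.2.2.2))) * partFour (-1) Ξ p
        ∂flatMeasure =
      ∫ p : ℝ × ℝ × ℝ × ℝ, (fourInt α p.1 * (β p.2.1 * (fourInt γ p.2.2.1 * δ p.2.2.2))) * Ξ p
        ∂flatMeasure := by
  have cα := hα.smooth.continuous
  have cβ := hβ.smooth.continuous
  have cγ := hγ.smooth.continuous
  have cδ := hδ.smooth.continuous
  have cFα := hα.continuous_fourInt
  have cFγ := hγ.continuous_fourInt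
  have cΞ := h.continuous
  set ΦL : (ℝ × ℝ) × (ℝ × ℝ) → ℂ := fun q => (α q.1.1 * (β q.2.1 * (γ q.1.2 * δ q.2.2))) *
    partFour (-1) Ξ (q.1.1, q.2.1, q.1.2, q.2.2) with hΦL
  set ΦR : (ℝ × ℝ) × (ℝ × ℝ) → ℂ := fun q =>
    (fourInt α q.1.1 * (β q.2.1 * (fourInt γ q.1.2 * δ q.2.2))) *
    Ξ (q.1.1, q.2.1, q.1.2, q.2.2) with hΦR
  have cL : Continuous ΦL := by
    have := (contDiff_partFour (-1) h).continuous
    fun_prop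
  have cR : Continuous ΦR := by fun_prop
  have sL : HasCompactSupport ΦL := by
    refine HasCompactSupport.intro ((hα.compact.isCompact.prod hγ.compact.isCompact).prod
      (hβ.compact.isCompact.prod hδ.compact.isCompact)) fun q hq => ?_
    simp only [hΦL]
    by_cases h1 : q.1.1 ∈ tsupport α
    · by_cases h2 : q.1.2 ∈ tsupport γ
      · by_cases h3 : q.2.1 ∈ tsupport β
        · have h4 : q.2.2 ∉ tsupport δ := fun h4 => hq ⟨⟨h1, h2⟩, h3, h4⟩
          simp [image_eq_zero_of_notMem_tsupport h4]
        · simp [image_eq_zero_of_notMem_tsupport h3]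
      · simp [image_eq_zero_of_notMem_tsupport h2]
    · simp [image_eq_zero_of_notMem_tsupport h1]
  have sR : HasCompactSupport ΦR := by
    have hk : IsCompact ((fun p : ℝ × ℝ × ℝ × ℝ => ((p.1, p.2.2.1), (p.2.1, p.2.2.2))) ''
      tsupport Ξ) := h.compact.isCompact.image (by fun_prop)
    refine HasCompactSupport.intro hk fun q hq => ?_
    simp only [hΦR]
    have : (q.1.1, q.2.1, q.1.2, q.2.2) ∉ tsupport Ξ := fun hm => hq ⟨_, hm, rfl⟩
    rw [image_eq_zero_of_notMem_tsupport this, mul_zero]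
  rw [integral_shuffle cL, integral_shuffle cR, integral_prod_symm _ (integrable_shuffle cL sL),
    integral_prod_symm _ (integrable_shuffle cR sR)]
  congr 1
  funext s
  -- the two iterated integrals over `(u, t)`
  set H : (ℝ × ℝ) → (ℝ × ℝ) → ℂ := fun u t => (β s.1 * δ s.2 * (((2 * Real.pi)⁻¹ : ℝ) : ℂ)) *
    (Ξ (t.1, s.1, t.2, s.2) * (α u.1 * γ u.2 *
      Complex.exp (Complex.I * (((-1 : ℝ) : ℂ) * (t.1 * u.1 + t.2 * u.2))))) with hH
  have cH : Continuous (Function.uncurry H) := by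
    simp only [hH, Function.uncurry_def]
    fun_prop
  have sH : HasCompactSupport (Function.uncurry H) := by
    refine HasCompactSupport.intro ((hα.compact.isCompact.prod hγ.compact.isCompact).prod
      h.isCompact_timeSupport) fun q hq => ?_
    simp only [hH, Function.uncurry_def]
    by_cases h1 : q.1.1 ∈ tsupport α
    · by_cases h2 : q.1.2 ∈ tsupport γ
      · have h3 : q.2 ∉ timeSupport Ξ := fun h3 => hq ⟨⟨h1, h2⟩, h3⟩
        simp [eq_zero_of_notMem_timeSupport h3]
      · simp [image_eq_zero_of_notMem_tsupport h2]
    · simp [image_eq_zero_of_notMem_tsupport h1]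
  have iH : Integrable (Function.uncurry H) ((volume : Measure (ℝ × ℝ)).prod volume) :=
    cH.integrable_of_hasCompactSupport sH
  calc ∫ u : ℝ × ℝ, ΦL (u, s) = ∫ u, ∫ t, H u t := by
        congr 1
        funext u
        simp only [hΦL, hH, partFour, fourKernel]
        rw [integral_const_mul, ← integral_const_mul, ← integral_const_mul,
          ← integral_const_mul]
        congr 1
        funext t
        ring
    _ = ∫ t, ∫ u, H u t := integral_integral_swap iH
    _ = ∫ t : ℝ × ℝ, ΦR (t, s) := by
        congr 1
        funext t
        simp only [hΦR, hH]
        rw [integral_const_mul, integral_const_mul]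
        have := integral_test_exp α γ t
        linear_combination (β s.1 * δ s.2 * Ξ (t.1, s.1, t.2, s.2)) * this

theorem star_toLp_inner {F : L2 flatMeasure} {G : ℝ × ℝ × ℝ × ℝ → ℂ} (hG : MemLp G 2 flatMeasure) :
    inner ℂ hG.star.toLp F = ∫ p, F p * G p ∂flatMeasure := by
  rw [L2.inner_def]
  refine integral_congr_ae ?_
  filter_upwards [hG.star.coeFn_toLp] with p hp
  rw [hp]
  simp [RCLike.inner_apply]

theorem tensor4_coeFn {f₁ f₂ f₃ : L2 (volume : Measure ℝ)} {f₄ : L2 posMeasure}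
    {b₁ b₂ b₃ b₄ : ℝ → ℂ} (e₁ : f₁ =ᵐ[volume] b₁) (e₂ : f₂ =ᵐ[volume] b₂) (e₃ : f₃ =ᵐ[volume] b₃)
    (e₄ : f₄ =ᵐ[posMeasure] b₄) : tensor f₁ (tensor f₂ (tensor f₃ f₄)) =ᵐ[flatMeasure]
      fun p => b₁ p.1 * (b₂ p.2.1 * (b₃ p.2.2.1 * b₄ p.2.2.2)) := by
  have q1 := Measure.quasiMeasurePreserving_snd (μ := (volume : Measure ℝ))
    (ν := (volume : Measure ℝ).prod ((volume : Measure ℝ).prod posMeasure))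
  have q2 := Measure.quasiMeasurePreserving_snd (μ := (volume : Measure ℝ))
    (ν := (volume : Measure ℝ).prod posMeasure)
  filter_upwards [tensor_coeFn f₁ (tensor f₂ (tensor f₃ f₄)),
    q1.ae (tensor_coeFn f₂ (tensor f₃ f₄)), q1.ae (q2.ae (tensor_coeFn f₃ f₄)),
    Measure.quasiMeasurePreserving_fst.ae e₁,
    q1.ae (Measure.quasiMeasurePreserving_fst.ae e₂),
    q1.ae (q2.ae (Measure.quasiMeasurePreserving_fst.ae e₃)),
    q1.ae (q2.ae (Measure.quasiMeasurePreserving_snd.ae e₄))] with p h1 h2 h3 h4 h5 h6 h7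
  rw [h1, h2, h3, h4, h5, h6, h7]

/-- **Parseval's identity**: the transpose of `U₁` is `partFour (-1)`. By totality it suffices to
consider products of test functions in place of `F`. -/
theorem integral_mul_partFour {Ξ : ℝ × ℝ × ℝ × ℝ → ℂ} (h : IsCc Ξ) (F : L2 flatMeasure) :
    ∫ p, F p * partFour (-1) Ξ p ∂flatMeasure = ∫ p, opU1 F p * Ξ p ∂flatMeasure := by
  have hJ := memLp_partFour (ε := -1) (by norm_num) h
  have hΞ := h.memLp
  suffices hv : hJ.star.toLp - ContinuousLinearMap.adjoint opU1.toContinuousLinearMap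
      hΞ.star.toLp = 0 by
    rw [← star_toLp_inner hJ, ← star_toLp_inner hΞ, sub_eq_zero.1 hv,
      ContinuousLinearMap.adjoint_inner_left]
    rfl
  have htot := isTotal_testClasses.tensor (isTotal_testClasses.tensor
    (isTotal_testClasses.tensor isTotal_testClasses_half))
  refine htot _ ?_
  rintro _ ⟨α', ⟨α, hα, eα⟩, _, ⟨β', ⟨β, hβ, eβ⟩, _, ⟨γ', ⟨γ, hγ, eγ⟩, δ', ⟨δ, hδ, eδ⟩, rfl⟩,
    rfl⟩, rfl⟩
  rw [inner_sub_right, ContinuousLinearMap.adjoint_inner_right, sub_eq_zero,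
    ← inner_conj_symm, star_toLp_inner hJ, ← inner_conj_symm, star_toLp_inner hΞ]
  congr 1
  have hL := tensor4_coeFn eα eβ eγ eδ
  have hR := tensor4_coeFn (hα.fourierL2_eq eα) eβ (hγ.fourierL2_eq eγ) eδ
  have hUs : opU1.toContinuousLinearMap (tensor α' (tensor β' (tensor γ' δ'))) =
      tensor (fourierL2 α') (tensor β' (tensor (fourierL2 γ') δ')) := opU1_tensor α' γ' β' δ'
  rw [hUs]
  refine (integral_congr_ae ?_).trans ((integral_tests_mul_partFour hα hβ hγ hδ h).trans
    (integral_congr_ae ?_))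
  · filter_upwards [hL] with p hp
    rw [hp]
  · filter_upwards [hR] with p hp
    rw [hp]

/-! ### First-order operators on `ℝ⁴` -/

/-- A complex vector field on `ℝ⁴` as a first-order differential operator. -/
def vectorField (a₁ a₂ a₃ a₄ : ℝ × ℝ × ℝ × ℝ → ℂ) (η : ℝ × ℝ × ℝ × ℝ → ℂ)
    (p : ℝ × ℝ × ℝ × ℝ) : ℂ :=
  a₁ p * fderiv ℝ η p (1, 0, 0, 0) + a₂ p * fderiv ℝ η p (0, 1, 0, 0) +
    a₃ p * fderiv ℝ η p (0, 0, 1, 0) + a₄ p * fderiv ℝ η p (0, 0, 0, 1)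

/-- Operators that act on smooth functions as derivations, and are local. -/
structure IsDerivation (D : (ℝ × ℝ × ℝ × ℝ → ℂ) → (ℝ × ℝ × ℝ × ℝ → ℂ)) : Prop where
  smooth : ∀ η, ContDiff ℝ (⊤ : ℕ∞) η → ContDiff ℝ (⊤ : ℕ∞) (D η)
  add : ∀ η ξ, ContDiff ℝ (⊤ : ℕ∞) η → ContDiff ℝ (⊤ : ℕ∞) ξ →
    D (fun p => η p + ξ p) = fun p => D η p + D ξ p
  mul : ∀ η ξ, ContDiff ℝ (⊤ : ℕ∞) η → ContDiff ℝ (⊤ : ℕ∞) ξ →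
    D (fun p => η p * ξ p) = fun p => η p * D ξ p + D η p * ξ p
  const_mul : ∀ (c : ℂ) η, ContDiff ℝ (⊤ : ℕ∞) η → D (fun p => c * η p) = fun p => c * D η p
  support : ∀ η, Function.support (D η) ⊆ tsupport η

theorem isDerivation_vectorField {a₁ a₂ a₃ a₄ : ℝ × ℝ × ℝ × ℝ → ℂ}
    (h₁ : ContDiff ℝ (⊤ : ℕ∞) a₁) (h₂ : ContDiff ℝ (⊤ : ℕ∞) a₂) (h₃ : ContDiff ℝ (⊤ : ℕ∞) a₃)
    (h₄ : ContDiff ℝ (⊤ : ℕ∞) a₄) : IsDerivation (vectorField a₁ a₂ a₃ a₄) where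
  smooth η hη := by
    have : ∀ v : ℝ × ℝ × ℝ × ℝ, ContDiff ℝ (⊤ : ℕ∞) fun p => fderiv ℝ η p v := fun v =>
      (hη.fderiv_right (m := (⊤ : ℕ∞)) (by norm_cast)).clm_apply contDiff_const
    exact (((h₁.mul (this _)).add (h₂.mul (this _))).add (h₃.mul (this _))).add (h₄.mul (this _))
  add η ξ hη hξ := by
    funext p
    simp only [vectorField]
    rw [fderiv_fun_add (hη.differentiable (by simp) p) (hξ.differentiable (by simp) p)]
    simp only [add_apply]
    ring
  mul η ξ hη hξ := by
    funext p
    simp only [vectorField]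
    rw [fderiv_fun_mul (hη.differentiable (by simp) p) (hξ.differentiable (by simp) p)]
    simp only [add_apply, smul_apply, smul_eq_mul]
    ring
  const_mul c η hη := by
    funext p
    simp only [vectorField]
    rw [fderiv_const_mul (hη.differentiable (by simp) p)]
    simp only [smul_apply, smul_eq_mul]
    ring
  support η p hp := by
    by_contra h
    refine hp ?_
    have : fderiv ℝ η p = 0 := by
      by_contra hne
      exact h (support_fderiv_subset ℝ (f := η) hne)
    simp [vectorField, this]

theorem flatCR_eq_vectorField : flatCR = vectorField (fun _ => 1 / 2) (fun _ => Complex.I / 2)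
    (fun p => -Complex.I * (p.1 + p.2.1 * Complex.I)) (fun _ => 0) := by
  funext η p
  rw [flatCR, vectorField]
  ring

theorem flatBar_eq_vectorField : flatBar = vectorField (fun _ => 0) (fun _ => 0)
    (fun _ => 1 / 2) (fun _ => Complex.I / 2) := by
  funext η p
  rw [flatBar, vectorField]
  ring

theorem isDerivation_flatCR : IsDerivation flatCR := by
  rw [flatCR_eq_vectorField]
  have := contDiff_ofReal
  exact isDerivation_vectorField contDiff_const contDiff_const (by fun_prop) contDiff_const

theorem isDerivation_flatBar : IsDerivation flatBar := by
  rw [flatBar_eq_vectorField]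
  exact isDerivation_vectorField contDiff_const contDiff_const contDiff_const contDiff_const

section Derivation

variable {D : (ℝ × ℝ × ℝ × ℝ → ℂ) → (ℝ × ℝ × ℝ × ℝ → ℂ)} (hD : IsDerivation D)

include hD

theorem IsDerivation.smooth_iterate {η : ℝ × ℝ × ℝ × ℝ → ℂ} (h : ContDiff ℝ (⊤ : ℕ∞) η) (n : ℕ) :
    ContDiff ℝ (⊤ : ℕ∞) (D^[n] η) := by
  induction n with
  | zero => exact h
  | succ n ih => rw [Function.iterate_succ_apply']; exact hD.smooth _ ih

theorem IsDerivation.add_iterate {η ξ : ℝ × ℝ × ℝ × ℝ → ℂ} (h : ContDiff ℝ (⊤ : ℕ∞) η)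
    (h' : ContDiff ℝ (⊤ : ℕ∞) ξ) (n : ℕ) :
    D^[n] (fun p => η p + ξ p) = fun p => D^[n] η p + D^[n] ξ p := by
  induction n with
  | zero => rfl
  | succ n ih =>
    rw [Function.iterate_succ_apply', ih,
      hD.add _ _ (hD.smooth_iterate h n) (hD.smooth_iterate h' n)]
    simp only [Function.iterate_succ_apply']

theorem IsDerivation.const_mul_iterate {η : ℝ × ℝ × ℝ × ℝ → ℂ} (h : ContDiff ℝ (⊤ : ℕ∞) η)
    (c : ℂ) (n : ℕ) : D^[n] (fun p => c * η p) = fun p => c * D^[n] η p := by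
  induction n with
  | zero => rfl
  | succ n ih =>
    rw [Function.iterate_succ_apply', ih, hD.const_mul _ _ (hD.smooth_iterate h n)]
    simp only [Function.iterate_succ_apply']

theorem IsDerivation.tsupport_subset (η : ℝ × ℝ × ℝ × ℝ → ℂ) : tsupport (D η) ⊆ tsupport η :=
  closure_minimal (hD.support η) (isClosed_tsupport η)

theorem IsDerivation.isCc {η : ℝ × ℝ × ℝ × ℝ → ℂ} (h : IsCc η) : IsCc (D η) :=
  ⟨hD.smooth _ h.smooth, h.compact.mono' (hD.support η)⟩

theorem IsDerivation.isCc_iterate {η : ℝ × ℝ × ℝ × ℝ → ℂ} (h : IsCc η) (n : ℕ) :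
    IsCc (D^[n] η) ∧ tsupport (D^[n] η) ⊆ tsupport η := by
  induction n with
  | zero => exact ⟨h, Subset.rfl⟩
  | succ n ih =>
    rw [Function.iterate_succ_apply']
    exact ⟨hD.isCc ih.1, (hD.tsupport_subset _).trans ih.2⟩

end Derivation

theorem isAddHaarMeasure_volume : (volume : Measure (ℝ × ℝ × ℝ × ℝ)).IsAddHaarMeasure := by
  have h2 : (volume : Measure (ℝ × ℝ)).IsAddHaarMeasure :=
    Measure.prod.instIsAddHaarMeasure (volume : Measure ℝ) (volume : Measure ℝ)
  have h3 : (volume : Measure (ℝ × ℝ × ℝ)).IsAddHaarMeasure :=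
    Measure.prod.instIsAddHaarMeasure (volume : Measure ℝ) (volume : Measure (ℝ × ℝ))
  exact Measure.prod.instIsAddHaarMeasure (volume : Measure ℝ) (volume : Measure (ℝ × ℝ × ℝ))

theorem integral_mul_fderiv_isCc {η φ : ℝ × ℝ × ℝ × ℝ → ℂ} (hη : ContDiff ℝ (⊤ : ℕ∞) η)
    (hφ : IsCc φ) (v : ℝ × ℝ × ℝ × ℝ) :
    ∫ p, η p * fderiv ℝ φ p v = -∫ p, fderiv ℝ η p v * φ p := by
  have h1 : Continuous fun p => fderiv ℝ η p v :=
    (hη.continuous_fderiv (by simp)).clm_apply continuous_const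
  have := isAddHaarMeasure_volume
  exact integral_mul_fderiv_eq_neg_fderiv_mul_of_integrable
    ((h1.mul hφ.continuous).integrable_of_hasCompactSupport hφ.compact.mul_left)
    ((hη.continuous.mul (hφ.fderiv_apply v).continuous).integrable_of_hasCompactSupport
      (hφ.fderiv_apply v).compact.mul_left)
    ((hη.continuous.mul hφ.continuous).integrable_of_hasCompactSupport hφ.compact.mul_left)
    (fun t _ => hη.differentiable (by simp) t) (fun t _ => hφ.smooth.differentiable (by simp) t)

/-- A divergence-free vector field is formally skew-symmetric. -/
theorem integral_mul_vectorField {a₁ a₂ a₃ a₄ : ℝ × ℝ × ℝ × ℝ → ℂ}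
    (h₁ : ContDiff ℝ (⊤ : ℕ∞) a₁) (h₂ : ContDiff ℝ (⊤ : ℕ∞) a₂) (h₃ : ContDiff ℝ (⊤ : ℕ∞) a₃)
    (h₄ : ContDiff ℝ (⊤ : ℕ∞) a₄)
    (d₁ : ∀ p, fderiv ℝ a₁ p (1, 0, 0, 0) = 0) (d₂ : ∀ p, fderiv ℝ a₂ p (0, 1, 0, 0) = 0)
    (d₃ : ∀ p, fderiv ℝ a₃ p (0, 0, 1, 0) = 0) (d₄ : ∀ p, fderiv ℝ a₄ p (0, 0, 0, 1) = 0)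
    {η φ : ℝ × ℝ × ℝ × ℝ → ℂ} (hη : ContDiff ℝ (⊤ : ℕ∞) η) (hφ : IsCc φ) :
    ∫ p, η p * vectorField a₁ a₂ a₃ a₄ φ p = -∫ p, vectorField a₁ a₂ a₃ a₄ η p * φ p := by
  have key : ∀ (a : ℝ × ℝ × ℝ × ℝ → ℂ) (v : ℝ × ℝ × ℝ × ℝ), ContDiff ℝ (⊤ : ℕ∞) a →
      (∀ p, fderiv ℝ a p v = 0) →
      (∫ p, η p * (a p * fderiv ℝ φ p v) = -∫ p, a p * fderiv ℝ η p v * φ p) ∧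
      Integrable (fun p => η p * (a p * fderiv ℝ φ p v)) ∧
      Integrable (fun p => a p * fderiv ℝ η p v * φ p) := by
    intro a v ha hd
    have hc : Continuous fun p => fderiv ℝ η p v :=
      (hη.continuous_fderiv (by simp)).clm_apply continuous_const
    refine ⟨?_, ?_, ?_⟩
    · have := integral_mul_fderiv_isCc (ha.mul hη) hφ v
      have e : ∀ p, fderiv ℝ (fun p => a p * η p) p v = a p * fderiv ℝ η p v := by
        intro p
        rw [fderiv_fun_mul (ha.differentiable (by simp) p) (hη.differentiable (by simp) p)]
        simp [hd]
      simp only [e] at this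
      rw [← this]
      congr 1
      funext p
      ring
    · exact (hη.continuous.mul (ha.continuous.mul
        (hφ.fderiv_apply v).continuous)).integrable_of_hasCompactSupport
        (hφ.fderiv_apply v).compact.mul_left.mul_left
    · exact ((ha.continuous.mul hc).mul hφ.continuous).integrable_of_hasCompactSupport
        hφ.compact.mul_left
  obtain ⟨k1, i1, j1⟩ := key a₁ (1, 0, 0, 0) h₁ d₁
  obtain ⟨k2, i2, j2⟩ := key a₂ (0, 1, 0, 0) h₂ d₂
  obtain ⟨k3, i3, j3⟩ := key a₃ (0, 0, 1, 0) h₃ d₃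
  obtain ⟨k4, i4, j4⟩ := key a₄ (0, 0, 0, 1) h₄ d₄
  simp only [vectorField, mul_add, add_mul]
  have A := integral_add ((i1.add i2).add i3) i4
  have A' := integral_add (i1.add i2) i3
  have B := integral_add ((j1.add j2).add j3) j4
  have B' := integral_add (j1.add j2) j3
  simp only [Pi.add_apply] at A A' B B'
  rw [A, A', integral_add i1 i2, B, B', integral_add j1 j2, k1, k2, k3, k4]
  ring

/-- Formal skew-symmetry on `ℝ⁴`; both Cauchy-Riemann operators have it in flat coordinates. -/
def IsSkew (D : (ℝ × ℝ × ℝ × ℝ → ℂ) → (ℝ × ℝ × ℝ × ℝ → ℂ)) : Prop :=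
  ∀ η φ : ℝ × ℝ × ℝ × ℝ → ℂ, ContDiff ℝ (⊤ : ℕ∞) η → IsCc φ →
    ∫ p, η p * D φ p = -∫ p, D η p * φ p

theorem isSkew_flatCR : IsSkew flatCR := by
  intro η φ hη hφ
  rw [flatCR_eq_vectorField]
  have := contDiff_ofReal
  have hs : ContDiff ℝ (⊤ : ℕ∞) fun p : ℝ × ℝ × ℝ × ℝ =>
    -Complex.I * ((p.1 : ℂ) + p.2.1 * Complex.I) := by fun_prop
  refine integral_mul_vectorField contDiff_const contDiff_const hs contDiff_const
    (by simp) (by simp) (fun p => ?_) (by simp) hη hφ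
  have h1 := (hs.differentiable (by simp) p).hasFDerivAt.hasLineDerivAt (0, 0, 1, 0)
  refine HasDerivAt.unique h1 ?_
  simpa using hasDerivAt_const (0 : ℝ) (-Complex.I * ((p.1 : ℂ) + p.2.1 * Complex.I))

theorem isSkew_flatBar : IsSkew flatBar := by
  intro η φ hη hφ
  rw [flatBar_eq_vectorField]
  exact integral_mul_vectorField contDiff_const contDiff_const contDiff_const contDiff_const
    (by simp) (by simp) (by simp) (by simp) hη hφ

theorem IsSkew.iterate {D : (ℝ × ℝ × ℝ × ℝ → ℂ) → (ℝ × ℝ × ℝ × ℝ → ℂ)} (hs : IsSkew D)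
    (hD : IsDerivation D) {η φ : ℝ × ℝ × ℝ × ℝ → ℂ} (hη : ContDiff ℝ (⊤ : ℕ∞) η) (hφ : IsCc φ)
    (n : ℕ) : ∫ p, η p * D^[n] φ p = (-1) ^ n * ∫ p, D^[n] η p * φ p := by
  induction n generalizing η with
  | zero => simp
  | succ n ih =>
    rw [Function.iterate_succ_apply', hs _ _ hη (hD.isCc_iterate hφ n).1, ih (hD.smooth _ hη),
      Function.iterate_succ_apply]
    ring

/-! ### Weak solutions in flat coordinates -/

/-- Test functions on the flat domain. -/
structure IsFlatTest (η : ℝ × ℝ × ℝ × ℝ → ℂ) : Prop extends IsCc η where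
  support : tsupport η ⊆ {p | 0 < p.2.2.2}

theorem kappa_eq (p : ℝ × ℝ × ℝ × ℝ) : kappa p = ((p.1 : ℂ) + Complex.I * p.2.1,
    (p.2.2.1 : ℂ) + Complex.I * (p.2.2.2 + (p.1 ^ 2 + p.2.1 ^ 2))) := by
  refine Prod.ext ?_ ?_
  · refine Complex.ext ?_ ?_ <;> simp [kappa, toComplex]
  · have h : (‖(toComplex p).1‖ : ℂ) ^ 2 = ((p.1 ^ 2 + p.2.1 ^ 2 : ℝ) : ℂ) := by
      rw [← Complex.ofReal_pow, Complex.sq_norm, Complex.normSq_apply]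
      simp [toComplex, sq]
    rw [kappa]
    simp only [h]
    refine Complex.ext ?_ ?_ <;> simp [toComplex, ← Complex.ofReal_pow]

theorem contDiff_kappa : ContDiff ℝ (⊤ : ℕ∞) kappa := by
  rw [show kappa = _ from funext kappa_eq]
  have := contDiff_ofReal
  fun_prop

theorem contDiff_kappaInv : ContDiff ℝ (⊤ : ℕ∞) kappaInv := by
  have h1 : ContDiff ℝ (⊤ : ℕ∞) Complex.re := Complex.reCLM.contDiff
  have h2 : ContDiff ℝ (⊤ : ℕ∞) Complex.im := Complex.imCLM.contDiff
  have h3 : ContDiff ℝ (⊤ : ℕ∞) fun ζ : ℂ × ℂ => ‖ζ.1‖ ^ 2 := contDiff_fst.norm_sq ℝ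
  unfold kappaInv
  fun_prop

/-- `κ` as a homeomorphism. -/
def kappaHomeo : (ℝ × ℝ × ℝ × ℝ) ≃ₜ (ℂ × ℂ) where
  toFun := kappa
  invFun := kappaInv
  left_inv := kappaInv_kappa
  right_inv := kappa_kappaInv
  continuous_toFun := contDiff_kappa.continuous
  continuous_invFun := contDiff_kappaInv.continuous

theorem kappa_mem_siegel (p : ℝ × ℝ × ℝ × ℝ) : kappa p ∈ siegel ↔ 0 < p.2.2.2 := by
  have h := congrArg (fun q => q.2.2.2) (kappaInv_kappa p)
  have h' : (kappa p).2.im - ‖(kappa p).1‖ ^ 2 = p.2.2.2 := h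
  rw [siegel, mem_ofPred_eq, h']

theorem IsTest.comp_kappa {φ : ℂ × ℂ → ℂ} (h : IsTest φ) : IsFlatTest (φ ∘ kappa) where
  smooth := h.smooth.comp contDiff_kappa
  compact := h.compact.comp_homeomorph kappaHomeo
  support p hp := by
    have h1 : kappa p ∈ tsupport φ := tsupport_comp_subset_preimage φ contDiff_kappa.continuous hp
    exact (kappa_mem_siegel p).1 (h.support h1)

theorem IsFlatTest.comp_kappaInv {η : ℝ × ℝ × ℝ × ℝ → ℂ} (h : IsFlatTest η) :
    IsTest (η ∘ kappaInv) where
  smooth := h.smooth.comp contDiff_kappaInv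
  compact := h.compact.comp_homeomorph kappaHomeo.symm
  support ζ hζ := by
    have h1 : kappaInv ζ ∈ tsupport η :=
      tsupport_comp_subset_preimage η contDiff_kappaInv.continuous hζ
    have h2 := (kappa_mem_siegel _).2 (h.support h1)
    rwa [kappa_kappaInv] at h2

theorem fderiv_comp_kappa {φ : ℂ × ℂ → ℂ} (h : ContDiff ℝ (⊤ : ℕ∞) φ) (p v : ℝ × ℝ × ℝ × ℝ) :
    fderiv ℝ (φ ∘ kappa) p v = fderiv ℝ φ (kappa p) ((v.1 : ℂ) + Complex.I * v.2.1,
      (v.2.2.1 : ℂ) + Complex.I * (v.2.2.2 + (2 * p.1 * v.1 + 2 * p.2.1 * v.2.1))) := by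
  have h1 := ((h.differentiable (by simp) (kappa p)).hasFDerivAt.comp p
    (contDiff_kappa.differentiable (by simp) p).hasFDerivAt).fderiv
  rw [h1, ContinuousLinearMap.comp_apply]
  congr 1
  have h2 := (contDiff_kappa.differentiable (by simp) p).hasFDerivAt.hasLineDerivAt v
  refine HasDerivAt.unique h2 ?_
  have lin : ∀ a b : ℝ, HasDerivAt (fun τ : ℝ => ((a + τ * b : ℝ) : ℂ)) b 0 := by
    intro a b
    have : HasDerivAt (fun τ : ℝ => a + τ * b) b 0 := by
      simpa using ((hasDerivAt_id (0 : ℝ)).mul_const b).const_add a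
    exact this.ofReal_comp
  simp only [kappa_eq]
  have l1 := lin p.1 v.1
  have l2 := lin p.2.1 v.2.1
  have l3 := lin p.2.2.1 v.2.2.1
  have l4 := lin p.2.2.2 v.2.2.2
  have := (l1.add (l2.const_mul Complex.I)).prodMk (l3.add ((l4.add ((l1.pow 2).add
    (l2.pow 2))).const_mul Complex.I))
  exact this.congr_deriv (by simp)

theorem tangCR_comp_kappa {φ : ℂ × ℂ → ℂ} (h : ContDiff ℝ (⊤ : ℕ∞) φ) :
    flatCR (φ ∘ kappa) = tangCR φ ∘ kappa := by
  funext p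
  have hlin : ∀ a b : ℂ, fderiv ℝ φ (kappa p) (a, b) =
      fderiv ℝ φ (kappa p) (a, 0) + fderiv ℝ φ (kappa p) (0, b) := by
    intro a b
    rw [← map_add]
    simp
  have hI : ∀ r : ℝ, fderiv ℝ φ (kappa p) (0, Complex.I * r) =
      r * fderiv ℝ φ (kappa p) (0, Complex.I) := by
    intro r
    rw [← Complex.real_smul, ← map_smul]
    congr 1
    simp [mul_comm]
  have hI1 := hI (2 * p.1)
  have hI2 := hI (2 * p.2.1)
  push_cast at hI1 hI2
  rw [flatCR, fderiv_comp_kappa h, fderiv_comp_kappa h, fderiv_comp_kappa h, Function.comp_apply,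
    tangCR, dbar1, dbar2]
  have hκ : (kappa p).1 = p.1 + Complex.I * p.2.1 := by rw [kappa_eq]
  rw [hκ]
  simp only [Complex.ofReal_one, Complex.ofReal_zero, mul_zero, mul_one, add_zero, zero_add]
  rw [hlin 1, hlin Complex.I, hI1, hI2]
  linear_combination ((p.1 + Complex.I * p.2.1) * fderiv ℝ φ (kappa p) (0, Complex.I)) *
    Complex.I_sq

theorem dbar2_comp_kappa {φ : ℂ × ℂ → ℂ} (h : ContDiff ℝ (⊤ : ℕ∞) φ) :
    flatBar (φ ∘ kappa) = dbar2 φ ∘ kappa := by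
  funext p
  rw [flatBar, fderiv_comp_kappa h, fderiv_comp_kappa h, Function.comp_apply, dbar2]
  simp

/-- `D` and `D'` correspond to each other under `κ`. -/
structure IsKappaRelated (D : (ℂ × ℂ → ℂ) → (ℂ × ℂ → ℂ))
    (D' : (ℝ × ℝ × ℝ × ℝ → ℂ) → (ℝ × ℝ × ℝ × ℝ → ℂ)) : Prop where
  test : ∀ φ, IsTest φ → IsTest (D φ)
  comp : ∀ φ, IsTest φ → D' (φ ∘ kappa) = D φ ∘ kappa

theorem isKappaRelated_tangCR : IsKappaRelated tangCR flatCR :=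
  ⟨fun _ h => h.tangCR, fun _ h => tangCR_comp_kappa h.smooth⟩

theorem isKappaRelated_dbar2 : IsKappaRelated dbar2 flatBar :=
  ⟨fun _ h => h.dbar2, fun _ h => dbar2_comp_kappa h.smooth⟩

theorem IsKappaRelated.integral_eq {D : (ℂ × ℂ → ℂ) → (ℂ × ℂ → ℂ)}
    {D' : (ℝ × ℝ × ℝ × ℝ → ℂ) → (ℝ × ℝ × ℝ × ℝ → ℂ)} (h : IsKappaRelated D D') (n : ℕ)
    (f : L2 siegelMeasure) {φ : ℂ × ℂ → ℂ} (hφ : IsTest φ) :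
    ∫ ζ in siegel, f ζ * (D^[n] φ) ζ = ∫ p, opU0 f p * D'^[n] (φ ∘ kappa) p ∂flatMeasure := by
  have e1 : ∀ n, D'^[n] (φ ∘ kappa) = D^[n] φ ∘ kappa := by
    intro n
    induction n with
    | zero => rfl
    | succ n ih =>
      rw [Function.iterate_succ_apply', ih, h.comp _ (hφ.iterate h.test n),
        Function.iterate_succ_apply']
  have hm : AEStronglyMeasurable (fun ζ => f ζ * (D^[n] φ) ζ) (flatMeasure.map kappa) := by
    rw [measurePreserving_kappa.map_eq]
    exact (Lp.memLp f).1.mul (hφ.iterate h.test n).memLp.1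
  have e2 := integral_map measurePreserving_kappa.measurable.aemeasurable hm
  rw [measurePreserving_kappa.map_eq] at e2
  rw [e2]
  refine integral_congr_ae ?_
  filter_upwards [weightedComp_coeFn (.of_measurePreserving measurePreserving_kappa) f] with p hp
  rw [opU0, hp, e1, one_mul, Function.comp_apply]

/-- Weak solutions, in flat coordinates. -/
theorem IsKappaRelated.isWeakSol_iff {D : (ℂ × ℂ → ℂ) → (ℂ × ℂ → ℂ)}
    {D' : (ℝ × ℝ × ℝ × ℝ → ℂ) → (ℝ × ℝ × ℝ × ℝ → ℂ)} (h : IsKappaRelated D D') (n : ℕ)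
    (f : L2 siegelMeasure) : IsWeakSol D n f ↔
      ∀ η, IsFlatTest η → ∫ p, opU0 f p * D'^[n] η p ∂flatMeasure = 0 := by
  refine ⟨fun hf η hη => ?_, fun hf φ hφ => ?_⟩
  · have h1 := hf _ hη.comp_kappaInv
    rw [h.integral_eq n f hη.comp_kappaInv] at h1
    rwa [show (η ∘ kappaInv) ∘ kappa = η from funext fun p => by
      simp [kappaInv_kappa]] at h1
  · rw [h.integral_eq n f hφ]
    exact hf _ hφ.comp_kappa

/-! ### Testing weak solutions against functions with compact frequency support -/

/-- `D` on the flat domain corresponds to `D'` on the Fourier side. -/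
structure IsFourierPair (ε : ℝ) (D D' : (ℝ × ℝ × ℝ × ℝ → ℂ) → (ℝ × ℝ × ℝ × ℝ → ℂ)) : Prop where
  isCc : ∀ Ξ, IsCc Ξ → IsCc (D' Ξ)
  tsupport : ∀ Ξ, IsCc Ξ → tsupport (D' Ξ) ⊆ tsupport Ξ
  comm : ∀ Ξ, IsCc Ξ → D (partFour ε Ξ) = partFour ε (D' Ξ)

theorem fderiv_apply_eq_zero_of_notMem_tsupport {η : ℝ × ℝ × ℝ × ℝ → ℂ} {p : ℝ × ℝ × ℝ × ℝ}
    (h : p ∉ tsupport η) (v : ℝ × ℝ × ℝ × ℝ) : fderiv ℝ η p v = 0 := by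
  have : fderiv ℝ η p = 0 := by
    by_contra hne
    exact h (support_fderiv_subset ℝ (f := η) hne)
  rw [this]
  rfl

theorem tsupport_subset_of_forall {η ξ : ℝ × ℝ × ℝ × ℝ → ℂ} (h : ∀ p ∉ tsupport η, ξ p = 0) :
    tsupport ξ ⊆ tsupport η :=
  closure_minimal (fun p (hp : ξ p ≠ 0) => by_contra fun hn => hp (h p hn)) (isClosed_tsupport η)

theorem isFourierPair_CR {ε : ℝ} (hε : ε * ε = 1) : IsFourierPair ε flatCR (hatCR ε) where
  isCc _ h := h.hatCR ε
  tsupport Ξ _ := tsupport_subset_of_forall fun p hp => by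
    simp [hatCR, fderiv_apply_eq_zero_of_notMem_tsupport hp, image_eq_zero_of_notMem_tsupport hp]
  comm _ h := flatCR_partFour hε h

theorem isFourierPair_Bar (ε : ℝ) : IsFourierPair ε flatBar (hatBar ε) where
  isCc _ h := h.hatBar ε
  tsupport Ξ _ := tsupport_subset_of_forall fun p hp => by
    simp [hatBar, fderiv_apply_eq_zero_of_notMem_tsupport hp, image_eq_zero_of_notMem_tsupport hp]
  comm _ h := flatBar_partFour h

theorem IsFourierPair.iterate {ε : ℝ} {D D' : (ℝ × ℝ × ℝ × ℝ → ℂ) → (ℝ × ℝ × ℝ × ℝ → ℂ)}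
    (h : IsFourierPair ε D D') {Ξ : ℝ × ℝ × ℝ × ℝ → ℂ} (hΞ : IsCc Ξ) (n : ℕ) :
    IsCc (D'^[n] Ξ) ∧ _root_.tsupport (D'^[n] Ξ) ⊆ _root_.tsupport Ξ ∧
      D^[n] (partFour ε Ξ) = partFour ε (D'^[n] Ξ) := by
  induction n with
  | zero => exact ⟨hΞ, Subset.rfl, rfl⟩
  | succ n ih =>
    simp only [Function.iterate_succ_apply']
    exact ⟨h.isCc _ ih.1, (h.tsupport _ ih.1).trans ih.2.1, by rw [ih.2.2, h.comm _ ih.1]⟩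

/-- A sequence of smooth functions that converges boundedly to the constant `c` on the slab
`|v₁| ≤ R`, with all `D`-derivatives converging boundedly to zero. -/
structure IsCutoff (D : (ℝ × ℝ × ℝ × ℝ → ℂ) → (ℝ × ℝ × ℝ × ℝ → ℂ)) (R : ℝ)
    (ω : ℕ → ℝ × ℝ × ℝ × ℝ → ℂ) (c : ℂ) : Prop where
  smooth : ∀ N, ContDiff ℝ (⊤ : ℕ∞) (ω N)
  bound : ∀ k, ∃ C, ∀ N p, |p.2.1| ≤ R → ‖D^[k] (ω N) p‖ ≤ C
  lim : ∀ p, |p.2.1| ≤ R → Filter.Tendsto (fun N => ω N p) Filter.atTop (nhds c)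
  lim_succ : ∀ k p, |p.2.1| ≤ R →
    Filter.Tendsto (fun N => D^[k + 1] (ω N) p) Filter.atTop (nhds 0)

theorem IsCutoff.shift {D : (ℝ × ℝ × ℝ × ℝ → ℂ) → (ℝ × ℝ × ℝ × ℝ → ℂ)} (hD : IsDerivation D)
    {R : ℝ} {ω : ℕ → ℝ × ℝ × ℝ × ℝ → ℂ} {c : ℂ} (h : IsCutoff D R ω c) :
    IsCutoff D R (fun N => D (ω N)) 0 where
  smooth N := hD.smooth _ (h.smooth N)
  bound k := h.bound (k + 1)
  lim p hp := h.lim_succ 0 p hp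
  lim_succ k p hp := h.lim_succ (k + 1) p hp

/-- By the Leibniz rule, in `D^m (ω_N J)` with `J = partFour ε Ξ` all terms in which a derivative
falls on the cutoff tend to zero. The others are dominated, since the functions `D^i J` are
transforms of functions with compact support, and therefore square-integrable. -/
theorem IsCutoff.tendsto_integral {ε : ℝ} (hε : ε * ε = 1)
    {D D' : (ℝ × ℝ × ℝ × ℝ → ℂ) → (ℝ × ℝ × ℝ × ℝ → ℂ)}
    (hD : IsDerivation D) (hDD : IsFourierPair ε D D') {R : ℝ} (F : L2 flatMeasure) (m : ℕ)
    {ω : ℕ → ℝ × ℝ × ℝ × ℝ → ℂ} {c : ℂ} (h : IsCutoff D R ω c) {Ξ : ℝ × ℝ × ℝ × ℝ → ℂ}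
    (hΞ : IsCc Ξ) (hs : tsupport Ξ ⊆ {q | |q.2.1| ≤ R}) :
    (∀ N, Integrable (fun p => F p * D^[m] (fun p => ω N p * partFour ε Ξ p) p) flatMeasure) ∧
    Filter.Tendsto (fun N => ∫ p, F p * D^[m] (fun p => ω N p * partFour ε Ξ p) p ∂flatMeasure)
      Filter.atTop (nhds (c * ∫ p, F p * D^[m] (partFour ε Ξ) p ∂flatMeasure)) := by
  induction m generalizing ω c Ξ with
  | zero =>
    obtain ⟨C, hC⟩ := h.bound 0
    have hJ := memLp_partFour hε hΞ
    have hint : Integrable (fun p => F p * partFour ε Ξ p) flatMeasure :=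
      (Lp.memLp F).integrable_mul hJ
    have hb : ∀ N p, ‖F p * (ω N p * partFour ε Ξ p)‖ ≤ C * ‖F p * partFour ε Ξ p‖ := by
      intro N p
      by_cases hp : |p.2.1| ≤ R
      · have h1 : ‖ω N p‖ ≤ C := hC N p hp
        rw [mul_left_comm, norm_mul]
        exact mul_le_mul_of_nonneg_right h1 (norm_nonneg _)
      · rw [partFour_eq_zero ε (p := p)]
        · simp
        · intro t
          exact image_eq_zero_of_notMem_tsupport fun hm => hp (by have h2 := hs hm; exact h2)
    have hm : ∀ N, AEStronglyMeasurable (fun p => F p * (ω N p * partFour ε Ξ p)) flatMeasure :=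
      fun N => (Lp.memLp F).1.mul ((h.smooth N).continuous.aestronglyMeasurable.mul hJ.1)
    refine ⟨fun N => (hint.norm.const_mul C).mono' (hm N) (Filter.Eventually.of_forall (hb N)), ?_⟩
    rw [← integral_const_mul]
    refine tendsto_integral_of_dominated_convergence _ hm (hint.norm.const_mul C)
      (fun N => Filter.Eventually.of_forall (hb N)) (Filter.Eventually.of_forall fun p => ?_)
    by_cases hp : |p.2.1| ≤ R
    · have := ((h.lim p hp).mul_const (F p * partFour ε Ξ p))
      refine this.congr fun N => ?_
      simp only [Function.iterate_zero, id]
      ring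
    · have h0 : partFour ε Ξ p = 0 := partFour_eq_zero ε fun t =>
        image_eq_zero_of_notMem_tsupport fun hm => hp (by have h2 := hs hm; exact h2)
      simp [h0]
  | succ m ih =>
    have hJs := contDiff_partFour ε hΞ
    have e : ∀ N, D^[m + 1] (fun p => ω N p * partFour ε Ξ p) = fun p =>
        D^[m] (fun p => ω N p * partFour ε (D' Ξ) p) p +
          D^[m] (fun p => D (ω N) p * partFour ε Ξ p) p := by
      intro N
      rw [Function.iterate_succ_apply, hD.mul _ _ (h.smooth N) hJs, hDD.comm _ hΞ]
      exact hD.add_iterate ((h.smooth N).mul (contDiff_partFour ε (hDD.isCc _ hΞ)))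
        ((hD.smooth _ (h.smooth N)).mul hJs) m
    obtain ⟨i1, t1⟩ := ih h (hDD.isCc _ hΞ) ((hDD.tsupport _ hΞ).trans hs)
    obtain ⟨i2, t2⟩ := ih (h.shift hD) hΞ hs
    simp only [e, mul_add]
    refine ⟨fun N => (i1 N).add (i2 N), ?_⟩
    rw [Function.iterate_succ_apply, hDD.comm _ hΞ]
    have := t1.add t2
    rw [zero_mul, add_zero] at this
    refine this.congr fun N => ?_
    rw [integral_add (i1 N) (i2 N)]

/-! ### The cutoff functions -/

theorem IsTest1.deriv {I : Set ℝ} {b : ℝ → ℂ} (h : IsTest1 I b) : IsTest1 I (deriv b) := by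
  refine ⟨?_, h.compact.deriv, (closure_minimal (support_deriv_subset) (isClosed_tsupport b)).trans
    h.support⟩
  exact (contDiff_infty_iff_deriv.1 h.smooth).2

theorem IsTest1.iterate_deriv {I : Set ℝ} {b : ℝ → ℂ} (h : IsTest1 I b) (n : ℕ) :
    IsTest1 I (_root_.deriv^[n] b) := by
  induction n with
  | zero => exact h
  | succ n ih => rw [Function.iterate_succ_apply']; exact ih.deriv

theorem exists_plateau (r : ℝ) (hr : 0 < r) : ∃ θ : ℝ → ℂ, IsTest1 (Icc (-(2 * r)) (2 * r)) θ ∧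
    (∀ x, |x| ≤ r → θ x = 1) ∧ ∀ x, ‖θ x‖ ≤ 1 := by
  let f : ContDiffBump (0 : ℝ) := ⟨r, 2 * r, hr, by linarith⟩
  refine ⟨fun x => (f x : ℂ), IsTest1.ofReal f.contDiff f.hasCompactSupport ?_, fun x hx => ?_,
    fun x => ?_⟩
  · rw [f.tsupport_eq, Real.closedBall_eq_Icc]
    simp [f]
  · simp only
    rw [f.one_of_mem_closedBall (by simpa using hx), Complex.ofReal_one]
  · rw [Complex.norm_real, Real.norm_of_nonneg f.nonneg]
    exact f.le_one

theorem fderiv_comp_linear {g : ℝ → ℂ} (hg : ContDiff ℝ (⊤ : ℕ∞) g)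
    (ℓ : (ℝ × ℝ × ℝ × ℝ) →L[ℝ] ℝ) (p v : ℝ × ℝ × ℝ × ℝ) :
    fderiv ℝ (fun p => g (ℓ p)) p v = (ℓ v : ℂ) * deriv g (ℓ p) := by
  have := ((hg.differentiable (by simp) (ℓ p)).hasFDerivAt.comp p ℓ.hasFDerivAt).fderiv
  rw [Function.comp_def] at this
  rw [this, ContinuousLinearMap.comp_apply, fderiv_eq_smul_deriv, Complex.real_smul]

/-- The functions `(u₁ + i v₁)^l r^(a+2b) θ⁽ᵃ⁾(r u₁) θ⁽ᵇ⁾(r² u₂)`. -/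
def cutTerm (θ : ℝ → ℂ) (r : ℝ) (a b l : ℕ) (p : ℝ × ℝ × ℝ × ℝ) : ℂ :=
  ((p.1 : ℂ) + p.2.1 * Complex.I) ^ l * ((r : ℂ) ^ (a + 2 * b) *
    (deriv^[a] θ (r * p.1) * deriv^[b] θ (r ^ 2 * p.2.2.1)))

section CutTerm

variable {θ : ℝ → ℂ} {I : Set ℝ} (hθ : IsTest1 I θ) (r : ℝ) (a b l : ℕ)

/-- The linear form `r u₁`. -/
def scale₁ (r : ℝ) : (ℝ × ℝ × ℝ × ℝ) →L[ℝ] ℝ := r • ContinuousLinearMap.fst ℝ ℝ (ℝ × ℝ × ℝ)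

/-- The linear form `r u₂`. -/
def scale₂ (r : ℝ) : (ℝ × ℝ × ℝ × ℝ) →L[ℝ] ℝ :=
  r • (ContinuousLinearMap.fst ℝ ℝ ℝ ∘L ContinuousLinearMap.snd ℝ ℝ (ℝ × ℝ) ∘L
    ContinuousLinearMap.snd ℝ ℝ (ℝ × ℝ × ℝ))

theorem contDiff_z : ContDiff ℝ (⊤ : ℕ∞) fun p : ℝ × ℝ × ℝ × ℝ =>
    (p.1 : ℂ) + p.2.1 * Complex.I := by
  have := contDiff_ofReal
  fun_prop

include hθ

theorem contDiff_cutTerm : ContDiff ℝ (⊤ : ℕ∞) (cutTerm θ r a b l) := by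
  unfold cutTerm
  have h1 := (hθ.iterate_deriv a).smooth
  have h2 := (hθ.iterate_deriv b).smooth
  have h3 := contDiff_z
  fun_prop

theorem derivation_cutTerm {D : (ℝ × ℝ × ℝ × ℝ → ℂ) → (ℝ × ℝ × ℝ × ℝ → ℂ)} (hD : IsDerivation D)
    {c₁ c₂ : ℂ} {e : ℕ}
    (hz : D (fun p => (p.1 : ℂ) + p.2.1 * Complex.I) = fun _ => 0)
    (h1 : ∀ (g : ℝ → ℂ) (r : ℝ), ContDiff ℝ (⊤ : ℕ∞) g →
      D (fun p => g (r * p.1)) = fun p => c₁ * (r * deriv g (r * p.1)))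
    (h2 : ∀ (g : ℝ → ℂ) (r : ℝ), ContDiff ℝ (⊤ : ℕ∞) g → D (fun p => g (r * p.2.2.1)) =
      fun p => c₂ * ((p.1 : ℂ) + p.2.1 * Complex.I) ^ e * (r * deriv g (r * p.2.2.1))) :
    D (cutTerm θ r a b l) = fun p => c₁ * cutTerm θ r (a + 1) b l p +
      c₂ * cutTerm θ r a (b + 1) (l + e) p := by
  have hzl : ∀ l : ℕ, D (fun p => ((p.1 : ℂ) + p.2.1 * Complex.I) ^ l) = fun _ => 0 := by
    intro l
    induction l with
    | zero =>
      have h0 := h1 (fun _ => 1) 0 contDiff_const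
      simpa using h0
    | succ l ih =>
      simp only [pow_succ]
      rw [hD.mul _ _ (contDiff_z.pow l) contDiff_z, ih, hz]
      funext p
      ring
  have s1 := (hθ.iterate_deriv a).smooth
  have s2 := (hθ.iterate_deriv b).smooth
  have t1 : ContDiff ℝ (⊤ : ℕ∞) fun p : ℝ × ℝ × ℝ × ℝ => deriv^[a] θ (r * p.1) := by fun_prop
  have t2 : ContDiff ℝ (⊤ : ℕ∞) fun p : ℝ × ℝ × ℝ × ℝ => deriv^[b] θ (r ^ 2 * p.2.2.1) := by
    fun_prop
  have hcut : cutTerm θ r a b l = fun p => (((p.1 : ℂ) + p.2.1 * Complex.I) ^ l) *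
      ((r : ℂ) ^ (a + 2 * b) * (deriv^[a] θ (r * p.1) * deriv^[b] θ (r ^ 2 * p.2.2.1))) := rfl
  rw [hcut, hD.mul _ _ (contDiff_z.pow l) (contDiff_const.mul (t1.mul t2)), hzl,
    hD.const_mul _ _ (t1.mul t2), hD.mul _ _ t1 t2, h1 _ r s1, h2 _ (r ^ 2) s2]
  funext p
  simp only [cutTerm, Function.iterate_succ_apply']
  push_cast
  ring

end CutTerm

theorem flatCR_z : flatCR (fun p => (p.1 : ℂ) + p.2.1 * Complex.I) = fun _ => 0 := by
  funext p
  have key : ∀ v : ℝ × ℝ × ℝ × ℝ, fderiv ℝ (fun p : ℝ × ℝ × ℝ × ℝ =>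
      (p.1 : ℂ) + p.2.1 * Complex.I) p v = v.1 + v.2.1 * Complex.I := by
    intro v
    have h : HasFDerivAt (fun p : ℝ × ℝ × ℝ × ℝ => (p.1 : ℂ) + p.2.1 * Complex.I)
        (Complex.ofRealCLM ∘L ContinuousLinearMap.fst ℝ ℝ (ℝ × ℝ × ℝ) +
          Complex.I • (Complex.ofRealCLM ∘L ContinuousLinearMap.fst ℝ ℝ (ℝ × ℝ) ∘L
            ContinuousLinearMap.snd ℝ ℝ (ℝ × ℝ × ℝ))) p := by
      refine (ContinuousLinearMap.hasFDerivAt _).congr_of_eventuallyEq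
        (Filter.Eventually.of_forall fun q => ?_)
      simp
      ring
    rw [h.fderiv]
    simp
    ring
  simp [flatCR, key]

theorem flatBar_z : flatBar (fun p => (p.1 : ℂ) + p.2.1 * Complex.I) = fun _ => 0 := by
  funext p
  have key : ∀ v : ℝ × ℝ × ℝ × ℝ, v.1 = 0 → v.2.1 = 0 → fderiv ℝ (fun p : ℝ × ℝ × ℝ × ℝ =>
      (p.1 : ℂ) + p.2.1 * Complex.I) p v = 0 := by
    intro v h1 h2
    have h := (contDiff_z.differentiable (by simp) p).hasFDerivAt.hasLineDerivAt v
    refine HasDerivAt.unique h ?_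
    simpa [h1, h2] using hasDerivAt_const (0 : ℝ) ((p.1 : ℂ) + p.2.1 * Complex.I)
  simp [flatBar, key]

theorem fderiv_scale₁ {g : ℝ → ℂ} (hg : ContDiff ℝ (⊤ : ℕ∞) g) (r : ℝ) (p v : ℝ × ℝ × ℝ × ℝ) :
    fderiv ℝ (fun p : ℝ × ℝ × ℝ × ℝ => g (r * p.1)) p v = r * v.1 * deriv g (r * p.1) := by
  have := fderiv_comp_linear hg (scale₁ r) p v
  simpa [scale₁] using this

theorem fderiv_scale₂ {g : ℝ → ℂ} (hg : ContDiff ℝ (⊤ : ℕ∞) g) (r : ℝ) (p v : ℝ × ℝ × ℝ × ℝ) :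
    fderiv ℝ (fun p : ℝ × ℝ × ℝ × ℝ => g (r * p.2.2.1)) p v =
      r * v.2.2.1 * deriv g (r * p.2.2.1) := by
  have := fderiv_comp_linear hg (scale₂ r) p v
  simpa [scale₂] using this

theorem flatCR_cutTerm {θ : ℝ → ℂ} {I : Set ℝ} (hθ : IsTest1 I θ) (r : ℝ) (a b l : ℕ) :
    flatCR (cutTerm θ r a b l) = fun p => (1 / 2) * cutTerm θ r (a + 1) b l p +
      (-Complex.I) * cutTerm θ r a (b + 1) (l + 1) p := by
  refine derivation_cutTerm hθ r a b l isDerivation_flatCR flatCR_z (fun g r hg => ?_)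
    fun g r hg => ?_
  · funext p
    simp [flatCR, fderiv_scale₁ hg]
  · funext p
    simp [flatCR, fderiv_scale₂ hg]

theorem flatBar_cutTerm {θ : ℝ → ℂ} {I : Set ℝ} (hθ : IsTest1 I θ) (r : ℝ) (a b l : ℕ) :
    flatBar (cutTerm θ r a b l) = fun p => 0 * cutTerm θ r (a + 1) b l p +
      (1 / 2) * cutTerm θ r a (b + 1) (l + 0) p := by
  refine derivation_cutTerm hθ r a b l isDerivation_flatBar flatBar_z (fun g r hg => ?_)
    fun g r hg => ?_
  · funext p
    simp [flatBar, fderiv_scale₁ hg]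
  · funext p
    simp [flatBar, fderiv_scale₂ hg]

theorem norm_cutTerm_le {θ : ℝ → ℂ} (hθ : IsTest1 (Icc (-2) 2) θ) (a b : ℕ) {R : ℝ} (hR : 0 ≤ R) :
    ∃ C, ∀ r, 0 < r → r ≤ 1 → ∀ l ≤ b, ∀ p : ℝ × ℝ × ℝ × ℝ, |p.2.1| ≤ R →
      ‖cutTerm θ r a b l p‖ ≤ C * r ^ (a + b) := by
  obtain ⟨A, hA⟩ := (hθ.iterate_deriv a).compact.exists_bound_of_continuous
    (hθ.iterate_deriv a).smooth.continuous
  obtain ⟨B, hB⟩ := (hθ.iterate_deriv b).compact.exists_bound_of_continuous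
    (hθ.iterate_deriv b).smooth.continuous
  have hA0 : 0 ≤ A := (norm_nonneg _).trans (hA 0)
  have hB0 : 0 ≤ B := (norm_nonneg _).trans (hB 0)
  refine ⟨(2 + R) ^ b * (A * B), fun r hr hr1 l hl p hp => ?_⟩
  by_cases hz : deriv^[a] θ (r * p.1) = 0
  · rw [cutTerm, hz, zero_mul, mul_zero, mul_zero, norm_zero]
    positivity
  · have hm := (hθ.iterate_deriv a).support (subset_tsupport _ hz)
    have hu : r * |p.1| ≤ 2 := by
      rw [← abs_of_pos hr, ← abs_mul]
      exact abs_le.2 hm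
    have hzn : r * ‖(p.1 : ℂ) + p.2.1 * Complex.I‖ ≤ 2 + R := by
      have h1 : ‖(p.1 : ℂ) + p.2.1 * Complex.I‖ ≤ |p.1| + |p.2.1| := by
        refine (norm_add_le _ _).trans ?_
        rw [norm_mul, Complex.norm_I, mul_one, Complex.norm_real, Complex.norm_real]
        rfl
      calc r * ‖(p.1 : ℂ) + p.2.1 * Complex.I‖ ≤ r * (|p.1| + |p.2.1|) := by gcongr
        _ = r * |p.1| + r * |p.2.1| := by ring
        _ ≤ 2 + 1 * R := by gcongr
        _ = 2 + R := by ring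
    rw [cutTerm, norm_mul, norm_mul, norm_mul, norm_pow, norm_pow, Complex.norm_real,
      Real.norm_of_nonneg hr.le]
    have hpow : r ^ (a + 2 * b) = r ^ l * (r ^ (b - l) * r ^ (a + b)) := by
      rw [← pow_add, ← pow_add]
      congr 1
      omega
    calc ‖(p.1 : ℂ) + p.2.1 * Complex.I‖ ^ l * (r ^ (a + 2 * b) *
          (‖deriv^[a] θ (r * p.1)‖ * ‖deriv^[b] θ (r ^ 2 * p.2.2.1)‖))
        = (r * ‖(p.1 : ℂ) + p.2.1 * Complex.I‖) ^ l * (r ^ (b - l) * r ^ (a + b)) *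
          (‖deriv^[a] θ (r * p.1)‖ * ‖deriv^[b] θ (r ^ 2 * p.2.2.1)‖) := by
          rw [hpow, mul_pow]; ring
      _ ≤ (2 + R) ^ b * (1 * r ^ (a + b)) * (A * B) := by
          have h1 : (r * ‖(p.1 : ℂ) + p.2.1 * Complex.I‖) ^ l ≤ (2 + R) ^ b :=
            (pow_le_pow_left₀ (by positivity) hzn l).trans
              (pow_le_pow_right₀ (by linarith) hl)
          have h2 : r ^ (b - l) ≤ 1 := pow_le_one₀ hr.le hr1
          gcongr
          · exact hA _
          · exact hB _
      _ = (2 + R) ^ b * (A * B) * r ^ (a + b) := by ring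

/-- The rescaled plateau functions form a cutoff sequence. Scaling `u₂` by `r²` and `u₁` by `r`
makes the unbounded coefficient `u₁ + i v₁` of `flatCR` harmless. -/
theorem isCutoff_cutTerm {θ : ℝ → ℂ} (hθ : IsTest1 (Icc (-2) 2) θ) (hθ0 : θ 0 = 1) {R : ℝ}
    (hR : 0 ≤ R) {D : (ℝ × ℝ × ℝ × ℝ → ℂ) → (ℝ × ℝ × ℝ × ℝ → ℂ)} (hD : IsDerivation D)
    {c₁ c₂ : ℂ} {e : ℕ} (he : e ≤ 1)
    (hcut : ∀ r a b l, D (cutTerm θ r a b l) = fun p => c₁ * cutTerm θ r (a + 1) b l p +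
      c₂ * cutTerm θ r a (b + 1) (l + e) p) :
    IsCutoff D R (fun N => cutTerm θ (1 / ((N : ℝ) + 1)) 0 0 0) 1 := by
  have key : ∀ k a b, ∃ C, ∀ r, 0 < r → r ≤ 1 → ∀ l ≤ b, ∀ p : ℝ × ℝ × ℝ × ℝ, |p.2.1| ≤ R →
      ‖D^[k] (cutTerm θ r a b l) p‖ ≤ C * r ^ (a + b + k) := by
    intro k
    induction k with
    | zero => intro a b; exact norm_cutTerm_le hθ a b hR
    | succ k ih =>
      intro a b
      obtain ⟨C₁, h₁⟩ := ih (a + 1) b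
      obtain ⟨C₂, h₂⟩ := ih a (b + 1)
      refine ⟨‖c₁‖ * C₁ + ‖c₂‖ * C₂, fun r hr hr1 l hl p hp => ?_⟩
      have s₁ := contDiff_cutTerm hθ r (a + 1) b l
      have s₂ := contDiff_cutTerm hθ r a (b + 1) (l + e)
      rw [Function.iterate_succ_apply, hcut, hD.add_iterate (contDiff_const.mul s₁)
        (contDiff_const.mul s₂), hD.const_mul_iterate s₁, hD.const_mul_iterate s₂]
      refine (norm_add_le _ _).trans ?_
      rw [norm_mul, norm_mul]
      have b₁ := h₁ r hr hr1 l hl p hp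
      have b₂ := h₂ r hr hr1 (l + e) (by omega) p hp
      rw [show a + 1 + b + k = a + b + (k + 1) by ring] at b₁
      rw [show a + (b + 1) + k = a + b + (k + 1) by ring] at b₂
      calc _ ≤ ‖c₁‖ * (C₁ * r ^ (a + b + (k + 1))) + ‖c₂‖ * (C₂ * r ^ (a + b + (k + 1))) := by
            gcongr
        _ = _ := by ring
  have hr0 : ∀ N : ℕ, 0 < 1 / ((N : ℝ) + 1) := fun N => by positivity
  have hr1 : ∀ N : ℕ, 1 / ((N : ℝ) + 1) ≤ 1 := fun N => by
    rw [div_le_one (by positivity)]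
    linarith [N.cast_nonneg (α := ℝ)]
  refine ⟨fun N => contDiff_cutTerm hθ _ 0 0 0, fun k => ?_, fun p _ => ?_, fun k p hp => ?_⟩
  · obtain ⟨C, hC⟩ := key k 0 0
    have hC0 : 0 ≤ C := by
      have := (norm_nonneg _).trans (hC 1 one_pos le_rfl 0 le_rfl 0 (by simpa using hR))
      simpa using this
    refine ⟨C, fun N p hp => (hC _ (hr0 N) (hr1 N) 0 le_rfl p hp).trans ?_⟩
    exact mul_le_of_le_one_right hC0 (pow_le_one₀ (hr0 N).le (hr1 N))
  · have ht := tendsto_one_div_add_atTop_nhds_zero_nat (𝕜 := ℝ)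
    have h1 : Filter.Tendsto (fun N : ℕ => θ (1 / ((N : ℝ) + 1) * p.1)) Filter.atTop (nhds 1) := by
      have := (hθ.smooth.continuous.tendsto (0 * p.1)).comp (ht.mul_const p.1)
      rwa [zero_mul, hθ0] at this
    have h2 : Filter.Tendsto (fun N : ℕ => θ ((1 / ((N : ℝ) + 1)) ^ 2 * p.2.2.1)) Filter.atTop
        (nhds 1) := by
      have := (hθ.smooth.continuous.tendsto (0 ^ 2 * p.2.2.1)).comp
        ((ht.pow 2).mul_const p.2.2.1)
      rwa [zero_pow two_ne_zero, zero_mul, hθ0] at this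
    have := h1.mul h2
    rw [mul_one] at this
    refine this.congr fun N => ?_
    simp [cutTerm]
  · obtain ⟨C, hC⟩ := key (k + 1) 0 0
    have ht := (tendsto_one_div_add_atTop_nhds_zero_nat (𝕜 := ℝ)).pow (0 + 0 + (k + 1))
    rw [zero_pow (by omega)] at ht
    have ht2 := ht.const_mul C
    rw [mul_zero] at ht2
    exact squeeze_zero_norm (fun N => hC _ (hr0 N) (hr1 N) 0 le_rfl p hp) ht2

theorem isFlatTest_cutTerm_mul {θ : ℝ → ℂ} (hθ : IsTest1 (Icc (-2) 2) θ) {r : ℝ} (hr : 0 < r)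
    (ε : ℝ) {Ξ : ℝ × ℝ × ℝ × ℝ → ℂ} (hΞ : IsCc Ξ) (hs : tsupport Ξ ⊆ {q | 0 < q.2.2.2}) :
    IsFlatTest fun p => cutTerm θ r 0 0 0 p * partFour ε Ξ p := by
  set S : Set (ℝ × ℝ) := (fun q => (q.2.1, q.2.2.2)) '' tsupport Ξ with hS
  have hSc : IsCompact S := hΞ.compact.isCompact.image (by fun_prop)
  set K : Set (ℝ × ℝ × ℝ × ℝ) := (fun x : (ℝ × ℝ) × (ℝ × ℝ) => (x.1.1, x.2.1, x.1.2, x.2.2)) ''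
    ((Icc (-(2 / r)) (2 / r) ×ˢ Icc (-(2 / r ^ 2)) (2 / r ^ 2)) ×ˢ S) with hK
  have hKc : IsCompact K := ((isCompact_Icc.prod isCompact_Icc).prod hSc).image (by fun_prop)
  have h0 : ∀ p ∉ K, cutTerm θ r 0 0 0 p * partFour ε Ξ p = 0 := by
    intro p hp
    have aux : ∀ r x : ℝ, 0 < r → r * x ∈ Icc (-2 : ℝ) 2 → x ∈ Icc (-(2 / r)) (2 / r) := by
      intro r x hr hx
      have h1 : -(2 / r) = -2 / r := by ring
      rw [h1]
      exact ⟨(div_le_iff₀' hr).2 hx.1, (le_div_iff₀' hr).2 hx.2⟩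
    by_cases h1 : r * p.1 ∈ Icc (-2 : ℝ) 2
    · by_cases h2 : r ^ 2 * p.2.2.1 ∈ Icc (-2 : ℝ) 2
      · rw [partFour_eq_zero ε, mul_zero]
        intro t
        by_contra hne
        exact hp ⟨((p.1, p.2.2.1), (p.2.1, p.2.2.2)), ⟨⟨aux r _ hr h1, aux _ _ (by positivity) h2⟩,
          _, subset_tsupport _ hne, rfl⟩, rfl⟩
      · have : θ (r ^ 2 * p.2.2.1) = 0 := image_eq_zero_of_notMem_tsupport fun hm =>
          h2 (hθ.support hm)
        simp [cutTerm, this]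
    · have : θ (r * p.1) = 0 := image_eq_zero_of_notMem_tsupport fun hm => h1 (hθ.support hm)
      simp [cutTerm, this]
  refine ⟨⟨(contDiff_cutTerm hθ r 0 0 0).mul (contDiff_partFour ε hΞ),
    HasCompactSupport.intro hKc h0⟩, ?_⟩
  refine (closure_minimal (fun p (hp : _ ≠ _) => by_contra fun hn => hp (h0 p hn)) hKc.isClosed).trans ?_
  rintro _ ⟨x, ⟨-, q, hq, hqx⟩, rfl⟩
  have : x.2.2 = q.2.2.2 := by rw [← hqx]
  rw [mem_ofPred_eq]
  simp only [this]
  exact hs hq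

/-- A weak solution, transported by `U₁ U₀`, annihilates the image of `D'^n` on the Fourier side. -/
theorem integral_hat_eq_zero {D D' : (ℝ × ℝ × ℝ × ℝ → ℂ) → (ℝ × ℝ × ℝ × ℝ → ℂ)}
    (hD : IsDerivation D) (hDD : IsFourierPair (-1) D D')
    (hcut : ∃ (c₁ c₂ : ℂ) (e : ℕ), e ≤ 1 ∧ ∀ (θ : ℝ → ℂ), IsTest1 (Icc (-2) 2) θ → ∀ r a b l,
      D (cutTerm θ r a b l) = fun p => c₁ * cutTerm θ r (a + 1) b l p +
        c₂ * cutTerm θ r a (b + 1) (l + e) p) {F : L2 flatMeasure} {n : ℕ}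
    (hF : ∀ η, IsFlatTest η → ∫ p, F p * D^[n] η p ∂flatMeasure = 0) {Ξ : ℝ × ℝ × ℝ × ℝ → ℂ}
    (hΞ : IsCc Ξ) (hs : tsupport Ξ ⊆ {q | 0 < q.2.2.2}) :
    ∫ p, opU1 F p * D'^[n] Ξ p ∂flatMeasure = 0 := by
  obtain ⟨c₁, c₂, e, he, hcut⟩ := hcut
  obtain ⟨θ, hθ, hθ1, -⟩ := exists_plateau 1 one_pos
  rw [mul_one] at hθ
  obtain ⟨R, hR⟩ := hΞ.compact.isCompact.isBounded.subset_closedBall 0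
  have hslab : tsupport Ξ ⊆ {q | |q.2.1| ≤ |R|} := by
    intro q hq
    have := hR hq
    rw [mem_closedBall_zero_iff] at this
    have h1 : |q.2.1| ≤ ‖q‖ := (norm_fst_le q.2).trans (norm_snd_le q)
    exact h1.trans (this.trans (le_abs_self R))
  have hω := isCutoff_cutTerm hθ (hθ1 0 (by simp)) (abs_nonneg R) hD he (hcut θ hθ)
  have hlim := (hω.tendsto_integral (ε := -1) (by norm_num) hD hDD F n hΞ hslab).2
  have hzero : ∀ N : ℕ, ∫ p, F p * D^[n] (fun p => cutTerm θ (1 / ((N : ℝ) + 1)) 0 0 0 p *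
      partFour (-1) Ξ p) p ∂flatMeasure = 0 := fun N =>
    hF _ (isFlatTest_cutTerm_mul hθ (by positivity) (-1) hΞ hs)
  simp only [hzero] at hlim
  have h0 := tendsto_nhds_unique hlim tendsto_const_nhds
  rw [one_mul] at h0
  obtain ⟨i1, -, i3⟩ := hDD.iterate hΞ n
  rw [← integral_mul_partFour i1, ← i3, h0]

theorem integral_hatCR_eq_zero {f : L2 siegelMeasure} {n : ℕ} (hf : IsWeakSol tangCR n f)
    {Ξ : ℝ × ℝ × ℝ × ℝ → ℂ} (hΞ : IsCc Ξ) (hs : tsupport Ξ ⊆ {q | 0 < q.2.2.2}) :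
    ∫ p, opU1 (opU0 f) p * (hatCR (-1))^[n] Ξ p ∂flatMeasure = 0 :=
  integral_hat_eq_zero isDerivation_flatCR (isFourierPair_CR (by norm_num))
    ⟨_, _, 1, le_rfl, fun _ hθ => flatCR_cutTerm hθ⟩
    ((isKappaRelated_tangCR.isWeakSol_iff n f).1 hf) hΞ hs

theorem integral_hatBar_eq_zero {f : L2 siegelMeasure} {n : ℕ} (hf : IsWeakSol dbar2 n f)
    {Ξ : ℝ × ℝ × ℝ × ℝ → ℂ} (hΞ : IsCc Ξ) (hs : tsupport Ξ ⊆ {q | 0 < q.2.2.2}) :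
    ∫ p, opU1 (opU0 f) p * (hatBar (-1))^[n] Ξ p ∂flatMeasure = 0 :=
  integral_hat_eq_zero isDerivation_flatBar (isFourierPair_Bar _)
    ⟨_, _, 0, zero_le_one, fun _ hθ => flatBar_cutTerm hθ⟩
    ((isKappaRelated_dbar2.isWeakSol_iff n f).1 hf) hΞ hs

/-! ### Products of test functions in the coordinates adapted to the operators -/

theorem IsTest1.mul_of_ne_zero {I : Set ℝ} (h0 : (0 : ℝ) ∉ I) {c : ℝ → ℂ} (hc : IsTest1 I c)
    {m : ℝ → ℂ} (hm : ∀ x ≠ 0, ContDiffAt ℝ (⊤ : ℕ∞) m x) : IsTest1 I fun x => m x * c x := by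
  refine ⟨?_, hc.compact.mul_left,
    (closure_mono (Function.support_mul_subset_right m c)).trans hc.support⟩
  rw [contDiff_iff_contDiffAt]
  intro x
  by_cases hx : x ∈ tsupport c
  · refine (hm x ?_).mul hc.smooth.contDiffAt
    rintro rfl
    exact h0 (hc.support hx)
  · have : (fun x => m x * c x) =ᶠ[nhds x] fun _ => 0 := by
      filter_upwards [(isClosed_tsupport c).isOpen_compl.mem_nhds hx] with y hy
      rw [image_eq_zero_of_notMem_tsupport hy, mul_zero]
    exact contDiffAt_const.congr_of_eventuallyEq this

theorem IsTest1.mul_left {I : Set ℝ} {b : ℝ → ℂ} (h : IsTest1 I b) {m : ℝ → ℂ}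
    (hm : ContDiff ℝ (⊤ : ℕ∞) m) : IsTest1 I fun y => m y * b y :=
  ⟨hm.mul h.smooth, h.compact.mul_left,
    (closure_mono (Function.support_mul_subset_right m b)).trans h.support⟩

theorem IsTest1.add {I : Set ℝ} {b b' : ℝ → ℂ} (h : IsTest1 I b) (h' : IsTest1 I b') :
    IsTest1 I fun y => b y + b' y :=
  ⟨h.smooth.add h'.smooth, h.compact.add h'.compact,
    (tsupport_add b b').trans (union_subset h.support h'.support)⟩

theorem contDiffAt_sqrt_abs {x : ℝ} (hx : x ≠ 0) : ContDiffAt ℝ (⊤ : ℕ∞) (fun x : ℝ => √|x|) x :=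
  (contDiffAt_abs hx).sqrt (abs_ne_zero.2 hx)

theorem contDiffAt_I_sqrt {x : ℝ} (hx : x ≠ 0) :
    ContDiffAt ℝ (⊤ : ℕ∞) (fun x : ℝ => Complex.I * (√|x| : ℝ)) x :=
  contDiffAt_const.mul (contDiff_ofReal.contDiffAt.comp x (contDiffAt_sqrt_abs hx))

theorem contDiffAt_I_abs {x : ℝ} (hx : x ≠ 0) :
    ContDiffAt ℝ (⊤ : ℕ∞) (fun x : ℝ => Complex.I * (|x| : ℝ)) x :=
  contDiffAt_const.mul (contDiff_ofReal.contDiffAt.comp x (contDiffAt_abs hx))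

/-- The first-order operator `b ↦ b' + μ b`. -/
def gaugeDeriv (μ : ℝ → ℝ) (b : ℝ → ℂ) (y : ℝ) : ℂ := deriv b y + μ y * b y

theorem IsTest1.gaugeDeriv {I : Set ℝ} {b : ℝ → ℂ} (h : IsTest1 I b) {μ : ℝ → ℝ}
    (hμ : ContDiff ℝ (⊤ : ℕ∞) μ) : IsTest1 I (gaugeDeriv μ b) :=
  h.deriv.add (h.mul_left (contDiff_ofReal.comp hμ))

theorem IsTest1.iterate_gaugeDeriv {I : Set ℝ} {b : ℝ → ℂ} (h : IsTest1 I b) {μ : ℝ → ℝ}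
    (hμ : ContDiff ℝ (⊤ : ℕ∞) μ) (n : ℕ) : IsTest1 I ((SiegelToeplitz.gaugeDeriv μ)^[n] b) := by
  induction n with
  | zero => exact h
  | succ n ih => rw [Function.iterate_succ_apply']; exact ih.gaugeDeriv hμ

/-- The product `a(x₁) b(y₁) c(x₂) d(y₂)`, as a function of the Fourier side variables
`(t₁, s₁, t₂, s₂) = ψ₁(ψ₂(x₁, y₁, x₂, y₂))`. -/
def chartFun (a b c d : ℝ → ℂ) (q : ℝ × ℝ × ℝ × ℝ) : ℂ :=
  a (q.1 / (2 * √|q.2.2.1|) - √|q.2.2.1| * q.2.1) *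
    (b (q.1 / (2 * √|q.2.2.1|) + √|q.2.2.1| * q.2.1) *
      (c q.2.2.1 * d (2 * |q.2.2.1| * q.2.2.2)))

theorem chartFun_psi (a b c d : ℝ → ℂ) {p : ℝ × ℝ × ℝ × ℝ} (hp : p.2.2.1 ≠ 0) :
    chartFun a b c d (psi1 (psi2 p)) = a p.1 * (b p.2.1 * (c p.2.2.1 * d p.2.2.2)) := by
  have h1 : 0 < √|p.2.2.1| := Real.sqrt_pos.2 (abs_pos.2 hp)
  have h2 : 0 < |p.2.2.1| := abs_pos.2 hp
  simp only [chartFun, psi1, psi2]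
  congr 2
  · field_simp
    ring
  · congr 1
    field_simp
    ring
  · congr 2
    field_simp

/-- The coordinates used in `chartFun` form a right inverse of `ψ₁ ∘ ψ₂`. -/
theorem psi1_psi2_chart {q : ℝ × ℝ × ℝ × ℝ} (hq : q.2.2.1 ≠ 0) :
    psi1 (psi2 (q.1 / (2 * √|q.2.2.1|) - √|q.2.2.1| * q.2.1,
      q.1 / (2 * √|q.2.2.1|) + √|q.2.2.1| * q.2.1, q.2.2.1, 2 * |q.2.2.1| * q.2.2.2)) = q := by
  have h1 : 0 < √|q.2.2.1| := Real.sqrt_pos.2 (abs_pos.2 hq)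
  have h2 : 0 < |q.2.2.1| := abs_pos.2 hq
  obtain ⟨q1, q2, q3, q4⟩ := q
  simp only [psi1, psi2, Prod.mk.injEq, true_and] at *
  refine ⟨?_, ?_, ?_⟩
  · field_simp
    ring
  · field_simp
    ring
  · field_simp

/-- The factors of a product of test functions in the adapted coordinates. In the applications, the
set `I` that contains the support of the function of `x₂` is a half-line without `0`, where the
coordinate change is smooth. -/
structure IsChartData (I J : Set ℝ) (a b c d : ℝ → ℂ) : Prop where
  a : IsTest1 univ a
  b : IsTest1 univ b
  c : IsTest1 I c
  d : IsTest1 J d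

variable {I J : Set ℝ} {a b c d : ℝ → ℂ}

/-- A compact set that carries `chartFun a b c d`. -/
def chartSupport (a b c d : ℝ → ℂ) : Set (ℝ × ℝ × ℝ × ℝ) :=
  (fun p => psi1 (psi2 p)) '' (tsupport a ×ˢ (tsupport b ×ˢ (tsupport c ×ˢ tsupport d)))

theorem IsChartData.isCompact_chartSupport (h : IsChartData I J a b c d) (h0 : (0 : ℝ) ∉ I) :
    IsCompact (chartSupport a b c d) := by
  refine (h.a.compact.isCompact.prod (h.b.compact.isCompact.prod
    (h.c.compact.isCompact.prod h.d.compact.isCompact))).image_of_continuousOn ?_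
  have hne : ∀ p ∈ tsupport a ×ˢ (tsupport b ×ˢ (tsupport c ×ˢ tsupport d)), p.2.2.1 ≠ 0 := by
    rintro p ⟨-, -, hp, -⟩ h00
    exact h0 (h00 ▸ h.c.support hp)
  have e : (fun p => psi1 (psi2 p)) = fun p : ℝ × ℝ × ℝ × ℝ => (√|p.2.2.1| * (p.1 + p.2.1),
    1 / (2 * √|p.2.2.1|) * (-p.1 + p.2.1), p.2.2.1, p.2.2.2 / (2 * |p.2.2.1|)) := rfl
  rw [e]
  refine ContinuousOn.prodMk (by fun_prop) (ContinuousOn.prodMk ?_ (ContinuousOn.prodMk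
    (by fun_prop) ?_))
  · refine ContinuousOn.mul (ContinuousOn.div (by fun_prop) (by fun_prop) fun p hp => ?_)
      (by fun_prop)
    have := Real.sqrt_pos.2 (abs_pos.2 (hne p hp))
    positivity
  · refine ContinuousOn.div (by fun_prop) (by fun_prop) fun p hp => ?_
    have := abs_pos.2 (hne p hp)
    positivity

theorem IsChartData.eq_zero_of_notMem (h : IsChartData I J a b c d) (h0 : (0 : ℝ) ∉ I)
    {q : ℝ × ℝ × ℝ × ℝ} (hq : q ∉ chartSupport a b c d) : chartFun a b c d q = 0 := by
  by_contra hne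
  simp only [chartFun, mul_eq_zero, not_or] at hne
  have h3 := subset_tsupport c hne.2.2.1
  have hq0 : q.2.2.1 ≠ 0 := fun h00 => h0 (h00 ▸ h.c.support h3)
  exact hq ⟨(_, _, _, 2 * |q.2.2.1| * q.2.2.2), ⟨subset_tsupport a hne.1, subset_tsupport b hne.2.1, h3,
    subset_tsupport d hne.2.2.2⟩, psi1_psi2_chart hq0⟩

theorem IsChartData.isCc (h : IsChartData I J a b c d) (h0 : (0 : ℝ) ∉ I) :
    IsCc (chartFun a b c d) := by
  refine ⟨?_, HasCompactSupport.intro (h.isCompact_chartSupport h0) fun q hq =>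
    h.eq_zero_of_notMem h0 hq⟩
  rw [contDiff_iff_contDiffAt]
  intro q
  by_cases hq : q.2.2.1 ∈ tsupport c
  · have hq0 : q.2.2.1 ≠ 0 := fun h00 => h0 (h00 ▸ h.c.support hq)
    have hs : ContDiffAt ℝ (⊤ : ℕ∞) (fun q : ℝ × ℝ × ℝ × ℝ => √|q.2.2.1|) q :=
      ContDiffAt.comp (g := fun x : ℝ => √|x|) (f := fun q : ℝ × ℝ × ℝ × ℝ => q.2.2.1) q
        (contDiffAt_sqrt_abs hq0) (by fun_prop)
    have hab : ContDiffAt ℝ (⊤ : ℕ∞) (fun q : ℝ × ℝ × ℝ × ℝ => |q.2.2.1|) q :=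
      ContDiffAt.comp (f := fun q : ℝ × ℝ × ℝ × ℝ => q.2.2.1) q (contDiffAt_abs hq0) (by fun_prop)
    have hpos := Real.sqrt_pos.2 (abs_pos.2 hq0)
    have hdiv : ContDiffAt ℝ (⊤ : ℕ∞) (fun q : ℝ × ℝ × ℝ × ℝ => q.1 / (2 * √|q.2.2.1|)) q :=
      ContDiffAt.div (by fun_prop) (contDiffAt_const.mul hs) (by positivity)
    have hm : ContDiffAt ℝ (⊤ : ℕ∞) (fun q : ℝ × ℝ × ℝ × ℝ => √|q.2.2.1| * q.2.1) q :=
      hs.mul (by fun_prop)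
    exact (h.a.smooth.contDiffAt.comp q (hdiv.sub hm)).mul
      ((h.b.smooth.contDiffAt.comp q (hdiv.add hm)).mul
        ((h.c.smooth.contDiffAt.comp q (by fun_prop)).mul
          (h.d.smooth.contDiffAt.comp q ((contDiffAt_const.mul hab).mul (by fun_prop)))))
  · have : chartFun a b c d =ᶠ[nhds q] fun _ => 0 := by
      have hn : ∀ᶠ q' : ℝ × ℝ × ℝ × ℝ in nhds q, q'.2.2.1 ∈ (tsupport c)ᶜ :=
        (by fun_prop : Continuous fun q' : ℝ × ℝ × ℝ × ℝ => q'.2.2.1).continuousAt.eventually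
          ((isClosed_tsupport c).isOpen_compl.mem_nhds hq)
      filter_upwards [hn] with y hy
      simp [chartFun, image_eq_zero_of_notMem_tsupport hy]
    exact contDiffAt_const.congr_of_eventuallyEq this

theorem IsChartData.tsupport_subset (h : IsChartData I (Ioi 0) a b c d) (h0 : (0 : ℝ) ∉ I) :
    tsupport (chartFun a b c d) ⊆ {q | 0 < q.2.2.2} := by
  refine (closure_minimal (fun q (hq : _ ≠ _) => by_contra fun hn =>
    hq (h.eq_zero_of_notMem h0 hn)) (h.isCompact_chartSupport h0).isClosed).trans ?_
  rintro _ ⟨p, ⟨-, -, hp3, hp4⟩, rfl⟩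
  have h3 : p.2.2.1 ≠ 0 := fun h00 => h0 (h00 ▸ h.c.support hp3)
  have h4 : 0 < p.2.2.2 := h.d.support hp4
  have := abs_pos.2 h3
  change 0 < p.2.2.2 / (2 * |p.2.2.1|)
  positivity

theorem IsChartData.fderiv_eq (h : IsChartData I J a b c d) (h0 : (0 : ℝ) ∉ I)
    (q v : ℝ × ℝ × ℝ × ℝ) (hv : v.2.2.1 = 0) : fderiv ℝ (chartFun a b c d) q v =
      (v.1 / (2 * √|q.2.2.1|) - √|q.2.2.1| * v.2.1 : ℝ) * chartFun (deriv a) b c d q +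
      (v.1 / (2 * √|q.2.2.1|) + √|q.2.2.1| * v.2.1 : ℝ) * chartFun a (deriv b) c d q +
      (2 * |q.2.2.1| * v.2.2.2 : ℝ) * chartFun a b c (deriv d) q := by
  have hl := ((h.isCc h0).smooth.differentiable (by simp) q).hasFDerivAt.hasLineDerivAt v
  refine HasDerivAt.unique hl ?_
  set r := √|q.2.2.1|
  set t := |q.2.2.1|
  have key : ∀ {g : ℝ → ℂ}, ContDiff ℝ (⊤ : ℕ∞) g → ∀ u w : ℝ,
      HasDerivAt (fun x : ℝ => g (u + x * w)) ((w : ℂ) * deriv g u) 0 := by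
    intro g hg u w
    have h1 : HasDerivAt (fun x : ℝ => u + x * w) w 0 := by
      simpa using ((hasDerivAt_id (0 : ℝ)).mul_const w).const_add u
    have h2 : HasDerivAt g (deriv g u) (u + 0 * w) := by
      rw [zero_mul, add_zero]
      exact (hg.differentiable (by simp) u).hasDerivAt
    have := h2.scomp (0 : ℝ) h1
    simpa [Function.comp_def] using this
  have ha := key h.a.smooth (q.1 / (2 * r) - r * q.2.1) (v.1 / (2 * r) - r * v.2.1)
  have hb := key h.b.smooth (q.1 / (2 * r) + r * q.2.1) (v.1 / (2 * r) + r * v.2.1)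
  have hd := key h.d.smooth (2 * t * q.2.2.2) (2 * t * v.2.2.2)
  have := ha.mul (hb.mul (hd.const_mul (c q.2.2.1)))
  refine (this.congr_of_eventuallyEq (Filter.Eventually.of_forall fun x => ?_)).congr_deriv ?_
  · simp only [chartFun, Prod.fst_add, Prod.snd_add, Prod.smul_fst, Prod.smul_snd, hv, smul_eq_mul,
      mul_zero, add_zero, Pi.mul_apply]
    congr 2
    · ring
    · congr 1
      ring
    · congr 2
      ring
  · simp only [chartFun, zero_mul, add_zero, Pi.mul_apply]
    ring

/-- In the adapted coordinates, and for `x₂ > 0`, the operator on the Fourier side is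
`i √x₂ (∂/∂y₁ + ε y₁)`. -/
theorem IsChartData.hatCR_eq (h : IsChartData (Ioi 0) J a b c d) (ε : ℝ) :
    hatCR ε (chartFun a b c d) = chartFun a (gaugeDeriv (fun y => ε * y) b)
      (fun x => (Complex.I * (√|x| : ℝ)) * c x) d := by
  funext q
  have h0 : (0 : ℝ) ∉ Ioi (0 : ℝ) := by simp
  by_cases hq : q.2.2.1 ∈ tsupport c
  · have hpos : 0 < q.2.2.1 := h.c.support hq
    rw [hatCR, h.fderiv_eq h0 _ _ rfl, h.fderiv_eq h0 _ _ rfl]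
    simp only [chartFun, gaugeDeriv]
    set r := √|q.2.2.1| with hr
    have hr0 : 0 < r := Real.sqrt_pos.2 (abs_pos.2 hpos.ne')
    have hr2 : q.2.2.1 = r ^ 2 := by rw [hr, Real.sq_sqrt (abs_nonneg _), abs_of_pos hpos]
    have hrC : (r : ℂ) ≠ 0 := by exact_mod_cast hr0.ne'
    have hr2' : (q.2.2.1 : ℂ) = r ^ 2 := by exact_mod_cast hr2
    push_cast
    rw [hr2']
    field_simp
    ring
  · have hz := image_eq_zero_of_notMem_tsupport hq
    rw [hatCR, h.fderiv_eq h0 _ _ rfl, h.fderiv_eq h0 _ _ rfl]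
    simp [chartFun, hz]

/-- In the adapted coordinates, and for `x₂` of sign `σ`, the operator on the Fourier side is
`i |x₂| (∂/∂y₂ + ε σ / 2)`. -/
theorem IsChartData.hatBar_eq (h : IsChartData I J a b c d) (h0 : (0 : ℝ) ∉ I) {σ : ℝ}
    (hσ : ∀ x ∈ I, x = σ * |x|) (ε : ℝ) :
    hatBar ε (chartFun a b c d) = chartFun a b (fun x => (Complex.I * (|x| : ℝ)) * c x)
      (gaugeDeriv (fun _ => ε * σ / 2) d) := by
  funext q
  by_cases hq : q.2.2.1 ∈ tsupport c
  · have hq' : (q.2.2.1 : ℂ) = σ * (|q.2.2.1| : ℝ) := by exact_mod_cast hσ _ (h.c.support hq)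
    rw [hatBar, h.fderiv_eq h0 _ _ rfl]
    simp only [chartFun, gaugeDeriv]
    push_cast
    generalize c q.2.2.1 = cc
    rw [hq']
    ring
  · have hz := image_eq_zero_of_notMem_tsupport hq
    rw [hatBar, h.fderiv_eq h0 _ _ rfl]
    simp [chartFun, hz]

theorem IsTest1.mul_sqrt {c : ℝ → ℂ} {I : Set ℝ} (h0 : (0 : ℝ) ∉ I) (hc : IsTest1 I c) :
    IsTest1 I fun x => (Complex.I * (√|x| : ℝ)) * c x :=
  hc.mul_of_ne_zero h0 fun _ hx => contDiffAt_I_sqrt hx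

theorem IsTest1.mul_abs {c : ℝ → ℂ} {I : Set ℝ} (h0 : (0 : ℝ) ∉ I) (hc : IsTest1 I c) :
    IsTest1 I fun x => (Complex.I * (|x| : ℝ)) * c x :=
  hc.mul_of_ne_zero h0 fun _ hx => contDiffAt_I_abs hx

theorem IsChartData.iterate_hatCR (h : IsChartData (Ioi 0) J a b c d) (ε : ℝ) (n : ℕ) :
    (hatCR ε)^[n] (chartFun a b c d) = chartFun a ((gaugeDeriv fun y => ε * y)^[n] b)
      (fun x => (Complex.I * (√|x| : ℝ)) ^ n * c x) d := by
  induction n generalizing b c with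
  | zero => simp
  | succ n ih =>
    rw [Function.iterate_succ_apply, h.hatCR_eq,
      ih ⟨h.a, h.b.gaugeDeriv (by fun_prop), h.c.mul_sqrt (by simp), h.d⟩,
      Function.iterate_succ_apply]
    congr 1
    funext x
    ring

theorem IsChartData.iterate_hatBar (h : IsChartData I J a b c d) (h0 : (0 : ℝ) ∉ I) {σ : ℝ}
    (hσ : ∀ x ∈ I, x = σ * |x|) (ε : ℝ) (n : ℕ) :
    (hatBar ε)^[n] (chartFun a b c d) = chartFun a b (fun x => (Complex.I * (|x| : ℝ)) ^ n * c x)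
      ((gaugeDeriv fun _ => ε * σ / 2)^[n] d) := by
  induction n generalizing c d with
  | zero => simp
  | succ n ih =>
    rw [Function.iterate_succ_apply, h.hatBar_eq h0 hσ,
      ih ⟨h.a, h.b, h.c.mul_abs h0, h.d.gaugeDeriv contDiff_const⟩,
      Function.iterate_succ_apply]
    congr 1
    funext x
    ring

/-! ### Transport through `V₂ V₁` -/

theorem opV_toLp {Ξ : ℝ × ℝ × ℝ × ℝ → ℂ} (h : MemLp Ξ 2 flatMeasure) :
    opV2 (opV1 h.toLp) =ᵐ[flatMeasure] fun p => weight1 (psi2 p) * Ξ (psi1 (psi2 p)) := by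
  have q2 := measurePreserving_psi2.quasiMeasurePreserving
  filter_upwards [weightedComp_coeFn (.of_measurePreserving measurePreserving_psi2) (opV1 h.toLp),
    q2.ae (weightedComp_coeFn isWeightedPullback_psi1 h.toLp),
    q2.ae (isWeightedPullback_psi1.quasi.ae h.coeFn_toLp)] with p h1 h2 h3
  rw [← h3, ← h2, opV2, h1, one_mul]
  rfl

theorem integral_opV (G : L2 flatMeasure) {Ξ : ℝ × ℝ × ℝ × ℝ → ℂ} (h : MemLp Ξ 2 flatMeasure) :
    ∫ p, G p * Ξ p ∂flatMeasure =
      ∫ p, opV2 (opV1 G) p * (weight1 (psi2 p) * Ξ (psi1 (psi2 p))) ∂flatMeasure := by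
  rw [← star_toLp_inner h, ← opV1.inner_map_map, ← opV2.inner_map_map, L2.inner_def]
  refine integral_congr_ae ?_
  filter_upwards [opV_toLp h.star] with p hp
  rw [hp, RCLike.inner_apply]
  simp [weight1]

/-- The factor `(2|x₂|)^{-1/2}` that `V₁` contributes. -/
def sideWeight (x : ℝ) : ℂ := (1 / (2 * |x|) ^ (1 / 2 : ℝ) : ℝ)

theorem sideWeight_ne_zero {x : ℝ} (hx : x ≠ 0) : sideWeight x ≠ 0 := by
  have := abs_pos.2 hx
  have : 0 < 1 / (2 * |x|) ^ (1 / 2 : ℝ) := by positivity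
  exact Complex.ofReal_ne_zero.2 this.ne'

theorem contDiffAt_sideWeight {x : ℝ} (hx : x ≠ 0) : ContDiffAt ℝ (⊤ : ℕ∞) sideWeight x := by
  have := abs_pos.2 hx
  refine contDiff_ofReal.contDiffAt.comp x (contDiffAt_const.div ?_ (by positivity))
  exact (contDiffAt_const.mul (contDiffAt_abs hx)).rpow_const_of_ne (by positivity)

theorem integral_chartFun (h : IsChartData I J a b c d) (h0 : (0 : ℝ) ∉ I) (G : L2 flatMeasure) :
    ∫ p, G p * chartFun a b c d p ∂flatMeasure = ∫ p, opV2 (opV1 G) p *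
      (a p.1 * (b p.2.1 * ((sideWeight p.2.2.1 * c p.2.2.1) * d p.2.2.2))) ∂flatMeasure := by
  rw [integral_opV G (h.isCc h0).memLp]
  refine integral_congr_ae ?_
  filter_upwards [ae_flat_x2_ne_zero] with p hp
  rw [chartFun_psi _ _ _ _ hp]
  have : weight1 (psi2 p) = sideWeight p.2.2.1 := rfl
  rw [this]
  ring

/-! ### Weak solutions in the coordinates of `U` -/

/-- Division by a function of `x₂` without zeros on `x₂ ≠ 0` stays within the test functions of
`x₂`; this removes the factors that `V₁` and the operators produce. -/
theorem IsTest1.div_of_ne_zero {I : Set ℝ} (h0 : (0 : ℝ) ∉ I) {c : ℝ → ℂ} (hc : IsTest1 I c)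
    {m : ℝ → ℂ} (hm : ∀ x ≠ 0, ContDiffAt ℝ (⊤ : ℕ∞) m x) (hm0 : ∀ x ≠ 0, m x ≠ 0) :
    IsTest1 I (fun x => (m x)⁻¹ * c x) ∧ ∀ x, m x * ((m x)⁻¹ * c x) = c x := by
  refine ⟨hc.mul_of_ne_zero h0 fun x hx => (hm x hx).inv (hm0 x hx), fun x => ?_⟩
  by_cases hx : x = 0
  · have : c x = 0 := image_eq_zero_of_notMem_tsupport fun h => h0 (hx ▸ hc.support h)
    simp [this]
  · rw [mul_inv_cancel_left₀ (hm0 x hx)]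

/-- The first equation for `f` is, for `U f` on `x₂ > 0`, an ordinary differential equation in `y₁`.
-/
theorem integral_opU_gaugeDeriv_fst {f : L2 siegelMeasure} {n : ℕ} (hf : IsWeakSol tangCR n f)
    (h : IsChartData (Ioi 0) (Ioi 0) a b c d) :
    ∫ p, opU f p * (a p.1 * ((gaugeDeriv fun y => -y)^[n] b p.2.1 * (c p.2.2.1 * d p.2.2.2)))
      ∂flatMeasure = 0 := by
  have h0 : (0 : ℝ) ∉ Ioi (0 : ℝ) := by simp
  obtain ⟨hc', hcc⟩ := h.c.div_of_ne_zero h0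
    (m := fun x => sideWeight x * (Complex.I * (√|x| : ℝ)) ^ n)
    (fun x hx => (contDiffAt_sideWeight hx).mul ((contDiffAt_I_sqrt hx).pow n))
    (fun x hx => mul_ne_zero (sideWeight_ne_zero hx) (pow_ne_zero n (mul_ne_zero Complex.I_ne_zero
      (Complex.ofReal_ne_zero.2 (Real.sqrt_pos.2 (abs_pos.2 hx)).ne'))))
  have h' : IsChartData (Ioi 0) (Ioi 0) a b _ d := ⟨h.a, h.b, hc', h.d⟩
  have key := integral_hatCR_eq_zero hf (h'.isCc h0) (h'.tsupport_subset h0)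
  rw [h'.iterate_hatCR, integral_chartFun ⟨h.a, h.b.iterate_gaugeDeriv (by fun_prop) n,
    hc'.mul_of_ne_zero h0 (m := fun x => (Complex.I * (√|x| : ℝ)) ^ n)
      fun x hx => (contDiffAt_I_sqrt hx).pow n, h.d⟩ h0] at key
  simp only [← mul_assoc (sideWeight _), hcc] at key
  simpa [opU] using key

/-- The second equation for `f` is, for `U f`, an ordinary differential equation in `y₂`, whose form
depends on the sign `σ` of `x₂`. -/
theorem integral_opU_gaugeDeriv_snd {f : L2 siegelMeasure} {n : ℕ} (hf : IsWeakSol dbar2 n f)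
    (h0 : (0 : ℝ) ∉ I) {σ : ℝ} (hσ : ∀ x ∈ I, x = σ * |x|) (h : IsChartData I (Ioi 0) a b c d) :
    ∫ p, opU f p * (a p.1 * (b p.2.1 * (c p.2.2.1 *
      (gaugeDeriv fun _ => -σ / 2)^[n] d p.2.2.2))) ∂flatMeasure = 0 := by
  obtain ⟨hc', hcc⟩ := h.c.div_of_ne_zero h0
    (m := fun x => sideWeight x * (Complex.I * (|x| : ℝ)) ^ n)
    (fun x hx => (contDiffAt_sideWeight hx).mul ((contDiffAt_I_abs hx).pow n))
    (fun x hx => mul_ne_zero (sideWeight_ne_zero hx) (pow_ne_zero n (mul_ne_zero Complex.I_ne_zero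
      (Complex.ofReal_ne_zero.2 (abs_pos.2 hx).ne'))))
  have h' : IsChartData I (Ioi 0) a b _ d := ⟨h.a, h.b, hc', h.d⟩
  have key := integral_hatBar_eq_zero hf (h'.isCc h0) (h'.tsupport_subset h0)
  rw [h'.iterate_hatBar h0 hσ, integral_chartFun ⟨h.a, h.b,
    hc'.mul_of_ne_zero h0 (m := fun x => (Complex.I * (|x| : ℝ)) ^ n)
      fun x hx => (contDiffAt_I_abs hx).pow n,
      h.d.iterate_gaugeDeriv contDiff_const n⟩ h0] at key
  simp only [← mul_assoc (sideWeight _), hcc] at key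
  simpa [opU] using key

/-! ### Weak solutions of `(d/dy + μ)ⁿ Φ = 0` on an interval -/

theorem IsTest1.integrable_mul {I : Set ℝ} {b : ℝ → ℂ} (hb : IsTest1 I b) {Ψ : ℝ → ℂ}
    (hΨ : LocallyIntegrableOn Ψ I) : Integrable fun y => Ψ y * b y := by
  have h1 : IntegrableOn (fun y => Ψ y * b y) (tsupport b) :=
    (hΨ.integrableOn_compact_subset hb.support hb.compact.isCompact).mul_continuousOn
      hb.smooth.continuous.continuousOn hb.compact.isCompact
  refine (integrableOn_iff_integrable_of_support_subset ?_).1 h1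
  exact (Function.support_mul_subset_right Ψ b).trans (subset_tsupport b)

/-- A test function on an interval with vanishing integral is the derivative of a test function. -/
theorem IsTest1.exists_deriv_eq {I : Set ℝ} (hI : I.OrdConnected) {g : ℝ → ℂ} (hg : IsTest1 I g)
    (h : ∫ y, g y = 0) : ∃ β, IsTest1 I β ∧ _root_.deriv β = g := by
  rcases (tsupport g).eq_empty_or_nonempty with he | hne
  · refine ⟨g, hg, ?_⟩
    rw [tsupport_eq_empty_iff] at he
    rw [he]
    exact deriv_const' _
  obtain ⟨p, hp, hpl⟩ := hg.compact.isCompact.exists_isLeast hne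
  obtain ⟨q, hq, hql⟩ := hg.compact.isCompact.exists_isGreatest hne
  have hd : ∀ x, HasDerivAt (fun x => ∫ t in (p - 1)..x, g t) (g x) x := fun x =>
    intervalIntegral.integral_hasDerivAt_right (hg.smooth.continuous.intervalIntegrable _ _)
      (hg.smooth.continuous.stronglyMeasurableAtFilter _ _) hg.smooth.continuous.continuousAt
  have hde : _root_.deriv (fun x => ∫ t in (p - 1)..x, g t) = g := funext fun x => (hd x).deriv
  have hsm : ContDiff ℝ (⊤ : ℕ∞) (_root_.deriv fun x => ∫ t in (p - 1)..x, g t) := by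
    rw [hde]
    exact hg.smooth
  have h0 : ∀ x ∉ Icc p q, ∫ t in (p - 1)..x, g t = 0 := by
    intro x hx
    have hout : ∀ t, g t ≠ 0 → p ≤ t ∧ t ≤ q := fun t ht =>
      ⟨hpl (subset_tsupport g ht), hql (subset_tsupport g ht)⟩
    by_cases hxp : x < p
    · refine intervalIntegral.integral_zero_ae (Filter.Eventually.of_forall fun t ht => ?_)
      by_contra hne
      have := (hout t hne).1
      rcases le_total (p - 1) x with h' | h'
      · rw [uIoc_of_le h'] at ht
        linarith [ht.2]
      · rw [uIoc_of_ge h'] at ht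
        linarith [ht.2]
    · have hxq : q < x := by
        by_contra hle
        exact hx ⟨not_lt.1 hxp, not_lt.1 hle⟩
      rw [intervalIntegral.integral_eq_integral_of_support_subset, h]
      intro t ht
      have := hout t ht
      exact ⟨by linarith, by linarith⟩
  refine ⟨_, ⟨contDiff_infty_iff_deriv.2 ⟨fun x => (hd x).differentiableAt, hsm⟩,
    HasCompactSupport.intro isCompact_Icc h0, ?_⟩, hde⟩
  exact (closure_minimal (fun x (hx : _ ≠ _) => by_contra fun hn => hx (h0 x hn))
    isClosed_Icc).trans (hI.out (hg.support hp) (hg.support hq))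

theorem exists_isTest1_integral_one {I : Set ℝ} (hI : IsOpen I) (hne : I.Nonempty) :
    ∃ ρ, IsTest1 I ρ ∧ ∫ y, ρ y = 1 := by
  obtain ⟨x, hx⟩ := hne
  obtain ⟨r, hr, hball⟩ := Metric.isOpen_iff.1 hI x hx
  let f : ContDiffBump x := ⟨r / 4, r / 2, by positivity, by linarith⟩
  refine ⟨fun y => (f.normed volume y : ℂ), IsTest1.ofReal f.contDiff_normed
    f.hasCompactSupport_normed ?_, ?_⟩
  · rw [f.tsupport_normed_eq]
    exact (Metric.closedBall_subset_ball (by change r / 2 < r; linarith)).trans hball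
  · rw [integral_complex_ofReal, f.integral_normed, Complex.ofReal_one]

/-- Integrating by parts `n` times. -/
theorem IsTest1.integral_pow_mul_iterate_deriv {I : Set ℝ} {b : ℝ → ℂ} (hb : IsTest1 I b) (n : ℕ) :
    ∫ y : ℝ, (y : ℂ) ^ n * (_root_.deriv^[n] b) y = (-1) ^ n * n.factorial * ∫ y, b y := by
  induction n with
  | zero => simp
  | succ n ih =>
    have hB := hb.iterate_deriv n
    have hB' := hB.deriv
    have hu : ∀ y : ℝ, HasDerivAt (fun y : ℝ => (y : ℂ) ^ (n + 1)) ((n + 1 : ℕ) * (y : ℂ) ^ n) y := by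
      intro y
      have := (hasDerivAt_pow (n + 1) (y : ℂ)).comp_ofReal
      simpa using this
    have hc : ∀ k : ℕ, Continuous fun y : ℝ => (y : ℂ) ^ k := by fun_prop
    have hi : ∀ {k : ℕ} {B : ℝ → ℂ}, IsTest1 I B → Integrable fun y : ℝ => (y : ℂ) ^ k * B y :=
      fun h => h.integrable_mul ((hc _).locallyIntegrable.locallyIntegrableOn _)
    have key := integral_mul_deriv_eq_deriv_mul_of_integrable (u := fun y : ℝ => (y : ℂ) ^ (n + 1))
      (v := _root_.deriv^[n] b) (fun y _ => hu y)
      (fun y _ => (hB.smooth.differentiable (by simp) y).hasDerivAt) (hi hB') (by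
        have := (hi (k := n) hB).const_mul ((n + 1 : ℕ) : ℂ)
        refine this.congr (Filter.Eventually.of_forall fun y => ?_)
        simp only [Pi.mul_apply]
        ring) (hi hB)
    rw [Function.iterate_succ_apply', key]
    simp only [mul_assoc]
    rw [integral_const_mul, ih, Nat.factorial_succ, pow_succ]
    push_cast
    ring

theorem iterate_deriv_sub_const_mul {I : Set ℝ} {b ρ : ℝ → ℂ} (hb : IsTest1 I b)
    (hρ : IsTest1 I ρ) (κ : ℂ) (n : ℕ) : deriv^[n] (fun y => b y - κ * ρ y) =
      fun y => (deriv^[n] b) y - κ * (deriv^[n] ρ) y := by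
  induction n with
  | zero => rfl
  | succ n ih =>
    rw [Function.iterate_succ_apply', ih, Function.iterate_succ_apply',
      Function.iterate_succ_apply']
    funext y
    have h1 := ((hb.iterate_deriv n).smooth.differentiable (by simp) y).hasDerivAt
    have h2 := ((hρ.iterate_deriv n).smooth.differentiable (by simp) y).hasDerivAt
    exact (h1.sub (h2.const_mul κ)).deriv

/-- **The lemma of du Bois-Reymond**: a function whose `n`-th distributional derivative vanishes
on an interval is a polynomial of degree less than `n`. -/
theorem exists_poly_of_integral_iterate_deriv {I : Set ℝ} (hI : IsOpen I) (hI' : I.OrdConnected)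
    (hne : I.Nonempty) (n : ℕ) {Ψ : ℝ → ℂ} (hΨ : LocallyIntegrableOn Ψ I)
    (h : ∀ b, IsTest1 I b → ∫ y, Ψ y * (deriv^[n] b) y = 0) :
    ∃ κ : ℕ → ℂ, ∀ᵐ y : ℝ, y ∈ I → Ψ y = ∑ i ∈ Finset.range n, κ i * (y : ℂ) ^ i := by
  induction n generalizing Ψ with
  | zero =>
    refine ⟨0, ?_⟩
    simpa using hI.ae_eq_zero_of_integral_contDiff_smul_eq_zero hΨ fun g hg hgc hgs => by
      rw [← h _ (IsTest1.ofReal hg hgc hgs)]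
      simp [mul_comm]
  | succ n ih =>
    obtain ⟨ρ, hρ, hρ1⟩ := exists_isTest1_integral_one hI hne
    set κ₀ : ℂ := ∫ y, Ψ y * (deriv^[n] ρ) y with hκ₀
    have key : ∀ b, IsTest1 I b → ∫ y, Ψ y * (deriv^[n] b) y = κ₀ * ∫ y, b y := by
      intro b hb
      have hbi : Integrable b := hb.smooth.continuous.integrable_of_hasCompactSupport hb.compact
      have hρi : Integrable ρ := hρ.smooth.continuous.integrable_of_hasCompactSupport hρ.compact
      have hg : IsTest1 I fun y => b y - (∫ y, b y) * ρ y := by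
        have := hb.add (hρ.mul_left (contDiff_const (c := -(∫ y, b y))))
        simpa [sub_eq_add_neg] using this
      obtain ⟨β, hβ, hβd⟩ := hg.exists_deriv_eq hI' (by
        rw [integral_sub hbi (hρi.const_mul _), integral_const_mul, hρ1, mul_one, sub_self])
      have h2 := h β hβ
      rw [Function.iterate_succ_apply, hβd, iterate_deriv_sub_const_mul hb hρ] at h2
      simp only [mul_sub] at h2
      rw [integral_sub ((hb.iterate_deriv n).integrable_mul hΨ)
        (((hρ.iterate_deriv n).mul_left contDiff_const).integrable_mul hΨ)] at h2
      simp only [mul_left_comm (Ψ _)] at h2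
      rw [integral_const_mul, ← hκ₀, sub_eq_zero] at h2
      rw [h2, mul_comm]
    set κ₁ : ℂ := κ₀ / ((-1) ^ n * n.factorial) with hκ₁
    have hκ : κ₁ * ((-1) ^ n * n.factorial) = κ₀ := by
      refine div_mul_cancel₀ _ (mul_ne_zero (by simp) ?_)
      exact_mod_cast n.factorial_ne_zero
    have hpow : LocallyIntegrableOn (fun y : ℝ => κ₁ * (y : ℂ) ^ n) I :=
      ((by fun_prop : Continuous fun y : ℝ => κ₁ * (y : ℂ) ^ n).locallyIntegrable).locallyIntegrableOn _
    obtain ⟨κ, hκ'⟩ := ih (Ψ := fun y => Ψ y - κ₁ * (y : ℂ) ^ n) (hΨ.sub hpow) fun b hb => by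
      have hbn := hb.iterate_deriv n
      simp only [sub_mul]
      rw [integral_sub (hbn.integrable_mul hΨ) (hbn.integrable_mul hpow), key b hb]
      simp only [mul_assoc κ₁]
      rw [integral_const_mul, hb.integral_pow_mul_iterate_deriv, ← mul_assoc, hκ, sub_self]
    refine ⟨fun i => if i = n then κ₁ else κ i, ?_⟩
    filter_upwards [hκ'] with y hy hyI
    rw [Finset.sum_range_succ, if_pos rfl, ← sub_eq_iff_eq_add, hy hyI]
    refine Finset.sum_congr rfl fun i hi => ?_
    rw [if_neg (Finset.mem_range.1 hi).ne]

/-- Conjugation by `e^{-M}` turns `d/dy + M'` into `d/dy`. -/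
theorem iterate_gaugeDeriv_exp {I : Set ℝ} {μ M : ℝ → ℝ} (hM : ∀ y, HasDerivAt M (μ y) y)
    {β : ℝ → ℂ} (hβ : IsTest1 I β) (n : ℕ) :
    (gaugeDeriv μ)^[n] (fun y => (Real.exp (-M y) : ℝ) * β y) =
      fun y => (Real.exp (-M y) : ℝ) * (deriv^[n] β) y := by
  induction n with
  | zero => rfl
  | succ n ih =>
    rw [Function.iterate_succ_apply', ih, Function.iterate_succ_apply']
    funext y
    have h1 := (hM y).neg.exp.ofReal_comp
    have h2 := ((hβ.iterate_deriv n).smooth.differentiable (by simp) y).hasDerivAt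
    have h3 : HasDerivAt (fun y => ((Real.exp (-M y) : ℝ) : ℂ) * (deriv^[n] β) y) _ y := h1.mul h2
    rw [gaugeDeriv, h3.deriv]
    simp only [Pi.neg_apply]
    push_cast
    ring

/-- The square-integrable weak solutions of `(d/dy - M')ⁿ Φ = 0` on an interval are of the form
`P e^M`, with a polynomial `P` of degree less than `n`. -/
theorem exists_poly_mul_exp {I : Set ℝ} (hI : IsOpen I) (hI' : I.OrdConnected) (hne : I.Nonempty)
    {μ M : ℝ → ℝ} (hMs : ContDiff ℝ (⊤ : ℕ∞) M) (hM : ∀ y, HasDerivAt M (μ y) y) {n : ℕ}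
    {Φ : ℝ → ℂ} (hΦ : MemLp Φ 2 (volume.restrict I))
    (h : ∀ b, IsTest1 I b → ∫ y in I, Φ y * (gaugeDeriv μ)^[n] b y = 0) :
    ∃ κ : ℕ → ℂ, ∀ᵐ y : ℝ ∂volume.restrict I,
      Φ y = (∑ i ∈ Finset.range n, κ i * (y : ℂ) ^ i) * (Real.exp (M y) : ℝ) := by
  have hexp : ContDiff ℝ (⊤ : ℕ∞) fun y => ((Real.exp (-M y) : ℝ) : ℂ) :=
    contDiff_ofReal.comp hMs.neg.exp
  obtain ⟨κ, hκ⟩ := exists_poly_of_integral_iterate_deriv hI hI' hne n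
    (Ψ := fun y => Φ y * (Real.exp (-M y) : ℝ))
    ((locallyIntegrableOn_of_memLp hI hΦ).mul_continuousOn hexp.continuous.continuousOn
      hI.isLocallyClosed) fun b hb => by
      have h1 := h _ (hb.mul_left hexp)
      rw [iterate_gaugeDeriv_exp hM hb, setIntegral_eq_integral_of_forall_compl_eq_zero] at h1
      · simpa only [mul_assoc] using h1
      · intro y hy
        have : (deriv^[n] b) y = 0 := image_eq_zero_of_notMem_tsupport fun hm =>
          hy ((hb.iterate_deriv n).support hm)
        simp [this]
  refine ⟨κ, ?_⟩
  rw [ae_restrict_iff' hI.measurableSet]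
  filter_upwards [hκ] with y hy hyI
  rw [← hy hyI, mul_assoc, ← Complex.ofReal_mul, ← Real.exp_add]
  simp

/-! ### Consequences for the Hermite and Laguerre functions -/

/-- The solutions are `P e^{-y²/2}` with `deg P < n`, and `h_m` is orthogonal to these for `m ≥ n`.
-/
theorem integral_mul_hermiteFun_eq_zero {n m : ℕ} (hm : n ≤ m) {Φ : ℝ → ℂ} (hΦ : MemLp Φ 2 volume)
    (h : ∀ b, IsTest1 univ b → ∫ y, Φ y * (gaugeDeriv fun y => -y)^[n] b y = 0) :
    ∫ y, Φ y * hermiteFun m y = 0 := by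
  obtain ⟨κ, hκ⟩ := exists_poly_mul_exp isOpen_univ ordConnected_univ univ_nonempty
    (M := fun y => -y ^ 2 / 2) (μ := fun y => -y) (by fun_prop) (fun y => by
      refine (((hasDerivAt_id y).pow 2).neg.div_const 2).congr_deriv ?_
      simp
      ring) (by simpa using hΦ) (by simpa using h)
  rw [Measure.restrict_univ] at hκ
  have e : ∀ᵐ y, Φ y * hermiteFun m y = ∑ i ∈ Finset.range n, (κ i * hermConst m) *
      ((((Polynomial.X ^ i : Polynomial ℝ).eval y * Real.exp (-y ^ 2 / 2) : ℝ) : ℂ) *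
        (((hermPoly m).eval y * Real.exp (-y ^ 2 / 2) : ℝ) : ℂ)) := by
    filter_upwards [hκ] with y hy
    rw [hy, hermiteFun_eq, Finset.sum_mul, Finset.sum_mul]
    refine Finset.sum_congr rfl fun i _ => ?_
    simp
    ring
  rw [integral_congr_ae e, integral_finsetSum]
  · refine Finset.sum_eq_zero fun i hi => ?_
    rw [integral_const_mul, integral_poly_hermPoly_eq_zero, mul_zero]
    rw [Polynomial.natDegree_X_pow]
    exact (Finset.mem_range.1 hi).trans_le hm
  · intro i _
    exact ((memLp_poly_mul_gaussian _).integrable_mul (memLp_poly_mul_gaussian _)).const_mul _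

/-- The solutions are `P e^{-y/2}` with `deg P < n`, and `ℓ_m` is orthogonal to these for `m ≥ n`.
-/
theorem integral_mul_laguerreFun_eq_zero {n m : ℕ} (hm : n ≤ m) {Φ : ℝ → ℂ}
    (hΦ : MemLp Φ 2 posMeasure)
    (h : ∀ b, IsTest1 (Ioi 0) b → ∫ y in Ioi 0, Φ y * (gaugeDeriv fun _ => -1 / 2)^[n] b y = 0) :
    ∫ y in Ioi 0, Φ y * laguerreFun m y = 0 := by
  obtain ⟨κ, hκ⟩ := exists_poly_mul_exp isOpen_Ioi ordConnected_Ioi nonempty_Ioi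
    (M := fun y => -y / 2) (μ := fun y => -1 / 2) (by fun_prop) (fun y =>
      (hasDerivAt_id y).neg.div_const 2) hΦ h
  have e : ∀ᵐ y ∂posMeasure, Φ y * laguerreFun m y = ∑ i ∈ Finset.range n,
      (κ i * (((-1) ^ m / m.factorial : ℝ) : ℂ)) *
      ((((Polynomial.X ^ i : Polynomial ℝ).eval y * Real.exp (-y / 2) : ℝ) : ℂ) *
        (((lagPoly m m).eval y * Real.exp (-y / 2) : ℝ) : ℂ)) := by
    filter_upwards [hκ] with y hy
    rw [hy, laguerreFun_eq, Finset.sum_mul, Finset.sum_mul]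
    refine Finset.sum_congr rfl fun i _ => ?_
    simp
    ring
  rw [integral_congr_ae e, integral_finsetSum]
  · refine Finset.sum_eq_zero fun i hi => ?_
    rw [integral_const_mul, integral_poly_lagPoly_eq_zero, mul_zero]
    rw [Polynomial.natDegree_X_pow]
    exact (Finset.mem_range.1 hi).trans_le hm
  · intro i _
    exact ((memLp_poly_mul_exp _).integrable_mul (memLp_poly_mul_exp _)).const_mul _

theorem eventually_le_norm_eval {P : Polynomial ℂ} (hP : P ≠ 0) :
    ∃ ε > 0, ∀ᶠ y : ℝ in Filter.atTop, ε ≤ ‖P.eval (y : ℂ)‖ := by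
  rcases lt_or_ge 0 P.degree with hd | hd
  · have hz : Filter.Tendsto (fun y : ℝ => ‖(y : ℂ)‖) Filter.atTop Filter.atTop := by
      simpa using Filter.tendsto_abs_atTop_atTop
    exact ⟨1, one_pos, (P.tendsto_norm_atTop hd hz).eventually_ge_atTop 1⟩
  · rw [Polynomial.eq_C_of_degree_le_zero hd] at hP ⊢
    refine ⟨‖P.coeff 0‖, norm_pos_iff.2 fun h => hP (by rw [h, Polynomial.C_0]), ?_⟩
    simp

/-- The growing exponential has no square-integrable solutions. -/
theorem ae_eq_zero_of_gaugeDeriv_half {n : ℕ} {Φ : ℝ → ℂ} (hΦ : MemLp Φ 2 posMeasure)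
    (h : ∀ b, IsTest1 (Ioi 0) b → ∫ y in Ioi 0, Φ y * (gaugeDeriv fun _ => 1 / 2)^[n] b y = 0) :
    Φ =ᵐ[posMeasure] 0 := by
  obtain ⟨κ, hκ⟩ := exists_poly_mul_exp isOpen_Ioi ordConnected_Ioi nonempty_Ioi
    (M := fun y => y / 2) (μ := fun y => 1 / 2) (by fun_prop) (fun y =>
      (hasDerivAt_id y).div_const 2) hΦ h
  set P : Polynomial ℂ := ∑ i ∈ Finset.range n, Polynomial.C (κ i) * Polynomial.X ^ i with hPdef
  have hP : ∀ y : ℝ, P.eval (y : ℂ) = ∑ i ∈ Finset.range n, κ i * (y : ℂ) ^ i := by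
    intro y
    simp [hPdef, Polynomial.eval_finsetSum]
  simp only [← hP] at hκ
  by_cases hP0 : P = 0
  · filter_upwards [hκ] with y hy
    rw [hy, hP0]
    simp
  exfalso
  obtain ⟨ε, hε, hev⟩ := eventually_le_norm_eval hP0
  obtain ⟨A, hA⟩ := Filter.eventually_atTop.1 hev
  set B := max A 0
  have hsub : Ioi B ⊆ Ioi 0 := Ioi_subset_Ioi (le_max_right _ _)
  have hΦB : MemLp Φ 2 (volume.restrict (Ioi B)) := hΦ.mono_measure
    (Measure.restrict_mono hsub le_rfl)
  have hconst : MemLp (fun _ : ℝ => ε) 2 (volume.restrict (Ioi B)) := by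
    refine hΦB.mono aestronglyMeasurable_const ?_
    filter_upwards [ae_restrict_of_ae_restrict_of_subset hsub hκ, ae_restrict_mem measurableSet_Ioi]
      with y hy hyB
    have hyB' : B < y := hyB
    have h1 : A ≤ y := (le_max_left _ _).trans hyB'.le
    have h2 : 0 ≤ y := (le_max_right A 0).trans hyB'.le
    rw [hy, norm_mul, Real.norm_of_nonneg hε.le, Complex.norm_real,
      Real.norm_of_nonneg (Real.exp_pos _).le]
    have h3 : 1 ≤ Real.exp (y / 2) := Real.one_le_exp (by positivity)
    calc ε ≤ ‖P.eval (y : ℂ)‖ * 1 := by rw [mul_one]; exact hA y h1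
      _ ≤ _ := mul_le_mul_of_nonneg_left h3 (norm_nonneg _)
  rw [memLp_const_iff (by norm_num) (by norm_num)] at hconst
  rcases hconst with h0 | h0
  · exact hε.ne' h0
  · simp at h0

/-! ### Orthogonality relations for weak solutions -/

/-- With `T b = a ⊗ b ⊗ c ⊗ d`, the adjoint integrates the other variables out: it reduces
statements about `F` to statements about functions of one variable, for which this identity computes
the pairings. -/
theorem integral_adjoint_mul {α H : Type*} [MeasurableSpace α] {μ : Measure α}
    [NormedAddCommGroup H] [InnerProductSpace ℂ H] [CompleteSpace H] (T : L2 μ →L[ℂ] H) (F : H)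
    {b : α → ℂ} (hb : MemLp b 2 μ) :
    ∫ y, ContinuousLinearMap.adjoint T F y * b y ∂μ = inner ℂ (T hb.star.toLp) F := by
  rw [← ContinuousLinearMap.adjoint_inner_right, L2.inner_def]
  refine integral_congr_ae ?_
  filter_upwards [hb.star.coeFn_toLp] with y hy
  rw [hy]
  simp [RCLike.inner_apply]

theorem inner_tensor4 {f₁ f₂ f₃ : L2 (volume : Measure ℝ)} {f₄ : L2 posMeasure}
    {b₁ b₂ b₃ b₄ : ℝ → ℂ} (e₁ : f₁ =ᵐ[volume] b₁) (e₂ : f₂ =ᵐ[volume] b₂) (e₃ : f₃ =ᵐ[volume] b₃)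
    (e₄ : f₄ =ᵐ[posMeasure] b₄) (F : L2 flatMeasure) :
    inner ℂ (tensor f₁ (tensor f₂ (tensor f₃ f₄))) F = ∫ p, F p * ((starRingEnd ℂ) (b₁ p.1) *
      ((starRingEnd ℂ) (b₂ p.2.1) * ((starRingEnd ℂ) (b₃ p.2.2.1) *
        (starRingEnd ℂ) (b₄ p.2.2.2)))) ∂flatMeasure := by
  rw [L2.inner_def]
  refine integral_congr_ae ?_
  filter_upwards [tensor4_coeFn e₁ e₂ e₃ e₄] with p hp
  rw [hp]
  simp [RCLike.inner_apply]

/-- Integrating `U f` against `a', c', d'` in the other variables leaves a square-integrable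
function of `y₁` to which `integral_mul_hermiteFun_eq_zero` applies. -/
theorem inner_tensor_hermiteL2_eq_zero {f : L2 siegelMeasure} {n m : ℕ}
    (hf : IsWeakSol tangCR n f) (hm : n ≤ m) {a' c' : L2 (volume : Measure ℝ)} {d' : L2 posMeasure}
    (ha : a' ∈ testClasses volume univ) (hc : c' ∈ testClasses volume (Ioi 0))
    (hd : d' ∈ testClasses posMeasure (Ioi 0)) :
    inner ℂ (tensor a' (tensor (hermiteL2 m) (tensor c' d'))) (opU f) = 0 := by
  obtain ⟨a, ha, ea⟩ := ha
  obtain ⟨c, hc, ec⟩ := hc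
  obtain ⟨d, hd, ed⟩ := hd
  set T : L2 (volume : Measure ℝ) →L[ℂ] L2 flatMeasure :=
    tensorCLM a' ∘L tensorCLM.flip (tensor c' d') with hT
  have hTb : ∀ b', T b' = tensor a' (tensor b' (tensor c' d')) := fun b' => rfl
  rw [← hTb, ← ContinuousLinearMap.adjoint_inner_right, inner_hermiteL2]
  simp only [mul_comm (hermiteFun m _ : ℂ)]
  refine integral_mul_hermiteFun_eq_zero hm (Lp.memLp _) fun b hb => ?_
  have hg := (hb.iterate_gaugeDeriv (μ := fun y => -y) (by fun_prop) n).memLp_volume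
  rw [integral_adjoint_mul T _ hg, hTb, inner_tensor4 ea hg.star.coeFn_toLp ec ed]
  have := integral_opU_gaugeDeriv_fst hf ⟨ha.conj, hb, hc.conj, hd.conj⟩
  simpa using this

/-- Integrating `U f` against `a', b', c'` in the other variables leaves a square-integrable
function of `y₂` to which `integral_mul_laguerreFun_eq_zero` applies. -/
theorem inner_tensor_laguerreL2_eq_zero {f : L2 siegelMeasure} {n m : ℕ}
    (hf : IsWeakSol dbar2 n f) (hm : n ≤ m) {a' b' c' : L2 (volume : Measure ℝ)}
    (ha : a' ∈ testClasses volume univ) (hb : b' ∈ testClasses volume univ)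
    (hc : c' ∈ testClasses volume (Ioi 0)) :
    inner ℂ (tensor a' (tensor b' (tensor c' (laguerreL2 m)))) (opU f) = 0 := by
  obtain ⟨a, ha, ea⟩ := ha
  obtain ⟨b, hb, eb⟩ := hb
  obtain ⟨c, hc, ec⟩ := hc
  set T : L2 posMeasure →L[ℂ] L2 flatMeasure := tensorCLM a' ∘L tensorCLM b' ∘L tensorCLM c' with hT
  have hTb : ∀ d', T d' = tensor a' (tensor b' (tensor c' d')) := fun d' => rfl
  rw [← hTb, ← ContinuousLinearMap.adjoint_inner_right, inner_laguerreL2]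
  simp only [mul_comm (laguerreFun m _ : ℂ)]
  refine integral_mul_laguerreFun_eq_zero hm (Lp.memLp _) fun d hd => ?_
  have hg := (hd.iterate_gaugeDeriv (μ := fun _ => -1 / 2) (by fun_prop) n).memLp (Ioi 0)
  rw [integral_adjoint_mul T _ hg, hTb, inner_tensor4 ea eb ec hg.star.coeFn_toLp]
  have := integral_opU_gaugeDeriv_snd (I := Ioi 0) hf (by simp) (σ := 1)
    (fun x hx => by rw [one_mul, abs_of_pos hx]) ⟨ha.conj, hb.conj, hc.conj, hd⟩
  simpa using this

/-- On the half space `x₂ < 0` the equation in `y₂` has only exponentially growing solutions. -/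
theorem inner_tensor_eq_zero_of_neg {f : L2 siegelMeasure} {n : ℕ}
    (hf : IsWeakSol dbar2 n f) {a' b' c' : L2 (volume : Measure ℝ)} (d' : L2 posMeasure)
    (ha : a' ∈ testClasses volume univ) (hb : b' ∈ testClasses volume univ)
    (hc : c' ∈ testClasses volume (Iio 0)) :
    inner ℂ (tensor a' (tensor b' (tensor c' d'))) (opU f) = 0 := by
  obtain ⟨a, ha, ea⟩ := ha
  obtain ⟨b, hb, eb⟩ := hb
  obtain ⟨c, hc, ec⟩ := hc
  set T : L2 posMeasure →L[ℂ] L2 flatMeasure := tensorCLM a' ∘L tensorCLM b' ∘L tensorCLM c' with hT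
  have hTb : ∀ d', T d' = tensor a' (tensor b' (tensor c' d')) := fun d' => rfl
  rw [← hTb, ← ContinuousLinearMap.adjoint_inner_right]
  have h0 : ContinuousLinearMap.adjoint T (opU f) = 0 := by
    refine Lp.ext ((ae_eq_zero_of_gaugeDeriv_half (n := n) (Lp.memLp _) fun d hd => ?_).trans
      (Lp.coeFn_zero _ _ _).symm)
    have hg := (hd.iterate_gaugeDeriv (μ := fun _ => 1 / 2) (by fun_prop) n).memLp (Ioi 0)
    rw [integral_adjoint_mul T _ hg, hTb, inner_tensor4 ea eb ec hg.star.coeFn_toLp]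
    have := integral_opU_gaugeDeriv_snd (I := Iio 0) hf (by simp) (σ := -1)
      (fun x hx => by rw [abs_of_neg hx]; ring) ⟨ha.conj, hb.conj, hc.conj, hd⟩
    simpa using this
  rw [h0, inner_zero_right]

theorem opU_eq_zero_of_neg {f : L2 siegelMeasure} {n : ℕ} (hf : IsWeakSol dbar2 n f) :
    ∀ᵐ p ∂flatMeasure, p.2.2.1 < 0 → opU f p = 0 := by
  set F := opU f with hF
  set s : Set (ℝ × ℝ × ℝ × ℝ) := {p | p.2.2.1 < 0} with hs
  have hsm : MeasurableSet s := measurableSet_lt (by fun_prop) measurable_const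
  have hG : MemLp (s.indicator F) 2 flatMeasure := (Lp.memLp F).indicator hsm
  suffices h : hG.toLp = 0 by
    filter_upwards [hG.coeFn_toLp, Lp.coeFn_zero ℂ 2 flatMeasure] with p h1 h2 hp
    rw [h, h2, indicator_of_mem (show p ∈ s from hp)] at h1
    exact h1.symm
  have htot := isTotal_testClasses.tensor (isTotal_testClasses.tensor
    ((isTotal_univ (H := L2 (volume : Measure ℝ))).tensor (isTotal_univ (H := L2 posMeasure))))
  refine htot _ ?_
  rintro _ ⟨a', ha, _, ⟨b', hb, _, ⟨c', -, d', -, rfl⟩, rfl⟩, rfl⟩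
  set T : L2 (volume : Measure ℝ) →L[ℂ] L2 flatMeasure :=
    tensorCLM a' ∘L tensorCLM b' ∘L tensorCLM.flip d' with hT
  have hTc : ∀ c', T c' = tensor a' (tensor b' (tensor c' d')) := fun c' => rfl
  -- the part of `c'` on the negative half line
  have hcn : MemLp ((Iio (0 : ℝ)).indicator c') 2 volume := (Lp.memLp c').indicator measurableSet_Iio
  have e : inner ℂ (tensor a' (tensor b' (tensor c' d'))) hG.toLp =
      inner ℂ (T hcn.toLp) F := by
    rw [hTc, L2.inner_def, L2.inner_def]
    refine integral_congr_ae ?_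
    filter_upwards [tensor4_coeFn (Filter.EventuallyEq.refl _ a') (Filter.EventuallyEq.refl _ b')
        (Filter.EventuallyEq.refl _ c') (Filter.EventuallyEq.refl _ d'),
      tensor4_coeFn (Filter.EventuallyEq.refl _ a') (Filter.EventuallyEq.refl _ b')
        hcn.coeFn_toLp (Filter.EventuallyEq.refl _ d'), hG.coeFn_toLp] with p h1 h2 h3
    rw [h1, h2, h3]
    by_cases hp : p.2.2.1 < 0
    · rw [indicator_of_mem (show p ∈ s from hp), indicator_of_mem (show p.2.2.1 ∈ Iio 0 from hp)]
    · rw [indicator_of_notMem (show p ∉ s from hp),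
        indicator_of_notMem (show p.2.2.1 ∉ Iio 0 from hp)]
      simp
  rw [e, ← ContinuousLinearMap.adjoint_inner_right]
  set Θ := ContinuousLinearMap.adjoint T F with hΘ
  have hΘ0 : Θ =ᵐ[volume.restrict (Iio 0)] 0 := by
    refine ae_eq_zero_of_integral_test isOpen_Iio ((Lp.memLp Θ).restrict _) fun c hc => ?_
    rw [setIntegral_eq_integral_of_forall_compl_eq_zero]
    · simp only [mul_comm (c _)]
      rw [hΘ, integral_adjoint_mul T F hc.memLp_volume, hTc]
      exact inner_tensor_eq_zero_of_neg hf d' ha hb ⟨_, hc.conj,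
        hc.memLp_volume.star.coeFn_toLp⟩
    · intro y hy
      have : c y = 0 := image_eq_zero_of_notMem_tsupport fun hm => hy (hc.support hm)
      rw [this, zero_mul]
  rw [L2.inner_def]
  refine integral_eq_zero_of_ae ?_
  rw [Filter.EventuallyEq, ae_restrict_iff' measurableSet_Iio] at hΘ0
  filter_upwards [hcn.coeFn_toLp, hΘ0] with y h1 h2
  rw [h1]
  by_cases hy : y ∈ Iio (0 : ℝ)
  · rw [h2 hy]
    simp
  · rw [indicator_of_notMem hy, inner_zero_left]
    rfl

/-! ### The ranges of the embeddings `R₀` -/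

theorem opR0_tensor (j k : ℕ) {a' : L2 (volume : Measure ℝ)} {c : ℝ → ℂ} (hc : IsTest1 (Ioi 0) c)
    {c'' : L2 posMeasure} (ec : c'' =ᵐ[posMeasure] c) :
    opR0 j k (tensor a' c'') = tensor a' (tensor (hermiteL2 (j - 1))
      (tensor hc.memLp_volume.toLp (laguerreL2 (k - 1)))) := by
  have h1 : zeroExt (tensor a' c'') = tensor (μ := (volume : Measure ℝ)) a'
      hc.memLp_volume.toLp := by
    refine Lp.ext ?_
    have h2 : ∀ᵐ x ∂(volume : Measure (ℝ × ℝ)), x ∈ univ ×ˢ Ioi (0 : ℝ) →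
        tensor a' c'' x = a' x.1 * c x.2 := by
      rw [← ae_halfMeasure_iff]
      filter_upwards [tensor_coeFn a' c'', Measure.quasiMeasurePreserving_snd.ae ec] with x h3 h4
      rw [h3, h4]
    filter_upwards [zeroExt_coeFn (tensor a' c''), h2,
      tensor_coeFn (μ := (volume : Measure ℝ)) a' hc.memLp_volume.toLp,
      (Measure.quasiMeasurePreserving_snd (μ := (volume : Measure ℝ))
        (ν := (volume : Measure ℝ))).ae hc.memLp_volume.coeFn_toLp] with x h3 h4 h5 h6
    rw [h3, h5, h6]
    by_cases hx : x ∈ univ ×ˢ Ioi (0 : ℝ)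
    · rw [indicator_of_mem hx, h4 hx]
    · have : c x.2 = 0 := image_eq_zero_of_notMem_tsupport fun hm =>
        hx ⟨mem_univ _, hc.support hm⟩
      rw [indicator_of_notMem hx, this, mul_zero]
  rw [opR0_eq, h1, shuffleL2_tensor]

theorem inner_opR0_eq_zero_of_tests {j k : ℕ} {F : L2 flatMeasure}
    (h : ∀ a' ∈ testClasses volume univ, ∀ c' ∈ testClasses volume (Ioi 0),
      inner ℂ (tensor a' (tensor (hermiteL2 (j - 1)) (tensor c' (laguerreL2 (k - 1))))) F = 0)
    (g : L2 halfMeasure) : inner ℂ (opR0 j k g) F = 0 := by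
  rw [← ContinuousLinearMap.adjoint_inner_right]
  suffices h0 : ContinuousLinearMap.adjoint (opR0 j k) F = 0 by rw [h0, inner_zero_right]
  refine (isTotal_testClasses.tensor isTotal_testClasses_half) _ ?_
  rintro _ ⟨a', ha, c'', ⟨c, hc, ec⟩, rfl⟩
  rw [ContinuousLinearMap.adjoint_inner_right, opR0_tensor j k hc ec]
  exact h a' ha _ ⟨c, hc, hc.memLp_volume.coeFn_toLp⟩

/-- A weak solution of the first equation of order `n` has no components along `h_m` with `m ≥ n`.
-/
theorem inner_opR0_opU_eq_zero_of_tangCR {f : L2 siegelMeasure} {n j : ℕ}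
    (hf : IsWeakSol tangCR n f) (hj : n ≤ j - 1) (k : ℕ) (g : L2 halfMeasure) :
    inner ℂ (opR0 j k g) (opU f) = 0 := by
  refine inner_opR0_eq_zero_of_tests (fun a' ha c' hc => ?_) g
  set T : L2 posMeasure →L[ℂ] L2 flatMeasure :=
    tensorCLM a' ∘L tensorCLM (hermiteL2 (j - 1)) ∘L tensorCLM c' with hT
  have hTd : ∀ d', T d' = tensor a' (tensor (hermiteL2 (j - 1)) (tensor c' d')) := fun d' => rfl
  have h0 : ContinuousLinearMap.adjoint T (opU f) = 0 := isTotal_testClasses_half _ fun d' hd => by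
    rw [ContinuousLinearMap.adjoint_inner_right, hTd]
    exact inner_tensor_hermiteL2_eq_zero hf hj ha hc hd
  rw [← hTd, ← ContinuousLinearMap.adjoint_inner_right, h0, inner_zero_right]

/-- A weak solution of the second equation of order `n` has no components along `ℓ_m` with `m ≥ n`.
-/
theorem inner_opR0_opU_eq_zero_of_dbar2 {f : L2 siegelMeasure} {n k : ℕ}
    (hf : IsWeakSol dbar2 n f) (hk : n ≤ k - 1) (j : ℕ) (g : L2 halfMeasure) :
    inner ℂ (opR0 j k g) (opU f) = 0 := by
  refine inner_opR0_eq_zero_of_tests (fun a' ha c' hc => ?_) g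
  set T : L2 (volume : Measure ℝ) →L[ℂ] L2 flatMeasure :=
    tensorCLM a' ∘L tensorCLM.flip (tensor c' (laguerreL2 (k - 1))) with hT
  have hTb : ∀ b', T b' = tensor a' (tensor b' (tensor c' (laguerreL2 (k - 1)))) := fun b' => rfl
  have h0 : ContinuousLinearMap.adjoint T (opU f) = 0 := isTotal_testClasses _ fun b' hb => by
    rw [ContinuousLinearMap.adjoint_inner_right, hTb]
    exact inner_tensor_laguerreL2_eq_zero hf hk ha hb hc
  rw [← hTb, ← ContinuousLinearMap.adjoint_inner_right, h0, inner_zero_right]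

/-! ### The ranges of the embeddings consist of weak solutions -/

theorem conj_partFour (ε : ℝ) (Ξ : ℝ × ℝ × ℝ × ℝ → ℂ) (p : ℝ × ℝ × ℝ × ℝ) :
    (starRingEnd ℂ) (partFour ε (fun q => (starRingEnd ℂ) (Ξ q)) p) = partFour (-ε) Ξ p := by
  rw [partFour, partFour, map_mul, Complex.conj_ofReal, ← integral_conj]
  congr 2
  funext t
  simp only [fourKernel, map_mul, Complex.conj_conj]
  rw [← Complex.exp_conj]
  congr 2
  simp

theorem conj_chartFun (a b c d : ℝ → ℂ) (q : ℝ × ℝ × ℝ × ℝ) :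
    (starRingEnd ℂ) (chartFun a b c d q) = chartFun (fun x => (starRingEnd ℂ) (a x))
      (fun x => (starRingEnd ℂ) (b x)) (fun x => (starRingEnd ℂ) (c x))
      (fun x => (starRingEnd ℂ) (d x)) q := by
  simp [chartFun]

/-- Pairing with a product in the coordinates of `U`, in terms of the inverse transform of the
product. -/
theorem integral_opV_opU1_mul {I J : Set ℝ} {a b c d : ℝ → ℂ} (h : IsChartData I J a b c d)
    (h0 : (0 : ℝ) ∉ I) {ψ : ℝ × ℝ × ℝ × ℝ → ℂ} (hψ : MemLp ψ 2 flatMeasure) :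
    ∫ p, opV2 (opV1 (opU1 hψ.star.toLp)) p * (starRingEnd ℂ)
      (a p.1 * (b p.2.1 * ((sideWeight p.2.2.1 * c p.2.2.1) * d p.2.2.2))) ∂flatMeasure =
      (starRingEnd ℂ) (∫ p, partFour 1 (chartFun a b c d) p * ψ p ∂flatMeasure) := by
  have h' : IsChartData I J _ _ _ _ := ⟨h.a.conj, h.b.conj, h.c.conj, h.d.conj⟩
  have e1 := integral_chartFun h' h0 (opU1 hψ.star.toLp)
  rw [← integral_mul_partFour (h'.isCc h0)] at e1
  have e2 : ∀ p : ℝ × ℝ × ℝ × ℝ, (starRingEnd ℂ) (sideWeight p.2.2.1) = sideWeight p.2.2.1 :=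
    fun p => Complex.conj_ofReal _
  simp only [map_mul, e2]
  rw [← e1, ← integral_conj]
  refine integral_congr_ae ?_
  filter_upwards [hψ.star.coeFn_toLp] with p hp
  rw [hp, map_mul, ← neg_neg (1 : ℝ), ← conj_partFour]
  simp only [conj_chartFun, Complex.conj_conj, neg_neg]
  rw [mul_comm]
  rfl

theorem exists_poly_hermiteFun (m : ℕ) : ∃ P : Polynomial ℝ, P.natDegree ≤ m ∧
    ∀ y, hermiteFun m y = P.eval y * Real.exp (-(y ^ 2 / 2)) := by
  refine ⟨Polynomial.C (hermConst m) * hermPoly m, ?_, fun y => ?_⟩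
  · refine (Polynomial.natDegree_C_mul_le _ _).trans ?_
    exact (hermPoly_degree m).1
  · rw [hermiteFun_eq, neg_div, Polynomial.eval_mul, Polynomial.eval_C, mul_assoc]

theorem exists_poly_laguerreFun (m : ℕ) : ∃ P : Polynomial ℝ, P.natDegree ≤ m ∧
    ∀ y, laguerreFun m y = P.eval y * Real.exp (-(y / 2)) := by
  refine ⟨Polynomial.C ((-1) ^ m / (m.factorial : ℝ)) * lagPoly m m, ?_, fun y => ?_⟩
  · refine (Polynomial.natDegree_C_mul_le _ _).trans ?_
    exact (lagPoly_degree m m).1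
  · rw [laguerreFun_eq, neg_div, Polynomial.eval_mul, Polynomial.eval_C, mul_assoc]

theorem iterate_deriv_poly (P : Polynomial ℝ) (n : ℕ) :
    deriv^[n] (fun y : ℝ => ((P.eval y : ℝ) : ℂ)) =
      fun y => (((Polynomial.derivative^[n] P).eval y : ℝ) : ℂ) := by
  induction n with
  | zero => rfl
  | succ n ih =>
    rw [Function.iterate_succ_apply', ih]
    funext y
    rw [((Polynomial.derivative^[n] P).hasDerivAt y).ofReal_comp.deriv,
      Function.iterate_succ_apply']

theorem contDiff_poly (P : Polynomial ℝ) :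
    ContDiff ℝ (⊤ : ℕ∞) fun y : ℝ => ((P.eval y : ℝ) : ℂ) :=
  contDiff_ofReal.comp (by simpa using P.contDiff_aeval (𝕜 := ℝ) (⊤ : ℕ∞))

theorem contDiff_hermiteFun (m : ℕ) :
    ContDiff ℝ (⊤ : ℕ∞) fun y => (hermiteFun m y : ℂ) := by
  obtain ⟨P, -, hP⟩ := exists_poly_hermiteFun m
  simp only [hP, Complex.ofReal_mul]
  exact (contDiff_poly P).mul (contDiff_ofReal.comp (by fun_prop))

theorem contDiff_laguerreFun (m : ℕ) :
    ContDiff ℝ (⊤ : ℕ∞) fun y => (laguerreFun m y : ℂ) := by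
  obtain ⟨P, -, hP⟩ := exists_poly_laguerreFun m
  simp only [hP, Complex.ofReal_mul]
  exact (contDiff_poly P).mul (contDiff_ofReal.comp (by fun_prop))

theorem isChartData_cutoff {I : Set ℝ} {θ a c : ℝ → ℂ} (hθ : IsTest1 univ θ) (m l : ℕ)
    (ha : IsTest1 univ a) (hc : IsTest1 I c) : IsChartData I univ a
      (fun y => θ y * hermiteFun m y) c (fun y => θ y * laguerreFun l y) := by
  refine ⟨ha, ?_, hc, ?_⟩
  · simpa only [mul_comm] using hθ.mul_left (contDiff_hermiteFun m)
  · simpa only [mul_comm] using hθ.mul_left (contDiff_laguerreFun l)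

/-- `(d/dy + N')ⁿ` annihilates `P e^{-N}` for polynomials `P` of degree less than `n`, so its value
on a truncation lives where the truncation is active. -/
theorem iterate_gaugeDeriv_cutoff {I : Set ℝ} {θ : ℝ → ℂ} (hθ : IsTest1 I θ) {r : ℝ}
    (hθ1 : ∀ x, |x| ≤ r → θ x = 1) {μ N : ℝ → ℝ} (hN : ∀ y, HasDerivAt N (μ y) y) {n : ℕ}
    {P : Polynomial ℝ} (hP : P.natDegree < n) {φ : ℝ → ℝ}
    (hφ : ∀ y, φ y = P.eval y * Real.exp (-N y)) {y : ℝ} (hy : |y| < r) :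
    (gaugeDeriv μ)^[n] (fun y => θ y * φ y) y = 0 := by
  have hβ := hθ.mul_left (contDiff_poly P)
  have e : (fun y => θ y * (φ y : ℂ)) =
      fun y => ((Real.exp (-N y) : ℝ) : ℂ) * ((P.eval y : ℝ) * θ y) := by
    funext y
    rw [hφ]
    push_cast
    ring
  have hloc : ∀ k : ℕ, deriv^[k] (fun y => ((P.eval y : ℝ) : ℂ) * θ y) =ᶠ[nhds y]
      deriv^[k] (fun y => ((P.eval y : ℝ) : ℂ)) := by
    intro k
    induction k with
    | zero =>
      have : ∀ᶠ x in nhds y, |x| < r :=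
        continuous_abs.continuousAt.eventually (Iio_mem_nhds hy)
      filter_upwards [this] with x hx
      simp [hθ1 x hx.le]
    | succ k ih => simpa only [Function.iterate_succ_apply'] using ih.deriv
  rw [e, iterate_gaugeDeriv_exp hN hβ]
  simp only
  rw [(hloc n).eq_of_nhds, iterate_deriv_poly, Polynomial.iterate_derivative_eq_zero hP]
  simp

theorem HasCompactSupport.exists_abs_le {a : ℝ → ℂ} (h : HasCompactSupport a) :
    ∃ A, ∀ x, a x ≠ 0 → |x| ≤ A := by
  obtain ⟨A, hA⟩ := h.isCompact.isBounded.subset_closedBall 0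
  exact ⟨A, fun x hx => by simpa using hA (subset_tsupport a hx)⟩

/-- If `D'^n Ξ_M` vanishes on larger and larger slabs, then the inverse transforms of the `Ξ_M`
solve `D^n f = 0` against any given test function, for large `M`. -/
theorem exists_integral_partFour_eq_zero {D D' : (ℝ × ℝ × ℝ × ℝ → ℂ) → (ℝ × ℝ × ℝ × ℝ → ℂ)}
    (hD : IsDerivation D) (hs : IsSkew D) (hDD : IsFourierPair 1 D D') {n : ℕ}
    {Ξ : ℕ → ℝ × ℝ × ℝ × ℝ → ℂ} (hΞ : ∀ M, IsCc (Ξ M))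
    (hzero : ∀ R : ℝ, ∃ M₀, ∀ M ≥ M₀, ∀ q : ℝ × ℝ × ℝ × ℝ, |q.2.1| ≤ R → |q.2.2.2| ≤ R →
      D'^[n] (Ξ M) q = 0) {η : ℝ × ℝ × ℝ × ℝ → ℂ} (hη : IsFlatTest η) :
    ∃ M₀, ∀ M ≥ M₀, ∫ p, partFour 1 (Ξ M) p * D^[n] η p ∂flatMeasure = 0 := by
  obtain ⟨R, hR⟩ := hη.compact.isCompact.isBounded.subset_closedBall 0
  obtain ⟨M₀, hM₀⟩ := hzero R
  refine ⟨M₀, fun M hM => ?_⟩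
  rw [flatMeasure_eq, setIntegral_eq_integral_of_forall_compl_eq_zero,
    hs.iterate hD (contDiff_partFour 1 (hΞ M)) hη.toIsCc, (hDD.iterate (hΞ M) n).2.2]
  · refine mul_eq_zero_of_right _ (integral_eq_zero_of_ae (Filter.Eventually.of_forall fun p => ?_))
    by_cases hp : η p = 0
    · simp [hp]
    · have h1 := hR (subset_tsupport η hp)
      rw [mem_closedBall_zero_iff, Prod.norm_def, Prod.norm_def, Prod.norm_def] at h1
      simp only [sup_le_iff, Real.norm_eq_abs] at h1
      have h2 := partFour_eq_zero 1 (Ξ := D'^[n] (Ξ M)) (p := p) fun t =>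
        hM₀ M hM _ h1.2.1 h1.2.2.2
      simp [h2]
  · intro p hp
    have : D^[n] η p = 0 := image_eq_zero_of_notMem_tsupport fun hm =>
      hp (hη.support ((hD.isCc_iterate hη.toIsCc n).2 hm))
    rw [this, mul_zero]

/-- If `D'^n` annihilates truncations of the products `a ⊗ h_{j-1} ⊗ c ⊗ ℓ_{k-1}` on large slabs,
then the range of `U⁻¹ R₀` consists of weak solutions of `D^n f = 0`. -/
theorem integral_opU0_eq_zero_of_cutoffs {D D' : (ℝ × ℝ × ℝ × ℝ → ℂ) → (ℝ × ℝ × ℝ × ℝ → ℂ)}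
    (hD : IsDerivation D) (hs : IsSkew D) (hDD : IsFourierPair 1 D D') {n j k : ℕ}
    (hcut : ∀ (θ : ℕ → ℝ → ℂ), (∀ M, IsTest1 univ (θ M)) →
      (∀ (M : ℕ) (x : ℝ), |x| ≤ M + 1 → θ M x = 1) → ∀ a c : ℝ → ℂ, IsTest1 univ a →
      IsTest1 (Ioi 0) c → ∀ R : ℝ, ∃ M₀, ∀ M ≥ M₀, ∀ q : ℝ × ℝ × ℝ × ℝ,
        |q.2.1| ≤ R → |q.2.2.2| ≤ R → D'^[n] (chartFun a (fun y => θ M y * hermiteFun (j - 1) y) c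
          (fun y => θ M y * laguerreFun (k - 1) y)) q = 0)
    {f : L2 siegelMeasure} {g : L2 halfMeasure} (hf : opU f = opR0 j k g)
    {η : ℝ × ℝ × ℝ × ℝ → ℂ} (hη : IsFlatTest η) :
    ∫ p, opU0 f p * D^[n] η p ∂flatMeasure = 0 := by
  have hψ : MemLp (D^[n] η) 2 flatMeasure := (hD.isCc_iterate hη.toIsCc n).1.memLp
  rw [← star_toLp_inner hψ, ← opU1.inner_map_map, ← opV1.inner_map_map, ← opV2.inner_map_map]
  set G := opV2 (opV1 (opU1 hψ.star.toLp)) with hG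
  have hf' : opV2 (opV1 (opU1 (opU0 f))) = opR0 j k g := hf
  rw [hf', ← inner_conj_symm, map_eq_zero]
  refine inner_opR0_eq_zero_of_tests ?_ g
  rintro a' ⟨a, ha, ea⟩ c' ⟨c, hc, ec⟩
  choose θ hθ hθ1 hθb using fun M : ℕ => exists_plateau ((M : ℝ) + 1) (by positivity)
  have h00 : (0 : ℝ) ∉ Ioi (0 : ℝ) := by simp
  obtain ⟨hc', hcc⟩ := hc.div_of_ne_zero h00 (m := sideWeight)
    (fun x hx => contDiffAt_sideWeight hx) (fun x hx => sideWeight_ne_zero hx)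
  have hdata : ∀ M, IsChartData (Ioi 0) univ a (fun y => θ M y * hermiteFun (j - 1) y)
      (fun x => (sideWeight x)⁻¹ * c x) (fun y => θ M y * laguerreFun (k - 1) y) :=
    fun M => isChartData_cutoff ((hθ M).mono (subset_univ _)) (j - 1) (k - 1) ha hc'
  obtain ⟨M₀, hM₀⟩ := exists_integral_partFour_eq_zero hD hs hDD (fun M => (hdata M).isCc h00)
    (hcut θ (fun M => (hθ M).mono (subset_univ _)) hθ1 a _ ha hc') hη
  -- the product without truncation
  set w : ℝ × ℝ × ℝ × ℝ → ℂ := fun p => a p.1 * ((hermiteFun (j - 1) p.2.1 : ℂ) *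
    (c p.2.2.1 * (laguerreFun (k - 1) p.2.2.2 : ℂ))) with hw
  have hwL : MemLp w 2 flatMeasure := memLp_tensor ha.memLp_volume
    (memLp_tensor (memLp_hermiteFun _) (memLp_tensor hc.memLp_volume (memLp_laguerreFun _)))
  have hzero : ∀ M ≥ M₀, ∫ p, G p * (starRingEnd ℂ) (θ M p.2.1 * θ M p.2.2.2 * w p)
      ∂flatMeasure = 0 := by
    intro M hM
    have h1 := integral_opV_opU1_mul (hdata M) h00 hψ
    rw [hM₀ M hM, map_zero] at h1
    rw [← h1]
    refine integral_congr_ae (Filter.Eventually.of_forall fun p => ?_)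
    simp only [hcc, hw, ← hG]
    congr 2
    ring
  have hint : Integrable (fun p => ‖G p‖ * ‖w p‖) flatMeasure :=
    (Lp.memLp G).norm.integrable_mul hwL.norm
  have hlim : Filter.Tendsto (fun M : ℕ => ∫ p, G p * (starRingEnd ℂ)
      (θ M p.2.1 * θ M p.2.2.2 * w p) ∂flatMeasure) Filter.atTop
      (nhds (∫ p, G p * (starRingEnd ℂ) (w p) ∂flatMeasure)) := by
    refine tendsto_integral_of_dominated_convergence _ (fun M => ?_) hint
      (fun M => Filter.Eventually.of_forall fun p => ?_) (Filter.Eventually.of_forall fun p => ?_)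
    · have c1 : Continuous fun p : ℝ × ℝ × ℝ × ℝ => θ M p.2.1 * θ M p.2.2.2 := by
        have := (hθ M).smooth.continuous
        fun_prop
      exact (Lp.memLp G).1.mul (Complex.continuous_conj.comp_aestronglyMeasurable
        (c1.aestronglyMeasurable.mul hwL.1))
    · rw [norm_mul, RCLike.norm_conj, norm_mul, norm_mul]
      refine mul_le_mul_of_nonneg_left (mul_le_of_le_one_left (norm_nonneg _) ?_) (norm_nonneg _)
      exact mul_le_one₀ (hθb M _) (norm_nonneg _) (hθb M _)
    · refine tendsto_const_nhds.congr' ?_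
      obtain ⟨M₁, hM₁⟩ := exists_nat_ge (max |p.2.1| |p.2.2.2|)
      filter_upwards [Filter.eventually_ge_atTop M₁] with M hM
      have hMr : (M₁ : ℝ) ≤ M := by exact_mod_cast hM
      rw [hθ1 M _ (by linarith [(le_max_left _ _).trans hM₁]),
        hθ1 M _ (by linarith [(le_max_right _ _).trans hM₁]), one_mul, one_mul]
  have h0 := tendsto_nhds_unique (hlim.congr' (Filter.eventually_atTop.2 ⟨M₀, hzero⟩))
    tendsto_const_nhds
  rw [hermiteL2, laguerreL2, inner_tensor4 ea (memLp_hermiteFun _).coeFn_toLp ec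
    (memLp_laguerreFun _).coeFn_toLp, ← h0]
  simp only [hw, map_mul]

/-- On the supports of `a` and `c`, a bound on `s₁` bounds `y₁ = x₁ + 2 √x₂ s₁`, so for large `M`
the truncation of `h_{j-1}` is invisible on a slab, and `(d/dy₁ + y₁)ⁿ` annihilates `h_{j-1}`. -/
theorem isWeakSol_tangCR_of_opU_eq {n j k : ℕ} (hj : j - 1 < n) {f : L2 siegelMeasure}
    {g : L2 halfMeasure} (hf : opU f = opR0 j k g) : IsWeakSol tangCR n f := by
  refine (isKappaRelated_tangCR.isWeakSol_iff n f).2 fun η hη => ?_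
  refine integral_opU0_eq_zero_of_cutoffs isDerivation_flatCR isSkew_flatCR
    (isFourierPair_CR (by norm_num)) (fun θ hθ hθ1 a c ha hc R => ?_) hf hη
  obtain ⟨P, hPd, hP⟩ := exists_poly_hermiteFun (j - 1)
  obtain ⟨A, hA⟩ := HasCompactSupport.exists_abs_le ha.compact
  obtain ⟨C, hC⟩ := HasCompactSupport.exists_abs_le hc.compact
  obtain ⟨M₀, hM₀⟩ := exists_nat_ge (A + 2 * (√C * R))
  refine ⟨M₀, fun M hM q h1 h2 => ?_⟩
  have hdata := isChartData_cutoff (hθ M) (j - 1) (k - 1) ha hc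
  rw [hdata.iterate_hatCR]
  by_contra hne
  simp only [chartFun, mul_eq_zero, not_or] at hne
  obtain ⟨hne1, hne2, hne3, -⟩ := hne
  refine hne2 (iterate_gaugeDeriv_cutoff (hθ M) (hθ1 M) (N := fun y => y ^ 2 / 2) (fun y => ?_)
    (hPd.trans_lt hj) hP ?_)
  · refine (((hasDerivAt_id y).pow 2).div_const 2).congr_deriv ?_
    simp
  · have b1 := hA _ hne1
    have b2 := hC _ hne3.2
    have e : q.1 / (2 * √|q.2.2.1|) + √|q.2.2.1| * q.2.1 =
        (q.1 / (2 * √|q.2.2.1|) - √|q.2.2.1| * q.2.1) + 2 * (√|q.2.2.1| * q.2.1) := by ring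
    have b3 : |√|q.2.2.1| * q.2.1| ≤ √C * R := by
      rw [abs_mul, abs_of_nonneg (Real.sqrt_nonneg _)]
      exact mul_le_mul (Real.sqrt_le_sqrt b2) h1 (abs_nonneg _) (Real.sqrt_nonneg _)
    have hMr : (M₀ : ℝ) ≤ M := by exact_mod_cast hM
    rw [e]
    refine (abs_add_le _ _).trans_lt ?_
    rw [abs_mul 2, abs_two]
    linarith

/-- On the support of `c`, a bound on `s₂` bounds `y₂ = 2 x₂ s₂`, so for large `M` the truncation of
`ℓ_{k-1}` is invisible on a slab, and `(d/dy₂ + 1/2)ⁿ` annihilates `ℓ_{k-1}`. -/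
theorem isWeakSol_dbar2_of_opU_eq {n j k : ℕ} (hk : k - 1 < n) {f : L2 siegelMeasure}
    {g : L2 halfMeasure} (hf : opU f = opR0 j k g) : IsWeakSol dbar2 n f := by
  refine (isKappaRelated_dbar2.isWeakSol_iff n f).2 fun η hη => ?_
  refine integral_opU0_eq_zero_of_cutoffs isDerivation_flatBar isSkew_flatBar
    (isFourierPair_Bar 1) (fun θ hθ hθ1 a c ha hc R => ?_) hf hη
  obtain ⟨Q, hQd, hQ⟩ := exists_poly_laguerreFun (k - 1)
  obtain ⟨C, hC⟩ := HasCompactSupport.exists_abs_le hc.compact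
  obtain ⟨M₀, hM₀⟩ := exists_nat_ge (2 * (C * R))
  refine ⟨M₀, fun M hM q h1 h2 => ?_⟩
  have hdata := isChartData_cutoff (hθ M) (j - 1) (k - 1) ha hc
  rw [hdata.iterate_hatBar (by simp) (σ := 1) (fun x hx => by rw [one_mul, abs_of_pos hx])]
  by_contra hne
  simp only [chartFun, mul_eq_zero, not_or] at hne
  obtain ⟨-, -, hne3, hne4⟩ := hne
  refine hne4 (iterate_gaugeDeriv_cutoff (hθ M) (hθ1 M) (N := fun y => y / 2) (fun y => ?_)
    (hQd.trans_lt hk) hQ ?_)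
  · refine ((hasDerivAt_id y).div_const 2).congr_deriv ?_
    simp
  · have b2 := hC _ hne3.2
    have b3 : |q.2.2.1| * |q.2.2.2| ≤ C * R :=
      mul_le_mul b2 h2 (abs_nonneg _) ((abs_nonneg _).trans b2)
    have hMr : (M₀ : ℝ) ≤ M := by exact_mod_cast hM
    rw [abs_mul, abs_mul, abs_two, abs_abs, mul_assoc]
    linarith

/-! ### The image of the true-poly-Bergman type space -/

theorem norm_opR0 (j k : ℕ) (g : L2 halfMeasure) : ‖opR0 j k g‖ = ‖g‖ := by
  rw [← sq_eq_sq₀ (norm_nonneg _) (norm_nonneg _)]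
  have h := inner_opR0 j k j k g g
  simp only [if_true, mul_one, inner_self_eq_norm_sq_to_K] at h
  exact_mod_cast h

theorem opR0_eq_zero_of_neg (j k : ℕ) (g : L2 halfMeasure) :
    ∀ᵐ p ∂flatMeasure, p.2.2.1 < 0 → opR0 j k g p = 0 := by
  filter_upwards [opR0_coeFn j k g] with p hp hneg
  simp [hp, embedFun, hneg.le]

theorem mem_polyBergman_of_opU_eq {n n' j k : ℕ} (hj : j - 1 < n) (hk : k - 1 < n')
    {f : L2 siegelMeasure} {g : L2 halfMeasure} (hf : opU f = opR0 j k g) :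
    f ∈ polyBergman n n' :=
  ⟨isWeakSol_tangCR_of_opU_eq hj hf, isWeakSol_dbar2_of_opU_eq hk hf⟩

/-- A function of the range of `R₀` solves both equations, and it is orthogonal to the solutions of
the equations of lower order, as these have no component in that range. -/
theorem mem_truePolyBergman_of_opU_eq {j k : ℕ} (hj : 1 ≤ j) (hk : 1 ≤ k) {f : L2 siegelMeasure}
    {g : L2 halfMeasure} (hf : opU f = opR0 j k g) : f ∈ truePolyBergman j k := by
  refine ⟨mem_polyBergman_of_opU_eq (by omega) (by omega) hf, ?_⟩
  rw [SetLike.mem_coe, ← Submodule.inf_orthogonal]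
  have key : ∀ h : L2 siegelMeasure, inner ℂ (opR0 j k g) (opU h) = 0 → inner ℂ h f = 0 := by
    intro h hh
    rw [← opU.inner_map_map, hf, ← inner_conj_symm, hh, map_zero]
  exact ⟨(Submodule.mem_orthogonal _ _).2 fun h hh =>
      key h (inner_opR0_opU_eq_zero_of_tangCR hh.1 le_rfl k g),
    (Submodule.mem_orthogonal _ _).2 fun h hh =>
      key h (inner_opR0_opU_eq_zero_of_dbar2 hh.2 le_rfl j g)⟩

/-- `U` maps the true-poly-Bergman type space into the range of `R₀`: the components of `U f` in the
ranges of all other embeddings vanish, by the equations for larger indices, and by orthogonality to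
the smaller spaces otherwise. -/
theorem opU_eq_opR0_of_mem_truePolyBergman {j k : ℕ} (hj : 1 ≤ j) (hk : 1 ≤ k)
    {f : L2 siegelMeasure} (hf : f ∈ truePolyBergman j k) :
    opU f = opR0 j k (ContinuousLinearMap.adjoint (opR0 j k) (opU f)) := by
  obtain ⟨⟨hf1, hf2⟩, hf3⟩ := hf
  rw [SetLike.mem_coe, ← Submodule.inf_orthogonal] at hf3
  rw [← sub_eq_zero]
  refine eq_zero_of_adjoint_opR0_eq_zero ?_ fun j' k' hj' hk' g' => ?_
  · filter_upwards [opU_eq_zero_of_neg hf2, opR0_eq_zero_of_neg j k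
      (ContinuousLinearMap.adjoint (opR0 j k) (opU f)), Lp.coeFn_sub (opU f)
        (opR0 j k (ContinuousLinearMap.adjoint (opR0 j k) (opU f)))] with p h1 h2 h3 hp
    rw [h3, Pi.sub_apply, h1 hp, h2 hp, sub_zero]
  · rw [inner_sub_right, inner_opR0]
    by_cases he : j' = j ∧ k' = k
    · obtain ⟨rfl, rfl⟩ := he
      simp [ContinuousLinearMap.adjoint_inner_right]
    · have hz : ((if j' - 1 = j - 1 then 1 else 0) * (if k' - 1 = k - 1 then 1 else 0) : ℂ) = 0 := by
        by_cases h1 : j' - 1 = j - 1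
        · rw [if_neg (c := k' - 1 = k - 1) (by omega), mul_zero]
        · rw [if_neg h1, zero_mul]
      rw [hz, mul_zero, sub_zero]
      rcases lt_or_ge j j' with h1 | h1
      · exact inner_opR0_opU_eq_zero_of_tangCR hf1 (by omega) k' g'
      rcases lt_or_ge k k' with h2 | h2
      · exact inner_opR0_opU_eq_zero_of_dbar2 hf2 (by omega) j' g'
      obtain ⟨h, hh⟩ := opU_surjective (opR0 j' k' g')
      rw [← hh, opU.inner_map_map]
      rcases h1.lt_or_eq with h1 | h1
      · exact (Submodule.mem_orthogonal _ _).1 hf3.1 h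
          (mem_polyBergman_of_opU_eq (by omega) (by omega) hh)
      · exact (Submodule.mem_orthogonal _ _).1 hf3.2 h
          (mem_polyBergman_of_opU_eq (by omega) (by omega) hh)

/-- The restriction of `R_{(L)}` to `A²_{(L)}(D₂)`, as a unitary operator. -/
def bargmannEquiv {j k : ℕ} (hj : 1 ≤ j) (hk : 1 ≤ k) :
    truePolyBergman j k ≃ₗᵢ[ℂ] L2 halfMeasure :=
  LinearIsometryEquiv.ofSurjective
    { toLinearMap := ((opR j k).comp (truePolyBergman j k).subtypeL).toLinearMap
      norm_map' := fun f => by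
        change ‖ContinuousLinearMap.adjoint (opR0 j k) (opU f)‖ = ‖(f : L2 siegelMeasure)‖
        rw [← opU.norm_map (f : L2 siegelMeasure), ← norm_opR0 j k,
          ← opU_eq_opR0_of_mem_truePolyBergman hj hk f.2] }
    fun g => by
      obtain ⟨f, hf⟩ := opU_surjective (opR0 j k g)
      refine ⟨⟨f, mem_truePolyBergman_of_opU_eq hj hk hf⟩, ?_⟩
      change ContinuousLinearMap.adjoint (opR0 j k) (opU f) = g
      rw [hf, adjoint_opR0_opR0]

theorem bargmannEquiv_apply {j k : ℕ} (hj : 1 ≤ j) (hk : 1 ≤ k) (f : truePolyBergman j k) :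
    bargmannEquiv hj hk f = opR j k f := rfl

theorem opU_bargmannEquiv_symm {j k : ℕ} (hj : 1 ≤ j) (hk : 1 ≤ k) (g : L2 halfMeasure) :
    opU ((bargmannEquiv hj hk).symm g) = opR0 j k g := by
  rw [opU_eq_opR0_of_mem_truePolyBergman hj hk ((bargmannEquiv hj hk).symm g).2]
  congr 1
  exact (bargmannEquiv hj hk).apply_symm_apply g

theorem bargmannEquiv_symm_coe {j k : ℕ} (hj : 1 ≤ j) (hk : 1 ≤ k) (g : L2 halfMeasure) :
    ((bargmannEquiv hj hk).symm g : L2 siegelMeasure) =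
      ContinuousLinearMap.adjoint (opR j k) g := by
  refine ext_inner_left ℂ fun f => ?_
  rw [ContinuousLinearMap.adjoint_inner_right, ← opU.inner_map_map, opU_bargmannEquiv_symm,
    ← ContinuousLinearMap.adjoint_inner_left]
  rfl

/-- The unitary operator turns the projection `B_{(L)}` into the adjoint of `R₀`. -/
theorem bargmannEquiv_toeplitz {j k : ℕ} (hj : 1 ≤ j) (hk : 1 ≤ k) {a : ℂ × ℂ → ℂ}
    (ha : MemLp a ∞ siegelMeasure) (g : L2 halfMeasure) :
    bargmannEquiv hj hk (toeplitz j k ha ((bargmannEquiv hj hk).symm g)) =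
      ContinuousLinearMap.adjoint (opR0 j k)
        (opU (mulOp ha ((bargmannEquiv hj hk).symm g : L2 siegelMeasure))) := by
  refine ext_inner_left ℂ fun g' => ?_
  rw [ContinuousLinearMap.adjoint_inner_right, ← opU_bargmannEquiv_symm hj hk,
    opU.inner_map_map, ← (bargmannEquiv hj hk).symm.inner_map_map,
    LinearIsometryEquiv.symm_apply_apply]
  exact Submodule.inner_orthogonalProjectionOnto_eq_of_mem_left _ _

end SiegelToeplitz

end

open SiegelToeplitz in
theorem mainTheorem5 (j k : ℕ) (hj : 1 ≤ j) (hk : 1 ≤ k) (c : ℝ → ℝ → ℂ)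
    (hc : MemLp (nilpotentSymbol c) ∞ siegelMeasure) :
    (∀ x₁ x₂ : ℝ, 0 < x₂ → Integrable (gammaIntegrand j k c (x₁, x₂)) halfMeasure) ∧
    MemLp (gammaFun j k c) ∞ halfMeasure ∧
    ∃ W : truePolyBergman j k ≃ₗᵢ[ℂ] L2 halfMeasure,
      (∀ f : truePolyBergman j k, W f = opR j k f) ∧
      (∀ g : L2 halfMeasure,
        (W.symm g : L2 siegelMeasure) = ContinuousLinearMap.adjoint (opR j k) g) ∧
      ∀ g : L2 halfMeasure,
        W (toeplitz j k hc (W.symm g)) =ᵐ[halfMeasure] fun x => gammaFun j k c x * g x := by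
  have hm := memLp_top_of_nilpotentSymbol hc
  refine ⟨fun x₁ x₂ hx => integrable_gammaIntegrand j k hm hx, memLp_gammaFun j k hm,
    bargmannEquiv hj hk, bargmannEquiv_apply hj hk, bargmannEquiv_symm_coe hj hk, fun g => ?_⟩
  rw [bargmannEquiv_toeplitz]
  refine adjoint_opR0_mul j k hm g ?_
  have h := opU_mulOp hc ((bargmannEquiv hj hk).symm g : L2 siegelMeasure)
  rwa [opU_bargmannEquiv_symm] at h
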